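/- Work over $\mathbb{C}$. Let $\phi: S \to \mathbb{P}^1\times\mathbb{P}^1$ be the blow-up of a closed point $q$, let $pr:\mathbb{P}^1\times\mathbb{P}^1\to\mathbb{P}^1$ be one of the two projections, and let $\pi = pr\circ\phi : S\to\mathbb{P}^1$. The fibre $Z=\pi^{-1}(pr(q))$ is a union of two smooth rational curves $Z_1,Z_2$ meeting transversally at a single node $p$. For integers $a,b$ let $\mathcal{O}_Z(a,b)$ denote the line bundle on $Z$ of degree $a$ on $Z_1$ and degree $b$ on $Z_2$. For a vector bundle $\mathcal{E}_Z\cong\bigoplus_{i=1}^r\mathcal{O}_Z(a_i,b_i)$ of rank $r$ on $Z$ and an integer $0\le m\le r$ put $$\operatorname{degbd}(\mathcal{E}_Z,m)=\inf_{J,K_1,K_2}\Big\{\sum_{i\in J}(a_i+b_i)+\sum_{i\in K_1}(a_i+1)+\sum_{i\in K_2}(b_i+1)\Big\},$$ where $J,K_1,K_2$ run over the pairwise disjoint subsets of $\{1,\dots,r\}$ with $|J|+|K_1|=|J|+|K_2|=m$. Theorem. Let $\mathcal{E}_Z$ be a vector bundle of rank $r$ on $Z$ and let $0\le m\le r$.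 Then $\mathcal{E}_Z$ is isomorphic to a direct sum $\bigoplus_{i=1}^r\mathcal{O}_Z(a_i,b_i)$ (so that $\operatorname{degbd}(\mathcal{E}_Z,m)$ is defined), and for every such decomposition there are a vector bundle $\mathcal{E}$ of rank $r$ on $S$ with $\mathcal{E}|_Z\cong\mathcal{E}_Z$, a torsion-free coherent sheaf $\mathcal{F}$ on $S$ which is locally free of rank $m$ away from the node $p$, and a surjection $\mathcal{E}\to\mathcal{F}$, such that for a general fibre $C\cong\mathbb{P}^1$ of $\pi$ (that is, for the fibre over every closed point of some non-empty open subset of $\mathbb{P}^1$) the restriction $\mathcal{F}|_C$ is a vector bundle of rank $m$ and degree $\operatorname{degbd}(\mathcal{E}_Z,m)$. -/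

import Mathlib

open CategoryTheory AlgebraicGeometry

namespace DegreeBound

noncomputable section

attribute [local instance] MvPolynomial.gradedAlgebra Abelian.hasFiniteBiproducts

/-! ### The projective line over `ℂ` and the product of two projective lines -/

/-- The standard grading on `ℂ[X₀, X₁]`. -/
abbrev grading : ℕ → Submodule ℂ (MvPolynomial (Fin 2) ℂ) :=
  MvPolynomial.homogeneousSubmodule (Fin 2) ℂ

/-- The complex projective line `Proj ℂ[X₀, X₁]`. -/
abbrev P1 : Scheme.{0} := Proj grading

/-- The structure morphism of the projective line. -/
def P1.toSpecC : P1 ⟶ Spec (CommRingCat.of ℂ) :=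
  Proj.toSpecZero grading ≫ Spec.map (CommRingCat.ofHom (algebraMap ℂ (grading 0)))

/-- The product `ℙ¹ × ℙ¹` over `Spec ℂ`. -/
abbrev P1xP1 : Scheme.{0} := Limits.pullback P1.toSpecC P1.toSpecC

/-- The standard affine open `D₊(Xᵢ)` of the projective line. -/
abbrev P1.chart (i : Fin 2) : P1.Opens := Proj.basicOpen grading (MvPolynomial.X i)

/-- The coordinate function `Xⱼ / Xᵢ` on `D₊(Xᵢ)`. -/
def P1.coord (i j : Fin 2) : Γ(P1, P1.chart i) :=
  Proj.awayToSection grading (MvPolynomial.X i)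
    (HomogeneousLocalization.Away.mk grading
      (f := MvPolynomial.X i) (d := 1) (MvPolynomial.isHomogeneous_X ℂ i) 1
      (MvPolynomial.X j) (by simpa using MvPolynomial.isHomogeneous_X ℂ j))

/-- The function `(X₀ / X₁) ^ d` on `D₊(X₀) ∩ D₊(X₁)`, for an integer `d`: it is the restriction of
`(X₀ / X₁) ^ d` if `d ≥ 0` and of `(X₁ / X₀) ^ (-d)` if `d ≤ 0`. -/
def P1.transition (d : ℤ) : Γ(P1, P1.chart 0 ⊓ P1.chart 1) :=
  (P1.presheaf.map (homOfLE inf_le_right).op) (P1.coord 1 0 ^ d.toNat) *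
    (P1.presheaf.map (homOfLE inf_le_left).op) (P1.coord 0 1 ^ (-d).toNat)

/-! ### Vector bundles, coherent sheaves, torsion-free sheaves -/

/-- The restriction of a section of a sheaf of modules to a smaller open subset. -/
def res {X : Scheme.{0}} (M : X.Modules) {V U : X.Opens} (h : V ≤ U) (s : Γ(M, U)) : Γ(M, V) :=
  M.presheaf.map (homOfLE h).op s

/-- `e₁, …, eₙ ∈ Γ(M, U)` is a frame of `M` over `U`, that is, the map `𝒪_U ^ n ⟶ M|_U`
defined by these sections is an isomorphism (it is bijective on sections over every `V ⊆ U`). -/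
def IsFrame {X : Scheme.{0}} (M : X.Modules) (U : X.Opens) {n : ℕ} (e : Fin n → Γ(M, U)) : Prop :=
  ∀ (V : X.Opens) (h : V ≤ U) (s : Γ(M, V)),
    ∃! c : Fin n → Γ(X, V), s = ∑ j, c j • res M h (e j)

/-- `M` is free of rank `r` in a neighbourhood of `x`. -/
def IsLocallyFreeAt {X : Scheme.{0}} (M : X.Modules) (r : ℕ) (x : X) : Prop :=
  ∃ U : X.Opens, x ∈ U ∧ ∃ e : Fin r → Γ(M, U), IsFrame M U e

/-- `M` is a vector bundle (locally free sheaf) of rank `r`. -/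
def IsVectorBundle {X : Scheme.{0}} (M : X.Modules) (r : ℕ) : Prop :=
  ∀ x : X, IsLocallyFreeAt M r x

/-- `M` is coherent. This is meant for locally Noetherian `X`, where it is the same as being
locally of finite presentation. -/
def IsCoherent {X : Scheme.{0}} (M : X.Modules) : Prop :=
  SheafOfModules.IsFinitePresentation (R := X.ringCatSheaf) M

/-- `M` is torsion-free. This is meant for integral `X`, where it says that a nonzero function on
an open subset does not annihilate any nonzero section of `M` over it. -/
def IsTorsionFree {X : Scheme.{0}} (M : X.Modules) : Prop :=
  ∀ U : X.Opens, Module.IsTorsionFree Γ(X, U) Γ(M, U)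

/-! ### Degrees on the projective line -/

/-- `M` is a vector bundle of rank `m` and degree `d` on the projective line: it has frames on the
two standard charts for which the determinant of the transition matrix is `(X₀ / X₁) ^ d`; in other
words, `det M` has the transition function of `𝒪(d)`, whose generators on the two charts are
`X₀ ^ d` and `X₁ ^ d`. -/
def HasRankDegree (M : P1.Modules) (m : ℕ) (d : ℤ) : Prop :=
  ∃ (e₀ : Fin m → Γ(M, P1.chart 0)) (e₁ : Fin m → Γ(M, P1.chart 1))
    (g : Matrix (Fin m) (Fin m) Γ(P1, P1.chart 0 ⊓ P1.chart 1)),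
    IsFrame M (P1.chart 0) e₀ ∧ IsFrame M (P1.chart 1) e₁ ∧
    (∀ j, res M inf_le_left (e₀ j) = ∑ i, g i j • res M inf_le_right (e₁ i)) ∧
    g.det = P1.transition d

/-- The restriction (inverse image) of a sheaf of modules along a morphism. -/
abbrev restr {X Y : Scheme.{0}} (f : X ⟶ Y) (M : Y.Modules) : X.Modules :=
  (Scheme.Modules.pullback f).obj M

/-! ### Splitting types on the nodal curve and the degree bound -/

/-- Let `f₁, f₂` be parametrizations of the two components of the nodal curve `Z`.
`L` is the line bundle `𝒪_Z(a, b)`: its degrees on the two components are `a` and `b`. -/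
def IsLineBundleOfBidegree {Z : Scheme.{0}} (f₁ f₂ : P1 ⟶ Z) (L : Z.Modules) (a b : ℤ) : Prop :=
  IsVectorBundle L 1 ∧ HasRankDegree (restr f₁ L) 1 a ∧ HasRankDegree (restr f₂ L) 1 b

/-- `E ≅ ⨁ᵢ 𝒪_Z(aᵢ, bᵢ)`. -/
def IsSplittingType {Z : Scheme.{0}} (f₁ f₂ : P1 ⟶ Z) (E : Z.Modules) {r : ℕ}
    (a b : Fin r → ℤ) : Prop :=
  ∃ L : Fin r → Z.Modules, (∀ i, IsLineBundleOfBidegree f₁ f₂ (L i) (a i) (b i)) ∧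
    Nonempty (E ≅ Limits.biproduct L)

/-- The degree bound `degbd(E, m)` of `E = ⨁ᵢ 𝒪_Z(aᵢ, bᵢ)`: the infimum of
`∑_{i ∈ J} (aᵢ + bᵢ) + ∑_{i ∈ K₁} (aᵢ + 1) + ∑_{i ∈ K₂} (bᵢ + 1)` over all disjoint sets of indices
`J, K₁, K₂` with `|J| + |K₁| = |J| + |K₂| = m`. -/
def degbd {r : ℕ} (a b : Fin r → ℤ) (m : ℕ) : ℤ :=
  sInf {d : ℤ | ∃ J K₁ K₂ : Finset (Fin r),
    Disjoint J K₁ ∧ Disjoint J K₂ ∧ Disjoint K₁ K₂ ∧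
    J.card + K₁.card = m ∧ J.card + K₂.card = m ∧
    d = ∑ i ∈ J, (a i + b i) + ∑ i ∈ K₁, (a i + 1) + ∑ i ∈ K₂, (b i + 1)}

/-! ### Blow-ups -/

/-- The ideal sheaf `I` is invertible, i.e. it defines an effective Cartier divisor: locally it is
generated by a nonzerodivisor. -/
def IsEffectiveCartier {X : Scheme.{0}} (I : X.IdealSheafData) : Prop :=
  ∀ x : X, ∃ U : X.affineOpens, x ∈ U.1 ∧
    ∃ t ∈ nonZeroDivisors Γ(X, U.1), I.ideal U = Ideal.span {t}

/-- `φ : S ⟶ Y` is the blow-up of `Y` along the ideal sheaf `I`: the inverse image ideal sheaf of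
`I` on `S` is invertible, and `φ` is universal (terminal) with this property. -/
def IsBlowUp {S Y : Scheme.{0}} (φ : S ⟶ Y) (I : Y.IdealSheafData) : Prop :=
  IsEffectiveCartier (I.comap φ) ∧
    ∀ (T : Scheme.{0}) (f : T ⟶ Y), IsEffectiveCartier (I.comap f) → ∃! g : T ⟶ S, g ≫ φ = f

/-- `φ : S ⟶ Y` is the blow-up of the closed point `q` of `Y`. -/
def IsBlowUpAtPoint {S Y : Scheme.{0}} (φ : S ⟶ Y) (q : Y) (hq : IsClosed {q}) : Prop :=
  IsBlowUp φ (Scheme.IdealSheafData.vanishingIdeal ⟨{q}, hq⟩)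

end

end DegreeBound

/-! Coordinates are chosen so that q = ([0:1],[0:1]). Let t be the coordinate X₀/X₁ on the base of π
and y the one on the other factor; both vanish at q. The blow-up has a chart around the node with
coordinates x₁ = y and x₂ = t/y, in which π is t = x₁x₂ and Z is x₁x₂ = 0. On Z the function x₁ is a
coordinate of the strict transform of the fibre and x₂ one of the exceptional curve. Sheaves on S
are written down on four charts (`SurfaceCharts`), by matrices over the torus where y and t are
invertible.

The infimum defining the degree bound runs over a finite set, so it is attained by some J, K₁, K₂,
and |K₁| = |K₂|. An involution τ pairs K₁ with K₂. An index k in J contributes to F a line bundle on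
S of bidegree (a_k, b_k), whose degree on a general fibre is a_k + b_k. A pair (k, τ k) with k in K₁
contributes a rank two bundle that restricts to O(a_k, b_k) ⊕ O(a_{τk}, b_{τk}) on Z, with a map to
a line bundle of bidegree (a_k + 1, b_{τk} + 1) given by (x₁, x₂) near the node. The image there is
the ideal of the node, so the image sheaf is torsion-free, free off the node, and of degree (a_k +
1) + (b_{τk} + 1) on a general fibre. All other summands of E map to zero. The rank two bundle is
not split: its transition matrices have off-diagonal terms divisible by x₂ on the first branch and
by x₁ on the second. They are invisible on Z, but they make the map a coordinate projection on the
other three charts. This is the content of `bundleMatrix`, `quotientMatrices_comm`,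
`node_isPresentation` and `exists_quotient`. The fibres over points other than pr(q) meet only
charts where F is free, with transition matrix diag(y^{d_k}), and the degree is the sum of the d_k.

That every bundle on Z splits is a version of Grothendieck's theorem on two branches at once. The
bundle is free on two affine lines and on the nodal conic x₁x₂ = 0; on the latter, frames on the
branches are matched at the node by a constant matrix (`IsNodalRing.exists_generatesMod`). The two
transition matrices are then diagonalized by one common change of frame at the node, minimizing the
total pole order (`exists_col_op`, `exists_isBound_isUnit`). Conversely the degrees on the two
components determine a line bundle on Z (`P1.degree_unique`,
`NodalCharts.IsParametrization.isDiagonal`), so any given decomposition has the expected diagonal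
transition matrices and agrees with the restriction of E.

The blow-up and the fibres are known only by universal properties. Their charts are recognized as
affine spaces by exhibiting the tautological point and proving its uniqueness (`isChart_of_section`,
`IsBlowUp.exists_chart`). -/

open CategoryTheory AlgebraicGeometry

namespace DegreeBound

noncomputable section

attribute [local instance] MvPolynomial.gradedAlgebra Abelian.hasFiniteBiproducts

/-! ### Restriction of functions and sections, gluing -/

section Restriction

variable {X : Scheme.{0}} (M : X.Modules)

/-- The restriction of functions to a smaller open subset. -/
def resF {U V : X.Opens} (h : V ≤ U) : Γ(X, U) →+* Γ(X, V) :=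
  (X.presheaf.map (homOfLE h).op).hom

@[simp] lemma resF_resF {U V W : X.Opens} (h : V ≤ U) (h' : W ≤ V) (a : Γ(X, U)) :
    resF h' (resF h a) = resF (h'.trans h) a := by
  simp only [resF, ← CommRingCat.comp_apply, ← Functor.map_comp]
  rfl

@[simp] lemma resF_self {U : X.Opens} (h : U ≤ U) (a : Γ(X, U)) : resF h a = a := by
  simp [resF]

@[simp] lemma res_res {U V W : X.Opens} (h : V ≤ U) (h' : W ≤ V) (s : Γ(M, U)) :
    res M h' (res M h s) = res M (h'.trans h) s := by
  simp only [res, ← ConcreteCategory.comp_apply, ← Functor.map_comp]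
  rfl

@[simp] lemma res_self {U : X.Opens} (h : U ≤ U) (s : Γ(M, U)) : res M h s = s := by
  simp [res]

@[simp] lemma res_add {U V : X.Opens} (h : V ≤ U) (s t : Γ(M, U)) :
    res M h (s + t) = res M h s + res M h t := map_add _ _ _

@[simp] lemma res_sub {U V : X.Opens} (h : V ≤ U) (s t : Γ(M, U)) :
    res M h (s - t) = res M h s - res M h t := map_sub _ _ _

@[simp] lemma res_zero {U V : X.Opens} (h : V ≤ U) : res M h (0 : Γ(M, U)) = 0 := map_zero _

@[simp] lemma res_sum {U V : X.Opens} (h : V ≤ U) {ι : Type*} (I : Finset ι) (s : ι → Γ(M, U)) :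
    res M h (∑ i ∈ I, s i) = ∑ i ∈ I, res M h (s i) := map_sum _ _ _

@[simp] lemma res_smul {U V : X.Opens} (h : V ≤ U) (a : Γ(X, U)) (s : Γ(M, U)) :
    res M h (a • s) = resF h a • res M h s := Scheme.Modules.map_smul M _ a s

lemma app_res {M N : X.Modules} (φ : M ⟶ N) {U V : X.Opens} (h : V ≤ U) (s : Γ(M, U)) :
    φ.app V (res M h s) = res N h (φ.app U s) :=
  congr($((φ.mapPresheaf).naturality (homOfLE h).op) s)

lemma section_ext {ι : Type} {V : X.Opens} (U : ι → X.Opens) (hU : ∀ i, U i ≤ V)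
    (hV : V ≤ ⨆ i, U i) {s t : Γ(M, V)} (h : ∀ i, res M (hU i) s = res M (hU i) t) : s = t :=
  TopCat.Sheaf.eq_of_locally_eq' ⟨_, M.isSheaf⟩ U V (fun i ↦ homOfLE (hU i)) hV s t h

lemma function_ext {ι : Type} {V : X.Opens} (U : ι → X.Opens) (hU : ∀ i, U i ≤ V)
    (hV : V ≤ ⨆ i, U i) {s t : Γ(X, V)} (h : ∀ i, resF (hU i) s = resF (hU i) t) : s = t :=
  X.sheaf.eq_of_locally_eq' U V (fun i ↦ homOfLE (hU i)) hV s t h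

lemma section_glue {ι : Type} {V : X.Opens} (U : ι → X.Opens) (hU : ∀ i, U i ≤ V)
    (hV : V ≤ ⨆ i, U i) (s : ∀ i, Γ(M, U i))
    (h : ∀ i j, res M (inf_le_left : U i ⊓ U j ≤ U i) (s i) = res M inf_le_right (s j)) :
    ∃ t : Γ(M, V), ∀ i, res M (hU i) t = s i :=
  (TopCat.Sheaf.existsUnique_gluing' ⟨_, M.isSheaf⟩ U V (fun i ↦ homOfLE (hU i)) hV s h).exists

lemma function_glue {ι : Type} {V : X.Opens} (U : ι → X.Opens) (hU : ∀ i, U i ≤ V)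
    (hV : V ≤ ⨆ i, U i) (s : ∀ i, Γ(X, U i))
    (h : ∀ i j, resF (inf_le_left : U i ⊓ U j ≤ U i) (s i) = resF inf_le_right (s j)) :
    ∃ t : Γ(X, V), ∀ i, resF (hU i) t = s i :=
  (X.sheaf.existsUnique_gluing' U V (fun i ↦ homOfLE (hU i)) hV s h).exists

/-- A morphism of sheaves of modules given by compatible linear maps on sections. -/
def homMk {M N : X.Modules} (f : ∀ U : X.Opens, Γ(M, U) →+ Γ(N, U))
    (hf : ∀ (U V : X.Opens) (h : V ≤ U) (s : Γ(M, U)), f V (res M h s) = res N h (f U s))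
    (hs : ∀ (U : X.Opens) (a : Γ(X, U)) (s : Γ(M, U)), f U (a • s) = a • f U s) : M ⟶ N :=
  ⟨PresheafOfModules.homMk
    { app := fun U ↦ AddCommGrpCat.ofHom (f U.unop)
      naturality := fun U V i ↦ by
        ext s
        exact hf U.unop V.unop (leOfHom i.unop) s }
    (fun U a s ↦ hs U.unop a s)⟩

@[simp] lemma homMk_app {M N : X.Modules} (f : ∀ U : X.Opens, Γ(M, U) →+ Γ(N, U)) (hf hs)
    (U : X.Opens) (s : Γ(M, U)) : (homMk f hf hs).app U s = f U s := rfl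

end Restriction

/-! ### Frames -/

section Frame

variable {X : Scheme.{0}} {M N : X.Modules} {U : X.Opens} {n : ℕ}

/-- The coordinates of a section in a frame. -/
def IsFrame.coeff {e : Fin n → Γ(M, U)} (he : IsFrame M U e) {V : X.Opens} (h : V ≤ U)
    (s : Γ(M, V)) : Fin n → Γ(X, V) :=
  (he V h s).choose

lemma IsFrame.eq_sum {e : Fin n → Γ(M, U)} (he : IsFrame M U e) {V : X.Opens} (h : V ≤ U)
    (s : Γ(M, V)) : s = ∑ j, he.coeff h s j • res M h (e j) :=
  (he V h s).choose_spec.1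

lemma IsFrame.coeff_eq {e : Fin n → Γ(M, U)} (he : IsFrame M U e) {V : X.Opens} (h : V ≤ U)
    {s : Γ(M, V)} {c : Fin n → Γ(X, V)} (hc : s = ∑ j, c j • res M h (e j)) :
    he.coeff h s = c :=
  ((he V h s).choose_spec.2 c hc).symm

lemma IsFrame.coeff_ext {e : Fin n → Γ(M, U)} (he : IsFrame M U e) {V : X.Opens} (h : V ≤ U)
    {c d : Fin n → Γ(X, V)}
    (hc : ∑ j, c j • res M h (e j) = ∑ j, d j • res M h (e j)) : c = d :=
  (he.coeff_eq h rfl).symm.trans (he.coeff_eq h hc)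

lemma IsFrame.coeff_res {e : Fin n → Γ(M, U)} (he : IsFrame M U e) {V W : X.Opens} (h : V ≤ U)
    (h' : W ≤ V) (s : Γ(M, V)) :
    he.coeff (h'.trans h) (res M h' s) = fun j ↦ resF h' (he.coeff h s j) := by
  refine he.coeff_eq _ ?_
  conv_lhs => rw [he.eq_sum h s]
  simp

lemma IsFrame.coeff_add {e : Fin n → Γ(M, U)} (he : IsFrame M U e) {V : X.Opens} (h : V ≤ U)
    (s t : Γ(M, V)) : he.coeff h (s + t) = he.coeff h s + he.coeff h t := by
  refine he.coeff_eq _ ?_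
  conv_lhs => rw [he.eq_sum h s, he.eq_sum h t]
  simp [add_smul, Finset.sum_add_distrib]

lemma IsFrame.coeff_smul {e : Fin n → Γ(M, U)} (he : IsFrame M U e) {V : X.Opens} (h : V ≤ U)
    (a : Γ(X, V)) (s : Γ(M, V)) : he.coeff h (a • s) = a • he.coeff h s := by
  refine he.coeff_eq _ ?_
  conv_lhs => rw [he.eq_sum h s]
  simp [Finset.smul_sum, smul_smul]

lemma IsFrame.mono {e : Fin n → Γ(M, U)} (he : IsFrame M U e) {V : X.Opens} (h : V ≤ U) :
    IsFrame M V (fun j ↦ res M h (e j)) := by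
  intro W hW s
  simpa using he W (hW.trans h) s

lemma IsFrame.iso {e : Fin n → Γ(M, U)} (he : IsFrame M U e) (φ : M ≅ N) :
    IsFrame N U (fun j ↦ φ.hom.app U (e j)) := by
  have hinv (V : X.Opens) (s : Γ(N, V)) : φ.hom.app V (φ.inv.app V s) = s := by
    rw [← ConcreteCategory.comp_apply, ← Scheme.Modules.Hom.comp_app]; simp
  have hinv' (V : X.Opens) (s : Γ(M, V)) : φ.inv.app V (φ.hom.app V s) = s := by
    rw [← ConcreteCategory.comp_apply, ← Scheme.Modules.Hom.comp_app]; simp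
  intro V h s
  refine ⟨he.coeff h (φ.inv.app V s), ?_, fun c hc ↦ ?_⟩
  · dsimp only
    simp_rw [← app_res, ← Scheme.Modules.Hom.app_smul, ← map_sum]
    rw [← he.eq_sum, hinv]
  · symm
    refine he.coeff_eq h ?_
    rw [hc]
    simp_rw [← app_res, ← Scheme.Modules.Hom.app_smul, ← map_sum]
    rw [hinv']

/-- It suffices to check that a family is a frame on a basis of open subsets. -/
lemma isFrame_of_basis (e : Fin n → Γ(M, U)) (B : Set X.Opens)
    (hB : ∀ V : X.Opens, V ≤ U → ∀ x ∈ V, ∃ W ∈ B, W ≤ V ∧ x ∈ W)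
    (h : ∀ V ∈ B, ∀ (hV : V ≤ U) (s : Γ(M, V)),
      ∃! c : Fin n → Γ(X, V), s = ∑ j, c j • res M hV (e j)) : IsFrame M U e := by
  -- Uniqueness of coordinates is first extended to all open subsets: gluing local coordinates needs
  -- it on intersections, which need not belong to the basis.
  have key (V : X.Opens) (hV : V ≤ U) (c d : Fin n → Γ(X, V))
      (hc : ∑ j, c j • res M hV (e j) = ∑ j, d j • res M hV (e j)) : c = d := by
    choose W hWB hWV hW using fun x : V ↦ hB V hV x x.2
    funext j
    refine function_ext W hWV (fun x hx ↦ TopologicalSpace.Opens.mem_iSup.mpr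
      ⟨⟨x, hx⟩, hW ⟨x, hx⟩⟩) fun x ↦ ?_
    have := (h (W x) (hWB x) ((hWV x).trans hV) (res M (hWV x) (∑ j, c j • res M hV (e j)))).unique
      (y₁ := fun j ↦ resF (hWV x) (c j)) (y₂ := fun j ↦ resF (hWV x) (d j))
      (by simp) (by rw [hc]; simp)
    exact congrFun this j
  intro V hV s
  choose W hWB hWV hW using fun x : V ↦ hB V hV x x.2
  have hcov : V ≤ ⨆ x, W x := fun x hx ↦ TopologicalSpace.Opens.mem_iSup.mpr
      ⟨⟨x, hx⟩, hW ⟨x, hx⟩⟩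
  choose c hc _ using fun x : V ↦ h (W x) (hWB x) ((hWV x).trans hV) (res M (hWV x) s)
  have hglue (j) : ∃ t : Γ(X, V), ∀ x, resF (hWV x) t = c x j := by
    refine function_glue W hWV hcov (fun x ↦ c x j) fun x y ↦ ?_
    refine congrFun (key (W x ⊓ W y) (inf_le_left.trans ((hWV x).trans hV))
      (fun j ↦ resF inf_le_left (c x j)) (fun j ↦ resF inf_le_right (c y j)) ?_) j
    have h₁ := congrArg (res M (inf_le_left : W x ⊓ W y ≤ W x)) (hc x)
    have h₂ := congrArg (res M (inf_le_right : W x ⊓ W y ≤ W y)) (hc y)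
    simp only [res_res, res_sum, res_smul] at h₁ h₂
    rw [← h₁, ← h₂]
  choose t ht using hglue
  refine ⟨t, ?_, fun d hd ↦ key V hV _ _ ?_⟩
  · refine section_ext M W hWV hcov fun x ↦ ?_
    rw [hc x]
    simp [ht]
  · rw [← hd]
    refine section_ext M W hWV hcov fun x ↦ ?_
    rw [hc x]
    simp [ht]

lemma isFrame_of_cover {ι : Type*} (e : Fin n → Γ(M, U)) (W : ι → X.Opens) (hW : ∀ i, W i ≤ U)
    (hU : U ≤ ⨆ i, W i) (h : ∀ i, IsFrame M (W i) (fun j ↦ res M (hW i) (e j))) :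
    IsFrame M U e := by
  refine isFrame_of_basis e {V | ∃ i, V ≤ W i} (fun V hV x hx ↦ ?_) ?_
  · obtain ⟨i, hi⟩ := TopologicalSpace.Opens.mem_iSup.mp (hU (hV hx))
    exact ⟨V ⊓ W i, ⟨i, inf_le_right⟩, inf_le_left, hx, hi⟩
  · rintro V ⟨i, hi⟩ hV s
    simpa using h i V hi s

lemma IsFrame.transition {m : ℕ} {e : Fin n → Γ(M, U)} (he : IsFrame M U e)
    {e' : Fin m → Γ(M, U)} (he' : IsFrame M U e') :
    ∃ (g : Matrix (Fin n) (Fin m) Γ(X, U)) (h : Matrix (Fin m) (Fin n) Γ(X, U)),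
      (∀ j, e' j = ∑ i, g i j • e i) ∧ (∀ j, e j = ∑ i, h i j • e' i) ∧ g * h = 1 ∧ h * g = 1 := by
  have h₁ (j) : e' j = ∑ i, he.coeff le_rfl (e' j) i • e i := by
    simpa using he.eq_sum le_rfl (e' j)
  have h₂ (j) : e j = ∑ i, he'.coeff le_rfl (e j) i • e' i := by
    simpa using he'.eq_sum le_rfl (e j)
  refine ⟨.of fun i j ↦ he.coeff le_rfl (e' j) i, .of fun i j ↦ he'.coeff le_rfl (e j) i,
    h₁, h₂, ?_, ?_⟩
  · ext i j
    refine congrFun (he.coeff_ext le_rfl (c := fun i ↦ (Matrix.of (fun i j ↦ he.coeff le_rfl (e' j) i) *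
      Matrix.of fun i j ↦ he'.coeff le_rfl (e j) i) i j)
      (d := fun i ↦ (1 : Matrix (Fin n) (Fin n) _) i j) ?_) i
    simp only [res_self, Matrix.mul_apply, Matrix.of_apply, Matrix.one_apply, ite_smul, one_smul,
      zero_smul, Finset.sum_ite_eq', Finset.mem_univ, if_true, Finset.sum_smul, mul_smul]
    rw [Finset.sum_comm]
    conv_rhs => rw [h₂ j]
    refine Finset.sum_congr rfl fun k _ ↦ ?_
    conv_rhs => rw [h₁ k, Finset.smul_sum]
    exact Finset.sum_congr rfl fun l _ ↦ by rw [smul_smul, smul_smul, mul_comm]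
  · ext i j
    refine congrFun (he'.coeff_ext le_rfl (c := fun i ↦ (Matrix.of (fun i j ↦ he'.coeff le_rfl (e j) i) *
      Matrix.of fun i j ↦ he.coeff le_rfl (e' j) i) i j)
      (d := fun i ↦ (1 : Matrix (Fin m) (Fin m) _) i j) ?_) i
    simp only [res_self, Matrix.mul_apply, Matrix.of_apply, Matrix.one_apply, ite_smul, one_smul,
      zero_smul, Finset.sum_ite_eq', Finset.mem_univ, if_true, Finset.sum_smul, mul_smul]
    rw [Finset.sum_comm]
    conv_rhs => rw [h₁ j]
    refine Finset.sum_congr rfl fun k _ ↦ ?_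
    conv_rhs => rw [h₂ k, Finset.smul_sum]
    exact Finset.sum_congr rfl fun l _ ↦ by rw [smul_smul, smul_smul, mul_comm]

lemma IsFrame.change {m : ℕ} {e : Fin n → Γ(M, U)} (he : IsFrame M U e)
    (g : Matrix (Fin n) (Fin m) Γ(X, U)) (h : Matrix (Fin m) (Fin n) Γ(X, U))
    (hgh : g * h = 1) (hhg : h * g = 1) : IsFrame M U (fun j ↦ ∑ i, g i j • e i) := by
  intro V hV s
  have hgh' : g.map (resF hV) * h.map (resF hV) = 1 := by
    rw [← Matrix.map_mul, hgh, Matrix.map_one _ (map_zero _) (map_one _)]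
  have hhg' : h.map (resF hV) * g.map (resF hV) = 1 := by
    rw [← Matrix.map_mul, hhg, Matrix.map_one _ (map_zero _) (map_one _)]
  have key (c : Fin m → Γ(X, V)) : ∑ j, c j • res M hV (∑ i, g i j • e i) =
      ∑ i, (g.map (resF hV)).mulVec c i • res M hV (e i) := by
    simp only [res_sum, res_smul, Finset.smul_sum, smul_smul, Matrix.mulVec, dotProduct,
      Finset.sum_smul, Matrix.map_apply]
    rw [Finset.sum_comm]
    exact Finset.sum_congr rfl fun i _ ↦ Finset.sum_congr rfl fun j _ ↦ by rw [mul_comm]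
  refine ⟨(h.map (resF hV)).mulVec (he.coeff hV s), ?_, fun c hc ↦ ?_⟩
  · dsimp only
    rw [key, Matrix.mulVec_mulVec, hgh', Matrix.one_mulVec]
    exact he.eq_sum hV s
  · dsimp only at hc
    rw [key] at hc
    rw [he.coeff_eq hV hc, Matrix.mulVec_mulVec, hhg', Matrix.one_mulVec]

end Frame

/-! ### Morphisms defined on frames -/

section HomOfFrames

variable {X : Scheme.{0}} {ι : Type} (U : ι → X.Opens)

/-- The sections of `N` over any open subset `V` are obtained by gluing sections
over the open subsets `V ⊓ U i`. -/
def Glues (N : X.Modules) : Prop :=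
  ∀ V : X.Opens,
    (∀ s t : Γ(N, V), (∀ i, res N (inf_le_left : V ⊓ U i ≤ V) s = res N inf_le_left t) → s = t) ∧
    ∀ s : ∀ i, Γ(N, V ⊓ U i), (∀ i j, res N (inf_le_left : (V ⊓ U i) ⊓ (V ⊓ U j) ≤ V ⊓ U i) (s i) =
      res N inf_le_right (s j)) → ∃ t : Γ(N, V), ∀ i, res N inf_le_left t = s i

variable {U}

lemma glues_of_iSup_eq_top (hU : ⨆ i, U i = ⊤) (N : X.Modules) : Glues U N := by
  intro V
  have hV : V ≤ ⨆ i, V ⊓ U i := by rw [← inf_iSup_eq, hU, inf_top_eq]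
  exact ⟨fun s t h ↦ section_ext N _ (fun i ↦ inf_le_left) hV h,
    fun s h ↦ section_glue N _ (fun i ↦ inf_le_left) hV s h⟩

variable {M N : X.Modules} {n : ℕ}

lemma hom_ext_of_frames (hN : Glues U N) {e : ∀ i, Fin n → Γ(M, U i)}
    (he : ∀ i, IsFrame M (U i) (e i)) {φ ψ : M ⟶ N}
    (h : ∀ i k, φ.app (U i) (e i k) = ψ.app (U i) (e i k)) : φ = ψ := by
  ext V s
  refine (hN V).1 _ _ fun i ↦ ?_
  rw [← app_res, ← app_res, (he i).eq_sum inf_le_right (res M inf_le_left s)]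
  simp [app_res, h]

/-- On each `U i` the map is forced by its values on the frame, and equal transition matrices make
these maps agree on overlaps. Only the target has to be determined by the `U i`; they need not cover
the scheme, which is what makes the lemma usable for a single open subset in `IsFrame.pull`. -/
lemma exists_hom_of_frames (hN : Glues U N) {e : ∀ i, Fin n → Γ(M, U i)}
    (he : ∀ i, IsFrame M (U i) (e i)) (f : ∀ i, Fin n → Γ(N, U i))
    (A : ∀ i j, Matrix (Fin n) (Fin n) Γ(X, U i ⊓ U j))
    (hA : ∀ i j k, res M inf_le_left (e i k) = ∑ l, A i j l k • res M inf_le_right (e j l))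
    (hA' : ∀ i j k, res N inf_le_left (f i k) = ∑ l, A i j l k • res N inf_le_right (f j l)) :
    ∃ φ : M ⟶ N, ∀ i k, φ.app (U i) (e i k) = f i k := by
  let L (i : ι) {V : X.Opens} (h : V ≤ U i) (s : Γ(M, V)) : Γ(N, V) :=
    ∑ k, (he i).coeff h s k • res N h (f i k)
  have Lres (i : ι) {V W : X.Opens} (h : V ≤ U i) (h' : W ≤ V) (s : Γ(M, V)) :
      res N h' (L i h s) = L i (h'.trans h) (res M h' s) := by
    simp [L, IsFrame.coeff_res _ h h']
  have Ladd (i : ι) {V : X.Opens} (h : V ≤ U i) (s t : Γ(M, V)) :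
      L i h (s + t) = L i h s + L i h t := by
    simp [L, IsFrame.coeff_add, add_smul, Finset.sum_add_distrib]
  have Lsmul (i : ι) {V : X.Opens} (h : V ≤ U i) (a : Γ(X, V)) (s : Γ(M, V)) :
      L i h (a • s) = a • L i h s := by
    simp [L, IsFrame.coeff_smul, Finset.smul_sum, smul_smul]
  -- Independence of the chosen frame: changing frame multiplies coordinates and values by the same
  -- matrix `A i j`.
  have Leq (i j : ι) {V : X.Opens} (hi : V ≤ U i) (hj : V ≤ U j) (s : Γ(M, V)) :
      L i hi s = L j hj s := by
    have hV : V ≤ U i ⊓ U j := le_inf hi hj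
    have hM (k) : res M hi (e i k) = ∑ l, resF hV (A i j l k) • res M hj (e j l) := by
      simpa using congrArg (res M hV) (hA i j k)
    have hN (k) : res N hi (f i k) = ∑ l, resF hV (A i j l k) • res N hj (f j l) := by
      simpa using congrArg (res N hV) (hA' i j k)
    have : (he j).coeff hj s = fun l ↦ ∑ k, (he i).coeff hi s k * resF hV (A i j l k) := by
      refine (he j).coeff_eq hj ?_
      conv_lhs => rw [(he i).eq_sum hi s]
      simp only [hM, Finset.smul_sum, smul_smul, Finset.sum_smul]
      rw [Finset.sum_comm]
    simp only [L, this, hN, Finset.smul_sum, smul_smul, Finset.sum_smul]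
    rw [Finset.sum_comm]
  have hex (V : X.Opens) (s : Γ(M, V)) : ∃ t : Γ(N, V), ∀ i,
      res N (inf_le_left : V ⊓ U i ≤ V) t = L i inf_le_right (res M inf_le_left s) := by
    refine (hN V).2 _ fun i j ↦ ?_
    rw [Lres, Lres, res_res, res_res]
    exact Leq i j _ _ _
  choose F hF using hex
  have hF' (V : X.Opens) (s : Γ(M, V)) (i : ι) (W : X.Opens) (h : W ≤ V) (h' : W ≤ U i) :
      res N h (F V s) = L i h' (res M h s) := by
    have := congrArg (res N (le_inf h h')) (hF V s i)
    rw [Lres] at this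
    simpa using this
  refine ⟨homMk (fun V ↦ AddMonoidHom.mk' (F V) fun s t ↦ (hN V).1 _ _ fun i ↦ ?_)
    (fun V W h s ↦ (hN W).1 _ _ fun i ↦ ?_) (fun V a s ↦ (hN V).1 _ _ fun i ↦ ?_), fun i k ↦ ?_⟩
  · rw [res_add, hF, hF, hF, res_add, Ladd]
  · simp only [AddMonoidHom.mk'_apply]
    rw [hF, res_res, res_res, hF' V s i _ _ inf_le_right]
  · simp only [AddMonoidHom.mk'_apply]
    rw [res_smul, hF, hF, res_smul, Lsmul]
  · rw [homMk_app, AddMonoidHom.mk'_apply]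
    refine (res_self N le_rfl _).symm.trans ?_
    rw [hF' (U i) (e i k) i _ le_rfl le_rfl, res_self]
    have : (he i).coeff le_rfl (e i k) = Pi.single k 1 :=
      (he i).coeff_eq le_rfl (by simp [Pi.single_apply])
    simp [L, this, Pi.single_apply]

/-- Two sheaves of modules with the same transition matrices are isomorphic. -/
lemma nonempty_iso_of_frames (hU : ⨆ i, U i = ⊤) {e : ∀ i, Fin n → Γ(M, U i)}
    (he : ∀ i, IsFrame M (U i) (e i)) {f : ∀ i, Fin n → Γ(N, U i)}
    (hf : ∀ i, IsFrame N (U i) (f i))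
    (A : ∀ i j, Matrix (Fin n) (Fin n) Γ(X, U i ⊓ U j))
    (hA : ∀ i j k, res M inf_le_left (e i k) = ∑ l, A i j l k • res M inf_le_right (e j l))
    (hA' : ∀ i j k, res N inf_le_left (f i k) = ∑ l, A i j l k • res N inf_le_right (f j l)) :
    Nonempty (M ≅ N) := by
  obtain ⟨φ, hφ⟩ := exists_hom_of_frames (glues_of_iSup_eq_top hU N) he f A hA hA'
  obtain ⟨ψ, hψ⟩ := exists_hom_of_frames (glues_of_iSup_eq_top hU M) hf e A hA' hA
  exact ⟨⟨φ, ψ, hom_ext_of_frames (glues_of_iSup_eq_top hU M) he fun i k ↦ by simp [hφ, hψ],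
    hom_ext_of_frames (glues_of_iSup_eq_top hU N) hf fun i k ↦ by simp [hφ, hψ]⟩⟩

end HomOfFrames

/-! ### Inverse images of frames -/

section Pull

open Scheme.Modules

/-- The structure sheaf as a sheaf of modules. -/
abbrev unitModule (X : Scheme.{0}) : X.Modules := SheafOfModules.unit X.ringCatSheaf

/-- The sheaf of modules `V ↦ Γ(M, V ⊓ W)`. -/
abbrev onOpen {X : Scheme.{0}} (W : X.Opens) (M : X.Modules) : X.Modules :=
  (pushforward W.ι).obj (M.restrict W.ι)

lemma onOpen_le {X : Scheme.{0}} (W V : X.Opens) : W.ι ''ᵁ (W.ι ⁻¹ᵁ V) ≤ V := by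
  rw [Scheme.Hom.image_preimage_eq_opensRange_inf]
  exact inf_le_right

lemma le_onOpen {X : Scheme.{0}} {W V : X.Opens} (h : V ≤ W) : V ≤ W.ι ''ᵁ (W.ι ⁻¹ᵁ V) := by
  rw [Scheme.Hom.image_preimage_eq_opensRange_inf]
  simpa using h

variable {X Y : Scheme.{0}}

/-- A section of `M` over `V ⊓ W` as a section of `onOpen W M` over `V`. -/
def toOnOpen {W : X.Opens} {M : X.Modules} {V : X.Opens} (s : Γ(M, W.ι ''ᵁ (W.ι ⁻¹ᵁ V))) :
    Γ(onOpen W M, V) := s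

/-- A section of `onOpen W M` over `V` as a section of `M` over `V ⊓ W`. -/
def ofOnOpen {W : X.Opens} {M : X.Modules} {V : X.Opens} (s : Γ(onOpen W M, V)) :
    Γ(M, W.ι ''ᵁ (W.ι ⁻¹ᵁ V)) := s

lemma ofOnOpen_smul {W : X.Opens} {M : X.Modules} {V : X.Opens} (a : Γ(X, V))
    (s : Γ(onOpen W M, V)) : ofOnOpen (a • s) = resF (onOpen_le W V) a • ofOnOpen s := by
  have : ofOnOpen (a • s) = (W.ι.appIso _).inv (W.ι.app V a) • ofOnOpen s := rfl
  rw [this]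
  congr 1
  simp only [Scheme.Opens.ι_appIso, Scheme.Opens.ι_app, resF, Iso.refl_inv]
  rfl

lemma exists_hom_onOpen {M N : X.Modules} {W : X.Opens}
    (G : ∀ V : X.Opens, Γ(M, V) → Γ(N, W.ι ''ᵁ (W.ι ⁻¹ᵁ V)))
    (hadd : ∀ V s t, G V (s + t) = G V s + G V t)
    (hsmul : ∀ (V : X.Opens) (a : Γ(X, V)) (s : Γ(M, V)),
      G V (a • s) = resF (onOpen_le W V) a • G V s)
    (hres : ∀ (U V : X.Opens) (h : V ≤ U) (s : Γ(M, U)),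
      G V (res M h s) = res N (W.ι.image_mono (W.ι.preimage_mono h)) (G U s)) :
    ∃ Φ : M ⟶ onOpen W N, ∀ V s, ofOnOpen (Φ.app V s) = G V s :=
  ⟨homMk (N := onOpen W N) (fun V ↦ AddMonoidHom.mk' (fun s ↦ toOnOpen (G V s)) (hadd V))
    (fun U V h s ↦ hres U V h s)
    (fun V a s ↦ (hsmul V a s).trans (ofOnOpen_smul a (toOnOpen (G V s))).symm), fun _ _ ↦ rfl⟩

lemma ofOnOpen_injective {W : X.Opens} {M : X.Modules} {V : X.Opens} :
    Function.Injective (ofOnOpen : Γ(onOpen W M, V) → _) := fun _ _ h ↦ h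

variable (f : X ⟶ Y) {M : Y.Modules}

/-- The inverse image of a section. -/
def pull {U : Y.Opens} (s : Γ(M, U)) : Γ(restr f M, f ⁻¹ᵁ U) :=
  ((pullbackPushforwardAdjunction f).unit.app M).app U s

lemma pull_res {U V : Y.Opens} (h : V ≤ U) (s : Γ(M, U)) :
    pull f (res M h s) = res _ (f.preimage_mono h) (pull f s) :=
  app_res ((pullbackPushforwardAdjunction f).unit.app M) h s

lemma pull_sum {U : Y.Opens} {ι : Type*} (I : Finset ι) (s : ι → Γ(M, U)) :
    pull f (∑ i ∈ I, s i) = ∑ i ∈ I, pull f (s i) :=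
  map_sum (((pullbackPushforwardAdjunction f).unit.app M).app U).hom s I

lemma pull_smul {U : Y.Opens} (a : Γ(Y, U)) (s : Γ(M, U)) :
    pull f (a • s) = f.app U a • pull f s :=
  ((pullbackPushforwardAdjunction f).unit.app M).app_smul a s

lemma exists_pullback_hom {N : X.Modules} (u : M ⟶ (pushforward f).obj N) :
    ∃ θ : restr f M ⟶ N, ∀ (U : Y.Opens) (s : Γ(M, U)), θ.app _ (pull f s) = u.app U s := by
  refine ⟨((pullbackPushforwardAdjunction f).homEquiv M N).symm u, fun U s ↦ ?_⟩
  have := ((pullbackPushforwardAdjunction f).homEquiv M N).apply_symm_apply u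
  conv_rhs => rw [← this]
  rw [Adjunction.homEquiv_unit]
  rfl

/-- Over `V` this sheaf only sees the part of `f ⁻¹ᵁ V` inside `W`, which already lies over `V ⊓ U`;
so restriction from `V` to `V ⊓ U` loses nothing. -/
lemma glues_pushforward_onOpen {U : Y.Opens} {W : X.Opens} (hW : W ≤ f ⁻¹ᵁ U) (N : X.Modules) :
    Glues (fun _ : Unit ↦ U) ((pushforward f).obj (onOpen W N)) := by
  intro V
  have hle : W.ι ''ᵁ (W.ι ⁻¹ᵁ (f ⁻¹ᵁ V)) ≤ W.ι ''ᵁ (W.ι ⁻¹ᵁ (f ⁻¹ᵁ (V ⊓ U))) := by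
    rw [Scheme.Hom.image_preimage_eq_opensRange_inf, Scheme.Hom.image_preimage_eq_opensRange_inf]
    simp only [Scheme.Opens.opensRange_ι]
    exact le_inf inf_le_left (le_inf inf_le_right (inf_le_left.trans hW))
  have key (s : Γ(N, W.ι ''ᵁ (W.ι ⁻¹ᵁ (f ⁻¹ᵁ V)))) : res N hle (res N
      (W.ι.image_mono (W.ι.preimage_mono (f.preimage_mono inf_le_left))) s) = s := by
    simp
  refine ⟨fun s t h ↦ ?_, fun s _ ↦ ⟨res N hle (ofOnOpen (s ())), fun _ ↦ ?_⟩⟩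
  · have := congrArg (fun s ↦ res N hle (ofOnOpen s)) (h ())
    exact ((key s).symm.trans this).trans (key t)
  · exact (res_res N hle (W.ι.image_mono (W.ι.preimage_mono (f.preimage_mono inf_le_left)))
      (ofOnOpen (s ()))).trans (res_self N _ _)

variable {f}

/-- The inverse image is accessible only through its adjunction with the direct image. Coordinate
functionals on it are adjoint to the coordinate functionals of `e`. That every section is the
combination given by its coordinates is an equality of two morphisms out of the inverse image, and
by adjunction it need only be tested on the frame `e`. -/
theorem IsFrame.pull {U : Y.Opens} {n : ℕ} {e : Fin n → Γ(M, U)} (he : IsFrame M U e) :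
    IsFrame (restr f M) (f ⁻¹ᵁ U) (fun j ↦ DegreeBound.pull f (e j)) := by
  set W := f ⁻¹ᵁ U with hW
  have hWW : W ≤ W.ι ''ᵁ (W.ι ⁻¹ᵁ W) := le_onOpen le_rfl
  let δ (k j : Fin n) : Γ(onOpen W (unitModule X), W) :=
    (if j = k then 1 else 0 : Γ(X, W.ι ''ᵁ (W.ι ⁻¹ᵁ W)))
  have hθ (k : Fin n) : ∃ θ : restr f M ⟶ onOpen W (unitModule X), ∀ j,
      θ.app W (DegreeBound.pull f (e j)) = δ k j := by
    obtain ⟨u, hu⟩ := exists_hom_of_frames (U := fun _ : Unit ↦ U) (M := M)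
      (glues_pushforward_onOpen f le_rfl (unitModule X)) (fun _ ↦ he)
      (fun _ ↦ δ k) (fun _ _ ↦ 1) (by simp [Matrix.one_apply])
      (fun _ _ j ↦ by
        simp only [Matrix.one_apply, ite_smul, one_smul, zero_smul, Finset.sum_ite_eq',
          Finset.mem_univ, if_true])
    obtain ⟨θ, hθ⟩ := exists_pullback_hom f u
    exact ⟨θ, fun j ↦ by rw [hθ, hu ()]⟩
  choose θ hθ using hθ
  let c (k : Fin n) {V : X.Opens} (s : Γ(restr f M, V)) : Γ(X, W.ι ''ᵁ (W.ι ⁻¹ᵁ V)) :=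
    ofOnOpen ((θ k).app V s)
  have c_res (k : Fin n) {V V' : X.Opens} (h : V' ≤ V) (s : Γ(restr f M, V)) :
      c k (res _ h s) = resF (W.ι.image_mono (W.ι.preimage_mono h)) (c k s) := by
    simp only [c, app_res]
    rfl
  have c_add (k : Fin n) {V : X.Opens} (s t : Γ(restr f M, V)) :
      c k (s + t) = c k s + c k t := by
    simp only [c, map_add]
    rfl
  have c_smul (k : Fin n) {V : X.Opens} (a : Γ(X, V)) (s : Γ(restr f M, V)) :
      c k (a • s) = resF (onOpen_le W V) a * c k s := by
    simp only [c, Scheme.Modules.Hom.app_smul]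
    exact ofOnOpen_smul _ _
  have c_sum (k : Fin n) {V : X.Opens} (s : Fin n → Γ(restr f M, V)) :
      c k (∑ j, s j) = ∑ j, c k (s j) :=
    map_sum (AddMonoidHom.mk' (fun s : Γ(restr f M, V) ↦ c k s) (c_add k)) s _
  have c_frame (k j : Fin n) : c k (DegreeBound.pull f (e j)) = if j = k then 1 else 0 := by
    exact congrArg ofOnOpen (hθ k j)
  have hle (V : X.Opens) : W.ι ''ᵁ (W.ι ⁻¹ᵁ V) ≤ W :=
    (W.ι.image_mono le_top).trans (by simp)
  obtain ⟨Ψ, hΨ⟩ := exists_hom_onOpen (M := restr f M) (N := restr f M) (W := W)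
    (fun V s ↦ ∑ k, c k s • res (restr f M) (hle V) (DegreeBound.pull f (e k)))
    (fun V s t ↦ by simp only [c_add, add_smul, Finset.sum_add_distrib])
    (fun V a s ↦ by simp only [c_smul, Finset.smul_sum, smul_smul])
    (fun U V h s ↦ by simp only [c_res, res_sum, res_smul, res_res])
  obtain ⟨Φ, hΦ⟩ := exists_hom_onOpen (M := restr f M) (N := restr f M) (W := W)
    (fun V s ↦ res _ (onOpen_le W V) s) (fun V s t ↦ by rw [res_add])
    (fun V a s ↦ by rw [res_smul]) (fun U V h s ↦ by rw [res_res, res_res])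
  -- `Φ` restricts a section to `W` and `Ψ` rebuilds it from its coordinates.
  have hΦΨ : Φ = Ψ := by
    apply ((pullbackPushforwardAdjunction f).homEquiv M _).injective
    refine hom_ext_of_frames (U := fun _ : Unit ↦ U)
      (glues_pushforward_onOpen f le_rfl _) (fun _ ↦ he) fun _ j ↦ ?_
    change Φ.app W (DegreeBound.pull f (e j)) = Ψ.app W (DegreeBound.pull f (e j))
    apply ofOnOpen_injective
    rw [hΦ, hΨ]
    simp [c_frame]
  intro V hV s
  have hVV := le_onOpen hV
  refine ⟨fun k ↦ resF hVV (c k s), ?_, fun d hd ↦ ?_⟩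
  · have := congrArg (fun Φ ↦ res (restr f M) hVV (ofOnOpen (Scheme.Modules.Hom.app Φ V s))) hΦΨ
    simp only [hΦ, hΨ] at this
    simpa using this
  · funext k
    rw [hd, c_sum]
    simp [c_smul, c_res, c_frame]

end Pull

/-! ### Presentations -/

section Presentation

open Scheme.Modules

variable {X : Scheme.{0}} {M N : X.Modules}

/-- A morphism is determined by a relation which is locally the graph of a linear map. -/
lemma exists_hom_of_relation (R : ∀ V : X.Opens, Γ(M, V) → Γ(N, V) → Prop)
    (hadd : ∀ V s s' t t', R V s t → R V s' t' → R V (s + s') (t + t'))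
    (hsmul : ∀ (V : X.Opens) (a : Γ(X, V)) s t, R V s t → R V (a • s) (a • t))
    (hres : ∀ (V W : X.Opens) (h : W ≤ V) s t, R V s t → R W (res M h s) (res N h t))
    (hloc : ∀ (V : X.Opens) (s : Γ(M, V)), ∀ x ∈ V, ∃ (W : X.Opens) (h : W ≤ V),
      x ∈ W ∧ ∃ t, R W (res M h s) t)
    (huniq : ∀ V s t t', R V s t → R V s t' → t = t') :
    ∃ φ : M ⟶ N, ∀ V s t, R V s t → φ.app V s = t := by
  have key (V : X.Opens) (s : Γ(M, V)) : ∃ t : Γ(N, V), ∀ (W : X.Opens) (h : W ≤ V) t',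
      R W (res M h s) t' → res N h t = t' := by
    choose W hWV hW t ht using fun x : V ↦ hloc V s x x.2
    have hcov : V ≤ ⨆ x, W x := fun x hx ↦ TopologicalSpace.Opens.mem_iSup.mpr
      ⟨⟨x, hx⟩, hW ⟨x, hx⟩⟩
    obtain ⟨T, hT⟩ := section_glue N W hWV hcov t fun x y ↦ by
      refine huniq _ (res M (inf_le_left.trans (hWV x)) s) _ _ ?_ ?_
      · simpa using hres _ _ inf_le_left _ _ (ht x)
      · simpa using hres _ _ (inf_le_right : W x ⊓ W y ≤ W y) _ _ (ht y)
    refine ⟨T, fun V' h t' ht' ↦ ?_⟩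
    refine section_ext N (fun x ↦ V' ⊓ W x) (fun x ↦ inf_le_left)
      (by rw [← inf_iSup_eq]; exact le_inf le_rfl (h.trans hcov)) fun x ↦ ?_
    refine huniq _ (res M (inf_le_left.trans h) s) _ _ ?_ ?_
    · have := congrArg (res N (inf_le_right : V' ⊓ W x ≤ W x)) (hT x)
      rw [res_res] at this
      rw [res_res, this]
      simpa using hres _ _ (inf_le_right : V' ⊓ W x ≤ W x) _ _ (ht x)
    · simpa using hres _ _ (inf_le_left : V' ⊓ W x ≤ V') _ _ ht'
  have ext (V : X.Opens) (s : Γ(M, V)) (t t' : Γ(N, V))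
      (h : ∀ (W : X.Opens) (h : W ≤ V) u, R W (res M h s) u → res N h t = u ∧ res N h t' = u) :
      t = t' := by
    choose W hWV hW u hu using fun x : V ↦ hloc V s x x.2
    refine section_ext N W hWV (fun x hx ↦ TopologicalSpace.Opens.mem_iSup.mpr
      ⟨⟨x, hx⟩, hW ⟨x, hx⟩⟩) fun x ↦ ?_
    obtain ⟨h₁, h₂⟩ := h (W x) (hWV x) (u x) (hu x)
    rw [h₁, h₂]
  choose F hF using key
  refine ⟨homMk (fun V ↦ AddMonoidHom.mk' (F V) fun s s' ↦ ?_) (fun V W h s ↦ ?_)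
    (fun V a s ↦ ?_), fun V s t h ↦ ?_⟩
  · choose W hWV hW u hu using fun x : V ↦ hloc V s x x.2
    choose W' hWV' hW' u' hu' using fun x : V ↦ hloc V s' x x.2
    refine section_ext N (fun x ↦ W x ⊓ W' x) (fun x ↦ inf_le_left.trans (hWV x))
      (fun x hx ↦ TopologicalSpace.Opens.mem_iSup.mpr ⟨⟨x, hx⟩, hW ⟨x, hx⟩, hW' ⟨x, hx⟩⟩)
      fun x ↦ ?_
    have h₁ := hres _ _ (inf_le_left : W x ⊓ W' x ≤ W x) _ _ (hu x)
    have h₂ := hres _ _ (inf_le_right : W x ⊓ W' x ≤ W' x) _ _ (hu' x)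
    have h₃ := hadd _ _ _ _ _ h₁ h₂
    rw [res_res] at h₁ h₂
    rw [res_res, res_res, ← res_add] at h₃
    rw [res_add, hF _ _ _ _ _ h₁, hF _ _ _ _ _ h₂, hF _ _ _ _ _ h₃]
  · refine ext W (res M h s) _ _ fun W' h' u hu ↦ ⟨hF _ _ _ _ _ hu, ?_⟩
    rw [AddMonoidHom.mk'_apply, res_res]
    rw [res_res] at hu
    exact hF _ _ _ _ _ hu
  · choose W hWV hW u hu using fun x : V ↦ hloc V s x x.2
    refine section_ext N W hWV (fun x hx ↦ TopologicalSpace.Opens.mem_iSup.mpr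
      ⟨⟨x, hx⟩, hW ⟨x, hx⟩⟩) fun x ↦ ?_
    have h₁ := hsmul _ (resF (hWV x) a) _ _ (hu x)
    rw [← res_smul] at h₁
    change res N _ (F V (a • s)) = res N _ (a • F V s)
    rw [res_smul, hF _ _ _ _ _ h₁,
      hF _ _ _ _ _ (hu x)]
  · rw [homMk_app, AddMonoidHom.mk'_apply, ← res_self N le_rfl (F V s)]
    exact hF V s V le_rfl t (by simpa using h)

/-- The sections `e` generate `M` over `U`, and the relations between them
are generated by the family `t`. -/
structure IsPresentation (M : X.Modules) (U : X.Opens) {n k : ℕ} (e : Fin n → Γ(M, U))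
    (t : Fin k → Fin n → Γ(X, U)) : Prop where
  generates : ∀ (V : X.Opens) (h : V ≤ U) (s : Γ(M, V)), ∀ x ∈ V, ∃ (W : X.Opens) (h' : W ≤ V),
    x ∈ W ∧ ∃ c : Fin n → Γ(X, W), res M h' s = ∑ j, c j • res M (h'.trans h) (e j)
  relation : ∀ l, ∑ j, t l j • e j = 0
  exact : ∀ (V : X.Opens) (h : V ≤ U) (c : Fin n → Γ(X, V)), ∑ j, c j • res M h (e j) = 0 →
    ∀ x ∈ V, ∃ (W : X.Opens) (h' : W ≤ V), x ∈ W ∧ ∃ d : Fin k → Γ(X, W),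
      ∀ j, resF h' (c j) = ∑ l, d l * resF (h'.trans h) (t l j)

lemma IsFrame.isPresentation {U : X.Opens} {n : ℕ} {e : Fin n → Γ(M, U)} (he : IsFrame M U e) :
    IsPresentation M U e (k := 0) (fun l ↦ l.elim0) where
  generates V h s x hx := ⟨V, le_rfl, hx, he.coeff h s, by rw [res_self]; exact he.eq_sum h s⟩
  relation l := l.elim0
  exact V h c hc x hx := by
    have : c = 0 := he.coeff_ext h (by simp [hc])
    exact ⟨V, le_rfl, hx, fun l ↦ l.elim0, by simp [this]⟩

/-- A global section as a section in the sense of `SheafOfModules`. -/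
def toSections (s : Γ(M, ⊤)) : SheafOfModules.sections (R := X.ringCatSheaf) M :=
  PresheafOfModules.sectionsMk (fun V ↦ res M (U := ⊤) (V := V.unop) le_top s)
    (fun V W f ↦ res_res M (U := ⊤) (V := V.unop) (W := W.unop) le_top (leOfHom f.unop) s)

/-- The global section defined by a section in the sense of `SheafOfModules`. -/
def ofSections (s : SheafOfModules.sections (R := X.ringCatSheaf) M) : Γ(M, ⊤) :=
  s.eval (.op ⊤)

lemma ofSections_injective :
    Function.Injective (ofSections (M := M)) := by
  intro s t h
  refine PresheafOfModules.sections_ext _ _ fun V ↦ ?_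
  have hs (s : SheafOfModules.sections (R := X.ringCatSheaf) M) :
      res M le_top (ofSections s) = (s.eval V : Γ(M, V.unop)) :=
    PresheafOfModules.sections_property s (homOfLE (le_top : V.unop ≤ ⊤)).op
  exact (hs s).symm.trans ((congrArg _ h).trans (hs t))

lemma ofSections_toSections (s : Γ(M, ⊤)) : ofSections (toSections s) = s := res_self M _ s

variable (X) in
/-- The free sheaf of modules of rank `n`. -/
def freeModule (n : ℕ) : X.Modules := SheafOfModules.free (R := X.ringCatSheaf) (Fin n)

/-- The morphism from a free sheaf of modules defined by global sections. -/
def freeHom {n : ℕ} (s : Fin n → Γ(M, ⊤)) :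
    freeModule X n ⟶ M :=
  (SheafOfModules.freeHomEquiv (R := X.ringCatSheaf) M).symm fun i ↦ toSections (s i)

variable (X) in
/-- The standard global sections of a free sheaf of modules. -/
def freeBasis (n : ℕ) (i : Fin n) :
    Γ(freeModule X n, ⊤) :=
  ofSections (SheafOfModules.freeSection i)

lemma freeHom_basis {n : ℕ} (s : Fin n → Γ(M, ⊤)) (i : Fin n) :
    (freeHom s).app ⊤ (freeBasis X n i) = s i := by
  have := SheafOfModules.sectionsMap_freeHomEquiv_symm_freeSection
    (M := M) (fun i ↦ toSections (s i)) i
  exact (congrArg ofSections this).trans (ofSections_toSections _)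

lemma free_hom_ext {n : ℕ}
    {φ ψ : freeModule X n ⟶ M}
    (h : ∀ i, φ.app ⊤ (freeBasis X n i) = ψ.app ⊤ (freeBasis X n i)) : φ = ψ := by
  apply (SheafOfModules.freeHomEquiv (R := X.ringCatSheaf) M).injective
  funext i
  exact ofSections_injective (h i)

/-- The module is the cokernel of the map between free modules given by `t`. Generation is only
local, so a morphism out of the cokernel is produced from its graph by `exists_hom_of_relation`. -/
lemma IsPresentation.exists_presentation {n k : ℕ} {e : Fin n → Γ(M, ⊤)}
    {t : Fin k → Fin n → Γ(X, ⊤)} (h : IsPresentation M ⊤ e t) :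
    ∃ P : SheafOfModules.Presentation (R := X.ringCatSheaf) M, P.IsFinite := by
  let f := freeHom fun l ↦ ∑ j, t l j • freeBasis X n j
  have hf {N : X.Modules} (ψ : freeModule X n ⟶ N)
      (l) : (f ≫ ψ).app ⊤ (freeBasis X k l) = ∑ j, t l j • ψ.app ⊤ (freeBasis X n j) := by
    simp [f, freeHom_basis]
  have H : f ≫ freeHom e = 0 := by
    refine free_hom_ext fun l ↦ ?_
    rw [hf]
    simp only [freeHom_basis]
    exact (h.relation l).trans rfl
  have ext {N : X.Modules} (φ ψ : M ⟶ N) (hφψ : freeHom e ≫ φ = freeHom e ≫ ψ) : φ = ψ := by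
    have he (j) : φ.app ⊤ (e j) = ψ.app ⊤ (e j) := by
      have := congr(Scheme.Modules.Hom.app $hφψ ⊤ (freeBasis X n j))
      simpa [freeHom_basis] using this
    ext V s
    choose W hWV hW c hc using fun x : V ↦ h.generates V le_top s x x.2
    refine section_ext N W hWV (fun x hx ↦ TopologicalSpace.Opens.mem_iSup.mpr
      ⟨⟨x, hx⟩, hW ⟨x, hx⟩⟩) fun x ↦ ?_
    rw [← app_res, ← app_res, hc]
    simp [app_res, he]
  have desc {N : X.Modules}
      (ψ : freeModule X n ⟶ N)
      (hψ : f ≫ ψ = 0) : ∃ φ : M ⟶ N, freeHom e ≫ φ = ψ := by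
    let p (j : Fin n) := ψ.app ⊤ (freeBasis X n j)
    have hp (l) : ∑ j, t l j • p j = 0 := by
      rw [← hf, hψ]
      rfl
    -- The graph sends `∑ c j • e j` to `∑ c j • p j`; it is single-valued because a relation
    -- between the `e j` is locally a combination of the rows of `t`, which annihilate `p`.
    have ⟨φ, hφ⟩ : ∃ φ : M ⟶ N, ∀ V s u, (∃ c : Fin n → Γ(X, V),
        s = ∑ j, c j • res M le_top (e j) ∧ u = ∑ j, c j • res N le_top (p j)) →
        φ.app V s = u := by
      refine exists_hom_of_relation (M := M) (N := N) _ ?_ ?_ ?_ ?_ ?_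
      · rintro V _ _ _ _ ⟨c, rfl, rfl⟩ ⟨d, rfl, rfl⟩
        exact ⟨c + d, by simp [add_smul, Finset.sum_add_distrib],
          by simp [add_smul, Finset.sum_add_distrib]⟩
      · rintro V a _ _ ⟨c, rfl, rfl⟩
        exact ⟨a • c, by simp [Finset.smul_sum, smul_smul], by simp [Finset.smul_sum, smul_smul]⟩
      · rintro V W hVW _ _ ⟨c, rfl, rfl⟩
        exact ⟨fun j ↦ resF hVW (c j), by simp, by simp⟩
      · intro V s x hx
        obtain ⟨W, hWV, hxW, c, hc⟩ := h.generates V le_top s x hx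
        exact ⟨W, hWV, hxW, _, c, hc, rfl⟩
      · rintro V s _ _ ⟨c, hc, rfl⟩ ⟨d, hd, rfl⟩
        choose W hWV hW a ha using fun x : V ↦ h.exact V le_top (c - d)
          (by simp [sub_smul, ← hc, ← hd]) x x.2
        refine section_ext N W hWV (fun x hx ↦ TopologicalSpace.Opens.mem_iSup.mpr
          ⟨⟨x, hx⟩, hW ⟨x, hx⟩⟩) fun x ↦ ?_
        rw [← sub_eq_zero, ← res_sub, ← Finset.sum_sub_distrib]
        simp only [← sub_smul, res_sum, res_smul, res_res]
        have := fun j ↦ ha x j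
        simp only [Pi.sub_apply] at this
        simp only [this, Finset.sum_smul, mul_smul]
        rw [Finset.sum_comm]
        refine Finset.sum_eq_zero fun l _ ↦ ?_
        have h0 := congrArg (res N (le_top : W x ≤ ⊤)) (hp l)
        simp only [res_sum, res_smul, res_zero] at h0
        rw [← Finset.smul_sum, h0, smul_zero]
    refine ⟨φ, free_hom_ext fun j ↦ ?_⟩
    have := hφ ⊤ (e j) (p j) ⟨Pi.single j 1, by simp [Pi.single_apply], by simp [Pi.single_apply]⟩
    simpa [freeHom_basis] using this
  have : Epi (freeHom e) := ⟨fun φ ψ hφψ ↦ ext φ ψ hφψ⟩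
  exact ⟨SheafOfModules.presentationOfIsCokernelFree (R := X.ringCatSheaf) f (freeHom e) H
    (Limits.CokernelCofork.IsColimit.ofπ' (freeHom e) H
      (fun ψ hψ ↦ ⟨(desc ψ hψ).choose, (desc ψ hψ).choose_spec⟩)),
      ⟨⟨inferInstanceAs (Finite (Fin n))⟩, ⟨inferInstanceAs (Finite (Fin k))⟩⟩⟩

/-- A section of `M` over an open subset of `U` as a section of `M.restrict U.ι`. -/
def toRestrict {U : X.Opens} {V : U.toScheme.Opens} (s : Γ(M, U.ι ''ᵁ V)) :
    Γ(M.restrict U.ι, V) := s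

lemma toRestrict_smul {U : X.Opens} {V : U.toScheme.Opens} (a : Γ(X, U.ι ''ᵁ V))
    (s : Γ(M, U.ι ''ᵁ V)) :
    toRestrict (a • s) = (show Γ(U.toScheme, V) from a) • toRestrict s := by
  have : (show Γ(U.toScheme, V) from a) • toRestrict s =
    toRestrict ((U.ι.appIso V).inv (show Γ(U.toScheme, V) from a) • s) := rfl
  rw [this]
  simp only [Scheme.Opens.ι_appIso, Iso.refl_inv]
  rfl

lemma toRestrict_sum {U : X.Opens} {V : U.toScheme.Opens} {n : ℕ} (s : Fin n → Γ(M, U.ι ''ᵁ V)) :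
    toRestrict (∑ j, s j) = ∑ j, toRestrict (s j) := rfl

lemma toRestrict_res {U : X.Opens} {V W : U.toScheme.Opens} (h : W ≤ V) (s : Γ(M, U.ι ''ᵁ V)) :
    res (M.restrict U.ι) h (toRestrict s) = toRestrict (res M (U.ι.image_mono h) s) := rfl

lemma ι_image_le (U : X.Opens) (V : U.toScheme.Opens) : U.ι ''ᵁ V ≤ U :=
  (U.ι.image_mono le_top).trans (by simp)

lemma exists_ι_image_eq {U W : X.Opens} (h : W ≤ U) : ∃ W' : U.toScheme.Opens, W = U.ι ''ᵁ W' :=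
  ⟨U.ι ⁻¹ᵁ W, by
    rw [Scheme.Hom.image_preimage_eq_opensRange_inf, right_eq_inf]
    simpa using h⟩

lemma toRestrict_res_top {U : X.Opens} (V : U.toScheme.Opens) (s : Γ(M, U)) :
    res (M.restrict U.ι) le_top (toRestrict (V := ⊤) (res M (ι_image_le U ⊤) s)) =
      toRestrict (V := V) (res M (ι_image_le U V) s) := by
  rw [toRestrict_res, res_res]

lemma resF_restrict_top {U : X.Opens} (V : U.toScheme.Opens) (a : Γ(X, U)) :
    (resF (X := U.toScheme) (le_top : V ≤ ⊤) (show Γ(U.toScheme, ⊤) from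
      resF (ι_image_le U ⊤) a)) = resF (ι_image_le U V) a :=
  resF_resF (ι_image_le U ⊤) (U.ι.image_mono (le_top : V ≤ ⊤)) a

lemma IsPresentation.restrict {U : X.Opens} {n k : ℕ} {e : Fin n → Γ(M, U)}
    {t : Fin k → Fin n → Γ(X, U)} (h : IsPresentation M U e t) :
    IsPresentation (M.restrict U.ι) ⊤ (fun j ↦ toRestrict (V := ⊤) (res M (ι_image_le U ⊤) (e j)))
      (fun l j ↦ (show Γ(U.toScheme, ⊤) from resF (ι_image_le U ⊤) (t l j))) where
  generates V _ s x hx := by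
    obtain ⟨W, hWV, hxW, c, hc⟩ := h.generates (U.ι ''ᵁ V) (ι_image_le U V) s x.1 ⟨x, hx, rfl⟩
    obtain ⟨W, rfl⟩ := exists_ι_image_eq (hWV.trans (ι_image_le U V))
    have hx' : x ∈ W := by
      obtain ⟨y, hy, hxy⟩ := hxW
      rwa [← U.ι.injective hxy]
    refine ⟨W, (U.ι.image_le_image_iff _ _).1 hWV, hx', c, ?_⟩
    refine (congrArg toRestrict hc).trans ?_
    rw [toRestrict_sum]
    simp only [toRestrict_res_top, toRestrict_smul]
  relation l := by
    have := congrArg (fun s ↦ toRestrict (V := ⊤) (res M (ι_image_le U ⊤) s)) (h.relation l)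
    simp only [res_sum, res_smul, toRestrict_sum, toRestrict_smul, res_zero] at this
    exact this
  exact V _ c hc x hx := by
    simp only [toRestrict_res_top] at hc
    obtain ⟨W, hWV, hxW, d, hd⟩ := h.exact (U.ι ''ᵁ V) (ι_image_le U V) c
      ((Finset.sum_congr rfl fun j _ ↦ toRestrict_smul (c j) _).trans hc) x.1 ⟨x, hx, rfl⟩
    obtain ⟨W, rfl⟩ := exists_ι_image_eq (hWV.trans (ι_image_le U V))
    have hx' : x ∈ W := by
      obtain ⟨y, hy, hxy⟩ := hxW
      rwa [← U.ι.injective hxy]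
    refine ⟨W, (U.ι.image_le_image_iff _ _).1 hWV, hx', d, fun j ↦ (hd j).trans ?_⟩
    refine Finset.sum_congr rfl fun l _ ↦ congrArg (d l * ·) ?_
    exact (resF_restrict_top W (t l j)).symm

/-- Finite presentation refers to modules over slices of the site, whereas the given presentations
live on open subschemes. The equivalence between the two kinds of modules preserves colimits and the
structure sheaf, hence carries presentations to presentations. -/
lemma isCoherent_of_presentation_cover {ι : Type} (U : ι → X.Opens) (hU : ⨆ i, U i = ⊤)
    (P : ∀ i, SheafOfModules.Presentation (R := (U i).toScheme.ringCatSheaf) (M.restrict (U i).ι))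
    (hP : ∀ i, (P i).IsFinite) : IsCoherent M := by
  have η (V : X.Opens) : SheafOfModules.unit (X.ringCatSheaf.over V) ≅
      (overEquiv V).inverse.obj (SheafOfModules.unit V.toScheme.ringCatSheaf) :=
    (overEquiv V).unitIso.app _ ≪≫ (overEquiv V).inverse.mapIso
      (((overFunctorEquiv V).app (SheafOfModules.unit X.ringCatSheaf)).trans (restrictUnitIso V.ι))
  let F (i) : SheafOfModules (U i).toScheme.ringCatSheaf ⥤
    SheafOfModules (X.ringCatSheaf.over (U i)) := (overEquiv (U i)).inverse
  have hpres (i) : Limits.PreservesColimitsOfSize.{0, 0} (F i) :=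
    inferInstanceAs (Limits.PreservesColimitsOfSize.{0, 0} (overEquiv (U i)).inverse)
  let iso (i) : (overEquiv (U i)).inverse.obj (M.restrict (U i).ι) ≅
      SheafOfModules.over (R := X.ringCatSheaf) M (U i) :=
    (overEquiv (U i)).inverse.mapIso ((overFunctorEquiv (U i)).symm.app M) ≪≫
      ((overEquiv (U i)).unitIso.app _).symm
  refine ⟨⟨⟨ι, U, ?_, fun i ↦ SheafOfModules.Presentation.ofIsIso (iso i).hom
    ((P i).map (F i) (η (U i)))⟩, ⟨fun i ↦ ?_⟩⟩⟩
  · rw [Opens.coversTop_iff]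
    exact hU
  · have := hP i
    have : ((P i).map (F i) (η (U i))).IsFinite :=
      ⟨⟨this.isFiniteType_generators.finite⟩, ⟨this.isFiniteType_relations.finite⟩⟩
    infer_instance

theorem isCoherent_of_isPresentation
    (h : ∀ x : X, ∃ (U : X.Opens) (n k : ℕ) (e : Fin n → Γ(M, U)) (t : Fin k → Fin n → Γ(X, U)),
      x ∈ U ∧ IsPresentation M U e t) : IsCoherent M := by
  choose U n k e t hxU ht using h
  choose P hP using fun x ↦ (ht x).restrict.exists_presentation
  exact isCoherent_of_presentation_cover U
    (top_le_iff.1 fun x _ ↦ TopologicalSpace.Opens.mem_iSup.2 ⟨x, hxU x⟩) P hP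

end Presentation

/-! ### Bundles given by transition matrices -/

section Gluing

variable {X : Scheme.{0}}

/-- A presheaf of abelian groups given by its sections and restriction maps. -/
def abPresheafMk (A : X.Opens → Type) [∀ V, AddCommGroup (A V)]
    (ρ : ∀ {U V : X.Opens}, V ≤ U → A U →+ A V)
    (ρ_id : ∀ (U : X.Opens) s, ρ (le_refl U) s = s)
    (ρ_comp : ∀ {U V W : X.Opens} (h : V ≤ U) (h' : W ≤ V) s, ρ h' (ρ h s) = ρ (h'.trans h) s) :
    X.Opensᵒᵖ ⥤ AddCommGrpCat where
  obj V := AddCommGrpCat.of (A V.unop)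
  map f := AddCommGrpCat.ofHom (ρ (leOfHom f.unop))
  map_id U := by
    ext s
    exact ρ_id _ s
  map_comp f g := by
    ext s
    exact (ρ_comp (leOfHom f.unop) (leOfHom g.unop) s).symm

/-- A sheaf of modules given by its sections and restriction maps. -/
def modulesMk (A : X.Opens → Type) [∀ V, AddCommGroup (A V)] [inst : ∀ V, Module Γ(X, V) (A V)]
    (ρ : ∀ {U V : X.Opens}, V ≤ U → A U →+ A V)
    (ρ_id : ∀ (U : X.Opens) s, ρ (le_refl U) s = s)
    (ρ_comp : ∀ {U V W : X.Opens} (h : V ≤ U) (h' : W ≤ V) s, ρ h' (ρ h s) = ρ (h'.trans h) s)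
    (ρ_smul : ∀ {U V : X.Opens} (h : V ≤ U) (a : Γ(X, U)) s, ρ h (a • s) = resF h a • ρ h s)
    (glue : ∀ {ι : Type} (U : ι → X.Opens) (s : ∀ i, A (U i)),
      (∀ i j, ρ (inf_le_left : U i ⊓ U j ≤ U i) (s i) = ρ inf_le_right (s j)) →
      ∃! t : A (iSup U), ∀ i, ρ (le_iSup U i) t = s i) : X.Modules where
  val :=
    letI (V : X.Opensᵒᵖ) : Module (X.ringCatSheaf.obj.obj V)
      ((abPresheafMk A ρ ρ_id ρ_comp).obj V) := inst V.unop
    PresheafOfModules.ofPresheaf (R := X.ringCatSheaf.obj) (abPresheafMk A ρ ρ_id ρ_comp)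
      fun {V W} f a s ↦ ρ_smul (leOfHom f.unop) a s
  isSheaf := (TopCat.Presheaf.isSheaf_iff_isSheafUniqueGluing _).2 fun ι U s hs ↦
    glue (U := U) (fun i ↦ s i) (fun i j ↦ hs i j)

/-- Tuples of functions on `V ⊓ T`, as a module over the functions on `V`. -/
def TupleOn (T V : X.Opens) (n : ℕ) : Type := Fin n → Γ(X, V ⊓ T)

instance (T V : X.Opens) (n : ℕ) : AddCommGroup (TupleOn T V n) :=
  inferInstanceAs (AddCommGroup (Fin n → Γ(X, V ⊓ T)))

instance (T V : X.Opens) (n : ℕ) : Module Γ(X, V) (TupleOn T V n) :=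
  Module.compHom (Fin n → Γ(X, V ⊓ T)) (resF (inf_le_left : V ⊓ T ≤ V))

lemma TupleOn.smul_apply {T V : X.Opens} {n : ℕ} (a : Γ(X, V)) (s : TupleOn T V n) (k : Fin n) :
    (a • s) k = resF inf_le_left a * s k := rfl

lemma TupleOn.add_apply {T V : X.Opens} {n : ℕ} (s t : TupleOn T V n) (k : Fin n) :
    (s + t) k = s k + t k := rfl

/-- The restriction of tuples. -/
def TupleOn.res {T U V : X.Opens} {n : ℕ} (h : V ≤ U) (s : TupleOn T U n) : TupleOn T V n :=
  fun k ↦ resF (inf_le_inf_right T h) (s k)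

variable {ι : Type} (U : ι → X.Opens) (T : X.Opens) (hTU : ∀ i, T ≤ U i) {n : ℕ}
  (P : ι → Matrix (Fin n) (Fin n) Γ(X, T))

/-- The tuples which are combinations of the columns of `P i` with coefficients on `V ⊓ U i`. -/
def gluedSections (V : X.Opens) : Submodule Γ(X, V) (TupleOn T V n) where
  carrier := {s | ∀ i, ∃ c : Fin n → Γ(X, V ⊓ U i), ∀ k,
    s k = ∑ l, resF inf_le_right (P i k l) * resF (inf_le_inf_left V (hTU i)) (c l)}
  zero_mem' i := ⟨0, fun k ↦ by simp; rfl⟩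
  add_mem' {s t} hs ht i := by
    obtain ⟨c, hc⟩ := hs i
    obtain ⟨d, hd⟩ := ht i
    exact ⟨c + d, fun k ↦ by
      simp [TupleOn.add_apply, hc, hd, mul_add, Finset.sum_add_distrib]⟩
  smul_mem' a s hs i := by
    obtain ⟨c, hc⟩ := hs i
    exact ⟨fun l ↦ resF inf_le_left a * c l, fun k ↦ by
      rw [TupleOn.smul_apply, hc, Finset.mul_sum]
      refine Finset.sum_congr rfl fun l _ ↦ ?_
      rw [map_mul, resF_resF, mul_left_comm]⟩

variable {U T P} in
lemma TupleOn.res_mem {V W : X.Opens} (h : W ≤ V) {s : TupleOn T V n}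
    (hs : s ∈ gluedSections U T hTU P V) : s.res h ∈ gluedSections U T hTU P W := by
  intro i
  obtain ⟨c, hc⟩ := hs i
  exact ⟨fun l ↦ resF (inf_le_inf_right _ h) (c l), fun k ↦ by simp [TupleOn.res, hc]⟩

/-- The inclusion of functions on `V` into functions on `V ⊓ T` is injective. -/
def IsDenseOpen (T : X.Opens) : Prop :=
  ∀ V : X.Opens, Function.Injective (resF (inf_le_left : V ⊓ T ≤ V))

variable {T P} in
-- Over the dense open subset the coefficients are recovered by applying the inverse matrix `P' i`,
-- and density determines them on all of `W`.
lemma coeff_unique (hT : IsDenseOpen T) (P' : ι → Matrix (Fin n) (Fin n) Γ(X, T))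
    (hPP' : ∀ i, P' i * P i = 1)
    {V W : X.Opens} (i : ι) (hW : W ⊓ T ≤ V ⊓ T) (c d : Fin n → Γ(X, W)) (s : TupleOn T V n)
    (hc : ∀ k, resF hW (s k) = ∑ l, resF inf_le_right (P i k l) * resF inf_le_left (c l))
    (hd : ∀ k, resF hW (s k) = ∑ l, resF inf_le_right (P i k l) * resF inf_le_left (d l)) :
    c = d := by
  have key (c : Fin n → Γ(X, W))
      (hc : ∀ k, resF hW (s k) = ∑ l, resF inf_le_right (P i k l) * resF inf_le_left (c l)) :
      (fun l ↦ resF (inf_le_left : W ⊓ T ≤ W) (c l)) =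
        ((P' i).map (resF inf_le_right)).mulVec (fun k ↦ resF hW (s k)) := by
    have : (fun k ↦ resF hW (s k)) =
        ((P i).map (resF inf_le_right)).mulVec (fun l ↦ resF inf_le_left (c l)) := by
      funext k
      rw [hc]
      rfl
    rw [this, Matrix.mulVec_mulVec, ← Matrix.map_mul, hPP',
      Matrix.map_one _ (map_zero _) (map_one _), Matrix.one_mulVec]
  funext l
  exact hT W (congrFun ((key c hc).trans (key d hd).symm) l)

/-- The sheaf of modules with sections `gluedSections`. -/
def gluedModules (hT : IsDenseOpen T) (P' : ι → Matrix (Fin n) (Fin n) Γ(X, T))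
    (hPP' : ∀ i, P' i * P i = 1) : X.Modules :=
  modulesMk (fun V ↦ gluedSections U T hTU P V)
    (fun {V W} h ↦ AddMonoidHom.mk' (fun s ↦ ⟨s.1.res h, TupleOn.res_mem hTU h s.2⟩)
      (fun s t ↦ Subtype.ext (funext fun k ↦ map_add _ _ _)))
    (fun V s ↦ Subtype.ext (funext fun k ↦ resF_self _ _))
    (fun h h' s ↦ Subtype.ext (funext fun k ↦ resF_resF _ _ _))
    (fun h a s ↦ Subtype.ext (funext fun k ↦ by
      change resF _ (resF _ _ * s.1 k) = resF _ (resF _ _) * resF _ (s.1 k)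
      simp))
    (fun {κ} V s hs ↦ by
      have hcov : (⨆ x, V x) ⊓ T ≤ ⨆ x, V x ⊓ T := by rw [iSup_inf_eq]
      have hs' (x y : κ) (k : Fin n) : resF (inf_le_inf_right T (inf_le_left : V x ⊓ V y ≤ V x))
          ((s x).1 k) = resF (inf_le_inf_right T inf_le_right) ((s y).1 k) :=
        congrFun (congrArg Subtype.val (hs x y)) k
      have hglue (k) := function_glue (V := (⨆ x, V x) ⊓ T) (fun x ↦ V x ⊓ T)
        (fun x ↦ inf_le_inf_right T (le_iSup V x)) hcov (fun x ↦ (s x).1 k) fun x y ↦ by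
          have := congrArg (resF (show (V x ⊓ T) ⊓ (V y ⊓ T) ≤ (V x ⊓ V y) ⊓ T from
            le_inf (inf_le_inf inf_le_left inf_le_left) (inf_le_left.trans inf_le_right)))
            (hs' x y k)
          simpa using this
      choose t ht using hglue
      -- The coefficients over the members of the cover are unique, hence compatible, hence glue.
      have htmem : (t : TupleOn T (⨆ x, V x) n) ∈ gluedSections U T hTU P (⨆ x, V x) := by
        intro i
        choose c hc using fun x ↦ (s x).2 i
        have hglue (l) := function_glue (V := (⨆ x, V x) ⊓ U i) (fun x ↦ V x ⊓ U i)
          (fun x ↦ inf_le_inf_right _ (le_iSup V x)) (by rw [iSup_inf_eq])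
          (fun x ↦ c x l) fun x y ↦ by
            refine congrFun (coeff_unique hT P' hPP' (V := V x ⊓ V y) i
              (show ((V x ⊓ U i) ⊓ (V y ⊓ U i)) ⊓ T ≤ (V x ⊓ V y) ⊓ T from
                inf_le_inf_right T (inf_le_inf inf_le_left inf_le_left))
              (fun l ↦ resF inf_le_left (c x l)) (fun l ↦ resF inf_le_right (c y l))
              ((s x).1.res inf_le_left) ?_ ?_) l
            · intro k
              simp [TupleOn.res, hc]
            · intro k
              have := congrArg (resF (show ((V x ⊓ U i) ⊓ (V y ⊓ U i)) ⊓ T ≤ (V x ⊓ V y) ⊓ T from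
                inf_le_inf_right T (inf_le_inf inf_le_left inf_le_left))) (hs' x y k)
              refine this.trans ?_
              simp [hc]
        choose d hd using hglue
        refine ⟨d, fun k ↦ ?_⟩
        refine function_ext (fun x ↦ V x ⊓ T) (fun x ↦ inf_le_inf_right T (le_iSup V x)) hcov
          fun x ↦ ?_
        rw [ht, hc]
        simp only [map_sum, map_mul, resF_resF, ← hd]
      refine ⟨⟨t, htmem⟩, fun x ↦ Subtype.ext (funext fun k ↦ ht k x), fun t' ht' ↦
        Subtype.ext (funext fun k ↦ ?_)⟩
      refine function_ext (fun x ↦ V x ⊓ T) (fun x ↦ inf_le_inf_right T (le_iSup V x)) hcov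
        fun x ↦ ?_
      rw [ht]
      exact congrFun (congrArg Subtype.val (ht' x)) k)

/-- Matrices `P i` over a dense open subset define a bundle with frames over `U i`
if the transition matrices extend to `U i ⊓ U j`. -/
theorem exists_bundle {ι : Type} {U : ι → X.Opens} {T : X.Opens} (hTU : ∀ i, T ≤ U i) {n : ℕ}
    {P : ι → Matrix (Fin n) (Fin n) Γ(X, T)} (hT : IsDenseOpen T) (P' : ι → Matrix (Fin n) (Fin n) Γ(X, T))
    (hPP' : ∀ i, P' i * P i = 1) (Q : ∀ i j, Matrix (Fin n) (Fin n) Γ(X, U i ⊓ U j))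
    (hQ : ∀ i j, P j * (Q i j).map (resF (le_inf (hTU i) (hTU j))) = P i) :
    ∃ (E : X.Modules) (e : ∀ i, Fin n → Γ(E, U i)), (∀ i, IsFrame E (U i) (e i)) ∧
      ∀ i j k, res E inf_le_left (e i k) = ∑ l, Q i j l k • res E inf_le_right (e j l) := by
  let E := gluedModules U T hTU P hT P' hPP'
  let val {V : X.Opens} (s : Γ(E, V)) : Fin n → Γ(X, V ⊓ T) :=
    (show gluedSections U T hTU P V from s).1
  have val_ext {V : X.Opens} {s t : Γ(E, V)} (h : ∀ k, val s k = val t k) : s = t :=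
    Subtype.ext (funext h)
  have val_res {V W : X.Opens} (h : W ≤ V) (s : Γ(E, V)) (k) :
    val (res E h s) k = resF (inf_le_inf_right T h) (val s k) := rfl
  have val_sum {V : X.Opens} (c : Fin n → Γ(X, V)) (s : Fin n → Γ(E, V)) (k) :
      val (∑ l, c l • s l) k = ∑ l, resF inf_le_left (c l) * val (s l) k := by
    have h (I : Finset (Fin n)) : val (∑ l ∈ I, c l • s l) k =
        ∑ l ∈ I, resF inf_le_left (c l) * val (s l) k := by
      induction I using Finset.cons_induction with
      | empty => rfl
      | cons a I ha ih =>
        rw [Finset.sum_cons, Finset.sum_cons, ← ih]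
        rfl
    exact h _
  have hQ' (i j k l) : P i k l =
      ∑ x, P j k x * resF (le_inf (hTU i) (hTU j)) (Q i j x l) := by
    conv_lhs => rw [← hQ i j]
    rfl
  -- The frame over `U i` consists of the columns of `P i`. In the chart `j` their coefficients are
  -- the columns of `Q i j`.
  let e (i) (l : Fin n) : Γ(E, U i) :=
    (⟨fun k ↦ resF inf_le_right (P i k l), fun j ↦ ⟨fun x ↦ Q i j x l, fun k ↦
      (congrArg (resF inf_le_right) (hQ' i j k l)).trans (by simp)⟩⟩ : gluedSections U T hTU P (U i))
  have val_e (i l k) : val (e i l) k = resF inf_le_right (P i k l) := rfl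
  refine ⟨E, e, fun i V hV s ↦ ?_, fun i j k ↦ val_ext fun x ↦ ?_⟩
  · obtain ⟨c, hc⟩ := (show gluedSections U T hTU P V from s).2 i
    have hc' : ∀ k, val s k = _ := hc
    refine ⟨fun l ↦ resF (le_inf le_rfl hV) (c l), val_ext fun k ↦ ?_, fun d hd ↦ ?_⟩
    · rw [val_sum, hc']
      refine Finset.sum_congr rfl fun l _ ↦ ?_
      rw [val_res, val_e, resF_resF, resF_resF, mul_comm]
    · refine coeff_unique hT P' hPP' i le_rfl _ _ (val s) (fun k ↦ ?_) (fun k ↦ ?_)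
      · rw [hd, val_sum, map_sum]
        refine Finset.sum_congr rfl fun l _ ↦ ?_
        rw [val_res, val_e, map_mul, resF_resF, resF_resF, resF_resF, mul_comm]
      · rw [hc']
        simp
  · rw [val_sum, val_res, val_e, resF_resF, hQ' i j x k, map_sum]
    refine Finset.sum_congr rfl fun l _ ↦ ?_
    rw [val_res, val_e, map_mul, resF_resF, resF_resF, mul_comm]

end Gluing

/-! ### Images and direct sums -/

section Image

variable {X : Scheme.{0}} {E M : X.Modules}

/-- The sections of `M` which are locally in the image of `ψ`. -/
def imageSections (ψ : E ⟶ M) (V : X.Opens) : Submodule Γ(X, V) Γ(M, V) where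
  carrier := {s | ∀ x ∈ V, ∃ (W : X.Opens) (h : W ≤ V), x ∈ W ∧ ∃ e, ψ.app W e = res M h s}
  zero_mem' x hx := ⟨V, le_rfl, hx, 0, by simp⟩
  add_mem' {s t} hs ht x hx := by
    obtain ⟨W, h, hW, e, he⟩ := hs x hx
    obtain ⟨W', h', hW', e', he'⟩ := ht x hx
    refine ⟨W ⊓ W', inf_le_left.trans h, ⟨hW, hW'⟩, res E inf_le_left e + res E inf_le_right e', ?_⟩
    rw [map_add, app_res, app_res, he, he', res_res, res_res, res_add]
  smul_mem' a s hs x hx := by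
    obtain ⟨W, h, hW, e, he⟩ := hs x hx
    exact ⟨W, h, hW, resF h a • e, by rw [Scheme.Modules.Hom.app_smul, he, res_smul]⟩

lemma res_mem_imageSections (ψ : E ⟶ M) {V V' : X.Opens} (h : V' ≤ V) {s : Γ(M, V)}
    (hs : s ∈ imageSections ψ V) : res M h s ∈ imageSections ψ V' := by
  intro x hx
  obtain ⟨W, hWV, hxW, e, he⟩ := hs x (h hx)
  refine ⟨W ⊓ V', inf_le_right, ⟨hxW, hx⟩, res E inf_le_left e, ?_⟩
  rw [app_res, he, res_res, res_res]

/-- The image of a morphism of sheaves of modules. -/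
def imageModules (ψ : E ⟶ M) : X.Modules :=
  modulesMk (fun V ↦ imageSections ψ V)
    (fun h ↦ AddMonoidHom.mk' (fun s ↦ ⟨res M h s.1, res_mem_imageSections ψ h s.2⟩)
      (fun s t ↦ Subtype.ext (res_add M h s.1 t.1)))
    (fun V s ↦ Subtype.ext (res_self M _ _))
    (fun h h' s ↦ Subtype.ext (res_res M h h' s.1))
    (fun h a s ↦ Subtype.ext (res_smul M h a s.1))
    (fun V s hs ↦ by
      obtain ⟨t, ht⟩ := section_glue M V (fun i ↦ le_iSup V i) le_rfl (fun i ↦ (s i).1)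
        (fun i j ↦ congrArg Subtype.val (hs i j))
      refine ⟨⟨t, fun x hx ↦ ?_⟩, fun i ↦ Subtype.ext (ht i), fun t' ht' ↦ Subtype.ext ?_⟩
      · obtain ⟨i, hi⟩ := TopologicalSpace.Opens.mem_iSup.1 hx
        obtain ⟨W, h, hW, e, he⟩ := (s i).2 x hi
        exact ⟨W, h.trans (le_iSup V i), hW, e, by rw [he, ← ht i, res_res]⟩
      · refine section_ext M V (fun i ↦ le_iSup V i) le_rfl fun i ↦ ?_
        rw [ht i]
        exact congrArg Subtype.val (ht' i))

/-- The quotient of `E` is realized as a subsheaf of a bundle, so that torsion-freeness and the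
frames away from the node are inherited from that bundle. -/
theorem exists_image (ψ : E ⟶ M) : ∃ (F : X.Modules) (p : E ⟶ F) (ι : F ⟶ M), p ≫ ι = ψ ∧
    (∀ V, Function.Injective (ι.app V)) ∧ ∀ (V : X.Opens) (s : Γ(F, V)), ∀ x ∈ V,
      ∃ (W : X.Opens) (h : W ≤ V), x ∈ W ∧ ∃ e, p.app W e = res F h s := by
  let F := imageModules ψ
  have hp (V : X.Opens) (e : Γ(E, V)) : ψ.app V e ∈ imageSections ψ V :=
    fun x hx ↦ ⟨V, le_rfl, hx, e, by rw [res_self]⟩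
  let p : E ⟶ F := homMk (N := F) (fun V ↦ AddMonoidHom.mk' (fun e ↦ (⟨ψ.app V e, hp V e⟩ :
      imageSections ψ V)) fun s t ↦ Subtype.ext (map_add _ _ _))
    (fun U V h s ↦ Subtype.ext (app_res ψ h s))
    (fun U a s ↦ Subtype.ext (Scheme.Modules.Hom.app_smul ψ a s))
  let ι : F ⟶ M := homMk (M := F) (fun V ↦ (imageSections ψ V).subtype.toAddMonoidHom)
    (fun U V h s ↦ rfl) (fun U a s ↦ rfl)
  refine ⟨F, p, ι, by ext; rfl, fun V s t h ↦ Subtype.ext h, fun V s x hx ↦ ?_⟩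
  obtain ⟨W, h, hW, e, he⟩ := (show imageSections ψ V from s).2 x hx
  exact ⟨W, h, hW, e, Subtype.ext he⟩

lemma epi_of_locally_surjective {F : X.Modules} (p : E ⟶ F)
    (hp : ∀ (V : X.Opens) (s : Γ(F, V)), ∀ x ∈ V,
      ∃ (W : X.Opens) (h : W ≤ V), x ∈ W ∧ ∃ e, p.app W e = res F h s) : Epi p where
  left_cancellation {N} φ ψ h := by
    ext V s
    choose W hWV hW e he using fun x : V ↦ hp V s x x.2
    refine section_ext N W hWV (fun x hx ↦ TopologicalSpace.Opens.mem_iSup.mpr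
      ⟨⟨x, hx⟩, hW ⟨x, hx⟩⟩) fun x ↦ ?_
    rw [← app_res, ← app_res, ← he]
    exact congr(Scheme.Modules.Hom.app $h (W x) (e x))

/-- If a frame of `M` lifts to `F` along an injective morphism then it lifts to a frame. -/
lemma IsFrame.of_injective {F : X.Modules} {ι : F ⟶ M} (hι : ∀ V, Function.Injective (ι.app V))
    {U : X.Opens} {n : ℕ} {f : Fin n → Γ(F, U)} (hf : IsFrame M U (fun j ↦ ι.app U (f j))) :
    IsFrame F U f := by
  have key (V : X.Opens) (h : V ≤ U) (c : Fin n → Γ(X, V)) :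
      ι.app V (∑ j, c j • res F h (f j)) = ∑ j, c j • res M h (ι.app U (f j)) := by
    simp [app_res]
  intro V h s
  refine ⟨hf.coeff h (ι.app V s), hι V ?_, fun c hc ↦ (hf.coeff_eq h ?_).symm⟩
  · rw [key]
    exact hf.eq_sum h _
  · rw [← key]
    exact congrArg _ hc

lemma IsVectorBundle.isTorsionFree [IsIntegral X] {r : ℕ} (hM : IsVectorBundle M r) :
    IsTorsionFree M := by
  refine fun U ↦ ⟨fun a ha s t hst ↦ ?_⟩
  choose W hW e he using fun x : U ↦ hM x
  refine section_ext M (fun x ↦ U ⊓ W x) (fun x ↦ inf_le_left) (fun x hx ↦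
    TopologicalSpace.Opens.mem_iSup.mpr ⟨⟨x, hx⟩, hx, hW ⟨x, hx⟩⟩) fun x ↦ ?_
  have hne : Nonempty (U ⊓ W x : X.Opens) := ⟨⟨x, x.2, hW x⟩⟩
  have hneU : Nonempty U := ⟨x⟩
  have ha0 : resF (inf_le_left : U ⊓ W x ≤ U) a ≠ 0 := by
    have : Function.Injective (resF (inf_le_left : U ⊓ W x ≤ U)) :=
      map_injective_of_isIntegral X (homOfLE (inf_le_left : U ⊓ W x ≤ U))
    rw [Ne, map_eq_zero_iff _ this]
    exact ha.ne_zero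
  have h := congrArg (fun s ↦ (he x).coeff inf_le_right (res M inf_le_left s)) hst
  simp only [res_smul, IsFrame.coeff_smul] at h
  rw [(he x).eq_sum inf_le_right (res M inf_le_left s),
    (he x).eq_sum inf_le_right (res M inf_le_left t)]
  refine Finset.sum_congr rfl fun j _ ↦ ?_
  rw [mul_left_cancel₀ ha0 (congrFun h j)]

lemma IsTorsionFree.of_injective {F : X.Modules} {ι : F ⟶ M}
    (hι : ∀ V, Function.Injective (ι.app V)) (hM : IsTorsionFree M) : IsTorsionFree F := fun U ↦
  have := hM U
  Function.Injective.moduleIsTorsionFree (ι.app U) (hι U) fun a s ↦ Scheme.Modules.Hom.app_smul ι a s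

end Image

section Biproduct

variable {X : Scheme.{0}} {r : ℕ} (L : Fin r → X.Modules)

open Limits

lemma sum_app {M N : X.Modules} {ι : Type*} (I : Finset ι) (φ : ι → (M ⟶ N)) (U : X.Opens)
    (s : Γ(M, U)) : (∑ i ∈ I, φ i).app U s = ∑ i ∈ I, (φ i).app U s := by
  induction I using Finset.cons_induction with
  | empty => rfl
  | cons a I ha ih =>
    rw [Finset.sum_cons, Finset.sum_cons, ← ih]
    rfl

/-- The frame of a direct sum of line bundles. -/
lemma isFrame_biproduct {U : X.Opens} {e : ∀ i, Fin 1 → Γ(L i, U)}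
    (he : ∀ i, IsFrame (L i) U (e i)) :
    IsFrame (biproduct L) U (fun i ↦ (biproduct.ι L i).app U (e i 0)) := by
  have h₁ (i : Fin r) (V : X.Opens) (s : Γ(L i, V)) :
      (biproduct.π L i).app V ((biproduct.ι L i).app V s) = s := by
    rw [← ConcreteCategory.comp_apply, ← Scheme.Modules.Hom.comp_app, biproduct.ι_π_self]
    rfl
  have h₂ (i j : Fin r) (hij : i ≠ j) (V : X.Opens) (s : Γ(L i, V)) :
      (biproduct.π L j).app V ((biproduct.ι L i).app V s) = 0 := by
    rw [← ConcreteCategory.comp_apply, ← Scheme.Modules.Hom.comp_app, biproduct.ι_π_ne _ hij]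
    rfl
  have h₃ (V : X.Opens) (s : Γ(biproduct L, V)) :
      s = ∑ i, (biproduct.ι L i).app V ((biproduct.π L i).app V s) := by
    have := congr(Scheme.Modules.Hom.app $(biproduct.total (f := L)) V s)
    rw [sum_app] at this
    exact this.symm
  intro V h s
  refine ⟨fun i ↦ (he i).coeff h ((biproduct.π L i).app V s) 0, ?_, fun c hc ↦ ?_⟩
  · dsimp only
    conv_lhs => rw [h₃ V s]
    refine Finset.sum_congr rfl fun i _ ↦ ?_
    conv_lhs => rw [(he i).eq_sum h ((biproduct.π L i).app V s)]
    simp [app_res]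
  · funext i
    have : (biproduct.π L i).app V s = c i • res (L i) h (e i 0) := by
      rw [hc, map_sum]
      simp only [Scheme.Modules.Hom.app_smul, ← app_res]
      rw [Finset.sum_eq_single i]
      · rw [h₁]
      · intro j _ hj
        rw [h₂ j i hj, smul_zero]
      · simp
    exact (congrFun ((he i).coeff_eq h (c := fun _ ↦ c i) (by simpa using this)) 0).symm

end Biproduct

/-! ### Bundles on a surface covered by four charts -/

section Twisted

variable {R R' : Type*} [CommRing R] [CommRing R'] {r : ℕ} (τ : Fin r → Fin r)

/-- The matrix with entries `p i` at `(i, i)` and `q i` at `(i, τ i)`. -/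
def tw (p q : Fin r → R) : Matrix (Fin r) (Fin r) R :=
  .of fun i j ↦ (if i = j then p i else 0) + (if τ i = j then q i else 0)

variable {τ}

lemma sum_tw_mul (p q f : Fin r → R) (i : Fin r) :
    ∑ x, tw τ p q i x * f x = p i * f i + q i * f (τ i) := by
  simp [tw, add_mul, Finset.sum_add_distrib]

/-- For an involution these matrices are block diagonal: a pair `{i, τ i}` gives a 2 × 2 block, and
at a fixed point of `τ` both terms sit on the diagonal. -/
lemma tw_mul (hτ : ∀ i, τ (τ i) = i) (p q p' q' : Fin r → R) :
    tw τ p q * tw τ p' q' =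
      tw τ (fun i ↦ p i * p' i + q i * q' (τ i)) (fun i ↦ p i * q' i + q i * p' (τ i)) := by
  ext i j
  rw [Matrix.mul_apply, sum_tw_mul]
  simp only [tw, Matrix.of_apply, hτ]
  split_ifs <;> ring

lemma tw_one : tw τ (fun _ ↦ (1 : R)) (fun _ ↦ 0) = 1 := by
  ext i j
  simp [tw, Matrix.one_apply]

lemma tw_map (f : R →+* R') (p q : Fin r → R) :
    (tw τ p q).map f = tw τ (fun i ↦ f (p i)) (fun i ↦ f (q i)) := by
  ext i j
  simp [tw, apply_ite f]

lemma tw_apply_mem {A : Subring R} {p q : Fin r → R} (hp : ∀ i, p i ∈ A) (hq : ∀ i, q i ∈ A)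
    (i j : Fin r) : tw τ p q i j ∈ A := by
  simp only [tw, Matrix.of_apply]
  refine A.add_mem ?_ ?_ <;> split_ifs
  exacts [hp i, A.zero_mem, hq i, A.zero_mem]

end Twisted

/-! ### Integer powers of an invertible function given together with its inverse -/

section ZPow

variable {R R' : Type*} [CommRing R] [CommRing R']

/-- The `d`-th power of `x`, where `w` is the inverse of `x`. -/
def zp (x w : R) (d : ℤ) : R := x ^ d.toNat * w ^ (-d).toNat

lemma map_zp (f : R →+* R') (x w : R) (d : ℤ) : f (zp x w d) = zp (f x) (f w) d := by
  simp [zp]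

lemma zp_unit (u : Rˣ) (d : ℤ) : zp (u : R) (↑u⁻¹ : R) d = ↑(u ^ d) := by
  rw [zp]
  rcases le_total 0 d with h | h
  · lift d to ℕ using h
    simp
  · obtain ⟨n, rfl⟩ : ∃ n : ℕ, d = -n := ⟨(-d).toNat, by omega⟩
    simp [zpow_neg]

lemma exists_unit_of_mul_eq_one {x w : R} (h : x * w = 1) :
    ∃ u : Rˣ, (u : R) = x ∧ (↑u⁻¹ : R) = w :=
  ⟨⟨x, w, h, by rw [mul_comm, h]⟩, rfl, rfl⟩

lemma zp_eq_unit {x w : R} {u : Rˣ} (hx : x = u) (hw : w = ↑u⁻¹) (d : ℤ) :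
    zp x w d = ↑(u ^ d) := by
  rw [hx, hw, zp_unit]

end ZPow

/-- An open cover of a surface by four open subsets (the charts containing the four torus fixed
points of a toric surface, the last one and the first one possibly enlarged),
together with functions on them, which are expressed in terms of the invertible functions `y`
and `t` on a dense open subset `T`. -/
structure SurfaceCharts (S : Scheme.{0}) where
  U : Fin 4 → S.Opens
  iSup_eq_top : ⨆ i, U i = ⊤
  T : S.Opens
  isDense : IsDenseOpen T
  T_le : ∀ i, T ≤ U i
  inf_le₀₂ : U 0 ⊓ U 2 ≤ T
  inf_le₁₃ : U 1 ⊓ U 3 ≤ T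
  y : Γ(S, T)ˣ
  t : Γ(S, T)ˣ
  w : Γ(S, U 0)
  res_w : resF (T_le 0) w = ↑(y⁻¹)
  x₁ : Γ(S, U 1)
  res_x₁ : resF (T_le 1) x₁ = y
  x₂ : Γ(S, U 1)
  res_x₂ : resF (T_le 1) x₂ = ↑(t * y⁻¹)
  t₂ : Γ(S, U 2)
  res_t₂ : resF (T_le 2) t₂ = t
  v : Γ(S, U 2)
  res_v : resF (T_le 2) v = ↑(y * t⁻¹)
  s : Γ(S, U 3)
  res_s : resF (T_le 3) s = ↑(t⁻¹)
  y₃ : Γ(S, U 3)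
  res_y₃ : resF (T_le 3) y₃ = y
  koszul : ∀ (V : S.Opens) (h : V ≤ U 1) (c c' : Γ(S, V)), resF h x₁ * c + resF h x₂ * c' = 0 →
    ∀ x ∈ V, ∃ (W : S.Opens) (h' : W ≤ V), x ∈ W ∧ ∃ d, resF h' c = resF (h'.trans h) x₂ * d ∧
      resF h' c' = -resF (h'.trans h) x₁ * d

namespace SurfaceCharts

variable {S : Scheme.{0}} (D : SurfaceCharts S)

/-- The functions on `T` which extend to `U i ⊓ U j`. -/
def regular (i j : Fin 4) : Subring Γ(S, D.T) := (resF (le_inf (D.T_le i) (D.T_le j))).range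

lemma regular_comm (i j : Fin 4) : D.regular i j = D.regular j i := by
  have h : ∀ i j, D.regular i j ≤ D.regular j i := by
    rintro i j _ ⟨a, rfl⟩
    exact ⟨resF (inf_comm _ _).le a, by simp⟩
  exact le_antisymm (h i j) (h j i)

lemma mem_regular_left {i j : Fin 4} {a : Γ(S, D.T)} (b : Γ(S, D.U i))
    (h : resF (D.T_le i) b = a) : a ∈ D.regular i j :=
  ⟨resF inf_le_left b, by simp [h]⟩

lemma mem_regular_right {i j : Fin 4} {a : Γ(S, D.T)} (b : Γ(S, D.U j))
    (h : resF (D.T_le j) b = a) : a ∈ D.regular i j :=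
  ⟨resF inf_le_right b, by simp [h]⟩

lemma mem_regular_of_le {i j : Fin 4} (h : D.U i ⊓ D.U j ≤ D.T) (a : Γ(S, D.T)) :
    a ∈ D.regular i j :=
  ⟨resF h a, by simp⟩

lemma zpow_mem {A : Subring Γ(S, D.T)} {u : Γ(S, D.T)ˣ} (h : (u : Γ(S, D.T)) ∈ A)
    (h' : (↑u⁻¹ : Γ(S, D.T)) ∈ A) (n : ℤ) : (↑(u ^ n) : Γ(S, D.T)) ∈ A := by
  rw [← zp_unit]
  exact A.mul_mem (A.pow_mem h _) (A.pow_mem h' _)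

lemma y_mem₀₁ (n : ℤ) : (↑(D.y ^ n) : Γ(S, D.T)) ∈ D.regular 0 1 :=
  D.zpow_mem (D.mem_regular_right D.x₁ D.res_x₁) (D.mem_regular_left D.w D.res_w) n

lemma x₂_mem₀₁ : (↑(D.t * D.y⁻¹) : Γ(S, D.T)) ∈ D.regular 0 1 :=
  D.mem_regular_right D.x₂ D.res_x₂

lemma x₂_mem₁₂ (n : ℤ) : (↑((D.t * D.y⁻¹) ^ n) : Γ(S, D.T)) ∈ D.regular 1 2 :=
  D.zpow_mem (D.mem_regular_left D.x₂ D.res_x₂)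
    (D.mem_regular_right D.v (by rw [D.res_v, mul_inv_rev, inv_inv])) n

lemma y_mem₁₂ : (D.y : Γ(S, D.T)) ∈ D.regular 1 2 := D.mem_regular_left D.x₁ D.res_x₁

lemma t_mem₂₃ (n : ℤ) : (↑(D.t ^ n) : Γ(S, D.T)) ∈ D.regular 2 3 :=
  D.zpow_mem (D.mem_regular_left D.t₂ D.res_t₂) (D.mem_regular_right D.s D.res_s) n

lemma y_mem₀₃ (n : ℤ) : (↑(D.y ^ n) : Γ(S, D.T)) ∈ D.regular 0 3 :=
  D.zpow_mem (D.mem_regular_right D.y₃ D.res_y₃) (D.mem_regular_left D.w D.res_w) n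

lemma s_mem₀₃ : (↑(D.t⁻¹) : Γ(S, D.T)) ∈ D.regular 0 3 := D.mem_regular_right D.s D.res_s

lemma res_injective {V : S.Opens} (h : D.T ≤ V) : Function.Injective (resF h) := by
  intro a b hab
  refine D.isDense V ?_
  have := congrArg (resF (inf_le_right : V ⊓ D.T ≤ D.T)) hab
  simpa using this

/-- Sheaf of modules with frames over the four charts, in terms of the transition matrices. -/
theorem exists_bundle_of_regular {n : ℕ} (P P' : Fin 4 → Matrix (Fin n) (Fin n) Γ(S, D.T))
    (hP : ∀ i, P' i * P i = 1) (hreg : ∀ i j k l, (P' j * P i) k l ∈ D.regular i j) :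
    ∃ (E : S.Modules) (e : ∀ i, Fin n → Γ(E, D.U i))
      (Q : ∀ i j, Matrix (Fin n) (Fin n) Γ(S, D.U i ⊓ D.U j)), (∀ i, IsFrame E (D.U i) (e i)) ∧
      (∀ i j, (Q i j).map (resF (le_inf (D.T_le i) (D.T_le j))) = P' j * P i) ∧
      ∀ i j k, res E inf_le_left (e i k) = ∑ l, Q i j l k • res E inf_le_right (e j l) := by
  choose Q hQ using hreg
  have hQ' (i j) : (Matrix.of (Q i j)).map (resF (le_inf (D.T_le i) (D.T_le j))) = P' j * P i := by
    ext k l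
    exact hQ i j k l
  obtain ⟨E, e, he, heQ⟩ := exists_bundle D.T_le D.isDense P' hP (fun i j ↦ .of (Q i j))
    (fun i j ↦ by
      rw [hQ', ← Matrix.mul_assoc, mul_eq_one_comm.1 (hP j), Matrix.one_mul])
  exact ⟨E, e, fun i j ↦ .of (Q i j), he, hQ', heQ⟩

end SurfaceCharts

namespace SurfaceCharts

variable {S : Scheme.{0}} (D : SurfaceCharts S)

/-- The monomial `y ^ i * t ^ j`. -/
def mono (i j : ℤ) : Γ(S, D.T) := ↑(D.y ^ i * D.t ^ j)

lemma mono_mul (i j k l : ℤ) : D.mono i j * D.mono k l = D.mono (i + k) (j + l) := by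
  simp only [mono, ← Units.val_mul, zpow_add]
  congr 1
  exact mul_mul_mul_comm _ _ _ _

lemma mono_zero : D.mono 0 0 = 1 := by simp [mono]

lemma y_eq_mono : (D.y : Γ(S, D.T)) = D.mono 1 0 := by simp [mono]

lemma x₂_eq_mono : (↑(D.t * D.y⁻¹) : Γ(S, D.T)) = D.mono (-1) 1 := by simp [mono, mul_comm]

lemma zpow_y (n : ℤ) : (↑(D.y ^ n) : Γ(S, D.T)) = D.mono n 0 := by simp [mono]

lemma zpow_t (n : ℤ) : (↑(D.t ^ n) : Γ(S, D.T)) = D.mono 0 n := by simp [mono]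

lemma zpow_x₂ (n : ℤ) : (↑((D.t * D.y⁻¹) ^ n) : Γ(S, D.T)) = D.mono (-n) n := by
  simp [mono, mul_zpow, mul_comm]

/-- On `U 0 ⊓ U 1` the function `y` is invertible and `t / y` is regular. The exponents 0 and 1 of
`t` are the only ones that occur in the transition matrices. -/
lemma mono_mem₀₁ {i j : ℤ} (h : j = 0 ∨ j = 1) : D.mono i j ∈ D.regular 0 1 := by
  rcases h with rfl | rfl
  · rw [← zpow_y]
    exact D.y_mem₀₁ i
  · have h := Subring.mul_mem _ (D.y_mem₀₁ (i + 1)) D.x₂_mem₀₁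
    rw [x₂_eq_mono, zpow_y, mono_mul] at h
    convert h using 2 <;> ring

/-- On `U 1 ⊓ U 2` the function `t / y` is invertible and `y` is regular: the two cases are `(t / y)
^ j` and `y * (t / y) ^ j`. -/
lemma mono_mem₁₂ {i j : ℤ} (h : i = -j ∨ i = 1 - j) : D.mono i j ∈ D.regular 1 2 := by
  rcases h with rfl | rfl
  · rw [← zpow_x₂]
    exact D.x₂_mem₁₂ j
  · have h := Subring.mul_mem _ (D.x₂_mem₁₂ j) D.y_mem₁₂
    rw [y_eq_mono, zpow_x₂, mono_mul] at h
    convert h using 2 <;> ring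

lemma mono_mem₂₃ {i j : ℤ} (h : i = 0) : D.mono i j ∈ D.regular 2 3 := by
  rw [h, ← zpow_t]
  exact D.t_mem₂₃ j

lemma mono_mem₀₃ {i j : ℤ} (h : j = 0 ∨ j = -1) : D.mono i j ∈ D.regular 0 3 := by
  rcases h with rfl | rfl
  · rw [← zpow_y]
    exact D.y_mem₀₃ i
  · have h := Subring.mul_mem _ (D.y_mem₀₃ i) D.s_mem₀₃
    rw [← zpow_neg_one, zpow_t, zpow_y, mono_mul] at h
    simpa using h

/-- The morphism between bundles given by a matrix over `T`. -/
theorem exists_hom_of_matrix {r m : ℕ} {P P' : Fin 4 → Matrix (Fin r) (Fin r) Γ(S, D.T)}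
    (hP : ∀ i, P' i * P i = 1) {E : S.Modules} {e : ∀ i, Fin r → Γ(E, D.U i)}
    (he : ∀ i, IsFrame E (D.U i) (e i)) {Q : ∀ i j, Matrix (Fin r) (Fin r) Γ(S, D.U i ⊓ D.U j)}
    (hQ : ∀ i j, (Q i j).map (resF (le_inf (D.T_le i) (D.T_le j))) = P' j * P i)
    (heQ : ∀ i j k, res E inf_le_left (e i k) = ∑ l, Q i j l k • res E inf_le_right (e j l))
    {R R' : Fin 4 → Matrix (Fin m) (Fin m) Γ(S, D.T)} (hR : ∀ i, R' i * R i = 1)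
    {M : S.Modules} {n : ∀ i, Fin m → Γ(M, D.U i)}
    {N : ∀ i j, Matrix (Fin m) (Fin m) Γ(S, D.U i ⊓ D.U j)}
    (hN : ∀ i j, (N i j).map (resF (le_inf (D.T_le i) (D.T_le j))) = R' j * R i)
    (hnN : ∀ i j k, res M inf_le_left (n i k) = ∑ l, N i j l k • res M inf_le_right (n j l))
    (Ψ : Matrix (Fin m) (Fin r) Γ(S, D.T)) (ψ : ∀ i, Matrix (Fin m) (Fin r) Γ(S, D.U i))
    (hψ : ∀ i, R i * (ψ i).map (resF (D.T_le i)) = Ψ * P i) :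
    ∃ f : E ⟶ M, ∀ i k, f.app (D.U i) (e i k) = ∑ l, ψ i l k • n i l := by
  refine exists_hom_of_frames (glues_of_iSup_eq_top D.iSup_eq_top M) he _ Q heQ fun i j k ↦ ?_
  -- Both sides restrict on `T` to `R' j * Ψ * P i`, and restriction to `T` is injective.
  have hmat : N i j * ((ψ i).map (resF inf_le_left) : Matrix (Fin m) (Fin r) Γ(S, D.U i ⊓ D.U j)) =
      ((ψ j).map (resF inf_le_right) : Matrix (Fin m) (Fin r) Γ(S, D.U i ⊓ D.U j)) * Q i j := by
    have hinj : Function.Injective fun A : Matrix (Fin m) (Fin r) Γ(S, D.U i ⊓ D.U j) ↦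
        A.map (resF (le_inf (D.T_le i) (D.T_le j))) := fun A B hAB ↦ by
      ext k l
      exact D.res_injective _ congr($hAB k l)
    apply hinj
    have h₁ : ((ψ i).map (resF (inf_le_left : D.U i ⊓ D.U j ≤ D.U i))).map
        (resF (le_inf (D.T_le i) (D.T_le j))) = (ψ i).map (resF (D.T_le i)) := by
      ext; simp
    have h₂ : ((ψ j).map (resF (inf_le_right : D.U i ⊓ D.U j ≤ D.U j))).map
        (resF (le_inf (D.T_le i) (D.T_le j))) = (ψ j).map (resF (D.T_le j)) := by
      ext; simp
    dsimp only
    rw [Matrix.map_mul, Matrix.map_mul, hN, hQ, h₁, h₂, Matrix.mul_assoc, hψ]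
    have h₃ : (ψ j).map (resF (D.T_le j)) = R' j * (Ψ * P j) := by
      rw [← hψ, ← Matrix.mul_assoc, hR, Matrix.one_mul]
    rw [h₃]
    have h₄ : P j * (P' j * P i) = P i := by
      rw [← Matrix.mul_assoc, mul_eq_one_comm.1 (hP j), Matrix.one_mul]
    rw [Matrix.mul_assoc, Matrix.mul_assoc, h₄]
  have hent (x) : ∑ l, N i j x l * resF inf_le_left (ψ i l k) =
      ∑ l, resF inf_le_right (ψ j x l) * Q i j l k := congr($hmat x k)
  simp only [res_sum, res_smul, hnN i j, Finset.smul_sum, smul_smul]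
  rw [Finset.sum_comm]
  conv_rhs => rw [Finset.sum_comm]
  refine Finset.sum_congr rfl fun x _ ↦ ?_
  rw [← Finset.sum_smul, ← Finset.sum_smul]
  congr 1
  refine (Finset.sum_congr rfl fun l _ ↦ mul_comm _ _).trans ((hent x).trans
    (Finset.sum_congr rfl fun l _ ↦ mul_comm _ _))

section Pairing

variable {r : ℕ} (a b : Fin r → ℤ) (K₁ K₂ : Finset (Fin r)) (τ : Fin r → Fin r)

/-- The matrices of the frames of the bundle on the four charts in terms of a frame over `T`. -/
def bundleMatrix : Fin 4 → Matrix (Fin r) (Fin r) Γ(S, D.T) :=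
  -- For `k ∈ K₁` the functional `(y, t / y)` on the block of `k` and `τ k` has to kill the column
  -- of `τ k` on `U 0` and the column of `k` on `U 2`. This dictates the off-diagonal entries: `y *
  -- (-y ^ (a (τ k) - 2) * t) + (t / y) * y ^ a (τ k) = 0`, and similarly for `b`. The fourth matrix
  -- is the third with its columns multiplied by powers of `t`, which is invertible on `U 2 ⊓ U 3`.
  -- The additional exponents 1 and -1 remove positive powers of `t` from the transition matrices
  -- between `U 0` and `U 3`.
  ![tw τ (fun i ↦ D.mono (a i) 0) (fun i ↦ if i ∈ K₁ then -D.mono (a (τ i) - 2) 1 else 0),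
    tw τ (fun _ ↦ 1) (fun _ ↦ 0),
    tw τ (fun i ↦ D.mono (-b i) (b i))
      (fun i ↦ if i ∈ K₂ then -D.mono (2 - b (τ i)) (b (τ i) - 1) else 0),
    tw τ (fun i ↦ D.mono (-b i) (if i ∈ K₁ then 1 else if i ∈ K₂ then -1 else 0))
      (fun i ↦ if i ∈ K₂ then -D.mono (2 - b (τ i)) 0 else 0)]

/-- The inverse matrices of `bundleMatrix`. -/
def bundleMatrixInv : Fin 4 → Matrix (Fin r) (Fin r) Γ(S, D.T) :=
  ![tw τ (fun i ↦ D.mono (-a i) 0) (fun i ↦ if i ∈ K₁ then D.mono (-a i - 2) 1 else 0),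
    tw τ (fun _ ↦ 1) (fun _ ↦ 0),
    tw τ (fun i ↦ D.mono (b i) (-b i))
      (fun i ↦ if i ∈ K₂ then D.mono (b i + 2) (-b i - 1) else 0),
    tw τ (fun i ↦ D.mono (b i) (if i ∈ K₁ then -1 else if i ∈ K₂ then 1 else 0))
      (fun i ↦ if i ∈ K₂ then D.mono (b i + 2) 0 else 0)]

variable {a b K₁ K₂ τ}

lemma bundleMatrixInv_mul (hτ : ∀ i, τ (τ i) = i) (hK : Disjoint K₁ K₂)
    (h₁ : ∀ i ∈ K₁, τ i ∈ K₂) (h₂ : ∀ i ∈ K₂, τ i ∈ K₁) (i : Fin 4) :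
    D.bundleMatrixInv a b K₁ K₂ τ i * D.bundleMatrix a b K₁ K₂ τ i = 1 := by
  have h₁' (i) (hi : i ∈ K₁) : i ∉ K₂ := Finset.disjoint_left.1 hK hi
  have h₂' (i) (hi : i ∈ K₂) : i ∉ K₁ := Finset.disjoint_right.1 hK hi
  fin_cases i
  all_goals
    simp only [bundleMatrix, bundleMatrixInv, Fin.zero_eta, Fin.mk_one, Fin.reduceFinMk,
      Matrix.cons_val, Matrix.cons_val_zero, Matrix.cons_val_one]
    rw [tw_mul hτ, ← tw_one (τ := τ)]
    congr 1 <;> funext k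
  all_goals
    by_cases hk₁ : k ∈ K₁
    · simp [hk₁, h₁' _ hk₁, h₂' _ (h₁ _ hk₁), h₁ _ hk₁, mono_mul, mono_zero, add_comm]
      try ring_nf
    · by_cases hk₂ : k ∈ K₂
      · simp [hk₁, hk₂, h₂ _ hk₂, h₁' _ (h₂ _ hk₂), mono_mul, mono_zero]
        try ring_nf
      · simp [hk₁, hk₂, mono_mul, mono_zero]

/-- Only the adjacent pairs of charts impose a condition, since the two opposite pairs meet inside
`T`. On an adjacent pair every entry is zero or, up to sign, one of the monomials that extend. -/
lemma bundleMatrix_regular (hτ : ∀ i, τ (τ i) = i) (hK : Disjoint K₁ K₂)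
    (h₁ : ∀ i ∈ K₁, τ i ∈ K₂) (h₂ : ∀ i ∈ K₂, τ i ∈ K₁) (i j : Fin 4) (k l : Fin r) :
    (D.bundleMatrixInv a b K₁ K₂ τ j * D.bundleMatrix a b K₁ K₂ τ i) k l ∈ D.regular i j := by
  have h₁' (i) (hi : i ∈ K₁) : i ∉ K₂ := Finset.disjoint_left.1 hK hi
  have h₂' (i) (hi : i ∈ K₂) : i ∉ K₁ := Finset.disjoint_right.1 hK hi
  have hself (i : Fin 4) : (D.bundleMatrixInv a b K₁ K₂ τ i * D.bundleMatrix a b K₁ K₂ τ i) k l ∈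
      D.regular i i := by
    rw [bundleMatrixInv_mul D hτ hK h₁ h₂, Matrix.one_apply]
    split_ifs
    exacts [Subring.one_mem _, Subring.zero_mem _]
  have cases (A : Subring Γ(S, D.T)) (p q : Fin r → Γ(S, D.T))
      (hp₁ : ∀ k ∈ K₁, p k ∈ A) (hp₂ : ∀ k ∈ K₂, p k ∈ A) (hp₃ : ∀ k, k ∉ K₁ → k ∉ K₂ → p k ∈ A)
      (hq₁ : ∀ k ∈ K₁, q k ∈ A) (hq₂ : ∀ k ∈ K₂, q k ∈ A) (hq₃ : ∀ k, k ∉ K₁ → k ∉ K₂ → q k ∈ A) :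
      tw τ p q k l ∈ A := by
    refine tw_apply_mem (fun k ↦ ?_) (fun k ↦ ?_) k l
    · by_cases hk₁ : k ∈ K₁
      · exact hp₁ k hk₁
      · by_cases hk₂ : k ∈ K₂
        exacts [hp₂ k hk₂, hp₃ k hk₁ hk₂]
    · by_cases hk₁ : k ∈ K₁
      · exact hq₁ k hk₁
      · by_cases hk₂ : k ∈ K₂
        exacts [hq₂ k hk₂, hq₃ k hk₁ hk₂]
  fin_cases i <;> fin_cases j
  · exact hself 0
  · simp only [bundleMatrix, bundleMatrixInv, Fin.zero_eta, Fin.mk_one, Fin.reduceFinMk,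
      Matrix.cons_val, Matrix.cons_val_zero, Matrix.cons_val_one]
    rw [tw_mul hτ]
    refine cases _ _ _ ?_ ?_ ?_ ?_ ?_ ?_
    all_goals
      intro k hk
      try intro hk'
      simp [*, mono_mul]
      try exact D.mono_mem₀₁ (by omega)
  · exact D.mem_regular_of_le D.inf_le₀₂ _
  · simp only [bundleMatrix, bundleMatrixInv, Fin.zero_eta, Fin.mk_one, Fin.reduceFinMk,
      Matrix.cons_val, Matrix.cons_val_zero, Matrix.cons_val_one]
    rw [tw_mul hτ]
    refine cases _ _ _ ?_ ?_ ?_ ?_ ?_ ?_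
    all_goals
      intro k hk
      try intro hk'
      simp [*, mono_mul]
      try exact D.mono_mem₀₃ (by omega)
  · change _ ∈ D.regular 1 0
    rw [D.regular_comm 1 0]
    simp only [bundleMatrix, bundleMatrixInv, Fin.zero_eta, Fin.mk_one, Fin.reduceFinMk,
      Matrix.cons_val, Matrix.cons_val_zero, Matrix.cons_val_one]
    rw [tw_mul hτ]
    refine cases _ _ _ ?_ ?_ ?_ ?_ ?_ ?_
    all_goals
      intro k hk
      try intro hk'
      simp [*, mono_mul]
      try exact D.mono_mem₀₁ (by omega)
  · exact hself 1
  · simp only [bundleMatrix, bundleMatrixInv, Fin.zero_eta, Fin.mk_one, Fin.reduceFinMk,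
      Matrix.cons_val, Matrix.cons_val_zero, Matrix.cons_val_one]
    rw [tw_mul hτ]
    refine cases _ _ _ ?_ ?_ ?_ ?_ ?_ ?_
    all_goals
      intro k hk
      try intro hk'
      simp [*, mono_mul]
      try exact D.mono_mem₁₂ (by omega)
  · exact D.mem_regular_of_le D.inf_le₁₃ _
  · exact D.mem_regular_of_le ((inf_comm _ _).trans_le D.inf_le₀₂) _
  · change _ ∈ D.regular 2 1
    rw [D.regular_comm 2 1]
    simp only [bundleMatrix, bundleMatrixInv, Fin.zero_eta, Fin.mk_one, Fin.reduceFinMk,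
      Matrix.cons_val, Matrix.cons_val_zero, Matrix.cons_val_one]
    rw [tw_mul hτ]
    refine cases _ _ _ ?_ ?_ ?_ ?_ ?_ ?_
    all_goals
      intro k hk
      try intro hk'
      simp [*, mono_mul]
      try exact D.mono_mem₁₂ (by omega)
  · exact hself 2
  · simp only [bundleMatrix, bundleMatrixInv, Fin.zero_eta, Fin.mk_one, Fin.reduceFinMk,
      Matrix.cons_val, Matrix.cons_val_zero, Matrix.cons_val_one]
    rw [tw_mul hτ]
    refine cases _ _ _ ?_ ?_ ?_ ?_ ?_ ?_
    all_goals
      intro k hk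
      try intro hk'
      simp [*, mono_mul]
      -- On the paired indices the off-diagonal entry is a difference of two equal monomials and
      -- vanishes.
      try first | exact D.mono_mem₂₃ (by omega) | (ring_nf; exact Subring.zero_mem _)
  · change _ ∈ D.regular 3 0
    rw [D.regular_comm 3 0]
    simp only [bundleMatrix, bundleMatrixInv, Fin.zero_eta, Fin.mk_one, Fin.reduceFinMk,
      Matrix.cons_val, Matrix.cons_val_zero, Matrix.cons_val_one]
    rw [tw_mul hτ]
    refine cases _ _ _ ?_ ?_ ?_ ?_ ?_ ?_
    all_goals
      intro k hk
      try intro hk'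
      simp [*, mono_mul]
      try first | exact D.mono_mem₀₃ (by omega) | (ring_nf; exact Subring.zero_mem _)
  · exact D.mem_regular_of_le ((inf_comm _ _).trans_le D.inf_le₁₃) _
  · change _ ∈ D.regular 3 2
    rw [D.regular_comm 3 2]
    simp only [bundleMatrix, bundleMatrixInv, Fin.zero_eta, Fin.mk_one, Fin.reduceFinMk,
      Matrix.cons_val, Matrix.cons_val_zero, Matrix.cons_val_one]
    rw [tw_mul hτ]
    refine cases _ _ _ ?_ ?_ ?_ ?_ ?_ ?_
    all_goals
      intro k hk
      try intro hk'
      simp [*, mono_mul]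
      try first | exact D.mono_mem₂₃ (by omega) | (ring_nf; exact Subring.zero_mem _)
  · exact hself 3

end Pairing

end SurfaceCharts

/-! ### Pairing the indices of `K₁` with those of `K₂` -/

section Index

variable {r : ℕ}

lemma exists_swap {K₁ K₂ : Finset (Fin r)} (hK : Disjoint K₁ K₂) (hcard : K₁.card = K₂.card) :
    ∃ τ : Fin r → Fin r, (∀ i, τ (τ i) = i) ∧ (∀ i ∈ K₁, τ i ∈ K₂) ∧ (∀ i ∈ K₂, τ i ∈ K₁) ∧
      ∀ i, i ∉ K₁ → i ∉ K₂ → τ i = i := by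
  let σ : K₁ ≃ K₂ := Finset.equivOfCardEq hcard
  let τ (i : Fin r) : Fin r :=
    if h : i ∈ K₁ then σ ⟨i, h⟩ else if h : i ∈ K₂ then σ.symm ⟨i, h⟩ else i
  have e₁ (i) (h : i ∈ K₁) : τ i = σ ⟨i, h⟩ := dif_pos h
  have e₂ (i) (h : i ∈ K₂) : τ i = σ.symm ⟨i, h⟩ :=
    (dif_neg (Finset.disjoint_right.1 hK h)).trans (dif_pos h)
  have e₃ (i) (h : i ∉ K₁) (h' : i ∉ K₂) : τ i = i := (dif_neg h).trans (dif_neg h')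
  have m₁ (i) (h : i ∈ K₁) : τ i ∈ K₂ := by
    rw [e₁ i h]
    exact Subtype.prop _
  have m₂ (i) (h : i ∈ K₂) : τ i ∈ K₁ := by
    rw [e₂ i h]
    exact Subtype.prop _
  refine ⟨τ, fun i ↦ ?_, m₁, m₂, e₃⟩
  by_cases h₁ : i ∈ K₁
  · rw [e₂ _ (m₁ i h₁)]
    simp [e₁ i h₁]
  · by_cases h₂ : i ∈ K₂
    · rw [e₁ _ (m₂ i h₂)]
      simp [e₂ i h₂]
    · rw [e₃ i h₁ h₂, e₃ i h₁ h₂]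

lemma sum_mul_tw {R : Type*} [CommRing R] {τ : Fin r → Fin r} (hτ : ∀ i, τ (τ i) = i)
    (p q f : Fin r → R) (j : Fin r) :
    ∑ x, f x * tw τ p q x j = f j * p j + f (τ j) * q (τ j) := by
  have h (x) : (τ x = j) = (x = τ j) := by
    refine propext ⟨fun h ↦ by rw [← h, hτ], fun h ↦ by rw [h, hτ]⟩
  simp [tw, mul_add, Finset.sum_add_distrib, h]

end Index

namespace SurfaceCharts

variable {S : Scheme.{0}} (D : SurfaceCharts S)

section Quotient

variable {r m : ℕ} {α β : Fin m → ℤ}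

/-- The diagonal matrices of a direct sum of line bundles. -/
def lineMatrix (α β : Fin m → ℤ) : Fin 4 → Matrix (Fin m) (Fin m) Γ(S, D.T) :=
  ![.diagonal fun l ↦ D.mono (α l) 0, 1, .diagonal fun l ↦ D.mono (-β l) (β l),
    .diagonal fun l ↦ D.mono (-β l) 0]

/-- The inverse matrices of `lineMatrix`. -/
def lineMatrixInv (α β : Fin m → ℤ) : Fin 4 → Matrix (Fin m) (Fin m) Γ(S, D.T) :=
  ![.diagonal fun l ↦ D.mono (-α l) 0, 1, .diagonal fun l ↦ D.mono (β l) (-β l),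
    .diagonal fun l ↦ D.mono (β l) 0]

lemma lineMatrixInv_mul (i : Fin 4) : D.lineMatrixInv α β i * D.lineMatrix α β i = 1 := by
  fin_cases i <;> simp [lineMatrix, lineMatrixInv, mono_mul, mono_zero]

lemma diagonal_apply_mem {R : Type*} [CommRing R] {A : Subring R} {p : Fin m → R}
    (hp : ∀ i, p i ∈ A) (i j : Fin m) : Matrix.diagonal p i j ∈ A := by
  rw [Matrix.diagonal_apply]
  split_ifs
  exacts [hp i, A.zero_mem]

lemma lineMatrix_regular (i j : Fin 4) (k l : Fin m) :
    (D.lineMatrixInv α β j * D.lineMatrix α β i) k l ∈ D.regular i j := by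
  have h (i j : Fin 4) (hij : i < j) :
      (D.lineMatrixInv α β j * D.lineMatrix α β i) k l ∈ D.regular i j ∧
      (D.lineMatrixInv α β i * D.lineMatrix α β j) k l ∈ D.regular i j := by
    fin_cases i <;> fin_cases j <;> first | (simp at hij; done) | skip
    all_goals
      simp only [lineMatrix, lineMatrixInv, Fin.zero_eta, Fin.mk_one, Fin.reduceFinMk,
        Matrix.cons_val, Matrix.cons_val_zero, Matrix.cons_val_one, Matrix.mul_one, Matrix.one_mul,
        Matrix.diagonal_mul_diagonal, mono_mul, ← Matrix.diagonal_one]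
      constructor <;> refine diagonal_apply_mem (fun l ↦ ?_) _ _
      all_goals
        try simp only [one_mul, mul_one]
        first
        | exact D.mem_regular_of_le D.inf_le₀₂ _
        | exact D.mem_regular_of_le D.inf_le₁₃ _
        | exact D.mono_mem₀₁ (by omega)
        | exact D.mono_mem₁₂ (by omega)
        | exact D.mono_mem₂₃ (by omega)
        | exact D.mono_mem₀₃ (by omega)
  rcases lt_trichotomy i j with hij | rfl | hij
  · exact (h i j hij).1
  · rw [lineMatrixInv_mul, Matrix.one_apply]
    split_ifs
    exacts [Subring.one_mem _, Subring.zero_mem _]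
  · rw [D.regular_comm]
    exact (h j i hij).2

variable {a b : Fin r → ℤ} {J K₁ K₂ : Finset (Fin r)} {τ : Fin r → Fin r} {ε : Fin m → Fin r}

/-- The matrix over `T` of the quotient map. -/
def quotientMatrix (K₁ : Finset (Fin r)) (τ : Fin r → Fin r) (ε : Fin m → Fin r) :
    Matrix (Fin m) (Fin r) Γ(S, D.T) :=
  (tw τ (fun k ↦ if k ∈ K₁ then D.mono 1 0 else 1)
    (fun k ↦ if k ∈ K₁ then D.mono (-1) 1 else 0)).submatrix ε id

/-- The matrix of the quotient map on the chart containing the node. -/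
def nodeMatrix (K₁ : Finset (Fin r)) (τ : Fin r → Fin r) (ε : Fin m → Fin r) :
    Matrix (Fin m) (Fin r) Γ(S, D.U 1) :=
  (tw τ (fun k ↦ if k ∈ K₁ then D.x₁ else 1) (fun k ↦ if k ∈ K₁ then D.x₂ else 0)).submatrix ε id

/-- The matrices of the quotient map on the four charts. -/
def quotientMatrices (K₁ : Finset (Fin r)) (τ : Fin r → Fin r) (ε : Fin m → Fin r) :
    ∀ i, Matrix (Fin m) (Fin r) Γ(S, D.U i) :=
  Fin.cons (.of fun l k ↦ if ε l = k then 1 else 0) <| Fin.cons (D.nodeMatrix K₁ τ ε) <|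
    Fin.cons (.of fun l k ↦ if τ (ε l) = k then 1 else 0) <|
    Fin.cons (.of fun l k ↦ if τ (ε l) = k then 1 else 0) finZeroElim

/-- Outside the chart of the node the map is a coordinate projection: in each paired block one
column cancels by the choice of the off-diagonal entries. The surviving one is `y * y ^ a (ε l)` on
`U 0` and `(t / y) * (t / y) ^ b (τ (ε l))` on `U 2`, whence the increments by 1 of the target
bidegree. -/
lemma quotientMatrices_comm (hτ : ∀ i, τ (τ i) = i) (hK : Disjoint K₁ K₂)
    (h₁ : ∀ i ∈ K₁, τ i ∈ K₂) (h₂ : ∀ i, i ∉ K₁ → i ∉ K₂ → τ i = i) (hε : ∀ l, ε l ∉ K₂)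
    (i : Fin 4) :
    D.lineMatrix (fun l ↦ a (ε l) + if ε l ∈ K₁ then 1 else 0)
      (fun l ↦ b (τ (ε l)) + if ε l ∈ K₁ then 1 else 0) i *
      (D.quotientMatrices K₁ τ ε i).map (resF (D.T_le i)) =
      D.quotientMatrix K₁ τ ε * D.bundleMatrix a b K₁ K₂ τ i := by
  have h₁' (i) (hi : i ∈ K₁) : i ∉ K₂ := Finset.disjoint_left.1 hK hi
  have h₂' (i) (hi : i ∈ K₂) : i ∉ K₁ := Finset.disjoint_right.1 hK hi
  have hmul (p q : Fin r → Γ(S, D.T)) (l j) : (D.quotientMatrix K₁ τ ε * tw τ p q) l j =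
      (if ε l = j then (if ε l ∈ K₁ then D.mono 1 0 * p (ε l) + D.mono (-1) 1 * q (τ (ε l)) else
        p (ε l)) else 0) +
      (if τ (ε l) = j then
        (if ε l ∈ K₁ then D.mono 1 0 * q (ε l) + D.mono (-1) 1 * p (τ (ε l)) else
        q (ε l)) else 0) := by
    have := congr($(tw_mul hτ (fun k ↦ if k ∈ K₁ then D.mono 1 0 else 1)
      (fun k ↦ if k ∈ K₁ then D.mono (-1) 1 else 0) p q) (ε l) j)
    refine Eq.trans this ?_
    simp only [tw, Matrix.of_apply]
    split_ifs <;> simp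
  ext l j
  fin_cases i
  all_goals
    simp only [bundleMatrix, lineMatrix, quotientMatrices, Fin.zero_eta, Fin.mk_one,
      Fin.reduceFinMk, Matrix.cons_val, Matrix.cons_val_zero, Matrix.cons_val_one, Fin.cons_zero,
      Matrix.one_mul, Matrix.diagonal_mul, Matrix.map_apply, Matrix.of_apply, hmul]
  · by_cases hk₁ : ε l ∈ K₁
    · simp only [hk₁, if_true, h₂' _ (h₁ _ hk₁), if_false, mul_zero, add_zero, mul_neg, mono_mul,
        apply_ite (resF _), map_one, map_zero, mul_ite, mul_one]
      ring_nf
      simp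
    · simp [hk₁, apply_ite (resF _)]
  · change resF _ (D.nodeMatrix K₁ τ ε l j) = _
    simp only [nodeMatrix, tw, Matrix.submatrix_apply, Matrix.of_apply, id, map_add,
      apply_ite (resF _), map_one, map_zero, D.res_x₁, D.res_x₂, y_eq_mono, x₂_eq_mono]
    simp
  · change _ * resF _ (if τ (ε l) = j then 1 else 0) = _
    by_cases hk₁ : ε l ∈ K₁
    · simp only [hk₁, if_true, h₁ _ hk₁, h₁' _ hk₁, hτ, if_false, mul_zero, zero_add, mul_neg,
        mono_mul, apply_ite (resF _), map_one, map_zero, mul_ite, mul_one]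
      ring_nf
      simp
    · simp [hk₁, hε l, h₂ _ hk₁ (hε l), apply_ite (resF _)]
  · change _ * resF _ (if τ (ε l) = j then 1 else 0) = _
    by_cases hk₁ : ε l ∈ K₁
    · simp only [hk₁, if_true, h₁ _ hk₁, h₁' _ hk₁, h₂' _ (h₁ _ hk₁), hτ, if_false, mul_zero,
        zero_add, mul_neg, mono_mul, apply_ite (resF _), map_one, map_zero, mul_ite, mul_one]
      ring_nf
      simp
    · simp [hk₁, hε l, h₂ _ hk₁ (hε l), apply_ite (resF _)]

/-- The presentation of the quotient near the node. -/
lemma node_isPresentation (hτ : ∀ i, τ (τ i) = i) (hK : Disjoint K₁ K₂)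
    (h₁ : ∀ i ∈ K₁, τ i ∈ K₂) (h₁₂ : ∀ i ∈ K₂, τ i ∈ K₁)
    (h₂ : ∀ i, i ∉ K₁ → i ∉ K₂ → τ i = i) (hε : ∀ k, (∃ l, ε l = k) ↔ k ∈ J ∨ k ∈ K₁) (hJ : Disjoint J K₂)
    (hJ₁ : Disjoint J K₁)
    {F M : S.Modules} {ι : F ⟶ M} (hι : ∀ V, Function.Injective (ι.app V))
    {g : Fin r → Γ(F, D.U 1)} {n : Fin m → Γ(M, D.U 1)} (hn : IsFrame M (D.U 1) n)
    (hg : ∀ k, ι.app (D.U 1) (g k) = ∑ l, D.nodeMatrix K₁ τ ε l k • n l)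
    (hgen : ∀ (V : S.Opens) (h : V ≤ D.U 1) (s : Γ(F, V)), ∀ x ∈ V, ∃ (W : S.Opens) (h' : W ≤ V),
      x ∈ W ∧ ∃ c : Fin r → Γ(S, W), res F h' s = ∑ j, c j • res F (h'.trans h) (g j)) :
    IsPresentation F (D.U 1) g
      (tw τ (fun k ↦ if k ∈ K₁ then D.x₂ else if k ∈ J ∪ K₂ then 0 else 1)
        (fun k ↦ if k ∈ K₁ then -D.x₁ else 0)) := by
  have h₁' (i) (hi : i ∈ K₁) : i ∉ K₂ := Finset.disjoint_left.1 hK hi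
  have h₂' (i) (hi : i ∈ K₂) : i ∉ K₁ := Finset.disjoint_right.1 hK hi
  have hJ' (i) (hi : i ∈ J) : i ∉ K₂ := Finset.disjoint_left.1 hJ hi
  have hJ₁' (i) (hi : i ∈ J) : i ∉ K₁ := Finset.disjoint_left.1 hJ₁ hi
  have hε' (l) : ε l ∈ J ∨ ε l ∈ K₁ := (hε _).1 ⟨l, rfl⟩
  have hεr (k) (hk : k ∈ J ∨ k ∈ K₁) : ∃ l, ε l = k := (hε k).2 hk
  have key (V : S.Opens) (h : V ≤ D.U 1) (c : Fin r → Γ(S, V)) :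
      ι.app V (∑ j, c j • res F h (g j)) =
        ∑ l, (resF h (if ε l ∈ K₁ then D.x₁ else 1) * c (ε l) +
          resF h (if ε l ∈ K₁ then D.x₂ else 0) * c (τ (ε l))) • res M h (n l) := by
    have hs (l : Fin m) := sum_tw_mul (τ := τ) (fun k ↦ resF h (if k ∈ K₁ then D.x₁ else 1))
      (fun k ↦ resF h (if k ∈ K₁ then D.x₂ else 0)) c (ε l)
    simp only [map_sum, Scheme.Modules.Hom.app_smul, app_res, hg, res_sum, res_smul,
      Finset.smul_sum, smul_smul]
    rw [Finset.sum_comm]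
    refine Finset.sum_congr rfl fun l _ ↦ ?_
    rw [← Finset.sum_smul, ← hs l]
    congr 1
    refine Finset.sum_congr rfl fun k _ ↦ ?_
    rw [mul_comm, ← tw_map]
    rfl
  -- The row of an index in `K₁` is the Koszul relation `x₂ • g k - x₁ • g (τ k) = 0`. The rows of
  -- `J ∪ K₂` are zero and only keep the relations indexed by `Fin r`. The remaining rows say that
  -- `g k = 0`. All of them can be checked in `M`.
  refine ⟨hgen, fun l ↦ hι _ ?_, fun V h c hc x hx ↦ ?_⟩
  · have := key _ le_rfl (tw τ (fun k ↦ if k ∈ K₁ then D.x₂ else if k ∈ J ∪ K₂ then 0 else 1)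
        (fun k ↦ if k ∈ K₁ then -D.x₁ else 0) l)
    simp only [res_self, resF_self] at this
    rw [this, map_zero]
    refine Finset.sum_eq_zero fun l' _ ↦ ?_
    refine (congrArg (· • _) ?_).trans (zero_smul _ _)
    simp only [tw, Matrix.of_apply]
    by_cases hl : l ∈ K₁
    · have e₁ : (τ l = τ (ε l')) = (l = ε l') :=
        propext ⟨fun h ↦ by rw [← hτ l, h, hτ], fun h ↦ by rw [h]⟩
      rcases hε' l' with hk | hk
      · have e₃ : l ≠ ε l' := fun h ↦ hJ₁' _ hk (h ▸ hl)
        have e₂ : τ l ≠ ε l' := fun h ↦ hJ' _ hk (h ▸ h₁ _ hl)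
        simp [hJ₁' _ hk, e₃, e₂]
      · have e₂ : τ l ≠ ε l' := fun h ↦ h₁' _ hk (h ▸ h₁ _ hl)
        have e₄ : l ≠ τ (ε l') := fun h ↦ h₁' _ hl (h ▸ h₁ _ hk)
        simp only [hl, hk, e₁, e₂, e₄, if_true, if_false]
        split_ifs <;> ring
    · by_cases hl' : l ∈ J ∪ K₂
      · simp [hl, hl']
      · have hl'' : l ∉ J ∧ l ∉ K₂ := by simpa using hl'
        have e₁ : l ≠ ε l' := fun h ↦ by rcases hε' l' with hk | hk <;> simp_all
        have e₂ : ε l' ∈ K₁ → l ≠ τ (ε l') := fun hk h ↦ hl''.2 (h ▸ h₁ _ hk)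
        by_cases hk : ε l' ∈ K₁
        · simp [hl, e₁, e₂ hk]
        · simp [hl, e₁, hk]
  · have h0 (l : Fin m) : resF h (if ε l ∈ K₁ then D.x₁ else 1) * c (ε l) +
          resF h (if ε l ∈ K₁ then D.x₂ else 0) * c (τ (ε l)) = 0 := by
      refine congrFun (hn.coeff_ext h (c := fun l ↦ resF h (if ε l ∈ K₁ then D.x₁ else 1) *
        c (ε l) + resF h (if ε l ∈ K₁ then D.x₂ else 0) * c (τ (ε l))) (d := 0) ?_) l
      rw [← key, hc, map_zero]
      simp
    -- By `h0` the coefficients of a relation satisfy `x₁ * c k + x₂ * c (τ k) = 0` for `k ∈ K₁`, so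
    -- locally they are a multiple of `(x₂, -x₁)`. The finitely many neighbourhoods are intersected
    -- afterwards.
    have hloc (k : Fin r) : ∃ (W : S.Opens) (h' : W ≤ V), x ∈ W ∧ ∃ d, k ∈ K₁ →
        resF h' (c k) = resF (h'.trans h) D.x₂ * d ∧
        resF h' (c (τ k)) = -resF (h'.trans h) D.x₁ * d := by
      by_cases hk : k ∈ K₁
      · obtain ⟨l, rfl⟩ := hεr k (.inr hk)
        obtain ⟨W, h', hW, d, hd⟩ := D.koszul V h (c (ε l)) (c (τ (ε l)))
          (by simpa [hk] using h0 l) x hx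
        exact ⟨W, h', hW, d, fun _ ↦ hd⟩
      · exact ⟨V, le_rfl, hx, 0, fun h ↦ absurd h hk⟩
    choose W hWV hW d hd using hloc
    let W' : S.Opens := V ⊓ Finset.univ.inf W
    have hW'k (k) : W' ≤ W k := inf_le_right.trans (Finset.inf_le (Finset.mem_univ k))
    refine ⟨W', inf_le_left, ⟨hx, ?_⟩, fun k ↦ if k ∈ K₁ then resF (hW'k k) (d k) else
      resF inf_le_left (c k), fun j ↦ ?_⟩
    · rw [TopologicalSpace.Opens.coe_finset_inf]
      simpa using hW
    have := sum_mul_tw hτ (fun k ↦ resF (inf_le_left.trans h : W' ≤ D.U 1)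
      (if k ∈ K₁ then D.x₂ else if k ∈ J ∪ K₂ then 0 else 1))
      (fun k ↦ resF (inf_le_left.trans h : W' ≤ D.U 1) (if k ∈ K₁ then -D.x₁ else 0))
      (fun k ↦ if k ∈ K₁ then resF (hW'k k) (d k) else resF (inf_le_left : W' ≤ V) (c k)) j
    rw [← tw_map] at this
    refine Eq.trans ?_ this.symm
    have hd₁ (k) (hk : k ∈ K₁) : resF (inf_le_left : W' ≤ V) (c k) =
        resF (inf_le_left.trans h : W' ≤ D.U 1) D.x₂ * resF (hW'k k) (d k) := by
      simpa using congrArg (resF (hW'k k)) (hd k hk).1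
    have hd₂ (k) (hk : k ∈ K₁) : resF (inf_le_left : W' ≤ V) (c (τ k)) =
        -resF (inf_le_left.trans h : W' ≤ D.U 1) D.x₁ * resF (hW'k k) (d k) := by
      simpa using congrArg (resF (hW'k k)) (hd k hk).2
    by_cases hj₁ : j ∈ K₁
    · simp only [hj₁, if_true, h₂' _ (h₁ _ hj₁), if_false, map_zero, mul_zero, add_zero, hd₁ j hj₁]
      ring
    by_cases hj₂ : j ∈ K₂
    · have := hd₂ (τ j) (h₁₂ j hj₂)
      rw [hτ] at this
      simp only [hj₁, hj₂, h₁₂ j hj₂, this, if_true, if_false, Finset.mem_union, or_true, map_zero,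
        mul_zero, zero_add, map_neg]
      ring
    by_cases hj : j ∈ J
    · obtain ⟨l, rfl⟩ := hεr j (.inl hj)
      have := h0 l
      simp only [hj₁, if_false, map_one, one_mul, map_zero, zero_mul, add_zero] at this
      simp [hj₁, this, h₂ _ hj₁ hj₂, hj]
    · simp [hj₁, hj₂, hj, h₂ _ hj₁ hj₂]

end Quotient

end SurfaceCharts

lemma exists_enumeration {r m : ℕ} {J K : Finset (Fin r)} (hJK : Disjoint J K)
    (hcard : J.card + K.card = m) : ∃ ε : Fin m → Fin r, Function.Injective ε ∧
      (∀ k, (∃ l, ε l = k) ↔ k ∈ J ∨ k ∈ K) ∧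
      ∀ f : Fin r → ℤ, ∑ l, f (ε l) = ∑ k ∈ J, f k + ∑ k ∈ K, f k := by
  have hc : (J ∪ K).card = m := by rw [Finset.card_union_of_disjoint hJK, hcard]
  let ε := (J ∪ K).orderEmbOfFin hc
  refine ⟨ε, ε.injective, fun k ↦ ?_, fun f ↦ ?_⟩
  · have : k ∈ Set.range ε ↔ k ∈ J ∪ K := by
      rw [Finset.range_orderEmbOfFin]
      rfl
    simpa using this
  · rw [← Finset.sum_union hJK]
    conv_rhs => rw [← Finset.image_orderEmbOfFin_univ (J ∪ K) hc]
    rw [Finset.sum_image fun _ _ _ _ h ↦ ε.injective h]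

namespace SurfaceCharts

variable {S : Scheme.{0}} (D : SurfaceCharts S) {r m : ℕ}

/-- The bundle on the surface, its quotient and their frames. -/
theorem exists_quotient [IsIntegral S] (a b : Fin r → ℤ) {J K₁ K₂ : Finset (Fin r)}
    (hJ₁ : Disjoint J K₁) (hJ₂ : Disjoint J K₂) (hK : Disjoint K₁ K₂)
    (hc₁ : J.card + K₁.card = m) (hc₂ : J.card + K₂.card = m) :
    ∃ (E F : S.Modules) (ψ : E ⟶ F) (e : ∀ i, Fin r → Γ(E, D.U i)) (f₀ : Fin m → Γ(F, D.U 0))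
      (f₂ : Fin m → Γ(F, D.U 2)) (f₃ : Fin m → Γ(F, D.U 3)) (d : Fin m → ℤ)
      (R₁ : Matrix (Fin r) (Fin r) Γ(S, D.U 1 ⊓ D.U 0))
      (R₂ : Matrix (Fin r) (Fin r) Γ(S, D.U 1 ⊓ D.U 2)),
      (∀ i, IsFrame E (D.U i) (e i)) ∧
      (∀ k, res E inf_le_left (e 1 k) = ∑ l, ((Matrix.diagonal fun k ↦
        zp (resF inf_le_left D.x₁) (resF inf_le_right D.w) (-a k)) +
        resF (inf_le_left : D.U 1 ⊓ D.U 0 ≤ D.U 1) D.x₂ • R₁) l k • res E inf_le_right (e 0 l)) ∧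
      (∀ k, res E inf_le_left (e 1 k) = ∑ l, ((Matrix.diagonal fun k ↦
        zp (resF inf_le_left D.x₂) (resF inf_le_right D.v) (-b k)) +
        resF (inf_le_left : D.U 1 ⊓ D.U 2 ≤ D.U 1) D.x₁ • R₂) l k • res E inf_le_right (e 2 l)) ∧
      Epi ψ ∧ IsCoherent F ∧ IsTorsionFree F ∧ IsFrame F (D.U 0) f₀ ∧ IsFrame F (D.U 2) f₂ ∧
      IsFrame F (D.U 3) f₃ ∧
      (∀ k, res F inf_le_left (f₀ k) =
        zp (resF inf_le_right D.y₃) (resF inf_le_left D.w) (d k) •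
          res F (inf_le_right : D.U 0 ⊓ D.U 3 ≤ D.U 3) (f₃ k)) ∧
      ∑ k, d k = ∑ i ∈ J, (a i + b i) + ∑ i ∈ K₁, (a i + 1) + ∑ i ∈ K₂, (b i + 1) := by
  have hcard : K₁.card = K₂.card := by omega
  obtain ⟨τ, hτ, h₁₂, h₂₁, hfix⟩ := exists_swap hK hcard
  obtain ⟨ε, hεinj, hεr, hεsum⟩ := exists_enumeration hJ₁ hc₁
  have hε₂ (l) : ε l ∉ K₂ := by
    rcases (hεr _).1 ⟨l, rfl⟩ with h | h
    exacts [Finset.disjoint_left.1 hJ₂ h, Finset.disjoint_left.1 hK h]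
  set α : Fin m → ℤ := fun l ↦ a (ε l) + if ε l ∈ K₁ then 1 else 0 with hα
  set β : Fin m → ℤ := fun l ↦ b (τ (ε l)) + if ε l ∈ K₁ then 1 else 0 with hβ
  have hPinv := D.bundleMatrixInv_mul (a := a) (b := b) hτ hK h₁₂ h₂₁
  have hRinv := D.lineMatrixInv_mul (α := α) (β := β)
  obtain ⟨E, e, Q, he, hQ, heQ⟩ := D.exists_bundle_of_regular _ _ hPinv
    (D.bundleMatrix_regular hτ hK h₁₂ h₂₁)
  obtain ⟨M, n, N, hn, hN, hnN⟩ := D.exists_bundle_of_regular _ _ hRinv D.lineMatrix_regular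
  obtain ⟨ψ, hψ⟩ := D.exists_hom_of_matrix hPinv he hQ heQ hRinv hN hnN (D.quotientMatrix K₁ τ ε)
    (D.quotientMatrices K₁ τ ε) (D.quotientMatrices_comm hτ hK h₁₂ hfix hε₂)
  -- At the node a paired summand of `ψ` has as image only the ideal `(x₁, x₂)`, so `F` has to be
  -- the image and not `M` itself.
  obtain ⟨F, p, ι, hpι, hι, hp⟩ := exists_image ψ
  have hM : IsVectorBundle M m := fun x ↦ by
    obtain ⟨i, hi⟩ := TopologicalSpace.Opens.mem_iSup.1
      (D.iSup_eq_top ▸ TopologicalSpace.Opens.mem_top x)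
    exact ⟨D.U i, hi, n i, hn i⟩
  have happ (V : S.Opens) (s : Γ(E, V)) : ι.app V (p.app V s) = ψ.app V s := by
    rw [← hpι]
    rfl
  have frame (i : Fin 4) (f : Fin m → Γ(F, D.U i)) (hf : ∀ l, ι.app _ (f l) = n i l) :
      IsFrame F (D.U i) f := by
    refine IsFrame.of_injective hι ?_
    rw [funext hf]
    exact hn i
  -- Away from the chart of the node the whole frame of `M` is hit, so it lifts to a frame of `F`.
  have hι₀ (l) : ι.app _ (p.app _ (e 0 (ε l))) = n 0 l := by
    rw [happ, hψ, Finset.sum_eq_single l]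
    · change (if ε l = ε l then (1 : Γ(S, D.U 0)) else 0) • _ = _
      simp
    · intro l' _ hl'
      change (if ε l' = ε l then (1 : Γ(S, D.U 0)) else 0) • _ = _
      simp [hεinj.ne hl']
    · simp
  have hτinj : Function.Injective τ := Function.LeftInverse.injective hτ
  have hι₂ (l) : ι.app _ (p.app _ (e 2 (τ (ε l)))) = n 2 l := by
    rw [happ, hψ, Finset.sum_eq_single l]
    · change (if τ (ε l) = τ (ε l) then (1 : Γ(S, D.U 2)) else 0) • _ = _
      simp
    · intro l' _ hl'
      change (if τ (ε l') = τ (ε l) then (1 : Γ(S, D.U 2)) else 0) • _ = _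
      simp [show τ (ε l') ≠ τ (ε l) from (hτinj.comp hεinj).ne hl']
    · simp
  have hι₃ (l) : ι.app _ (p.app _ (e 3 (τ (ε l)))) = n 3 l := by
    rw [happ, hψ, Finset.sum_eq_single l]
    · change (if τ (ε l) = τ (ε l) then (1 : Γ(S, D.U 3)) else 0) • _ = _
      simp
    · intro l' _ hl'
      change (if τ (ε l') = τ (ε l) then (1 : Γ(S, D.U 3)) else 0) • _ = _
      simp [show τ (ε l') ≠ τ (ε l) from (hτinj.comp hεinj).ne hl']
    · simp
  have hf₀ := frame 0 _ hι₀
  have hf₂ := frame 2 _ hι₂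
  have hf₃ := frame 3 _ hι₃
  have hgen (V : S.Opens) (h : V ≤ D.U 1) (s : Γ(F, V)) (x : S) (hx : x ∈ V) :
      ∃ (W : S.Opens) (h' : W ≤ V), x ∈ W ∧ ∃ c : Fin r → Γ(S, W),
        res F h' s = ∑ j, c j • res F (h'.trans h) (p.app _ (e 1 j)) := by
    obtain ⟨W, h', hW, e', he'⟩ := hp V s x hx
    refine ⟨W, h', hW, (he 1).coeff (h'.trans h) e', ?_⟩
    rw [← he']
    conv_lhs => rw [(he 1).eq_sum (h'.trans h) e']
    simp [app_res]
  have hpres := D.node_isPresentation hτ hK h₁₂ h₂₁ hfix hεr hJ₂ hJ₁ hι (hn 1)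
    (g := fun k ↦ p.app _ (e 1 k)) (fun k ↦ by rw [happ, hψ]; rfl) hgen
  have hmap (i j : Fin 4) (A : Matrix (Fin r) (Fin r) Γ(S, D.U i ⊓ D.U j))
      (hA : A.map (resF (le_inf (D.T_le i) (D.T_le j))) =
        (Q i j).map (resF (le_inf (D.T_le i) (D.T_le j)))) : Q i j = A := by
    ext k l
    exact D.res_injective _ congr($hA.symm k l)
  -- The matrices `R₁` and `R₂` are the off-diagonal parts of the transition matrices divided by
  -- `x₂` and `x₁`: for instance `y ^ (-a - 2) * t = x₂ * y ^ (-a - 1)`.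
  refine ⟨E, F, p, e, _, _, _, fun l ↦ α l + β l, tw τ (fun _ ↦ 0) (fun k ↦ if k ∈ K₁ then
    zp (resF inf_le_left D.x₁) (resF inf_le_right D.w) (-a k - 1) else 0),
    tw τ (fun _ ↦ 0) (fun k ↦ if k ∈ K₂ then
    zp (resF inf_le_left D.x₂) (resF inf_le_right D.v) (-b k - 1) else 0),
    he, fun k ↦ ?_, fun k ↦ ?_, epi_of_locally_surjective p hp,
    isCoherent_of_isPresentation fun x ↦ ?_, hM.isTorsionFree.of_injective hι,
    hf₀, hf₂, hf₃, fun k ↦ ?_, ?_⟩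
  · rw [heQ 1 0 k, hmap 1 0 _ ?_]
    rw [hQ]
    ext i j
    simp only [bundleMatrix, bundleMatrixInv, Matrix.cons_val_zero, Matrix.cons_val_one,
      Matrix.map_apply, Matrix.add_apply, Matrix.smul_apply, smul_eq_mul, map_add, map_mul,
      resF_resF, tw_one, Matrix.mul_one]
    rw [← Matrix.map_apply (f := resF _), ← Matrix.map_apply (f := resF _) (M := tw _ _ _),
      Matrix.diagonal_map (map_zero _), tw_map]
    simp only [tw, Matrix.of_apply, map_zero, map_zp, apply_ite (resF _), resF_resF, D.res_x₁,
      D.res_x₂, D.res_w, zp_unit, zpow_y, x₂_eq_mono, Matrix.diagonal_apply]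
    simp only [ite_self, zero_add, mul_ite, mul_zero, mono_mul]
    ring_nf
  · rw [heQ 1 2 k, hmap 1 2 _ ?_]
    rw [hQ]
    have hu : (↑(D.y * D.t⁻¹) : Γ(S, D.T)) = ↑(D.t * D.y⁻¹)⁻¹ := by simp
    ext i j
    simp only [bundleMatrix, bundleMatrixInv, Matrix.cons_val, Matrix.cons_val_one,
      Matrix.map_apply, Matrix.add_apply, Matrix.smul_apply, smul_eq_mul, map_add, map_mul,
      resF_resF, tw_one, Matrix.mul_one]
    rw [← Matrix.map_apply (f := resF _), ← Matrix.map_apply (f := resF _) (M := tw _ _ _),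
      Matrix.diagonal_map (map_zero _), tw_map]
    simp only [tw, Matrix.of_apply, map_zero, map_zp, apply_ite (resF _), resF_resF, D.res_x₁,
      D.res_x₂, D.res_v, hu, zp_unit, zpow_x₂, y_eq_mono, Matrix.diagonal_apply]
    simp only [ite_self, zero_add, mul_ite, mul_zero, mono_mul]
    ring_nf
  · obtain ⟨i, hi⟩ := TopologicalSpace.Opens.mem_iSup.1
      (D.iSup_eq_top ▸ TopologicalSpace.Opens.mem_top x)
    fin_cases i
    exacts [⟨_, _, _, _, _, hi, hf₀.isPresentation⟩, ⟨_, _, _, _, _, hi, hpres⟩,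
      ⟨_, _, _, _, _, hi, hf₂.isPresentation⟩, ⟨_, _, _, _, _, hi, hf₃.isPresentation⟩]
  · apply hι
    rw [Scheme.Modules.Hom.app_smul, app_res, app_res, hι₀, hι₃, hnN 0 3 k,
      Finset.sum_eq_single k]
    · congr 1
      refine D.res_injective _ ((congr($(hN 0 3) k k)).trans ?_)
      simp only [lineMatrix, lineMatrixInv, Matrix.cons_val, Matrix.cons_val_zero,
        Matrix.diagonal_mul_diagonal, Matrix.diagonal_apply_eq, mono_mul, map_zp, resF_resF,
        D.res_y₃, D.res_w, zp_unit, zpow_y]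
      ring_nf
    · intro l _ hl
      have : N 0 3 l k = 0 := by
        refine D.res_injective _ ((congr($(hN 0 3) l k)).trans ?_)
        simp [lineMatrix, lineMatrixInv, hl]
      rw [this, zero_smul]
    · simp
  -- The summand 2 collects the increments of `α` and `β` at a paired index; the `b`-terms over `K₁`
  -- are then moved to `K₂` by `τ`.
  · have := hεsum fun k ↦ a k + b (τ k) + if k ∈ K₁ then 2 else 0
    refine Eq.trans (Finset.sum_congr rfl fun l _ ↦ ?_) (this.trans ?_)
    · simp only [hα, hβ]
      split_ifs <;> ring
    · have hs₁ : ∑ k ∈ J, (a k + b (τ k) + if k ∈ K₁ then 2 else 0) = ∑ k ∈ J, (a k + b k) := by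
        refine Finset.sum_congr rfl fun k hk ↦ ?_
        rw [if_neg (Finset.disjoint_left.1 hJ₁ hk), hfix k (Finset.disjoint_left.1 hJ₁ hk)
          (Finset.disjoint_left.1 hJ₂ hk), add_zero]
      have hs₂ : ∑ k ∈ K₁, (a k + b (τ k) + if k ∈ K₁ then 2 else 0) =
          ∑ k ∈ K₁, (a k + 1) + ∑ k ∈ K₁, (b (τ k) + 1) := by
        rw [← Finset.sum_add_distrib]
        refine Finset.sum_congr rfl fun k hk ↦ ?_
        rw [if_pos hk]
        ring
      have hs₃ : ∑ k ∈ K₁, (b (τ k) + 1) = ∑ k ∈ K₂, (b k + 1) :=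
        Finset.sum_nbij' τ τ h₁₂ h₂₁ (fun k _ ↦ hτ k) (fun k _ ↦ hτ k) (fun k _ ↦ rfl)
      rw [hs₁, hs₂, hs₃, add_assoc]

end SurfaceCharts

/-! ### Charts: affine open subsets with a given ring of functions -/

section Charts

variable {X Y Z : Scheme.{0}}

/-- The pullback of functions. -/
def pullF (f : X ⟶ Y) {V : Y.Opens} {W : X.Opens} (h : W ≤ f ⁻¹ᵁ V) : Γ(Y, V) →+* Γ(X, W) :=
  (f.appLE V W h).hom

@[simp] lemma pullF_pullF (f : X ⟶ Y) (g : Y ⟶ Z) {U : Z.Opens} {V : Y.Opens} {W : X.Opens}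
    (h : W ≤ f ⁻¹ᵁ V) (h' : V ≤ g ⁻¹ᵁ U) (a : Γ(Z, U)) :
    pullF f h (pullF g h' a) = pullF (f ≫ g) (h.trans fun _ hx ↦ h' hx) a := by
  simp only [pullF, ← CommRingCat.comp_apply, Scheme.Hom.appLE_comp_appLE]

@[simp] lemma resF_pullF (f : X ⟶ Y) {V : Y.Opens} {W W' : X.Opens} (h : W ≤ f ⁻¹ᵁ V)
    (h' : W' ≤ W) (a : Γ(Y, V)) : resF h' (pullF f h a) = pullF f (h'.trans h) a := by
  simp only [pullF, resF, ← CommRingCat.comp_apply, Scheme.Hom.appLE_map]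

@[simp] lemma pullF_resF (f : X ⟶ Y) {V V' : Y.Opens} {W : X.Opens} (h : W ≤ f ⁻¹ᵁ V')
    (h' : V' ≤ V) (a : Γ(Y, V)) :
    pullF f h (resF h' a) = pullF f (h.trans fun _ hx ↦ h' hx) a := by
  simp only [pullF, resF, ← CommRingCat.comp_apply, Scheme.Hom.map_appLE]

lemma pullF_id {V W : X.Opens} (h : W ≤ 𝟙 X ⁻¹ᵁ V) (a : Γ(X, V)) :
    pullF (𝟙 X) h a = resF h a := by
  simp [pullF, resF, Scheme.Hom.appLE]
  rfl

lemma pullF_congr {f g : X ⟶ Y} (hfg : f = g) {V : Y.Opens} {W : X.Opens} (h : W ≤ f ⁻¹ᵁ V)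
    (a : Γ(Y, V)) : pullF f h a = pullF g (hfg ▸ h) a := by
  subst hfg
  rfl

lemma pullF_eq_app (f : X ⟶ Y) {V : Y.Opens} (h : f ⁻¹ᵁ V ≤ f ⁻¹ᵁ V) (a : Γ(Y, V)) :
    pullF f h a = f.app V a := by
  simp [pullF, Scheme.Hom.app_eq_appLE]

lemma top_le_preimage_top (f : X ⟶ Y) : ⊤ ≤ f ⁻¹ᵁ ⊤ := le_rfl

lemma hom_ext_of_isAffineOpen {V : Y.Opens} (hV : IsAffineOpen V) {f g : X ⟶ Y}
    (hf : ⊤ ≤ f ⁻¹ᵁ V) (hg : ⊤ ≤ g ⁻¹ᵁ V) (h : ∀ a, pullF f hf a = pullF g hg a) : f = g := by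
  have key (f : X ⟶ Y) (hf : ⊤ ≤ f ⁻¹ᵁ V) : (⊤ : X.Opens).ι ≫ f =
      (⊤ : X.Opens).toSpecΓ ≫ Spec.map (f.appLE V ⊤ hf) ≫ hV.fromSpec := by
    rw [Scheme.Opens.toSpecΓ_SpecMap_appLE_assoc, hV.toSpecΓ_fromSpec]
    simp
  have h' : f.appLE V ⊤ hf = g.appLE V ⊤ hg := by
    ext a
    exact h a
  refine (cancel_epi X.topIso.hom).1 ?_
  change (⊤ : X.Opens).ι ≫ f = (⊤ : X.Opens).ι ≫ g
  rw [key f hf, key g hg, h']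

lemma exists_hom_of_isAffineOpen {V : Y.Opens} (hV : IsAffineOpen V) (θ : Γ(Y, V) →+* Γ(X, ⊤)) :
    ∃ (f : X ⟶ Y) (h : ⊤ ≤ f ⁻¹ᵁ V), ∀ a, pullF f h a = θ a := by
  let g := X.toSpecΓ ≫ Spec.map (CommRingCat.ofHom θ)
  have hV' : (⊤ : (Spec Γ(Y, V)).Opens) ≤ hV.fromSpec ⁻¹ᵁ V := by rw [hV.fromSpec_preimage_self]
  refine ⟨g ≫ hV.fromSpec, fun x _ ↦ hV' trivial, fun a ↦ ?_⟩
  have h₁ : pullF hV.fromSpec hV' a = (Scheme.ΓSpecIso Γ(Y, V)).inv a := by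
    have := congr($(hV.fromSpec_app_self) a)
    rw [CommRingCat.comp_apply] at this
    rw [pullF, Scheme.Hom.appLE, CommRingCat.comp_apply, this, ← CommRingCat.comp_apply,
      ← Functor.map_comp]
    exact congr($((Spec Γ(Y, V)).presheaf.map_id _) _)
  rw [← pullF_pullF g hV.fromSpec (top_le_preimage_top g) hV', h₁,
    ← pullF_pullF X.toSpecΓ _ (top_le_preimage_top X.toSpecΓ)
      (top_le_preimage_top (Spec.map (CommRingCat.ofHom θ)))]
  have h₂ : pullF (Spec.map (CommRingCat.ofHom θ)) (top_le_preimage_top _) ((Scheme.ΓSpecIso Γ(Y, V)).inv a) =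
      (Scheme.ΓSpecIso Γ(X, ⊤)).inv (θ a) := by
    refine (pullF_eq_app _ _ _).trans ?_
    exact congr($(Scheme.ΓSpecIso_inv_naturality (CommRingCat.ofHom θ)).hom a).symm
  rw [h₂]
  refine (pullF_eq_app _ _ _).trans ?_
  exact congr($(Scheme.toSpecΓ_appTop X).hom _).trans (by simp)

/-- The open subset `V` is affine with ring of functions `R`. -/
def IsChart {R : Type} [CommRing R] (V : X.Opens) (ρ : R →+* Γ(X, V)) : Prop :=
  IsAffineOpen V ∧ Function.Bijective ρ

variable {R : Type} [CommRing R]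

lemma IsChart.hom_ext {V : Y.Opens} {ρ : R →+* Γ(Y, V)} (hρ : IsChart V ρ) {f g : X ⟶ Y}
    (hf : ⊤ ≤ f ⁻¹ᵁ V) (hg : ⊤ ≤ g ⁻¹ᵁ V) (h : ∀ a, pullF f hf (ρ a) = pullF g hg (ρ a)) :
    f = g := by
  refine hom_ext_of_isAffineOpen hρ.1 hf hg fun a ↦ ?_
  obtain ⟨b, rfl⟩ := hρ.2.2 a
  exact h b

lemma IsChart.exists_hom {V : Y.Opens} {ρ : R →+* Γ(Y, V)} (hρ : IsChart V ρ)
    (θ : R →+* Γ(X, ⊤)) : ∃ (f : X ⟶ Y) (h : ⊤ ≤ f ⁻¹ᵁ V), ∀ a, pullF f h (ρ a) = θ a := by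
  obtain ⟨f, h, hf⟩ := exists_hom_of_isAffineOpen hρ.1
    (θ.comp (RingEquiv.ofBijective ρ hρ.2).symm.toRingHom)
  refine ⟨f, h, fun a ↦ ?_⟩
  rw [hf]
  exact congrArg θ ((RingEquiv.ofBijective ρ hρ.2).symm_apply_apply a)

/-- The functions on the spectrum of a ring. -/
def specF (R : Type) [CommRing R] : R →+* Γ(Spec (.of R), ⊤) := (Scheme.ΓSpecIso (.of R)).inv.hom

lemma specF_bijective (R : Type) [CommRing R] : Function.Bijective (specF R) :=
  ConcreteCategory.bijective_of_isIso (Scheme.ΓSpecIso (.of R)).inv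

lemma isChart_spec (R : Type) [CommRing R] : IsChart ⊤ (specF R) :=
  ⟨isAffineOpen_top _, specF_bijective R⟩

lemma top_le_ι_preimage (V : X.Opens) : ⊤ ≤ V.ι ⁻¹ᵁ V := by simp

lemma pullF_ι_bijective (V : X.Opens) :
    Function.Bijective (pullF V.ι (top_le_ι_preimage V)) := by
  have : IsIso (V.ι.appLE V ⊤ (top_le_ι_preimage V)) := by
    rw [Scheme.Opens.ι_appLE]
    exact inferInstanceAs (IsIso V.topIso.inv)
  exact ConcreteCategory.bijective_of_isIso (V.ι.appLE V ⊤ (top_le_ι_preimage V))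

/-- Recognition of charts by their universal property. -/
theorem isChart_of_section {V : X.Opens} {ρ : R →+* Γ(X, V)} (k : Spec (.of R) ⟶ X)
    (hk : ⊤ ≤ k ⁻¹ᵁ V) (hk' : ∀ r, pullF k hk (ρ r) = specF R r)
    (huniq : ∀ (f : V.toScheme ⟶ X) (hf : ⊤ ≤ f ⁻¹ᵁ V),
      (∀ r, pullF f hf (ρ r) = pullF V.ι (top_le_ι_preimage V) (ρ r)) → f = V.ι) :
    IsChart V ρ := by
  obtain ⟨j, hj, hjρ⟩ := (isChart_spec R).exists_hom
    ((pullF V.ι (top_le_ι_preimage V)).comp ρ)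
  -- Both morphisms pull back the functions `ρ r` in the same way, so `huniq` identifies them. Hence
  -- `j` is inverse to the corestriction `k'` of `k` to `V`.
  have hjk : j ≫ k = V.ι := by
    refine huniq _ (hj.trans fun x _ ↦ hk trivial) fun r ↦ ?_
    rw [← pullF_pullF j k hj hk, hk', hjρ]
    rfl
  let k' : Spec (.of R) ⟶ V.toScheme := IsOpenImmersion.lift V.ι k (by
    rintro _ ⟨x, rfl⟩
    simpa using hk (x := x) trivial)
  have hk'ι : k' ≫ V.ι = k := IsOpenImmersion.lift_fac _ _ _
  have hkj : k' ≫ j = 𝟙 _ := by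
    refine (isChart_spec R).hom_ext (top_le_preimage_top _) (top_le_preimage_top _) fun r ↦ ?_
    rw [← pullF_pullF k' j (top_le_preimage_top k') hj, hjρ, RingHom.comp_apply,
      pullF_pullF, pullF_congr hk'ι, hk', pullF_id]
    exact (resF_self _ _).symm
  have hjk' : j ≫ k' = 𝟙 _ := by
    rw [← cancel_mono V.ι, Category.assoc, hk'ι, hjk, Category.id_comp]
  have hiso : IsIso j := ⟨k', hjk', hkj⟩
  have haff : IsAffine V.toScheme := .of_isIso j
  refine ⟨haff, ?_⟩
  have h₁ : Function.Bijective ((pullF V.ι (top_le_ι_preimage V)).comp ρ) := by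
    have : ((pullF V.ι (top_le_ι_preimage V)).comp ρ) = (pullF j hj).comp (specF R) := by
      ext r
      exact (hjρ r).symm
    rw [this]
    have hj' : (pullF j hj : Γ(Spec (.of R), ⊤) → _) = j.appTop :=
      funext fun a ↦ pullF_eq_app j _ a
    refine Function.Bijective.comp (g := pullF j hj) ?_ (specF_bijective R)
    rw [hj']
    have : IsIso j.appTop := inferInstanceAs (IsIso (j.app ⊤))
    exact ConcreteCategory.bijective_of_isIso j.appTop
  exact (Function.Bijective.of_comp_iff' (pullF_ι_bijective V) ρ).1 h₁

end Charts

/-! ### Constants and affine spaces as charts -/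

section Constants

variable {X Y : Scheme.{0}}

lemma le_preimage_top (f : X ⟶ Y) (V : X.Opens) : V ≤ f ⁻¹ᵁ ⊤ := le_top

/-- The constant functions on a scheme over `ℂ`. -/
def cst (s : X ⟶ Spec (.of ℂ)) (V : X.Opens) : ℂ →+* Γ(X, V) :=
  (pullF s (le_preimage_top s V)).comp (specF ℂ)

@[simp] lemma resF_cst (s : X ⟶ Spec (.of ℂ)) {V W : X.Opens} (h : W ≤ V) (c : ℂ) :
    resF h (cst s V c) = cst s W c := by
  rw [cst, cst, RingHom.comp_apply, RingHom.comp_apply, resF_pullF]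

@[simp] lemma pullF_cst (f : X ⟶ Y) (s : Y ⟶ Spec (.of ℂ)) {V : Y.Opens} {W : X.Opens}
    (h : W ≤ f ⁻¹ᵁ V) (c : ℂ) : pullF f h (cst s V c) = cst (f ≫ s) W c := by
  rw [cst, cst, RingHom.comp_apply, RingHom.comp_apply, pullF_pullF]

lemma eq_of_cst {s s' : X ⟶ Spec (.of ℂ)} (h : ∀ c, cst s ⊤ c = cst s' ⊤ c) : s = s' :=
  (isChart_spec ℂ).hom_ext (top_le_preimage_top s) (top_le_preimage_top s') h

lemma pullF_specMap {R R' : Type} [CommRing R] [CommRing R'] (f : R →+* R') (a : R) :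
    pullF (Spec.map (CommRingCat.ofHom f)) (top_le_preimage_top _) (specF R a) =
      specF R' (f a) := by
  refine (pullF_eq_app _ _ _).trans ?_
  exact congr($(Scheme.ΓSpecIso_inv_naturality (CommRingCat.ofHom f)).hom a).symm

variable {σ : Type}

/-- The open subset `V` of the scheme `X` over `ℂ` is an affine space with coordinates `a`. -/
def IsAffineSpace (s : X ⟶ Spec (.of ℂ)) (V : X.Opens) (a : σ → Γ(X, V)) : Prop :=
  IsChart V (MvPolynomial.eval₂Hom (cst s V) a)

variable {s : Y ⟶ Spec (.of ℂ)} {V : Y.Opens} {a : σ → Γ(Y, V)}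

lemma ringHom_eval₂_ext {A B : Type*} [CommRing A] [CommRing B] {c : ℂ →+* A} {x : σ → A}
    {f g : A →+* B} (h : ∀ z, f (c z) = g (c z)) (h' : ∀ i, f (x i) = g (x i))
    (p : MvPolynomial σ ℂ) : f (MvPolynomial.eval₂Hom c x p) = g (MvPolynomial.eval₂Hom c x p) := by
  have : f.comp (MvPolynomial.eval₂Hom c x) = g.comp (MvPolynomial.eval₂Hom c x) := by
    apply MvPolynomial.ringHom_ext <;> simp [h, h']
  exact congr($this p)

lemma IsAffineSpace.hom_ext (ha : IsAffineSpace s V a) {f g : X ⟶ Y}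
    (hf : ⊤ ≤ f ⁻¹ᵁ V) (hg : ⊤ ≤ g ⁻¹ᵁ V) (hs : f ≫ s = g ≫ s)
    (h : ∀ i, pullF f hf (a i) = pullF g hg (a i)) : f = g := by
  refine IsChart.hom_ext ha hf hg (ringHom_eval₂_ext ?_ h)
  simp [hs]

lemma IsAffineSpace.exists_hom (ha : IsAffineSpace s V a) (s' : X ⟶ Spec (.of ℂ))
    (x : σ → Γ(X, ⊤)) :
    ∃ (f : X ⟶ Y) (hf : ⊤ ≤ f ⁻¹ᵁ V), f ≫ s = s' ∧ ∀ i, pullF f hf (a i) = x i := by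
  obtain ⟨f, hf, h⟩ := IsChart.exists_hom ha (MvPolynomial.eval₂Hom (cst s' ⊤) x)
  refine ⟨f, hf, eq_of_cst fun c ↦ ?_, fun i ↦ ?_⟩
  · simpa using h (MvPolynomial.C c)
  · simpa using h (MvPolynomial.X i)

/-- The structure morphism of the affine space. -/
def specC (σ : Type) : Spec (.of (MvPolynomial σ ℂ)) ⟶ Spec (.of ℂ) :=
  Spec.map (CommRingCat.ofHom MvPolynomial.C)

lemma cst_specC (c : ℂ) : cst (specC σ) ⊤ c = specF _ (MvPolynomial.C c) :=
  pullF_specMap MvPolynomial.C c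

/-- A morphism out of a polynomial ring is determined by constants and coordinates. In the
applications `Y` is a product, a blow-up or a fibre, whose universal property supplies both the
tautological point `k` and the uniqueness. -/
theorem isAffineSpace_of_section (k : Spec (.of (MvPolynomial σ ℂ)) ⟶ Y) (hk : ⊤ ≤ k ⁻¹ᵁ V)
    (hks : k ≫ s = specC σ) (hka : ∀ i, pullF k hk (a i) = specF _ (MvPolynomial.X i))
    (huniq : ∀ (f : V.toScheme ⟶ Y) (hf : ⊤ ≤ f ⁻¹ᵁ V), f ≫ s = V.ι ≫ s →
      (∀ i, pullF f hf (a i) = pullF V.ι (top_le_ι_preimage V) (a i)) → f = V.ι) :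
    IsAffineSpace s V a := by
  refine isChart_of_section k hk (fun p ↦ ?_) fun f hf h ↦ huniq f hf (eq_of_cst fun c ↦ ?_)
    fun i ↦ ?_
  · have : (pullF k hk).comp (MvPolynomial.eval₂Hom (cst s V) a) = specF _ := by
      refine MvPolynomial.ringHom_ext (fun c ↦ ?_) (fun i ↦ ?_)
      · simp [hks, cst_specC]
      · simp [hka]
    exact congr($this p)
  · simpa using h (MvPolynomial.C c)
  · simpa using h (MvPolynomial.X i)

end Constants

/-! ### The charts of the projective line -/

namespace P1

lemma eval₂_mul_of_isHomogeneous {σ A B : Type*} [CommSemiring A] [CommSemiring B]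
    {p : MvPolynomial σ A} {n : ℕ} (hp : p.IsHomogeneous n) (f : A →+* B) (u : B) (v : σ → B) :
    p.eval₂ f (fun i ↦ u * v i) = u ^ n * p.eval₂ f v := by
  rw [MvPolynomial.eval₂_eq, MvPolynomial.eval₂_eq, Finset.mul_sum]
  refine Finset.sum_congr rfl fun d hd ↦ ?_
  simp only [mul_pow, Finset.prod_mul_distrib, Finset.prod_pow_eq_pow_sum]
  have : ∑ i ∈ d.support, d i = n := by
    have := hp (MvPolynomial.mem_support_iff.1 hd)
    rw [Finsupp.weight_apply, Finsupp.sum] at this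
    simpa using this
  rw [this]
  ring

open HomogeneousLocalization in
/-- The fraction `Xⱼ / Xᵢ`. -/
def frac (i j : Fin 2) : Away grading (MvPolynomial.X i) :=
  Away.mk grading (f := MvPolynomial.X i) (d := 1) (MvPolynomial.isHomogeneous_X ℂ i) 1
      (MvPolynomial.X j) (by simpa using MvPolynomial.isHomogeneous_X ℂ j)

lemma X_mem (i : Fin 2) : MvPolynomial.X i ∈ grading 1 := MvPolynomial.isHomogeneous_X ℂ i

lemma coord_eq (i j : Fin 2) :
    coord i j = Proj.awayToSection grading (MvPolynomial.X i) (frac i j) := rfl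

open HomogeneousLocalization in
/-- The constants in the ring of fractions. -/
def fracC (i : Fin 2) : ℂ →+* Away grading (MvPolynomial.X i) :=
  (fromZeroRingHom grading _).comp (algebraMap ℂ (grading 0))

open HomogeneousLocalization in
-- Dehomogenization, sending `X i` to 1, provides a left inverse. Surjectivity holds because a
-- fraction `a / X i ^ n` with `a` homogeneous of degree `n` is the dehomogenized `a` evaluated at
-- `X j / X i`.
lemma fracHom_bijective {i j : Fin 2} (hij : i ≠ j) :
    Function.Bijective (MvPolynomial.eval₂Hom (fracC i) (fun _ : Fin 1 ↦ frac i j)) := by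
  let valH : Away grading (MvPolynomial.X i) →+* Localization.Away (MvPolynomial.X (R := ℂ) i) :=
    algebraMap _ _
  have hvalC (c : ℂ) : valH (fracC i c) = algebraMap _ _ (MvPolynomial.C (σ := Fin 2) c) := by
    change (fromZeroRingHom grading _ _).val = _
    simp [fromZeroRingHom]
    rfl
  have hvalX (k : Fin 2) : algebraMap (MvPolynomial (Fin 2) ℂ)
      (Localization.Away (MvPolynomial.X (R := ℂ) i)) (MvPolynomial.X k) =
        algebraMap (MvPolynomial (Fin 2) ℂ) _ (MvPolynomial.X i) * valH (frac i k) := by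
    change _ = _ * (Away.mk grading (X_mem i) 1 (MvPolynomial.X k) _).val
    rw [Away.val_mk, ← Localization.mk_one_eq_algebraMap, ← Localization.mk_one_eq_algebraMap,
      Localization.mk_mul, Localization.mk_eq_mk_iff, Localization.r_iff_exists]
    exact ⟨1, by simp⟩
  have hval : Function.Injective valH := HomogeneousLocalization.val_injective _
  constructor
  · let g : Fin 2 → MvPolynomial (Fin 1) ℂ := fun k ↦ if k = i then 1 else MvPolynomial.X 0
    let β : Localization.Away (MvPolynomial.X (R := ℂ) i) →+* MvPolynomial (Fin 1) ℂ :=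
      IsLocalization.Away.lift (MvPolynomial.X i) (g := MvPolynomial.eval₂Hom MvPolynomial.C g)
        (by simp [g])
    have hβ (p) : β (algebraMap _ _ p) = MvPolynomial.eval₂Hom MvPolynomial.C g p :=
      IsLocalization.Away.lift_eq _ _ _
    have hβX : β (valH (frac i j)) = MvPolynomial.X 0 := by
      have := congrArg β (hvalX j)
      rw [map_mul, hβ, hβ] at this
      simpa [g, hij.symm] using this.symm
    have : (β.comp valH).comp (MvPolynomial.eval₂Hom (fracC i) (fun _ : Fin 1 ↦ frac i j)) =
        RingHom.id _ := by
      refine MvPolynomial.ringHom_ext (fun c ↦ ?_) (fun k ↦ ?_)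
      · simp [hvalC, hβ]
      · simp [hβX, Subsingleton.elim k 0]
    exact Function.LeftInverse.injective (g := β.comp valH) fun p ↦ congr($this p)
  · intro z
    obtain ⟨n, a, ha, rfl⟩ := Away.mk_surjective (f := MvPolynomial.X i) grading (d := 1)
      (X_mem i) z
    let g : Fin 2 → MvPolynomial (Fin 1) ℂ := fun k ↦ if k = i then 1 else MvPolynomial.X 0
    refine ⟨MvPolynomial.eval₂Hom MvPolynomial.C g a, hval ?_⟩
    have hg (k : Fin 2) : valH (MvPolynomial.eval₂Hom (fracC i) (fun _ : Fin 1 ↦ frac i j) (g k)) =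
        valH (frac i k) := by
      by_cases hk : k = i
      · subst hk
        simp only [g, if_true, map_one]
        change 1 = (Away.mk grading (X_mem k) 1 (MvPolynomial.X k) _).val
        rw [Away.val_mk, eq_comm, ← Localization.mk_one, Localization.mk_eq_mk_iff,
          Localization.r_iff_exists]
        exact ⟨1, by simp⟩
      · have : k = j := by omega
        simp [g, hk, this]
        rw [if_neg (by omega)]
        simp
    have h₁ : valH (MvPolynomial.eval₂Hom (fracC i) (fun _ : Fin 1 ↦ frac i j)
        (MvPolynomial.eval₂Hom MvPolynomial.C g a)) =
        a.eval₂ (valH.comp (fracC i)) (fun k ↦ valH (frac i k)) := by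
      have : (valH.comp (MvPolynomial.eval₂Hom (fracC i) (fun _ : Fin 1 ↦ frac i j))).comp
          (MvPolynomial.eval₂Hom MvPolynomial.C g) =
          MvPolynomial.eval₂Hom (valH.comp (fracC i)) (fun k ↦ valH (frac i k)) := by
        refine MvPolynomial.ringHom_ext (fun c ↦ ?_) (fun k ↦ ?_)
        · simp
        · rw [RingHom.comp_apply, RingHom.comp_apply, MvPolynomial.eval₂Hom_X',
            MvPolynomial.eval₂Hom_X']
          exact hg k
      exact congr($this a)
    have h₂ : algebraMap (MvPolynomial (Fin 2) ℂ) (Localization.Away (MvPolynomial.X (R := ℂ) i)) a =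
        a.eval₂ (valH.comp (fracC i)) (fun k ↦ algebraMap (MvPolynomial (Fin 2) ℂ) _
        (MvPolynomial.X i) * valH (frac i k)) := by
      have : algebraMap (MvPolynomial (Fin 2) ℂ) (Localization.Away (MvPolynomial.X (R := ℂ) i)) =
          MvPolynomial.eval₂Hom (valH.comp (fracC i)) (fun k ↦
            algebraMap (MvPolynomial (Fin 2) ℂ) _ (MvPolynomial.X i) * valH (frac i k)) := by
        refine MvPolynomial.ringHom_ext (fun c ↦ ?_) (fun k ↦ ?_)
        · simp [hvalC]
        · simpa using hvalX k
      exact congr($this a)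
    rw [eval₂_mul_of_isHomogeneous (n := n) (by simpa using ha)] at h₂
    rw [h₁]
    change _ = (Away.mk grading (X_mem i) n a _).val
    rw [Away.val_mk, Localization.mk_eq_mk', eq_comm, IsLocalization.mk'_eq_iff_eq_mul, h₂]
    simp [mul_comm]

lemma pullF_ι_awayToSection (i : Fin 2) (z) :
    pullF (chart i).ι (top_le_ι_preimage _) (Proj.awayToSection grading (MvPolynomial.X i) z) =
      pullF (Proj.basicOpenToSpec grading (MvPolynomial.X i)) (top_le_preimage_top _)
        (specF _ z) := by
  refine Eq.trans ?_ (pullF_eq_app (V := ⊤)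
    (Proj.basicOpenToSpec grading (MvPolynomial.X (R := ℂ) i)) le_rfl _).symm
  have := congr($(Proj.basicOpenToSpec_app_top grading (MvPolynomial.X (R := ℂ) i)) (specF _ z))
  refine Eq.trans ?_ this.symm
  have h : (Scheme.ΓSpecIso _).hom (specF _ z) = z := by simp [specF]
  simp only [CommRingCat.comp_apply]
  rw [h]
  rfl

lemma cst_chart (i : Fin 2) (c : ℂ) : cst toSpecC (chart i) c =
    Proj.awayToSection grading (MvPolynomial.X i) (fracC i c) := by
  apply (pullF_ι_bijective _).1
  rw [pullF_ι_awayToSection, pullF_cst]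
  have h₁ : (chart i).ι ≫ toSpecC = Proj.basicOpenToSpec grading (MvPolynomial.X i) ≫
      Spec.map (CommRingCat.ofHom (fracC i)) := by
    have h₀ : (chart i).ι = Proj.basicOpenToSpec grading (MvPolynomial.X i) ≫
        Proj.awayι grading _ (X_mem i) one_pos :=
      (Iso.hom_inv_id_assoc (Proj.basicOpenIsoSpec grading _ (X_mem i) one_pos) _).symm
    rw [toSpecC, h₀, Category.assoc, Proj.awayι_toSpecZero_assoc, ← Spec.map_comp]
    rfl
  have h₂ := pullF_specMap (fracC i) c
  rw [← h₂, pullF_pullF]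
  exact congr(cst $h₁ ⊤ c)

/-- The standard charts of the projective line are affine lines. -/
theorem isAffineSpace_chart {i j : Fin 2} (hij : i ≠ j) :
    IsAffineSpace toSpecC (chart i) (fun _ : Fin 1 ↦ coord i j) := by
  refine ⟨Proj.isAffineOpen_basicOpen grading _ (MvPolynomial.isHomogeneous_X ℂ i) one_pos, ?_⟩
  have h : MvPolynomial.eval₂Hom (cst toSpecC (chart i)) (fun _ : Fin 1 ↦ coord i j) =
      (Proj.awayToSection grading (MvPolynomial.X i)).hom.comp
        (MvPolynomial.eval₂Hom (fracC i) (fun _ : Fin 1 ↦ frac i j)) := by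
    refine MvPolynomial.ringHom_ext (fun c ↦ ?_) (fun k ↦ ?_)
    · simp [cst_chart]
    · simp [coord_eq]
  rw [h]
  have := Proj.basicOpenIsoAway_hom grading (f := MvPolynomial.X i)
    (MvPolynomial.isHomogeneous_X ℂ i) one_pos
  refine Function.Bijective.comp (g := (Proj.awayToSection grading (MvPolynomial.X i)).hom) ?_
    (fracHom_bijective hij)
  rw [← this]
  exact ConcreteCategory.bijective_of_isIso (Proj.basicOpenIsoAway grading _ _ _).hom

end P1

/-! ### Inverse images of ideal sheaves, regular functions -/

section Ideals

open Scheme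

variable {X Y : Scheme.{0}}

/-- Both inclusions come from the Galois connection between inverse and direct images of ideal
sheaves, tested on global sections. -/
lemma ideal_comap_of_isAffine [IsAffine X] [IsAffine Y] (J : Y.IdealSheafData) (g : X ⟶ Y) :
    (J.comap g).ideal ⟨⊤, isAffineOpen_top X⟩ =
      (J.ideal ⟨⊤, isAffineOpen_top Y⟩).map (pullF g (top_le_preimage_top g)) := by
  have hg : pullF g (top_le_preimage_top g) = (g.app ⊤).hom :=
    RingHom.ext fun a ↦ pullF_eq_app g _ a
  rw [hg]
  refine le_antisymm ?_ ?_
  · have h : J.comap g ≤ IdealSheafData.ofIdealTop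
        ((J.ideal ⟨⊤, isAffineOpen_top Y⟩).map (g.app ⊤).hom) := by
      rw [← IdealSheafData.le_map_iff_comap_le]
      refine IdealSheafData.le_of_isAffine ?_
      rw [IdealSheafData.ideal_map _ g ⟨⊤, isAffineOpen_top Y⟩ (isAffineOpen_top X)]
      rw [← Ideal.map_le_iff_le_comap]
      exact (IdealSheafData.equivOfIsAffine.apply_symm_apply _).ge
    exact (h _).trans (IdealSheafData.equivOfIsAffine.apply_symm_apply _).le
  · refine Ideal.map_le_iff_le_comap.2 ?_
    have h := (IdealSheafData.le_map_comap J g) ⟨⊤, isAffineOpen_top Y⟩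
    rwa [IdealSheafData.ideal_map _ g ⟨⊤, isAffineOpen_top Y⟩ (isAffineOpen_top X)] at h

lemma ideal_comap_ι (J : X.IdealSheafData) (U : X.affineOpens) (hU : IsAffineOpen (X := U.1) ⊤) :
    (J.comap U.1.ι).ideal ⟨⊤, hU⟩ = (J.ideal U).map (pullF U.1.ι (top_le_ι_preimage U.1)) := by
  rw [IdealSheafData.ideal_comap_of_isOpenImmersion]
  have hle : (⟨U.1.ι ''ᵁ ⊤, hU.image_of_isOpenImmersion U.1.ι⟩ : X.affineOpens) ≤ U := by
    change U.1.ι ''ᵁ ⊤ ≤ U.1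
    simp
  rw [← IdealSheafData.map_ideal J hle]
  have h := Ideal.map_symm (I := (J.ideal U).map (X.presheaf.map (homOfLE hle).op).hom)
    (U.1.ι.appIso ⊤).symm.commRingCatIsoToRingEquiv
  refine h.symm.trans ?_
  rw [← Ideal.map_coe, Ideal.map_map]
  congr 1
  ext a
  change (U.1.ι.appIso ⊤).hom (resF hle a) = _
  rw [Scheme.Hom.appIso_hom']
  exact pullF_resF _ _ _ _

/-- The inverse image ideal sheaf on affine open subsets. -/
lemma ideal_comap (I : Y.IdealSheafData) (f : X ⟶ Y) (U : X.affineOpens) (V : Y.affineOpens)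
    (h : U.1 ≤ f ⁻¹ᵁ V.1) : (I.comap f).ideal U = (I.ideal V).map (pullF f h) := by
  have : IsAffine U.1 := U.2
  have : IsAffine V.1 := V.2
  obtain ⟨g, hg⟩ : ∃ g : U.1.toScheme ⟶ V.1.toScheme, g ≫ V.1.ι = U.1.ι ≫ f :=
    ⟨f.resLE V.1 U.1 h, Scheme.Hom.resLE_comp_ι _ _⟩
  have h₁ := ideal_comap_ι (I.comap f) U (isAffineOpen_top _)
  rw [← IdealSheafData.comap_comp, ← hg, IdealSheafData.comap_comp, ideal_comap_of_isAffine,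
    ideal_comap_ι, Ideal.map_map] at h₁
  have h₂ : (pullF g (top_le_preimage_top g)).comp (pullF V.1.ι (top_le_ι_preimage V.1)) =
      (pullF U.1.ι (top_le_ι_preimage U.1)).comp (pullF f h) := by
    ext a
    rw [RingHom.comp_apply, RingHom.comp_apply, pullF_pullF, pullF_pullF, pullF_congr hg]
  rw [h₂, ← Ideal.map_map] at h₁
  have h₃ := congrArg (Ideal.comap (pullF U.1.ι (top_le_ι_preimage U.1))) h₁
  rw [Ideal.comap_map_of_bijective _ (pullF_ι_bijective U.1),
    Ideal.comap_map_of_bijective _ (pullF_ι_bijective U.1)] at h₃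
  exact h₃.symm

/-- The function `a` is regular: its restriction to any open subset is a nonzerodivisor. -/
def IsReg {V : X.Opens} (a : Γ(X, V)) : Prop :=
  ∀ (W : X.Opens) (h : W ≤ V) (z : Γ(X, W)), resF h a * z = 0 → z = 0

lemma IsReg.res {V W : X.Opens} {a : Γ(X, V)} (ha : IsReg a) (h : W ≤ V) : IsReg (resF h a) :=
  fun W' h' z hz ↦ ha W' (h'.trans h) z (by simpa using hz)

lemma IsReg.mul_left_cancel {V : X.Opens} {a b c : Γ(X, V)} (ha : IsReg a) (h : a * b = a * c) :
    b = c := by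
  refine sub_eq_zero.1 (ha V le_rfl _ ?_)
  rw [resF_self, mul_sub, h, sub_self]

lemma IsReg.of_isUnit {V : X.Opens} {a : Γ(X, V)} (ha : IsUnit a) : IsReg a :=
  fun W h z hz ↦ ((ha.map (resF h)).mul_right_eq_zero).1 hz

lemma IsReg.mul {V : X.Opens} {a b : Γ(X, V)} (ha : IsReg a) (hb : IsReg b) : IsReg (a * b) :=
  fun W h z hz ↦ hb W h z (ha W h _ (by rw [← hz, map_mul, mul_assoc]))

lemma isReg_of_cover {ι : Type} {V : X.Opens} (U : ι → X.Opens) (hU : ∀ i, U i ≤ V)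
    (hV : V ≤ ⨆ i, U i) {a : Γ(X, V)} (h : ∀ i, IsReg (resF (hU i) a)) : IsReg a := by
  intro W hW z hz
  refine function_ext (fun i ↦ W ⊓ U i) (fun i ↦ inf_le_left) (fun x hx ↦ ?_) fun i ↦ ?_
  · obtain ⟨i, hi⟩ := TopologicalSpace.Opens.mem_iSup.1 (hV (hW hx))
    exact TopologicalSpace.Opens.mem_iSup.2 ⟨i, hx, hi⟩
  · rw [map_zero]
    refine h i _ inf_le_right _ ?_
    have := congrArg (resF (inf_le_left : W ⊓ U i ≤ W)) hz
    simpa using this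

/-- Localization preserves nonzerodivisors, and every open subset of an affine one is covered by
basic open subsets. -/
lemma isReg_of_mem_nonZeroDivisors {U : X.affineOpens} {a : Γ(X, U.1)}
    (ha : a ∈ nonZeroDivisors Γ(X, U.1)) : IsReg a := by
  intro W hW z hz
  choose f hf hxf using fun x : W ↦ U.2.exists_basicOpen_le x (hW x.2)
  refine function_ext (fun x : W ↦ X.basicOpen (f x)) hf (fun x hx ↦
    TopologicalSpace.Opens.mem_iSup.2 ⟨⟨x, hx⟩, hxf _⟩) fun x ↦ ?_
  rw [map_zero]
  have hloc := U.2.isLocalization_basicOpen (f x)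
  have hle := X.basicOpen_le (f x)
  have hreg : resF hle a ∈ nonZeroDivisors Γ(X, X.basicOpen (f x)) := by
    have := IsLocalization.map_nonZeroDivisors_le (Submonoid.powers (f x)) Γ(X, X.basicOpen (f x))
      (Submonoid.mem_map_of_mem (algebraMap Γ(X, U.1) Γ(X, X.basicOpen (f x))) ha)
    exact this
  refine (mem_nonZeroDivisors_iff.1 hreg).1 _ ?_
  have := congrArg (resF (hf x)) hz
  rw [map_mul, map_zero, resF_resF] at this
  exact this

lemma isReg_of_isIntegral [IsIntegral X] {V : X.Opens} {a : Γ(X, V)}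
    (ha : ∀ (W : X.Opens) (h : W ≤ V), (W : Set X).Nonempty → resF h a ≠ 0) : IsReg a := by
  intro W hW z hz
  by_cases hne : (W : Set X).Nonempty
  · have : Nonempty W := hne.to_subtype
    exact (mul_eq_zero.1 hz).resolve_left (ha W hW hne)
  · refine function_ext (fun i : Empty ↦ i.elim) (fun i ↦ i.elim) (fun x hx ↦ ?_) fun i ↦ i.elim
    exact absurd ⟨x, hx⟩ hne

lemma IsReg.of_nonzero [IsIntegral X] {V : X.Opens} {a : Γ(X, V)} (ha : a ≠ 0) : IsReg a := by
  refine isReg_of_isIntegral fun W hW hne h ↦ ha ?_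
  have : Nonempty W := hne.to_subtype
  exact map_injective_of_isIntegral X (homOfLE hW) (h.trans (map_zero (resF hW)).symm)

lemma IsReg.ι {V : X.Opens} {a : Γ(X, V)} (ha : IsReg a) :
    IsReg (pullF V.ι (top_le_ι_preimage V) a) := by
  intro W hW z hz
  refine ha (V.ι ''ᵁ W) (by rintro _ ⟨y, -, rfl⟩; exact y.2) (z : Γ(X, V.ι ''ᵁ W)) (Eq.trans ?_ hz)
  congr 1
  rw [resF_pullF]
  simp only [pullF, resF, Scheme.Hom.appLE, Scheme.Opens.ι_app, Scheme.Opens.toScheme_presheaf_map]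
  refine congrArg (fun f : Γ(X, V) ⟶ Γ(X, V.ι ''ᵁ W) ↦ f.hom a) (Eq.trans ?_
    (X.presheaf.map_comp _ _))
  rfl

lemma isUnit_resF_basicOpen {V : X.Opens} (a : Γ(X, V)) : IsUnit (resF (X.basicOpen_le a) a) :=
  RingedSpace.isUnit_res_basicOpen X.toRingedSpace a

end Ideals

/-! ### Charts of blow-ups -/

section BlowUp

variable {S Y : Scheme.{0}} {φ : S ⟶ Y} {I : Y.IdealSheafData} {sY : Y ⟶ Spec (.of ℂ)}

lemma isEffectiveCartier_top {X : Scheme.{0}} : IsEffectiveCartier (⊤ : X.IdealSheafData) := by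
  intro x
  obtain ⟨U, hU, hx, -⟩ := exists_isAffineOpen_mem_and_subset (X := X) (x := x) (U := ⊤) trivial
  exact ⟨⟨U, hU⟩, hx, 1, one_mem _, by simp⟩

lemma isEffectiveCartier_of_isReg {T : Scheme.{0}} {V : Y.affineOpens} {a b : Γ(Y, V.1)}
    (hI : I.ideal V = Ideal.span {a, b}) (f : T ⟶ Y) (hf : ⊤ ≤ f ⁻¹ᵁ V.1) (e : Γ(T, ⊤))
    (he : pullF f hf a = pullF f hf b * e) (hreg : IsReg (pullF f hf b)) :
    IsEffectiveCartier (I.comap f) := by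
  intro x
  obtain ⟨U, hU, hx, -⟩ := exists_isAffineOpen_mem_and_subset (X := T) (x := x) (U := ⊤) trivial
  refine ⟨⟨U, hU⟩, hx, resF le_top (pullF f hf b), ?_, ?_⟩
  · rw [mem_nonZeroDivisors_iff_right]
    exact fun z hz ↦ hreg U le_top z (by rwa [mul_comm])
  · rw [ideal_comap I f ⟨U, hU⟩ V (le_top.trans hf), hI, Ideal.map_span, Set.image_pair]
    have h (z) : pullF f (le_top.trans hf : U ≤ f ⁻¹ᵁ V.1) z = resF le_top (pullF f hf z) := by
      rw [resF_pullF]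
    rw [h, h, he, map_mul]
    refine le_antisymm (Ideal.span_le.2 ?_) (Ideal.span_mono (by simp))
    rintro z (rfl | rfl)
    · exact Ideal.mul_mem_right _ _ (Ideal.subset_span rfl)
    · exact Ideal.subset_span rfl

/-- On `N` the function `b` generates the inverse image ideal of `(a, b)`. -/
def Generates (φ : S ⟶ Y) {V : Y.Opens} (a b : Γ(Y, V)) (N : S.Opens) : Prop :=
  ∃ (h : N ≤ φ ⁻¹ᵁ V) (e : Γ(S, N)), pullF φ h a = pullF φ h b * e ∧ IsReg (pullF φ h b)

/-- Near `x` the ideal has a single regular generator `τ`. Writing `a = cτ`, `b = dτ` and `τ = αa +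
βb` gives `αc + βd = 1` after cancelling `τ`, so `c` or `d` is a unit at `x`, and correspondingly
`a` or `b` is a generator. -/
lemma IsBlowUp.exists_generates (hφ : IsBlowUp φ I) {V : Y.affineOpens} {a b : Γ(Y, V.1)}
    (hI : I.ideal V = Ideal.span {a, b}) {x : S} (hx : φ x ∈ V.1) :
    ∃ N, x ∈ N ∧ (Generates φ a b N ∨ Generates φ b a N) := by
  obtain ⟨U, hxU, τ, hτ, hUτ⟩ := hφ.1 x
  obtain ⟨W, hW, hxW, hWU⟩ := exists_isAffineOpen_mem_and_subset (X := S) (x := x)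
    (U := U.1 ⊓ φ ⁻¹ᵁ V.1) ⟨hxU, hx⟩
  have hWU₁ : W ≤ U.1 := fun y hy ↦ (hWU hy).1
  have hWV : W ≤ φ ⁻¹ᵁ V.1 := fun y hy ↦ (hWU hy).2
  have hreg : IsReg (resF hWU₁ τ) := (isReg_of_mem_nonZeroDivisors hτ).res hWU₁
  have hspan : Ideal.span {resF hWU₁ τ} = Ideal.span {pullF φ hWV a, pullF φ hWV b} := by
    have h₁ := ideal_comap I φ ⟨W, hW⟩ V hWV
    have h₂ := Scheme.IdealSheafData.map_ideal (I.comap φ) (U := ⟨W, hW⟩) (V := U) hWU₁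
    rw [hUτ, Ideal.map_span, Set.image_singleton] at h₂
    rw [hI, Ideal.map_span, Set.image_pair, ← h₂] at h₁
    exact h₁
  have ha : pullF φ hWV a ∈ Ideal.span {resF hWU₁ τ} := hspan ▸ Ideal.subset_span (by simp)
  have hb : pullF φ hWV b ∈ Ideal.span {resF hWU₁ τ} := hspan ▸ Ideal.subset_span (by simp)
  have hτ' : resF hWU₁ τ ∈ Ideal.span {pullF φ hWV a, pullF φ hWV b} :=
    hspan ▸ Ideal.subset_span rfl
  obtain ⟨c, hc⟩ := Ideal.mem_span_singleton'.1 ha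
  obtain ⟨d, hd⟩ := Ideal.mem_span_singleton'.1 hb
  obtain ⟨α, β, hαβ⟩ := Ideal.mem_span_pair.1 hτ'
  have h1 : α * c + β * d = 1 := by
    refine hreg.mul_left_cancel ?_
    conv_rhs => rw [mul_one, ← hαβ, ← hc, ← hd]
    ring
  have key (a b : Γ(Y, V.1)) (c d : Γ(S, W)) (hc : c * resF hWU₁ τ = pullF φ hWV a)
      (hd : d * resF hWU₁ τ = pullF φ hWV b) (hxd : x ∈ S.basicOpen d) :
      ∃ N, x ∈ N ∧ Generates φ a b N := by
    have hle := S.basicOpen_le d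
    obtain ⟨d', hd'⟩ := (isUnit_resF_basicOpen d).exists_right_inv
    have hcd (z : Γ(Y, V.1)) : pullF φ (hle.trans hWV) z = resF hle (pullF φ hWV z) := by
      rw [resF_pullF]
    refine ⟨S.basicOpen d, hxd, hle.trans hWV, resF hle c * d', ?_, ?_⟩
    · rw [hcd, hcd, ← hc, ← hd, map_mul, map_mul]
      linear_combination (-resF hle c * resF hle (resF hWU₁ τ)) * hd'
    · rw [hcd, ← hd, map_mul]
      exact (IsReg.of_isUnit (isUnit_resF_basicOpen d)).mul (hreg.res hle)
  have hx1 : x ∈ S.basicOpen (α * c + β * d) := by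
    rw [h1, S.basicOpen_of_isUnit isUnit_one]
    exact hxW
  rcases S.basicOpen_add_le _ _ hx1 with h | h
  · rw [S.basicOpen_mul] at h
    obtain ⟨N, hN, hN'⟩ := key b a d c hd hc h.2
    exact ⟨N, hN, .inr hN'⟩
  · rw [S.basicOpen_mul] at h
    obtain ⟨N, hN, hN'⟩ := key a b c d hc hd h.2
    exact ⟨N, hN, .inl hN'⟩

/-- Since `b` is regular, the quotient `e` of `a` by `b` is unique where it exists; so local
quotients glue over the union of all such open subsets. -/
lemma exists_greatest_generates (φ : S ⟶ Y) {V : Y.Opens} (a b : Γ(Y, V)) :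
    ∃ N, Generates φ a b N ∧ ∀ N', Generates φ a b N' → N' ≤ N := by
  let ι := {N : S.Opens // Generates φ a b N}
  let U (i : ι) : S.Opens := i.1
  have hU (i : ι) : U i ≤ ⨆ i, U i := le_iSup U i
  choose hUV e he hreg using fun i : ι ↦ i.2
  obtain ⟨x, hx⟩ := function_glue U hU le_rfl e fun i j ↦ by
    refine ((hreg i).res inf_le_left).mul_left_cancel ?_
    rw [← map_mul, ← he]
    have h := congrArg (resF (inf_le_right : U i ⊓ U j ≤ U j)) (he j)
    rw [map_mul] at h
    simpa using h
  have hsup : ⨆ i, U i ≤ φ ⁻¹ᵁ V := iSup_le hUV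
  refine ⟨⨆ i, U i, ⟨hsup, x, ?_, ?_⟩, fun N hN ↦ hU ⟨N, hN⟩⟩
  · refine function_ext U hU le_rfl fun i ↦ ?_
    rw [map_mul, hx]
    simpa using he i
  · refine isReg_of_cover U hU le_rfl fun i ↦ ?_
    simpa using hreg i

/-- A chart of the blow-up of the origin of an affine plane. -/
theorem IsBlowUp.exists_chart (hφ : IsBlowUp φ I) {V : Y.affineOpens} {a b : Γ(Y, V.1)}
    (hI : I.ideal V = Ideal.span {a, b}) (hV : IsAffineSpace sY V.1 ![a, b]) :
    ∃ (W : S.Opens) (h : W ≤ φ ⁻¹ᵁ V.1) (e : Γ(S, W)),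
      IsAffineSpace (φ ≫ sY) W ![pullF φ h b, e] ∧ pullF φ h a = pullF φ h b * e ∧
      (∀ N, Generates φ a b N → N ≤ W) ∧ IsReg (pullF φ h b) := by
  obtain ⟨W, ⟨hWV, e, he, hreg⟩, hmax⟩ := exists_greatest_generates φ a b
  refine ⟨W, hWV, e, ?_, he, hmax, hreg⟩
  let A := Spec (.of (MvPolynomial (Fin 2) ℂ))
  let x₁ : Γ(A, ⊤) := specF _ (MvPolynomial.X 0)
  let x₂ : Γ(A, ⊤) := specF _ (MvPolynomial.X 1)
  -- The expected chart is the plane with its map `(x₁, x₂) ↦ (x₁ x₂, x₁)` to the `(a, b)`-plane.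
  -- The ideal `(a, b)` pulls back to `(x₁)`, so this map lifts to the blow-up.
  obtain ⟨f, hf, hfs, hfa⟩ := hV.exists_hom (specC (Fin 2)) ![x₁ * x₂, x₁]
  have hf₁ : pullF f hf a = x₁ * x₂ := hfa 0
  have hf₂ : pullF f hf b = x₁ := hfa 1
  have hx₁ : IsReg x₁ := by
    refine IsReg.of_nonzero fun h ↦ MvPolynomial.X_ne_zero (R := ℂ) (0 : Fin 2) ?_
    exact (specF_bijective _).1 (h.trans (map_zero _).symm)
  obtain ⟨k, hk, -⟩ := hφ.2 A f
    (isEffectiveCartier_of_isReg hI f hf x₂ (by rw [hf₁, hf₂]) (by rwa [hf₂]))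
  -- If near a point of the lift it is `a` that generates, say `b = a c`, then pulling back gives
  -- `x₁ = x₁ x₂ c`. So `c` is a unit there, `b` generates as well, and maximality of `W` applies.
  have hkW : ⊤ ≤ k ⁻¹ᵁ W := by
    intro p _
    have hp : φ (k p) ∈ V.1 := by
      have : (k ≫ φ) p ∈ V.1 := by
        rw [hk]
        exact hf (x := p) trivial
      simpa using this
    obtain ⟨N, hpN, hN | hN⟩ := hφ.exists_generates hI hp
    · exact hmax N hN hpN
    · obtain ⟨hNV, c, hc, hcreg⟩ := hN
      have hkN : k ⁻¹ᵁ N ≤ (k ≫ φ) ⁻¹ᵁ V.1 := fun y hy ↦ hNV hy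
      have hpull (z : Γ(Y, V.1)) : pullF k (le_refl (k ⁻¹ᵁ N)) (pullF φ hNV z) =
          resF le_top (pullF f hf z) := by
        rw [pullF_pullF, pullF_congr hk, resF_pullF]
      have h := congrArg (pullF k (le_refl (k ⁻¹ᵁ N))) hc
      rw [map_mul, hpull, hpull, hf₁, hf₂, map_mul, mul_assoc] at h
      have h1 : resF le_top x₂ * pullF k (le_refl (k ⁻¹ᵁ N)) c = 1 :=
        (hx₁.res le_top).mul_left_cancel (by rw [← h, mul_one])
      have hpc : k p ∈ S.basicOpen c := by
        have : p ∈ A.basicOpen (pullF k (le_refl (k ⁻¹ᵁ N)) c) := by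
          rw [A.basicOpen_of_isUnit (.of_mul_eq_one_right _ h1)]
          exact hpN
        rw [pullF, Scheme.basicOpen_appLE] at this
        exact this.2
      refine hmax _ ?_ hpc
      have hle := S.basicOpen_le c
      obtain ⟨c', hc'⟩ := (isUnit_resF_basicOpen c).exists_right_inv
      have hcd (z : Γ(Y, V.1)) : pullF φ (hle.trans hNV) z = resF hle (pullF φ hNV z) := by
        rw [resF_pullF]
      refine ⟨hle.trans hNV, c', ?_, ?_⟩
      · rw [hcd, hcd, hc, map_mul]
        linear_combination (-resF hle (pullF φ hNV a)) * hc'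
      · rw [hcd, hc, map_mul]
        exact (hcreg.res hle).mul (IsReg.of_isUnit (isUnit_resF_basicOpen c))
  have hpull (z : Γ(Y, V.1)) : pullF k hkW (pullF φ hWV z) = pullF f hf z := by
    rw [pullF_pullF, pullF_congr hk]
  refine isAffineSpace_of_section k hkW (by rw [← Category.assoc, hk, hfs]) ?_ ?_
  · intro i
    fin_cases i
    · exact (hpull b).trans hf₂
    · refine hx₁.mul_left_cancel ?_
      have := congrArg (pullF k hkW) he
      rw [map_mul, hpull, hpull, hf₁, hf₂] at this
      exact this.symm
  -- Since `a = b e`, a morphism with prescribed `b` and `e` is determined after composition with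
  -- `φ`, and hence by the uniqueness in the universal property of the blow-up.
  · intro g hg hgs hgz
    have hgb : pullF g hg (pullF φ hWV b) = pullF W.ι (top_le_ι_preimage W) (pullF φ hWV b) := hgz 0
    have hge : pullF g hg e = pullF W.ι (top_le_ι_preimage W) e := hgz 1
    have hgφ : g ≫ φ = W.ι ≫ φ := by
      refine hV.hom_ext (hg.trans fun y hy ↦ hWV hy)
        ((top_le_ι_preimage W).trans fun y hy ↦ hWV hy) (by simpa using hgs) fun i ↦ ?_
      fin_cases i
      · have h₁ := congrArg (pullF g hg) he
        have h₂ := congrArg (pullF W.ι (top_le_ι_preimage W)) he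
        rw [map_mul, hgb, hge, ← map_mul, ← he] at h₁
        simpa using h₁
      · simpa using hgb
    refine (hφ.2 _ (W.ι ≫ φ) ?_).unique hgφ rfl
    refine isEffectiveCartier_of_isReg hI _ ((top_le_ι_preimage W).trans fun y hy ↦ hWV hy)
      (pullF W.ι (top_le_ι_preimage W) e) ?_ ?_
    · have := congrArg (pullF W.ι (top_le_ι_preimage W)) he
      rw [map_mul] at this
      simpa using this
    · have := hreg.ι
      simpa using this

/-- The charts of the complement of the exceptional divisor. -/
theorem IsBlowUp.isAffineSpace_preimage (hφ : IsBlowUp φ I) {V : Y.Opens} {σ : Type}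
    {a : σ → Γ(Y, V)} (hV : IsAffineSpace sY V a)
    (hI : ∀ (T : Scheme.{0}) (f : T ⟶ Y), ⊤ ≤ f ⁻¹ᵁ V → I.comap f = ⊤) :
    IsAffineSpace (φ ≫ sY) (φ ⁻¹ᵁ V) (fun i ↦ pullF φ le_rfl (a i)) := by
  obtain ⟨f, hf, hfs, hfa⟩ := hV.exists_hom (specC σ) fun i ↦ specF _ (MvPolynomial.X i)
  obtain ⟨k, hk, -⟩ := hφ.2 _ f (by rw [hI _ f hf]; exact isEffectiveCartier_top)
  have hkV : ⊤ ≤ k ⁻¹ᵁ φ ⁻¹ᵁ V := by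
    have : ⊤ ≤ (k ≫ φ) ⁻¹ᵁ V := by rwa [hk]
    exact this
  refine isAffineSpace_of_section k hkV (by rw [← Category.assoc, hk, hfs])
    (fun i ↦ by rw [pullF_pullF, pullF_congr hk, hfa]) fun g hg hgs hga ↦ ?_
  have hgφ : g ≫ φ = (φ ⁻¹ᵁ V).ι ≫ φ :=
    hV.hom_ext hg (top_le_ι_preimage (φ ⁻¹ᵁ V)) (by simpa using hgs) fun i ↦ by simpa using hga i
  refine (hφ.2 _ _ ?_).unique hgφ rfl
  rw [hI _ ((φ ⁻¹ᵁ V).ι ≫ φ) (top_le_ι_preimage (φ ⁻¹ᵁ V))]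
  exact isEffectiveCartier_top

end BlowUp

/-! ### Quotients of linear forms on the projective line -/

namespace P1

open HomogeneousLocalization

/-- The quotient `L / N` of two linear forms as a function on the open subset `N ≠ 0`. -/
def linFrac {L N : MvPolynomial (Fin 2) ℂ} (hL : L ∈ grading 1) (hN : N ∈ grading 1) :
    Γ(P1, Proj.basicOpen grading N) :=
  Proj.awayToSection grading N (Away.mk grading hN 1 L (by simpa using hL))

variable {L N M : MvPolynomial (Fin 2) ℂ} (hL : L ∈ grading 1) (hN : N ∈ grading 1)
  (hM : M ∈ grading 1)

lemma linFrac_val (p : P1) (hp : p ∈ Proj.basicOpen grading N) :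
    HomogeneousLocalization.val ((linFrac hL hN).val ⟨p, hp⟩) = Localization.mk L ⟨N, hp⟩ := by
  refine (ProjectiveSpectrum.Proj.awayToSection_apply grading N _ ⟨p, hp⟩).trans ?_
  rw [Away.val_mk, Localization.mk_eq_mk', Localization.mk_eq_mk', IsLocalization.map_mk']
  simp

lemma linFrac_mul : resF inf_le_left (linFrac hL hN) * resF inf_le_right (linFrac hN hM) =
    resF (inf_le_right : Proj.basicOpen grading N ⊓ Proj.basicOpen grading M ≤ _)
      (linFrac hL hM) := by
  apply Subtype.ext
  ext ⟨p, hp⟩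
  change HomogeneousLocalization.val (((linFrac hL hN).val ⟨p, hp.1⟩) *
    ((linFrac hN hM).val ⟨p, hp.2⟩)) = HomogeneousLocalization.val ((linFrac hL hM).val ⟨p, hp.2⟩)
  refine (val_mul _ _).trans ((congrArg₂ (· * ·) (linFrac_val hL hN p hp.1)
    (linFrac_val hN hM p hp.2)).trans (Eq.trans ?_ (linFrac_val hL hM p hp.2).symm))
  dsimp only
  rw [Localization.mk_mul, Localization.mk_eq_mk_iff, Localization.r_iff_exists]
  refine ⟨1, ?_⟩
  simp
  ring

lemma linFrac_self : linFrac hN hN = 1 := by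
  apply Subtype.ext
  ext ⟨p, hp⟩
  change HomogeneousLocalization.val ((linFrac hN hN).val ⟨p, hp⟩) = HomogeneousLocalization.val 1
  refine (linFrac_val hN hN p hp).trans (Eq.trans ?_ (val_one).symm)
  exact Localization.mk_self ⟨N, hp⟩

lemma linFrac_mul_linFrac :
    resF inf_le_left (linFrac hL hN) *
      resF (inf_le_right : Proj.basicOpen grading N ⊓ Proj.basicOpen grading L ≤ _)
        (linFrac hN hL) = 1 := by
  rw [linFrac_mul, linFrac_self, map_one]

/-- If `L / N` is invertible at a point, then `L` is a unit in the localization at the corresponding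
prime, so it lies outside that prime. -/
lemma basicOpen_linFrac : P1.basicOpen (linFrac hL hN) =
    Proj.basicOpen grading N ⊓ Proj.basicOpen grading L := by
  refine le_antisymm (le_inf (P1.basicOpen_le _) fun x hx ↦ ?_) fun x hx ↦ ?_
  · have hxN : x ∈ Proj.basicOpen grading N := P1.basicOpen_le _ hx
    by_contra hxL
    have hprime : x.asHomogeneousIdeal.toIdeal.IsPrime := ProjectiveSpectrum.isPrime x
    obtain ⟨h, hh⟩ := (isUnit_resF_basicOpen (linFrac hL hN)).exists_right_inv
    have h₁ : HomogeneousLocalization.val ((linFrac hL hN).val ⟨x, hxN⟩ * h.val ⟨x, hx⟩) =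
        HomogeneousLocalization.val 1 := congrArg (fun s ↦ HomogeneousLocalization.val
        (s.val ⟨x, hx⟩)) hh
    have h₂ : Localization.mk L ⟨N, hxN⟩ * HomogeneousLocalization.val (h.val ⟨x, hx⟩) = 1 :=
      ((congrArg (· * _) (linFrac_val hL hN x hxN)).symm.trans
        ((val_mul _ _).symm.trans h₁)).trans val_one
    have h₃ : IsUnit (algebraMap _ (Localization.AtPrime x.asHomogeneousIdeal.toIdeal) L) := by
      have h₄ : algebraMap _ (Localization.AtPrime x.asHomogeneousIdeal.toIdeal) L =
          Localization.mk L ⟨N, hxN⟩ * algebraMap _ _ N := by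
        rw [← Localization.mk_one_eq_algebraMap, ← Localization.mk_one_eq_algebraMap,
          Localization.mk_mul, Localization.mk_eq_mk_iff, Localization.r_iff_exists]
        exact ⟨1, by simp [mul_comm]⟩
      rw [h₄]
      exact (IsUnit.of_mul_eq_one _ h₂).mul
        (IsLocalization.map_units (M := x.asHomogeneousIdeal.toIdeal.primeCompl) _
          (⟨N, hxN⟩ : x.asHomogeneousIdeal.toIdeal.primeCompl))
    rw [IsLocalization.AtPrime.isUnit_to_map_iff _ x.asHomogeneousIdeal.toIdeal] at h₃
    exact hxL h₃
  · have h := (IsUnit.of_mul_eq_one _ (linFrac_mul_linFrac hL hN))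
    have := P1.basicOpen_of_isUnit h
    rw [← this] at hx
    rw [resF, Scheme.basicOpen_res] at hx
    exact hx.2

end P1

/-! ### Linear changes of coordinates on the projective line -/

namespace P1

open HomogeneousLocalization MvPolynomial

lemma aeval_mem {v : Fin 2 → MvPolynomial (Fin 2) ℂ} (hv : ∀ i, v i ∈ grading 1) {n : ℕ}
    {p : MvPolynomial (Fin 2) ℂ} (hp : p ∈ grading n) : aeval v p ∈ grading n := by
  have := IsHomogeneous.aeval (n := 1) hp v fun i ↦ hv i
  rwa [one_mul] at this

/-- The linear substitution `Xᵢ ↦ vᵢ`. -/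
def subst {v : Fin 2 → MvPolynomial (Fin 2) ℂ} (hv : ∀ i, v i ∈ grading 1) :
    grading →+*ᵍ grading where
  toRingHom := (aeval v).toRingHom
  map_mem := aeval_mem hv

lemma subst_apply {v : Fin 2 → MvPolynomial (Fin 2) ℂ} (hv : ∀ i, v i ∈ grading 1)
    (p : MvPolynomial (Fin 2) ℂ) : subst hv p = aeval v p := rfl

variable {v v' : Fin 2 → MvPolynomial (Fin 2) ℂ} (hv : ∀ i, v i ∈ grading 1)

lemma aeval_aeval_eq (h : ∀ i, aeval v (v' i) = X i) (p : MvPolynomial (Fin 2) ℂ) :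
    aeval v (aeval v' p) = p := by
  have : (aeval v).comp (aeval v') = AlgHom.id ℂ (MvPolynomial (Fin 2) ℂ) := by
    ext i : 1
    simpa using h i
  exact congr($this p)

lemma irrelevant_le_map_subst (hv' : ∀ i, v' i ∈ grading 1) (h : ∀ i, aeval v (v' i) = X i) :
    HomogeneousIdeal.irrelevant grading ≤
      (HomogeneousIdeal.irrelevant grading).map (subst hv) := by
  rw [HomogeneousIdeal.irrelevant_le]
  intro i hi x hx
  have h₁ : aeval v' x ∈ HomogeneousIdeal.irrelevant grading :=
    HomogeneousIdeal.mem_irrelevant_of_mem _ hi (aeval_mem hv' hx)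
  have h₂ : subst hv (aeval v' x) ∈ (HomogeneousIdeal.irrelevant grading).map (subst hv) :=
    Ideal.mem_map_of_mem _ h₁
  rw [subst_apply, aeval_aeval_eq h] at h₂
  exact h₂

variable (hv' : ∀ i, v' i ∈ grading 1)

/-- A linear change of coordinates. -/
def linMap (h : ∀ i, aeval v (v' i) = X i) : P1 ⟶ P1 :=
  Proj.map (subst hv) (irrelevant_le_map_subst hv hv' h)

lemma linMap_comp (h : ∀ i, aeval v (v' i) = X i) (h' : ∀ i, aeval v' (v i) = X i) :
    linMap hv hv' h ≫ linMap hv' hv h' = 𝟙 P1 := by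
  rw [linMap, linMap, ← Proj.map_comp]
  refine Eq.trans ?_ (Proj.map_id (𝒜 := grading))
  congr 1
  ext p
  exact congrArg _ (aeval_aeval_eq h p)

lemma linMap_preimage (h : ∀ i, aeval v (v' i) = X i) (i : Fin 2) :
    linMap hv hv' h ⁻¹ᵁ chart i = Proj.basicOpen grading (v i) := by
  refine (Proj.map_preimage_basicOpen _ _ _).trans ?_
  rw [subst_apply, aeval_X]

lemma iSup_chart : chart 0 ⊔ chart 1 = ⊤ := by
  rw [eq_top_iff]
  intro x _
  by_contra hx
  have h (i : Fin 2) : X i ∈ x.asHomogeneousIdeal := by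
    by_contra hi
    fin_cases i
    · exact hx (.inl hi)
    · exact hx (.inr hi)
  refine x.not_irrelevant_le ((HomogeneousIdeal.irrelevant_le _).2 fun n hn p hp ↦ ?_)
  have h₁ : p ∈ Ideal.span (X '' (Set.univ : Set (Fin 2))) := by
    rw [mem_ideal_span_X_image]
    intro k hk
    by_contra! hk'
    have hk₀ : k = 0 := Finsupp.ext fun i ↦ hk' i trivial
    have := hp (mem_support_iff.1 hk)
    rw [hk₀, map_zero] at this
    exact hn.ne this
  refine Ideal.span_le.2 ?_ h₁
  rintro _ ⟨i, -, rfl⟩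
  exact h i

lemma awayι_toSpecC {f : MvPolynomial (Fin 2) ℂ} {n : ℕ} (hf : f ∈ grading n) (hn : 0 < n) :
    Proj.awayι grading f hf hn ≫ toSpecC = Spec.map (CommRingCat.ofHom
      ((fromZeroRingHom grading (.powers f)).comp (algebraMap ℂ (grading 0)))) := by
  rw [toSpecC, Proj.awayι_toSpecZero_assoc, ← Spec.map_comp]
  rfl

lemma linMap_toSpecC (h : ∀ i, aeval v (v' i) = X i) :
    linMap hv hv' h ≫ toSpecC = toSpecC := by
  have hle := irrelevant_le_map_subst hv hv' h
  refine (Proj.mapAffineOpenCover (subst hv) hle).openCover.hom_ext _ _ fun s ↦ ?_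
  change Proj.awayι grading _ ((subst hv).2 s.2.2) s.1.2 ≫ _ =
    Proj.awayι grading _ ((subst hv).2 s.2.2) s.1.2 ≫ _
  refine Eq.trans ?_ (awayι_toSpecC ((subst hv).2 s.2.2) s.1.2).symm
  refine (Proj.awayι_comp_map_assoc (subst hv) hle s.1.2 s.2 s.2.2 _).trans ?_
  refine (congrArg _ (awayι_toSpecC s.2.2 s.1.2)).trans ?_
  rw [← Spec.map_comp]
  congr 1
  ext c : 2
  apply val_injective
  have h₁ : (fromZeroRingHom grading (.powers s.2.1) (algebraMap ℂ (grading 0) c)) =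
    HomogeneousLocalization.mk ⟨0, algebraMap ℂ (grading 0) c, 1, Submonoid.one_mem _⟩ := rfl
  have h₂ : (fromZeroRingHom grading (.powers (subst hv s.2.1)) (algebraMap ℂ (grading 0) c)) =
    HomogeneousLocalization.mk ⟨0, algebraMap ℂ (grading 0) c, 1, Submonoid.one_mem _⟩ := rfl
  change HomogeneousLocalization.val (Away.map (subst hv) s.2.1
    (fromZeroRingHom grading (.powers s.2.1) (algebraMap ℂ (grading 0) c))) =
    HomogeneousLocalization.val (fromZeroRingHom grading (.powers (subst hv s.2.1))
      (algebraMap ℂ (grading 0) c))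
  rw [h₁, h₂, Away.map, HomogeneousLocalization.map_mk, val_mk, val_mk, Localization.mk_eq_mk_iff,
    Localization.r_iff_exists]
  refine ⟨1, ?_⟩
  have h₃ : subst hv (C c) = C c := aeval_C _ _
  have h₄ : ((algebraMap ℂ (grading 0) c : grading 0) : MvPolynomial (Fin 2) ℂ) = C c := rfl
  have h₆ : ((1 : grading 0) : MvPolynomial (Fin 2) ℂ) = 1 := rfl
  simp only [h₄, h₆, h₃, map_one]

lemma pullF_linMap_coord (h : ∀ i, aeval v (v' i) = X i) (i j : Fin 2) :
    pullF (linMap hv hv' h) (linMap_preimage hv hv' h i).ge (coord i j) =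
      linFrac (hv j) (hv i) := by
  have h₁ (k : Fin 2) : subst hv (X k) = v k := aeval_X _ _
  have h₂ := congr($(Proj.awayToSection_comp_appLE (subst hv) (irrelevant_le_map_subst hv hv' h)
    (X_mem i)) (frac i j))
  have h₀ : frac i j = Away.mk grading (X_mem i) 1 (X j) (by simpa using X_mem j) := rfl
  rw [CommRingCat.comp_apply, CommRingCat.comp_apply, CommRingCat.ofHom_apply, h₀,
    Away.map_mk] at h₂
  have key (w : Fin 2 → MvPolynomial (Fin 2) ℂ) (hw : w = v) (hwi : w i ∈ grading 1)
    (hwj : w j ∈ grading (1 • 1)) (hle : Proj.basicOpen grading (w i) ≤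
      linMap hv hv' h ⁻¹ᵁ chart i) (heq : pullF (linMap hv hv' h) hle (coord i j) =
      Proj.awayToSection grading (w i) (Away.mk grading hwi 1 (w j) hwj)) :
    pullF (linMap hv hv' h) (linMap_preimage hv hv' h i).ge (coord i j) =
      linFrac (hv j) (hv i) := by
    subst hw
    exact heq
  exact key (fun k ↦ subst hv (X k)) (funext h₁) _ _ _ h₂

/-- The linear form vanishing at the point with coordinate `z`. -/
def form (z : ℂ) : MvPolynomial (Fin 2) ℂ := X 1 - C z * X 0

lemma form_mem (z : ℂ) : form z ∈ grading 1 :=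
  Submodule.sub_mem _ (X_mem 1) (IsHomogeneous.C_mul (isHomogeneous_X ℂ 0) z)

lemma mk_add_mk_one {A : Type*} [CommRing A] {M : Submonoid A} (a b c : A) (d : M)
    (h : a + d * b = c) : Localization.mk a d + Localization.mk b 1 = Localization.mk c d := by
  rw [Localization.add_mk, ← h, mul_one, Submonoid.coe_one, one_mul, add_comm]

lemma mk_form (z : ℂ) :
    Away.mk grading (X_mem 0) 1 (form z) (by simpa using form_mem z) = frac 0 1 - fracC 0 z := by
  apply val_injective
  have hd : (X 0 : MvPolynomial (Fin 2) ℂ) ^ 1 ∈ Submonoid.powers (X 0 : MvPolynomial (Fin 2) ℂ) :=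
    pow_mem (Submonoid.mem_powers _) 1
  generalize hD : (⟨_, hd⟩ : Submonoid.powers (X 0 : MvPolynomial (Fin 2) ℂ)) = d
  have hdX : (d : MvPolynomial (Fin 2) ℂ) = X 0 :=
    (congrArg Subtype.val hD).symm.trans (pow_one _)
  have h (L : MvPolynomial (Fin 2) ℂ) (hL : L ∈ grading (1 • 1)) :
      (Away.mk grading (X_mem 0) 1 L hL).val = Localization.mk L d :=
    (Away.val_mk _ _ _ _ _).trans (congrArg _ hD)
  have h₃ : (fracC 0 z).val = Localization.mk (C z) 1 := rfl
  have h₂ := h (X 1) (by simpa using X_mem 1)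
  refine (h _ _).trans (Eq.trans ?_ (val_sub _ _).symm)
  refine eq_sub_of_add_eq ?_
  rw [h₃]
  refine Eq.trans ?_ h₂.symm
  refine mk_add_mk_one _ _ _ _ ?_
  rw [hdX, form]
  ring

lemma linFrac_form (z : ℂ) : linFrac (form_mem z) (X_mem 0) =
    coord 0 1 - cst toSpecC (chart 0) z := by
  rw [cst_chart, coord_eq, linFrac]
  refine Eq.trans ?_ (map_sub (Proj.awayToSection grading (X 0)).hom _ _)
  exact congrArg (Proj.awayToSection grading (X 0)).hom (mk_form z)

end P1

/-! ### Affine curves generated by one coordinate, and the zero of the coordinate -/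

section

variable {X Y : Scheme.{0}} {σ : Type}

lemma pullF_bijective (τ : X ⟶ Y) [IsIso τ] {V : Y.Opens} {W : X.Opens} (hW : W = τ ⁻¹ᵁ V) :
    Function.Bijective (pullF τ hW.le) := by
  subst hW
  have h : (pullF τ (le_refl (τ ⁻¹ᵁ V)) : Γ(Y, V) → _) = τ.app V :=
    funext fun a ↦ pullF_eq_app τ _ a
  rw [h]
  exact ConcreteCategory.bijective_of_isIso (τ.app V)

lemma IsAffineSpace.of_iso {s : Y ⟶ Spec (.of ℂ)} {V : Y.Opens} {a : σ → Γ(Y, V)}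
    (ha : IsAffineSpace s V a) (τ : X ⟶ Y) [IsIso τ] {W : X.Opens} (hW : W = τ ⁻¹ᵁ V) :
    IsAffineSpace (τ ≫ s) W (fun i ↦ pullF τ hW.le (a i)) := by
  refine ⟨hW ▸ ha.1.preimage_of_isIso τ, ?_⟩
  have : MvPolynomial.eval₂Hom (cst (τ ≫ s) W) (fun i ↦ pullF τ hW.le (a i)) =
      (pullF τ hW.le).comp (MvPolynomial.eval₂Hom (cst s V) a) := by
    apply MvPolynomial.ringHom_ext <;> simp
  rw [this]
  exact (pullF_bijective τ hW).comp ha.2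

/-- The affine open subset `V` is a closed subscheme of a line, with the coordinate `a`. -/
def HasCoord (s : X ⟶ Spec (.of ℂ)) (V : X.Opens) (a : Γ(X, V)) : Prop :=
  IsAffineOpen V ∧ Function.Surjective (MvPolynomial.eval₂Hom (cst s V) fun _ : Fin 1 ↦ a)

lemma IsAffineSpace.hasCoord {s : X ⟶ Spec (.of ℂ)} {V : X.Opens} {a : Fin 1 → Γ(X, V)}
    (ha : IsAffineSpace s V a) : HasCoord s V (a 0) := by
  refine ⟨ha.1, ?_⟩
  have : (fun _ : Fin 1 ↦ a 0) = a := funext fun i ↦ congrArg a (Subsingleton.elim _ _)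
  rw [this]
  exact ha.2.2

lemma HasCoord.exists_eq {s : X ⟶ Spec (.of ℂ)} {V : X.Opens} {a : Γ(X, V)}
    (ha : HasCoord s V a) (f : Γ(X, V)) : ∃ c g, f = cst s V c + a * g := by
  obtain ⟨p, rfl⟩ := ha.2 f
  induction p using MvPolynomial.induction_on with
  | C c => exact ⟨c, 0, by simp⟩
  | add p q hp hq =>
    obtain ⟨c, g, h⟩ := hp
    obtain ⟨c', g', h'⟩ := hq
    exact ⟨c + c', g + g', by rw [map_add, h, h', map_add]; ring⟩
  | mul_X p i hp =>
    exact ⟨0, MvPolynomial.eval₂Hom (cst s V) (fun _ : Fin 1 ↦ a) p, by simp [mul_comm]⟩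

lemma mem_basicOpen_mul_iff {V : X.Opens} (a b : Γ(X, V)) (x : X) :
    x ∈ X.basicOpen (a * b) ↔ x ∈ X.basicOpen a ∧ x ∈ X.basicOpen b := by
  rw [X.basicOpen_mul]
  exact Iff.rfl

lemma mem_basicOpen_cst_iff {s : X ⟶ Spec (.of ℂ)} {V : X.Opens} {x : X} (hx : x ∈ V) (c : ℂ) :
    x ∈ X.basicOpen (cst s V c) ↔ c ≠ 0 := by
  constructor
  · rintro h rfl
    rw [map_zero, X.basicOpen_zero] at h
    exact h
  · intro h
    rw [X.basicOpen_of_isUnit ((IsUnit.mk0 c h).map _)]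
    exact hx

lemma mem_basicOpen_cst_add_iff {s : X ⟶ Spec (.of ℂ)} {V : X.Opens} {x : X} (hx : x ∈ V)
    {a : Γ(X, V)} (ha : x ∉ X.basicOpen a) (c : ℂ) (g : Γ(X, V)) :
    x ∈ X.basicOpen (cst s V c + a * g) ↔ c ≠ 0 := by
  rw [← mem_basicOpen_cst_iff (s := s) hx c]
  constructor <;> intro h
  · exact (X.basicOpen_add_le _ _ h).resolve_right fun h' ↦ ha ((mem_basicOpen_mul_iff _ _ _).1 h').1
  · have : cst s V c = (cst s V c + a * g) + -(a * g) := by ring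
    rw [this] at h
    refine (X.basicOpen_add_le _ _ h).resolve_right fun h' ↦ ?_
    rw [← mul_neg] at h'
    exact ha ((mem_basicOpen_mul_iff _ _ _).1 h').1

/-- Basic open subsets form a basis of an affine open subset, and the space of a scheme is T₀. -/
lemma IsAffineOpen.ext_of_basicOpen {V : X.Opens} (hV : IsAffineOpen V) {x y : X} (hx : x ∈ V)
    (hy : y ∈ V) (h : ∀ f : Γ(X, V), x ∈ X.basicOpen f ↔ y ∈ X.basicOpen f) : x = y := by
  refine Inseparable.eq ((inseparable_iff_forall_isOpen).2 fun U hU ↦ ?_)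
  have key {x y : X} (hx : x ∈ V) (h : ∀ f : Γ(X, V), x ∈ X.basicOpen f ↔ y ∈ X.basicOpen f)
      (hxU : x ∈ U) : y ∈ U := by
    obtain ⟨f, hf, hxf⟩ := hV.exists_basicOpen_le (V := ⟨U, hU⟩) ⟨x, hxU⟩ hx
    exact hf ((h f).1 hxf)
  exact ⟨key hx h, key hy fun f ↦ (h f).symm⟩

/-- The coordinate vanishes in at most one point. -/
lemma HasCoord.eq_of_notMem {s : X ⟶ Spec (.of ℂ)} {V : X.Opens} {a : Γ(X, V)}
    (ha : HasCoord s V a) {x y : X} (hx : x ∈ V) (hy : y ∈ V) (hxa : x ∉ X.basicOpen a)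
    (hya : y ∉ X.basicOpen a) : x = y := by
  refine IsAffineOpen.ext_of_basicOpen ha.1 hx hy fun f ↦ ?_
  obtain ⟨c, g, rfl⟩ := ha.exists_eq f
  rw [mem_basicOpen_cst_add_iff hx hxa, mem_basicOpen_cst_add_iff hy hya]

end

/-! ### Closed points of the projective line as zeros of linear forms -/

namespace P1

open MvPolynomial

instance : LocallyOfFiniteType toSpecC := by
  have : IsScalarTower ℂ (grading 0) (MvPolynomial (Fin 2) ℂ) :=
    ⟨fun a b c ↦ smul_mul_assoc a (b : MvPolynomial (Fin 2) ℂ) c⟩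
  have : Algebra.FiniteType (grading 0) (MvPolynomial (Fin 2) ℂ) :=
    Algebra.FiniteType.of_restrictScalars_finiteType ℂ _ _
  have h : Function.Surjective (algebraMap ℂ (grading 0)) := by
    rintro ⟨p, hp⟩
    refine ⟨coeff 0 p, Subtype.ext ?_⟩
    exact (totalDegree_eq_zero_iff_eq_C.1 ((totalDegree_zero_iff_isHomogeneous _).2 hp)).symm
  have : IsClosedImmersion (Spec.map (CommRingCat.ofHom (algebraMap ℂ (grading 0)))) :=
    IsClosedImmersion.spec_of_surjective _ h
  unfold toSpecC
  infer_instance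

/-- The linear form with the given coefficients. -/
def lin (u : Fin 2 → ℂ) : MvPolynomial (Fin 2) ℂ := ∑ j, C (u j) * X j

lemma lin_mem (u : Fin 2 → ℂ) : lin u ∈ grading 1 :=
  Submodule.sum_mem _ fun j _ ↦ IsHomogeneous.C_mul (isHomogeneous_X ℂ j) (u j)

lemma X_zero_eq_lin : X 0 = lin ![1, 0] := by simp [lin]

lemma form_eq_lin (z : ℂ) : form z = lin ![-z, 1] := by simp [lin, form]; ring

lemma aeval_lin (A : Matrix (Fin 2) (Fin 2) ℂ) (u : Fin 2 → ℂ) :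
    aeval (fun i ↦ lin (A i)) (lin u) = lin (Matrix.vecMul u A) := by
  simp only [lin, map_sum, map_mul, aeval_X, algHom_C, Finset.mul_sum, Matrix.vecMul, dotProduct,
    Finset.sum_mul]
  rw [Finset.sum_comm]
  simp [mul_assoc]

lemma aeval_lin_inv {A B : Matrix (Fin 2) (Fin 2) ℂ} (h : B * A = 1) (i : Fin 2) :
    aeval (fun i ↦ lin (A i)) (lin (B i)) = X i := by
  rw [aeval_lin, ← Matrix.mul_apply_eq_vecMul, h]
  simp [lin, Matrix.one_apply]

variable {A B : Matrix (Fin 2) (Fin 2) ℂ}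

/-- The linear change of coordinates given by a matrix. -/
def linIso (hAB : A * B = 1) (hBA : B * A = 1) : P1 ≅ P1 where
  hom := linMap (fun i ↦ lin_mem (A i)) (fun i ↦ lin_mem (B i)) (aeval_lin_inv hBA)
  inv := linMap (fun i ↦ lin_mem (B i)) (fun i ↦ lin_mem (A i)) (aeval_lin_inv hAB)
  hom_inv_id := linMap_comp _ _ _ _
  inv_hom_id := linMap_comp _ _ _ _

lemma linIso_hom_toSpecC (hAB : A * B = 1) (hBA : B * A = 1) :
    (linIso hAB hBA).hom ≫ toSpecC = toSpecC := linMap_toSpecC (fun i ↦ lin_mem (A i)) (fun i ↦ lin_mem (B i)) (aeval_lin_inv hBA)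

lemma linIso_preimage (hAB : A * B = 1) (hBA : B * A = 1) (i : Fin 2) :
    (linIso hAB hBA).hom ⁻¹ᵁ chart i = Proj.basicOpen grading (lin (A i)) := 
  linMap_preimage (fun i ↦ lin_mem (A i)) (fun i ↦ lin_mem (B i)) (aeval_lin_inv hBA) i

lemma isAffineSpace_linFrac (hAB : A * B = 1) (hBA : B * A = 1) {i j : Fin 2} (hij : i ≠ j) :
    IsAffineSpace toSpecC (Proj.basicOpen grading (lin (A i)))
      (fun _ : Fin 1 ↦ linFrac (lin_mem (A j)) (lin_mem (A i))) := by
  have h := (isAffineSpace_chart hij).of_iso (linIso hAB hBA).hom (linIso_preimage hAB hBA i).symm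
  rw [linIso_hom_toSpecC] at h
  have h' : (fun _ : Fin 1 ↦ pullF (linIso hAB hBA).hom (linIso_preimage hAB hBA i).ge
      (coord i j)) = fun _ ↦ linFrac (lin_mem (A j)) (lin_mem (A i)) :=
    funext fun _ ↦ pullF_linMap_coord (fun i ↦ lin_mem (A i)) (fun i ↦ lin_mem (B i)) (aeval_lin_inv hBA) i j
  exact h' ▸ h

lemma sup_basicOpen_lin (hAB : A * B = 1) (hBA : B * A = 1) :
    Proj.basicOpen grading (lin (A 0)) ⊔ Proj.basicOpen grading (lin (A 1)) = ⊤ := by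
  rw [← linIso_preimage hAB hBA, ← linIso_preimage hAB hBA, ← Scheme.Hom.preimage_sup, iSup_chart]
  rfl

/-- The zeros of the first form lie in the chart of the second, where they are zeros of the affine
coordinate given by the quotient of the two forms. -/
lemma eq_of_notMem_lin (hAB : A * B = 1) (hBA : B * A = 1) {x y : P1}
    (hx : x ∉ Proj.basicOpen grading (lin (A 0))) (hy : y ∉ Proj.basicOpen grading (lin (A 0))) :
    x = y := by
  have h (x : P1) (hx : x ∉ Proj.basicOpen grading (lin (A 0))) :
      x ∈ Proj.basicOpen grading (lin (A 1)) := by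
    have : x ∈ (⊤ : P1.Opens) := trivial
    rw [← sup_basicOpen_lin hAB hBA] at this
    exact this.resolve_left hx
  refine (isAffineSpace_linFrac hAB hBA one_ne_zero).hasCoord.eq_of_notMem (h x hx) (h y hy) ?_ ?_
  · rw [basicOpen_linFrac]
    exact fun h ↦ hx h.2
  · rw [basicOpen_linFrac]
    exact fun h ↦ hy h.2

lemma exists_inv {u u' : Fin 2 → ℂ} (h : u 0 * u' 1 - u 1 * u' 0 ≠ 0) :
    ∃ B : Matrix (Fin 2) (Fin 2) ℂ, Matrix.of ![u, u'] * B = 1 ∧ B * Matrix.of ![u, u'] = 1 := by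
  have h' : IsUnit (Matrix.of ![u, u']).det := by
    rw [Matrix.det_fin_two]
    exact (IsUnit.mk0 _ h)
  exact ⟨_, Matrix.mul_nonsing_inv _ h', Matrix.nonsing_inv_mul _ h'⟩

/-- A closed point of a scheme of finite type over ℂ is rational, and `z` is the value of the
coordinate there. -/
lemma exists_coord_eq {α : P1} (hα : IsClosed {α}) (h : α ∈ chart 0) :
    ∃ z, α ∉ P1.basicOpen (coord 0 1 - cst toSpecC (chart 0) z) := by
  let p := pointOfClosedPoint toSpecC α hα
  have hp : ⊤ ≤ p ⁻¹ᵁ chart 0 := by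
    intro x _
    have : p x = α := pointOfClosedPoint_apply toSpecC α hα x
    change p x ∈ chart 0
    rwa [this]
  have hps : p ≫ toSpecC = 𝟙 _ := pointOfClosedPoint_comp _ _ _
  obtain ⟨z, hz⟩ := (specF_bijective ℂ).2 (pullF p hp (coord 0 1))
  refine ⟨z, fun hmem ↦ ?_⟩
  have h₀ : pullF p hp (coord 0 1 - cst toSpecC (chart 0) z) = 0 := by
    rw [map_sub, pullF_cst, ← hz, cst, RingHom.comp_apply, pullF_congr hps, pullF_id, sub_eq_zero]
    exact (resF_self _ _).symm
  have h₁ : (Spec (.of ℂ)).basicOpen (pullF p hp (coord 0 1 - cst toSpecC (chart 0) z)) = ⊥ := by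
    rw [h₀, Scheme.basicOpen_zero]
  rw [pullF, Scheme.basicOpen_appLE] at h₁
  have h₂ : IsLocalRing.closedPoint ℂ ∈ (⊥ : (Spec (.of ℂ)).Opens) := by
    rw [← h₁]
    refine ⟨trivial, ?_⟩
    have : p (IsLocalRing.closedPoint ℂ) = α := pointOfClosedPoint_apply toSpecC α hα _
    change p _ ∈ P1.basicOpen (coord 0 1 - cst toSpecC (chart 0) z)
    rwa [this]
  exact h₂

/-- Every closed point of the projective line is the zero locus of a linear form. -/
lemma exists_lin {α : P1} (hα : IsClosed {α}) :
    ∃ u : Fin 2 → ℂ, u ≠ 0 ∧ ∀ x, x ∈ Proj.basicOpen grading (lin u) ↔ x ≠ α := by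
  have key (u u' : Fin 2 → ℂ) (h : u 0 * u' 1 - u 1 * u' 0 ≠ 0)
      (hu : α ∉ Proj.basicOpen grading (lin u)) :
      ∃ u : Fin 2 → ℂ, u ≠ 0 ∧ ∀ x, x ∈ Proj.basicOpen grading (lin u) ↔ x ≠ α := by
    obtain ⟨B, h₁, h₂⟩ := exists_inv h
    refine ⟨u, by rintro rfl; simp at h, fun x ↦ ⟨?_, fun hx ↦ ?_⟩⟩
    · rintro hx rfl
      exact hu hx
    · by_contra hxu
      exact hx (eq_of_notMem_lin h₁ h₂ hxu hu)
  by_cases h : α ∈ chart 0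
  · obtain ⟨z, hz⟩ := exists_coord_eq hα h
    rw [← linFrac_form, basicOpen_linFrac] at hz
    refine key ![-z, 1] ![1, 0] (by simp) ?_
    rw [← form_eq_lin]
    exact fun h' ↦ hz ⟨h, h'⟩
  · refine key ![1, 0] ![0, 1] (by simp) ?_
    rwa [← X_zero_eq_lin]

lemma lin_smul (c : ℂ) (u : Fin 2 → ℂ) : lin (c • u) = C c * lin u := by
  simp [lin, mul_assoc, Finset.mul_sum]
  ring

/-- Linear forms which vanish in different points are linearly independent. -/
lemma exists_inv_of_ne {α β : P1} (hαβ : α ≠ β) {u u' : Fin 2 → ℂ} (hu : u ≠ 0)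
    (hα : ∀ x, x ∈ Proj.basicOpen grading (lin u) ↔ x ≠ α)
    (hβ : ∀ x, x ∈ Proj.basicOpen grading (lin u') ↔ x ≠ β) :
    ∃ B : Matrix (Fin 2) (Fin 2) ℂ, Matrix.of ![u, u'] * B = 1 ∧ B * Matrix.of ![u, u'] = 1 := by
  refine exists_inv fun h ↦ ?_
  obtain ⟨c, rfl⟩ : ∃ c : ℂ, u' = c • u := by
    by_cases h₀ : u 0 = 0
    · have h₁ : u 1 ≠ 0 := fun h₁ ↦ hu (by ext i; fin_cases i <;> assumption)
      refine ⟨u' 1 / u 1, ?_⟩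
      ext i
      fin_cases i
      · have : u' 0 = 0 := by simpa [h₀, h₁] using h
        simp [h₀, this]
      · simp [h₁]
    · refine ⟨u' 0 / u 0, ?_⟩
      ext i
      fin_cases i
      · simp [h₀]
      · simp
        field_simp
        linear_combination h
  have h₁ : β ∈ Proj.basicOpen grading (lin u) := (hα β).2 hαβ.symm
  have h₂ : α ∈ Proj.basicOpen grading (lin (c • u)) := (hβ α).2 hαβ
  rw [lin_smul, Proj.basicOpen_mul] at h₂
  exact (hα α).1 h₂.2 rfl

/-- Every closed point can be moved to `[0 : 1]`. -/
lemma exists_iso {α : P1} (hα : IsClosed {α}) : ∃ τ : P1 ≅ P1, τ.hom ≫ toSpecC = toSpecC ∧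
    ∀ x, τ.hom x ∈ chart 0 ↔ x ≠ α := by
  obtain ⟨u, hu, h⟩ := exists_lin hα
  -- The second row is conjugate-orthogonal to `u`, so the determinant is |u₀|² + |u₁|², which is
  -- nonzero.
  obtain ⟨B, h₁, h₂⟩ : ∃ B : Matrix (Fin 2) (Fin 2) ℂ, Matrix.of ![u, ![-star (u 1), star (u 0)]] * B = 1 ∧
      B * Matrix.of ![u, ![-star (u 1), star (u 0)]] = 1 := by
    refine exists_inv fun h' ↦ hu ?_
    have h'' : Complex.normSq (u 0) + Complex.normSq (u 1) = 0 := by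
      have h₃ : ((Complex.normSq (u 0) + Complex.normSq (u 1) : ℝ) : ℂ) = 0 := by
        push_cast
        rw [← Complex.mul_conj, ← Complex.mul_conj]
        simpa using h'
      exact_mod_cast h₃
    have h0 := Complex.normSq_nonneg (u 0)
    have h1 := Complex.normSq_nonneg (u 1)
    ext i
    fin_cases i
    · exact Complex.normSq_eq_zero.1 (show Complex.normSq (u 0) = 0 by linarith)
    · exact Complex.normSq_eq_zero.1 (show Complex.normSq (u 1) = 0 by linarith)
  refine ⟨linIso h₁ h₂, linIso_hom_toSpecC _ _, fun x ↦ ?_⟩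
  rw [← h]
  exact congr(x ∈ $(linIso_preimage h₁ h₂ 0)).to_iff

end P1

/-! ### Products, the ideal of a point, integrality -/

section

variable {X Y X₁ X₂ : Scheme.{0}} {σ : Type}

/-- The product of two lines is a plane. -/
theorem isAffineSpace_prod {p₁ : Y ⟶ X₁} {p₂ : Y ⟶ X₂} {s₁ : X₁ ⟶ Spec (.of ℂ)}
    {s₂ : X₂ ⟶ Spec (.of ℂ)} (hp : IsPullback p₁ p₂ s₁ s₂) {V₁ : X₁.Opens} {V₂ : X₂.Opens}
    {a : Γ(X₁, V₁)} {b : Γ(X₂, V₂)} (ha : IsAffineSpace s₁ V₁ (fun _ : Fin 1 ↦ a))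
    (hb : IsAffineSpace s₂ V₂ (fun _ : Fin 1 ↦ b)) :
    IsAffineSpace (p₁ ≫ s₁) (p₁ ⁻¹ᵁ V₁ ⊓ p₂ ⁻¹ᵁ V₂)
      ![pullF p₁ inf_le_left a, pullF p₂ inf_le_right b] := by
  obtain ⟨f₁, hf₁, hf₁s, hf₁a⟩ := ha.exists_hom (specC (Fin 2))
    fun _ ↦ specF (MvPolynomial (Fin 2) ℂ) (.X 0)
  obtain ⟨f₂, hf₂, hf₂s, hf₂b⟩ := hb.exists_hom (specC (Fin 2))
    fun _ ↦ specF (MvPolynomial (Fin 2) ℂ) (.X 1)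
  let k := hp.lift f₁ f₂ (hf₁s.trans hf₂s.symm)
  have hk₁ : k ≫ p₁ = f₁ := hp.lift_fst _ _ _
  have hk₂ : k ≫ p₂ = f₂ := hp.lift_snd _ _ _
  have hk : ⊤ ≤ k ⁻¹ᵁ (p₁ ⁻¹ᵁ V₁ ⊓ p₂ ⁻¹ᵁ V₂) := by
    have h₁ : ⊤ ≤ (k ≫ p₁) ⁻¹ᵁ V₁ := by rwa [hk₁]
    have h₂ : ⊤ ≤ (k ≫ p₂) ⁻¹ᵁ V₂ := by rwa [hk₂]
    exact le_inf h₁ h₂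
  refine isAffineSpace_of_section k hk (by rw [← Category.assoc, hk₁, hf₁s]) (fun i ↦ ?_)
    fun f hf hfs hfa ↦ ?_
  · fin_cases i
    · exact (pullF_pullF _ _ _ _ _).trans ((pullF_congr hk₁ _ _).trans (hf₁a 0))
    · exact (pullF_pullF _ _ _ _ _).trans ((pullF_congr hk₂ _ _).trans (hf₂b 0))
  · have hι := top_le_ι_preimage (p₁ ⁻¹ᵁ V₁ ⊓ p₂ ⁻¹ᵁ V₂)
    refine hp.hom_ext ?_ ?_
    · refine ha.hom_ext (hf.trans fun x hx ↦ hx.1) (hι.trans fun x hx ↦ hx.1) (by simpa using hfs)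
        fun _ ↦ ?_
      have := hfa 0
      simpa using this
    · refine hb.hom_ext (hf.trans fun x hx ↦ hx.2) (hι.trans fun x hx ↦ hx.2) ?_ fun _ ↦ ?_
      · rw [Category.assoc, Category.assoc, ← hp.w]
        exact hfs
      · have := hfa 1
        simpa using this

lemma mem_basicOpen_cst_add_iff' {s : X ⟶ Spec (.of ℂ)} {V : X.Opens} {x : X} (hx : x ∈ V)
    {e : Γ(X, V)} (he : x ∉ X.basicOpen e) (c : ℂ) : x ∈ X.basicOpen (cst s V c + e) ↔ c ≠ 0 := by
  have := mem_basicOpen_cst_add_iff (s := s) hx he c 1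
  rwa [mul_one] at this

lemma notMem_basicOpen_add {V : X.Opens} {x : X} {e e' : Γ(X, V)} (he : x ∉ X.basicOpen e)
    (he' : x ∉ X.basicOpen e') : x ∉ X.basicOpen (e + e') :=
  fun h ↦ (X.basicOpen_add_le _ _ h).elim he he'

lemma notMem_basicOpen_mul {V : X.Opens} {x : X} {e : Γ(X, V)} (he : x ∉ X.basicOpen e)
    (g : Γ(X, V)) : x ∉ X.basicOpen (e * g) :=
  fun h ↦ he ((mem_basicOpen_mul_iff _ _ _).1 h).1

lemma IsAffineSpace.exists_eq {s : X ⟶ Spec (.of ℂ)} {V : X.Opens} {a b : Γ(X, V)}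
    (h : IsAffineSpace s V ![a, b]) (f : Γ(X, V)) : ∃ c g g', f = cst s V c + (a * g + b * g') := by
  obtain ⟨p, rfl⟩ := h.2.2 f
  induction p using MvPolynomial.induction_on with
  | C c => exact ⟨c, 0, 0, by simp⟩
  | add p q hp hq =>
    obtain ⟨c, g, k, h⟩ := hp
    obtain ⟨c', g', k', h'⟩ := hq
    exact ⟨c + c', g + g', k + k', by rw [map_add, h, h', map_add]; ring⟩
  | mul_X p i hp =>
    fin_cases i
    · exact ⟨0, MvPolynomial.eval₂Hom (cst s V) ![a, b] p, 0, by simp [mul_comm]⟩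
    · exact ⟨0, 0, MvPolynomial.eval₂Hom (cst s V) ![a, b] p, by simp [mul_comm]⟩

open Scheme TopologicalSpace in
lemma mem_vanishingIdeal_iff {q : X} (hq : IsClosed {q}) (V : X.affineOpens) (hqV : q ∈ V.1)
    (f : Γ(X, V.1)) :
    f ∈ (IdealSheafData.vanishingIdeal ⟨{q}, hq⟩).ideal V ↔ q ∉ X.basicOpen f := by
  rw [IdealSheafData.vanishingIdeal_ideal, PrimeSpectrum.mem_vanishingIdeal]
  have key (y : Spec Γ(X, V.1)) : y ∈ V.2.fromSpec ⁻¹ᵁ X.basicOpen f ↔ f ∉ y.asIdeal := by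
    rw [V.2.fromSpec_preimage_basicOpen]
    exact Iff.rfl
  obtain ⟨y, hy⟩ : ∃ y, V.2.fromSpec y = q := by
    have : q ∈ Set.range V.2.fromSpec := by rwa [V.2.range_fromSpec]
    exact this
  constructor
  · intro h hq
    refine (key y).1 ?_ (h y hy)
    change V.2.fromSpec y ∈ X.basicOpen f
    rwa [hy]
  · intro h z hz
    by_contra hfz
    have hz' : V.2.fromSpec z = q := hz
    refine h ?_
    rw [← hz']
    exact (key z).2 hfz

/-- Every function on the plane is a constant plus an element of `(a, b)`, and it vanishes at `q`
exactly when the constant does. -/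
lemma vanishingIdeal_eq_span {q : X} (hq : IsClosed {q}) {s : X ⟶ Spec (.of ℂ)}
    (V : X.affineOpens) {a b : Γ(X, V.1)} (h : IsAffineSpace s V.1 ![a, b]) (hqV : q ∈ V.1)
    (ha : q ∉ X.basicOpen a) (hb : q ∉ X.basicOpen b) :
    (Scheme.IdealSheafData.vanishingIdeal ⟨{q}, hq⟩).ideal V = Ideal.span {a, b} := by
  refine le_antisymm (fun f hf ↦ ?_) (Ideal.span_le.2 ?_)
  · rw [mem_vanishingIdeal_iff hq V hqV] at hf
    obtain ⟨c, g, g', rfl⟩ := h.exists_eq f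
    rw [mem_basicOpen_cst_add_iff' hqV (notMem_basicOpen_add (notMem_basicOpen_mul ha _)
      (notMem_basicOpen_mul hb _)), not_not] at hf
    rw [hf, map_zero, zero_add, mul_comm a, mul_comm b]
    exact Ideal.mem_span_pair.2 ⟨g, g', rfl⟩
  · rintro _ (rfl | rfl)
    · exact (mem_vanishingIdeal_iff hq V hqV _).2 ha
    · exact (mem_vanishingIdeal_iff hq V hqV _).2 hb

lemma comap_vanishingIdeal_eq_top {q : Y} (hq : IsClosed {q}) (f : X ⟶ Y)
    (hf : ∀ x, f x ≠ q) : (Scheme.IdealSheafData.vanishingIdeal ⟨{q}, hq⟩).comap f = ⊤ := by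
  rw [← Scheme.IdealSheafData.support_eq_bot_iff, Scheme.IdealSheafData.support_comap]
  ext x
  simp [hf]

lemma IsAffineSpace.isDomain {s : X ⟶ Spec (.of ℂ)} {V : X.Opens} {a : σ → Γ(X, V)}
    (h : IsAffineSpace s V a) : IsDomain Γ(X, V) :=
  (RingEquiv.ofBijective _ h.2).symm.toMulEquiv.isDomain _

lemma IsAffineSpace.isIntegral {s : X ⟶ Spec (.of ℂ)} {V : X.Opens} {a : σ → Γ(X, V)}
    (h : IsAffineSpace s V a) (hV : (V : Set X).Nonempty) : IsIntegral V.toScheme := by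
  have : IsAffine V.toScheme := h.1
  have : Nonempty V := hV.to_subtype
  have : IsDomain Γ(X, V) := h.isDomain
  have : IsDomain Γ(V.toScheme, ⊤) :=
    (RingEquiv.ofBijective _ (pullF_ι_bijective V)).symm.toMulEquiv.isDomain _
  exact isIntegral_of_isAffine_of_isDomain _

/-- A scheme covered by affine spaces with a common point is integral. -/
theorem isIntegral_of_cover {ι : Type} (V : ι → X.Opens) (hV : ⨆ i, V i = ⊤)
    (h : ∀ i, IsIntegral (V i).toScheme) {x : X} (hx : ∀ i, x ∈ V i) : IsIntegral X := by
  have hred : IsReduced X := by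
    let 𝒰 := X.openCoverOfIsOpenCover V hV
    have (i : 𝒰.I₀) : IsReduced (𝒰.X i) := by
      have := h i
      change IsReduced (V i).toScheme
      infer_instance
    exact IsReduced.of_openCover _ 𝒰
  have hirr (i : ι) : IsPreirreducible (V i : Set X) := by
    have := h i
    have := irreducibleSpace_of_isIntegral (V i).toScheme
    have h' : IsPreirreducible (Set.range (V i).ι) := by
      rw [← Set.image_univ]
      exact (PreirreducibleSpace.isPreirreducible_univ).image _ (V i).ι.continuous.continuousOn
    simpa using h'
  have hmem (y : X) : ∃ i, y ∈ V i := by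
    have : y ∈ ⨆ i, V i := hV ▸ trivial
    simpa using this
  have : IrreducibleSpace X := by
    refine { isPreirreducible_univ := ?_, toNonempty := ⟨x⟩ }
    rintro A B hA hB ⟨a, -, ha⟩ ⟨b, -, hb⟩
    obtain ⟨i, hi⟩ := hmem a
    obtain ⟨j, hj⟩ := hmem b
    -- The common point `x` shows that `V i` and `V j` meet; irreducibility of `V i` moves the point
    -- of `A` into `V j`, where irreducibility of `V j` applies.
    obtain ⟨z, hzi, hzA, hzj⟩ := hirr i A (V j) hA (V j).2 ⟨a, hi, ha⟩ ⟨x, hx i, hx j⟩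
    obtain ⟨z', -, hz'⟩ := hirr j A B hA hB ⟨z, hzj, hzA⟩ ⟨b, hj, hb⟩
    exact ⟨z', trivial, hz'⟩
  exact isIntegral_of_irreducibleSpace_of_isReduced X

end

/-! ### Dense open subsets and the Koszul relation in the plane -/

section

variable {X : Scheme.{0}}

lemma isDenseOpen_of_isIntegral [IsIntegral X] {T : X.Opens} (hT : (T : Set X).Nonempty) :
    IsDenseOpen T := by
  intro V
  by_cases hV : (V : Set X).Nonempty
  · have := irreducibleSpace_of_isIntegral X
    obtain ⟨z, hz⟩ := nonempty_preirreducible_inter V.2 T.2 hV hT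
    have : Nonempty (V ⊓ T : X.Opens) := ⟨z, hz⟩
    exact map_injective_of_isIntegral X (homOfLE (inf_le_left : V ⊓ T ≤ V))
  · have hV' : V = ⊥ := by
      ext x
      exact ⟨fun hx ↦ (hV ⟨x, hx⟩).elim, fun hx ↦ hx.elim⟩
    subst hV'
    intro a b _
    exact Subsingleton.elim _ _

lemma IsAffineSpace.swap {s : X ⟶ Spec (.of ℂ)} {V : X.Opens} {a b : Γ(X, V)}
    (h : IsAffineSpace s V ![a, b]) : IsAffineSpace s V ![b, a] := by
  refine ⟨h.1, ?_⟩
  have h' : MvPolynomial.eval₂Hom (cst s V) ![b, a] =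
      (MvPolynomial.eval₂Hom (cst s V) ![a, b]).comp
        (MvPolynomial.renameEquiv ℂ (Equiv.swap (0 : Fin 2) 1)).toRingEquiv.toRingHom := by
    refine MvPolynomial.ringHom_ext (fun c ↦ ?_) fun i ↦ ?_
    · simp
    · fin_cases i <;> simp
  rw [h']
  exact h.2.comp (MvPolynomial.renameEquiv ℂ (Equiv.swap (0 : Fin 2) 1)).bijective

/-- The variables are non-associated primes of the polynomial ring, so they form a regular sequence.
-/
lemma IsAffineSpace.exists_of_mul_eq {s : X ⟶ Spec (.of ℂ)} {V : X.Opens} {a b : Γ(X, V)}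
    (h : IsAffineSpace s V ![a, b]) {g g' : Γ(X, V)} (hg : a * g = b * g') :
    ∃ d, g = b * d ∧ g' = a * d := by
  obtain ⟨p, rfl⟩ := h.2.2 g
  obtain ⟨p', rfl⟩ := h.2.2 g'
  have h0 : MvPolynomial.eval₂Hom (cst s V) ![a, b] (MvPolynomial.X 0) = a := by simp
  have h1 : MvPolynomial.eval₂Hom (cst s V) ![a, b] (MvPolynomial.X 1) = b := by simp
  have hp : MvPolynomial.X 0 * p = MvPolynomial.X 1 * p' := by
    apply h.2.1
    rw [map_mul, map_mul, h0, h1, hg]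
  have hdvd : MvPolynomial.X (R := ℂ) (0 : Fin 2) ∣ MvPolynomial.X 1 * p' := ⟨p, hp.symm⟩
  obtain ⟨d, rfl⟩ := ((MvPolynomial.X_prime (R := ℂ) (i := (0 : Fin 2))).dvd_or_dvd hdvd).resolve_left
    (by rw [MvPolynomial.X_dvd_X]; simp)
  have hp' : p = MvPolynomial.X 1 * d := by
    refine mul_left_cancel₀ (MvPolynomial.X_ne_zero (R := ℂ) (0 : Fin 2)) ?_
    rw [hp]
    ring
  refine ⟨MvPolynomial.eval₂Hom (cst s V) ![a, b] d, ?_, ?_⟩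
  · rw [hp', map_mul, h1]
  · rw [map_mul, h0]

/-- After shrinking to a basic open subset and clearing denominators, integrality turns the relation
into one between polynomials, where `exists_of_mul_eq` applies. -/
lemma IsAffineSpace.koszul [IsIntegral X] {s : X ⟶ Spec (.of ℂ)} {U : X.Opens} {a b : Γ(X, U)}
    (hab : IsAffineSpace s U ![a, b]) (V : X.Opens) (h : V ≤ U) (c c' : Γ(X, V))
    (hc : resF h a * c + resF h b * c' = 0) (x : X) (hx : x ∈ V) :
    ∃ (W : X.Opens) (h' : W ≤ V), x ∈ W ∧ ∃ d, resF h' c = resF (h'.trans h) b * d ∧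
      resF h' c' = -resF (h'.trans h) a * d := by
  obtain ⟨f, hf, hxf⟩ := hab.1.exists_basicOpen_le ⟨x, hx⟩ (h hx)
  have := hab.1.isLocalization_basicOpen f
  have hle : X.basicOpen f ≤ U := X.basicOpen_le f
  have halg (z : Γ(X, U)) : algebraMap Γ(X, U) Γ(X, X.basicOpen f) z = resF hle z := rfl
  obtain ⟨⟨p, p'⟩, ⟨_, n, rfl⟩, hn⟩ : ∃ (p : Γ(X, U) × Γ(X, U)) (m : Submonoid.powers f),
      resF hf c * resF hle m = resF hle p.1 ∧ resF hf c' * resF hle m = resF hle p.2 := by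
    obtain ⟨⟨p, m⟩, hp⟩ := IsLocalization.surj (Submonoid.powers f) (resF hf c)
    obtain ⟨⟨p', m'⟩, hp'⟩ := IsLocalization.surj (Submonoid.powers f) (resF hf c')
    simp only [halg] at hp hp'
    refine ⟨⟨p * m', p' * m⟩, m * m', ?_, ?_⟩
    · simp only [Submonoid.coe_mul, map_mul, ← hp]
      ring
    · simp only [Submonoid.coe_mul, map_mul, ← hp']
      ring
  dsimp only at hn
  obtain ⟨u, hu⟩ : ∃ u, resF hle (f ^ n) * u = 1 := by
    refine IsUnit.exists_right_inv ?_
    rw [map_pow]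
    exact (isUnit_resF_basicOpen f).pow n
  have hne : Nonempty (X.basicOpen f) := ⟨x, hxf⟩
  have hinj : Function.Injective (resF hle) := map_injective_of_isIntegral X (homOfLE hle)
  have h₀ : a * p = b * -p' := by
    apply hinj
    have h₁ := congrArg (resF hf) hc
    simp only [map_add, map_mul, resF_resF, map_zero] at h₁
    simp only [map_mul, map_neg, ← hn.1, ← hn.2]
    linear_combination resF hle (f ^ n) * h₁
  obtain ⟨d, hd, hd'⟩ := hab.exists_of_mul_eq h₀
  refine ⟨X.basicOpen f, hf, hxf, resF hle d * u, ?_, ?_⟩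
  · have h₂ := congrArg (resF hle) hd
    rw [map_mul] at h₂
    linear_combination (-resF hf c) * hu + u * hn.1 + u * h₂
  · have h₂ := congrArg (resF hle) hd'
    rw [map_mul, map_neg] at h₂
    linear_combination (-resF hf c') * hu + u * hn.2 - u * h₂

end

namespace P1

lemma coord_mul_coord (i j : Fin 2) (V : P1.Opens) (h : V ≤ chart i) (h' : V ≤ chart j) :
    resF h (coord i j) * resF h' (coord j i) = 1 := by
  have := congrArg (resF (le_inf h h')) (linFrac_mul_linFrac (X_mem j) (X_mem i))
  simp only [map_mul, map_one, resF_resF] at this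
  exact this

lemma basicOpen_coord (i j : Fin 2) : P1.basicOpen (coord i j) = chart i ⊓ chart j :=
  basicOpen_linFrac (X_mem j) (X_mem i)

end P1

/-! ### Charts of the blow-up of the product of two projective lines -/

section

variable {S : Scheme.{0}}

/-- The pullback of the coordinate on the `i`-th standard chart. -/
def pc (P : S ⟶ P1) (i : Fin 2) : Γ(S, P ⁻¹ᵁ P1.chart i) := pullF P le_rfl (P1.coord i (1 - i))

lemma basicOpen_pc (P : S ⟶ P1) (i : Fin 2) :
    S.basicOpen (pc P i) = P ⁻¹ᵁ P1.chart 0 ⊓ P ⁻¹ᵁ P1.chart 1 := by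
  rw [pc, pullF, Scheme.basicOpen_appLE, P1.basicOpen_coord]
  fin_cases i
  · ext x
    exact ⟨fun h ↦ h.2, fun h ↦ ⟨h.1, h⟩⟩
  · ext x
    exact ⟨fun h ↦ ⟨h.2.2, h.2.1⟩, fun h ↦ ⟨h.2, h.2, h.1⟩⟩

lemma pc_mul_pc (P : S ⟶ P1) {V : S.Opens} (h : V ≤ P ⁻¹ᵁ P1.chart 1) (h' : V ≤ P ⁻¹ᵁ P1.chart 0) :
    resF h (pc P 1) * resF h' (pc P 0) = 1 := by
  have h₁ : V ≤ P ⁻¹ᵁ (P1.chart 1 ⊓ P1.chart 0) := le_inf h h'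
  have := congrArg (pullF P h₁) (P1.coord_mul_coord 1 0 _ inf_le_left inf_le_right)
  simpa [pc] using this

lemma resF_pc (P : S ⟶ P1) {i : Fin 2} {V : S.Opens} (h : V ≤ P ⁻¹ᵁ P1.chart i) :
    resF h (pc P i) = pullF P h (P1.coord i (1 - i)) := resF_pullF _ _ _ _

/-- The charts of the blow-up of `ℙ¹ × ℙ¹` at the point `([0 : 1], [0 : 1])`, with projections
`P` and `Q`. -/
structure BlowUpCharts (P Q : S ⟶ P1) where
  comm : P ≫ P1.toSpecC = Q ≫ P1.toSpecC
  W₁ : S.Opens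
  W₂ : S.Opens
  le_P₁ : W₁ ≤ P ⁻¹ᵁ P1.chart 1
  le_Q₁ : W₁ ≤ Q ⁻¹ᵁ P1.chart 1
  le_P₂ : W₂ ≤ P ⁻¹ᵁ P1.chart 1
  le_Q₂ : W₂ ≤ Q ⁻¹ᵁ P1.chart 1
  le_sup : P ⁻¹ᵁ P1.chart 1 ⊓ Q ⁻¹ᵁ P1.chart 1 ≤ W₁ ⊔ W₂
  e₁ : Γ(S, W₁)
  e₂ : Γ(S, W₂)
  eq₁ : resF le_P₁ (pc P 1) = resF le_Q₁ (pc Q 1) * e₁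
  eq₂ : resF le_Q₂ (pc Q 1) = resF le_P₂ (pc P 1) * e₂
  isAffineSpace₁ : IsAffineSpace (P ≫ P1.toSpecC) W₁ ![resF le_Q₁ (pc Q 1), e₁]
  isAffineSpace₂ : IsAffineSpace (P ≫ P1.toSpecC) W₂ ![resF le_P₂ (pc P 1), e₂]
  le₁ : P ⁻¹ᵁ P1.chart 1 ⊓ (Q ⁻¹ᵁ P1.chart 0 ⊓ Q ⁻¹ᵁ P1.chart 1) ≤ W₁
  le₂ : Q ⁻¹ᵁ P1.chart 1 ⊓ (P ⁻¹ᵁ P1.chart 0 ⊓ P ⁻¹ᵁ P1.chart 1) ≤ W₂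
  basicOpen_le₁ : S.basicOpen e₁ ≤ W₂
  basicOpen_le₂ : S.basicOpen e₂ ≤ W₁
  mul_eq_one : resF (inf_le_left : W₁ ⊓ W₂ ≤ W₁) e₁ * resF inf_le_right e₂ = 1
  isAffineSpace (i j : Fin 2) (h : i = 0 ∨ j = 0) : IsAffineSpace (P ≫ P1.toSpecC)
    (P ⁻¹ᵁ P1.chart i ⊓ Q ⁻¹ᵁ P1.chart j) ![resF inf_le_left (pc P i), resF inf_le_right (pc Q j)]

/-- Near `q` the ideal of the point is generated by the two coordinates, and `W₁`, `W₂` are the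
greatest open subsets on which the coordinate of the second, respectively first, factor generates
its inverse image. The remaining product charts avoid `q`, where the blow-up changes nothing. -/
theorem exists_blowUpCharts {Y : Scheme.{0}} {p₁ p₂ : Y ⟶ P1}
    (hp : IsPullback p₁ p₂ P1.toSpecC P1.toSpecC) {q : Y} (hq : IsClosed {q})
    (hq₁ : p₁ q ∉ P1.chart 0) (hq₂ : p₂ q ∉ P1.chart 0) {φ : S ⟶ Y}
    (hφ : IsBlowUpAtPoint φ q hq) : Nonempty (BlowUpCharts (φ ≫ p₁) (φ ≫ p₂)) := by
  have hchart {x : P1} (hx : x ∉ P1.chart 0) : x ∈ P1.chart 1 := by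
    have : x ∈ P1.chart 0 ⊔ P1.chart 1 := P1.iSup_chart ▸ trivial
    exact this.resolve_left hx
  have hne : ∀ i : Fin 2, i ≠ 1 - i := by decide
  have hprod (i j : Fin 2) := isAffineSpace_prod hp (P1.isAffineSpace_chart (hne i))
    (P1.isAffineSpace_chart (hne j))
  let V : Y.affineOpens := ⟨p₁ ⁻¹ᵁ P1.chart 1 ⊓ p₂ ⁻¹ᵁ P1.chart 1, (hprod 1 1).1⟩
  let a : Γ(Y, V.1) := pullF p₁ inf_le_left (P1.coord 1 0)
  let b : Γ(Y, V.1) := pullF p₂ inf_le_right (P1.coord 1 0)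
  have hab : IsAffineSpace (p₁ ≫ P1.toSpecC) V.1 ![a, b] := hprod 1 1
  have hba : IsAffineSpace (p₁ ≫ P1.toSpecC) V.1 ![b, a] := hab.swap
  have hqV : q ∈ V.1 := ⟨hchart hq₁, hchart hq₂⟩
  have ha : q ∉ Y.basicOpen a := by
    rw [show Y.basicOpen a = _ from Scheme.basicOpen_appLE _ _ _ _ _, P1.basicOpen_coord]
    exact fun h ↦ hq₁ h.2.2
  have hb : q ∉ Y.basicOpen b := by
    rw [show Y.basicOpen b = _ from Scheme.basicOpen_appLE _ _ _ _ _, P1.basicOpen_coord]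
    exact fun h ↦ hq₂ h.2.2
  have hI := vanishingIdeal_eq_span hq V hab hqV ha hb
  have hI' := vanishingIdeal_eq_span hq V hba hqV hb ha
  obtain ⟨W₁, h₁, e₁, hW₁, he₁, hmax₁, hreg₁⟩ := IsBlowUp.exists_chart hφ hI hab
  obtain ⟨W₂, h₂, e₂, hW₂, he₂, hmax₂, hreg₂⟩ := IsBlowUp.exists_chart hφ hI' hba
  have hA (N : S.Opens) (hN : N ≤ φ ⁻¹ᵁ V.1) : pullF φ hN a =
      resF (fun x hx ↦ (hN hx).1) (pc (φ ≫ p₁) 1) :=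
    (pullF_pullF φ p₁ hN inf_le_left _).trans (resF_pc (φ ≫ p₁) _).symm
  have hB (N : S.Opens) (hN : N ≤ φ ⁻¹ᵁ V.1) : pullF φ hN b =
      resF (fun x hx ↦ (hN hx).2) (pc (φ ≫ p₂) 1) :=
    (pullF_pullF φ p₂ hN inf_le_right _).trans (resF_pc (φ ≫ p₂) _).symm
  have hgen (N : S.Opens) (hN : N ≤ φ ⁻¹ᵁ V.1) (c d : Γ(Y, V.1)) (hd : IsUnit (pullF φ hN d)) :
      Generates φ c d N := by
    obtain ⟨u, hu⟩ := hd.exists_right_inv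
    exact ⟨hN, pullF φ hN c * u, by linear_combination (-pullF φ hN c) * hu, IsReg.of_isUnit hd⟩
  -- If `c = d e` and `d` generates, then `c` generates wherever `e` is a unit. By maximality the
  -- locus where `e₁` is invertible therefore lies in `W₂`, and conversely.
  have hgen' (W : S.Opens) (hW : W ≤ φ ⁻¹ᵁ V.1) (c d : Γ(Y, V.1)) (e : Γ(S, W))
      (he : pullF φ hW c = pullF φ hW d * e) (hreg : IsReg (pullF φ hW d)) :
      Generates φ d c (S.basicOpen e) := by
    have hle := S.basicOpen_le e
    obtain ⟨u, hu⟩ := (isUnit_resF_basicOpen e).exists_right_inv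
    have hcd (z : Γ(Y, V.1)) : pullF φ (hle.trans hW) z = resF hle (pullF φ hW z) := by
      rw [resF_pullF]
    refine ⟨hle.trans hW, u, ?_, ?_⟩
    · rw [hcd, hcd, he, map_mul]
      linear_combination (-resF hle (pullF φ hW d)) * hu
    · rw [hcd, he, map_mul]
      exact (hreg.res hle).mul (IsReg.of_isUnit (isUnit_resF_basicOpen e))
  have hmul : resF (inf_le_left : W₁ ⊓ W₂ ≤ W₁) e₁ * resF inf_le_right e₂ = 1 := by
    refine (hreg₁.res (inf_le_left : W₁ ⊓ W₂ ≤ W₁)).mul_left_cancel ?_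
    have h₃ := congrArg (resF (inf_le_left : W₁ ⊓ W₂ ≤ W₁)) he₁
    have h₄ := congrArg (resF (inf_le_right : W₁ ⊓ W₂ ≤ W₂)) he₂
    rw [map_mul, resF_pullF, resF_pullF] at h₃ h₄
    rw [resF_pullF]
    linear_combination (-resF inf_le_right e₂) * h₃ - h₄
  exact ⟨{
    basicOpen_le₁ := hmax₂ _ (hgen' W₁ h₁ a b e₁ he₁ hreg₁)
    basicOpen_le₂ := hmax₁ _ (hgen' W₂ h₂ b a e₂ he₂ hreg₂)
    mul_eq_one := hmul
    comm := by simp [hp.w]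
    W₁ := W₁
    W₂ := W₂
    le_P₁ := fun x hx ↦ (h₁ hx).1
    le_Q₁ := fun x hx ↦ (h₁ hx).2
    le_P₂ := fun x hx ↦ (h₂ hx).1
    le_Q₂ := fun x hx ↦ (h₂ hx).2
    le_sup := by
      intro x hx
      obtain ⟨N, hxN, hN | hN⟩ := IsBlowUp.exists_generates hφ hI (x := x) hx
      · exact .inl (hmax₁ N hN hxN)
      · exact .inr (hmax₂ N hN hxN)
    e₁ := e₁
    e₂ := e₂
    eq₁ := by rwa [hA, hB] at he₁
    eq₂ := by rwa [hA, hB] at he₂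
    isAffineSpace₁ := by
      rw [hB] at hW₁
      exact hW₁
    isAffineSpace₂ := by
      rw [hA] at hW₂
      exact hW₂
    le₁ := by
      have hN : (φ ≫ p₁) ⁻¹ᵁ P1.chart 1 ⊓ ((φ ≫ p₂) ⁻¹ᵁ P1.chart 0 ⊓ (φ ≫ p₂) ⁻¹ᵁ P1.chart 1) ≤
        φ ⁻¹ᵁ V.1 := le_inf inf_le_left (inf_le_right.trans inf_le_right)
      refine hmax₁ _ (hgen _ hN a b ?_)
      rw [hB]
      exact IsUnit.of_mul_eq_one _ (pc_mul_pc _ _ (inf_le_right.trans inf_le_left))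
    le₂ := by
      have hN : (φ ≫ p₂) ⁻¹ᵁ P1.chart 1 ⊓ ((φ ≫ p₁) ⁻¹ᵁ P1.chart 0 ⊓ (φ ≫ p₁) ⁻¹ᵁ P1.chart 1) ≤
        φ ⁻¹ᵁ V.1 := le_inf (inf_le_right.trans inf_le_right) inf_le_left
      refine hmax₂ _ (hgen _ hN b a ?_)
      rw [hA]
      exact IsUnit.of_mul_eq_one _ (pc_mul_pc _ _ (inf_le_right.trans inf_le_left))
    isAffineSpace := by
      intro i j hij
      have := IsBlowUp.isAffineSpace_preimage hφ (hprod i j) fun T f hf ↦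
        comap_vanishingIdeal_eq_top hq f fun x hx ↦ ?_
      · have h : (fun k ↦ pullF φ (le_refl (φ ⁻¹ᵁ (p₁ ⁻¹ᵁ P1.chart i ⊓ p₂ ⁻¹ᵁ P1.chart j)))
            (![pullF p₁ inf_le_left (P1.coord i (1 - i)),
              pullF p₂ inf_le_right (P1.coord j (1 - j))] k)) =
            ![resF inf_le_left (pc (φ ≫ p₁) i), resF inf_le_right (pc (φ ≫ p₂) j)] := by
          funext k
          fin_cases k
          · exact (pullF_pullF φ p₁ _ inf_le_left _).trans (resF_pc (φ ≫ p₁) _).symm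
          · exact (pullF_pullF φ p₂ _ inf_le_right _).trans (resF_pc (φ ≫ p₂) _).symm
        exact h ▸ this
      · have hx' := hf (x := x) trivial
        change f x ∈ p₁ ⁻¹ᵁ P1.chart i ⊓ p₂ ⁻¹ᵁ P1.chart j at hx'
        rw [hx] at hx'
        rcases hij with rfl | rfl
        exacts [hq₁ hx'.1, hq₂ hx'.2] }⟩

end

/-! ### Integrality of the blow-up and its four charts -/

section

variable {X Y S : Scheme.{0}}

lemma mem_basicOpen_of_isUnit_pullF (f : X ⟶ Y) {V : Y.Opens} {W : X.Opens} (h : W ≤ f ⁻¹ᵁ V)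
    {a : Γ(Y, V)} (ha : IsUnit (pullF f h a)) {x : X} (hx : x ∈ W) : f x ∈ Y.basicOpen a := by
  have := X.basicOpen_of_isUnit ha
  rw [pullF, Scheme.basicOpen_appLE] at this
  exact (this.ge hx).2

lemma mem_basicOpen_resF {V W : X.Opens} (h : W ≤ V) (a : Γ(X, V)) {x : X} :
    x ∈ X.basicOpen (resF h a) ↔ x ∈ W ∧ x ∈ X.basicOpen a := by
  rw [show X.basicOpen (resF h a) = _ from Scheme.basicOpen_res _ _ _]
  exact Iff.rfl

lemma mem_chart (x : P1) : x ∈ P1.chart 0 ∨ x ∈ P1.chart 1 := by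
  have : x ∈ P1.chart 0 ⊔ P1.chart 1 := P1.iSup_chart ▸ trivial
  exact this

lemma mem_basicOpen_pc (P : S ⟶ P1) (i : Fin 2) (x : S) :
    x ∈ S.basicOpen (pc P i) ↔ P x ∈ P1.chart 0 ∧ P x ∈ P1.chart 1 := by
  rw [basicOpen_pc]
  exact Iff.rfl

/-- The inverse image of the torus under a map to the projective line. -/
def tor (P : S ⟶ P1) : S.Opens := P ⁻¹ᵁ P1.chart 0 ⊓ P ⁻¹ᵁ P1.chart 1

/-- The coordinate as an invertible function on the inverse image of the torus. -/
def unitOn (P : S ⟶ P1) {V : S.Opens} (h : V ≤ tor P) : Γ(S, V)ˣ :=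
  Units.mkOfMulEqOne (resF (h.trans inf_le_right) (pc P 1)) (resF (h.trans inf_le_left) (pc P 0))
    (pc_mul_pc P _ _)

lemma coe_unitOn (P : S ⟶ P1) {V : S.Opens} (h : V ≤ tor P) :
    (unitOn P h : Γ(S, V)) = resF (h.trans inf_le_right) (pc P 1) := rfl

namespace BlowUpCharts

variable {P Q : S ⟶ P1}

/-- The point with both coordinates equal to 1 lies over the torus. -/
lemma exists_mem_tor (D : BlowUpCharts P Q) : ∃ x, x ∈ tor P ⊓ tor Q := by
  obtain ⟨f, hf, -, hfa⟩ := (D.isAffineSpace 0 0 (.inl rfl)).exists_hom (𝟙 (Spec (.of ℂ)))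
    fun _ ↦ 1
  have h₁ := hfa 0
  have h₂ := hfa 1
  have hx := IsLocalRing.closedPoint ℂ
  have h₁' := mem_basicOpen_of_isUnit_pullF f hf (h₁ ▸ isUnit_one) (x := IsLocalRing.closedPoint ℂ)
    trivial
  have h₂' := mem_basicOpen_of_isUnit_pullF f hf (h₂ ▸ isUnit_one) (x := IsLocalRing.closedPoint ℂ)
    trivial
  refine ⟨f (IsLocalRing.closedPoint ℂ), ?_, ?_⟩
  · exact (mem_basicOpen_pc _ _ _).1 ((mem_basicOpen_resF _ _).1 h₁').2
  · exact (mem_basicOpen_pc _ _ _).1 ((mem_basicOpen_resF _ _).1 h₂').2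


theorem isIntegral (D : BlowUpCharts P Q) : IsIntegral S := by
  obtain ⟨x, hxP, hxQ⟩ := D.exists_mem_tor
  let V : Option (Option {ij : Fin 2 × Fin 2 // ij.1 = 0 ∨ ij.2 = 0}) → S.Opens
    | none => D.W₁
    | some none => D.W₂
    | some (some ij) => P ⁻¹ᵁ P1.chart ij.1.1 ⊓ Q ⁻¹ᵁ P1.chart ij.1.2
  have hx : ∀ i, x ∈ V i
    | none => D.le₁ ⟨hxP.2, hxQ⟩
    | some none => D.le₂ ⟨hxQ.2, hxP⟩
    | some (some ⟨(0, 0), h⟩) => ⟨hxP.1, hxQ.1⟩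
    | some (some ⟨(0, 1), h⟩) => ⟨hxP.1, hxQ.2⟩
    | some (some ⟨(1, 0), h⟩) => ⟨hxP.2, hxQ.1⟩
    | some (some ⟨(1, 1), h⟩) => ⟨hxP.2, hxQ.2⟩
  refine isIntegral_of_cover V (eq_top_iff.2 fun z _ ↦ ?_) ?_ hx
  · rw [TopologicalSpace.Opens.mem_iSup]
    rcases mem_chart (P z) with hP | hP <;> rcases mem_chart (Q z) with hQ | hQ
    · exact ⟨some (some ⟨(0, 0), .inl rfl⟩), hP, hQ⟩
    · exact ⟨some (some ⟨(0, 1), .inl rfl⟩), hP, hQ⟩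
    · exact ⟨some (some ⟨(1, 0), .inr rfl⟩), hP, hQ⟩
    · rcases D.le_sup ⟨hP, hQ⟩ with h | h
      exacts [⟨none, h⟩, ⟨some none, h⟩]
  · rintro (_ | _ | ij)
    · exact D.isAffineSpace₁.isIntegral ⟨x, hx none⟩
    · exact D.isAffineSpace₂.isIntegral ⟨x, hx (some none)⟩
    · exact (D.isAffineSpace ij.1.1 ij.1.2 ij.2).isIntegral ⟨x, hx (some (some ij))⟩

variable (D : BlowUpCharts P Q)

/-- The charts of the surface. -/
def opens : Fin 4 → S.Opens :=
  ![Q ⁻¹ᵁ P1.chart 0, D.W₁, D.W₂, P ⁻¹ᵁ P1.chart 0 ⊓ Q ⁻¹ᵁ P1.chart 1]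

lemma tor_le (i : Fin 4) : tor P ⊓ tor Q ≤ D.opens i := by
  fin_cases i
  · exact inf_le_right.trans inf_le_left
  · exact fun x hx ↦ D.le₁ ⟨hx.1.2, hx.2⟩
  · exact fun x hx ↦ D.le₂ ⟨hx.2.2, hx.1⟩
  · exact fun x hx ↦ ⟨hx.1.1, hx.2.2⟩

/-- The surface charts of the blow-up. -/
def surfaceCharts [IsIntegral S] : SurfaceCharts S where
  U := D.opens
  iSup_eq_top := by
    refine eq_top_iff.2 fun z _ ↦ TopologicalSpace.Opens.mem_iSup.2 ?_
    rcases mem_chart (Q z) with hQ | hQ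
    · exact ⟨0, hQ⟩
    rcases mem_chart (P z) with hP | hP
    · exact ⟨3, hP, hQ⟩
    · rcases D.le_sup ⟨hP, hQ⟩ with h | h
      exacts [⟨1, h⟩, ⟨2, h⟩]
  T := tor P ⊓ tor Q
  isDense := isDenseOpen_of_isIntegral D.exists_mem_tor
  T_le := D.tor_le
  -- On `W₂` one has `y = t * e₂`; where `y` is invertible, so is `t`.
  inf_le₀₂ := by
    rintro x ⟨hx : Q x ∈ P1.chart 0, hx₂ : x ∈ D.W₂⟩
    have h₁ : x ∈ S.basicOpen (resF D.le_Q₂ (pc Q 1)) :=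
      (mem_basicOpen_resF _ _).2 ⟨hx₂, (mem_basicOpen_pc _ _ _).2 ⟨hx, D.le_Q₂ hx₂⟩⟩
    rw [D.eq₂, mem_basicOpen_mul_iff, mem_basicOpen_resF, mem_basicOpen_pc] at h₁
    exact ⟨h₁.1.2, hx, D.le_Q₂ hx₂⟩
  -- On `W₁` one has `t = y * e₁`; where `t` is invertible, so is `y`.
  inf_le₁₃ := by
    rintro x ⟨hx₁ : x ∈ D.W₁, hx : P x ∈ P1.chart 0, hx' : Q x ∈ P1.chart 1⟩
    have h₁ : x ∈ S.basicOpen (resF D.le_P₁ (pc P 1)) :=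
      (mem_basicOpen_resF _ _).2 ⟨hx₁, (mem_basicOpen_pc _ _ _).2 ⟨hx, D.le_P₁ hx₁⟩⟩
    rw [D.eq₁, mem_basicOpen_mul_iff, mem_basicOpen_resF, mem_basicOpen_pc] at h₁
    exact ⟨⟨hx, D.le_P₁ hx₁⟩, h₁.1.2⟩
  y := unitOn Q inf_le_right
  t := unitOn P inf_le_left
  w := pc Q 0
  res_w := rfl
  x₁ := resF D.le_Q₁ (pc Q 1)
  res_x₁ := resF_resF _ _ _
  x₂ := D.e₁
  res_x₂ := by
    have h := congrArg (resF (show tor P ⊓ tor Q ≤ D.W₁ from D.tor_le 1)) D.eq₁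
    rw [map_mul] at h
    rw [Units.val_mul, Units.eq_mul_inv_iff_mul_eq, mul_comm]
    refine Eq.trans ?_ (h.symm.trans ?_)
    · rw [coe_unitOn]
      exact congrArg (· * _) (resF_resF _ _ _).symm
    · exact resF_resF _ _ _
  t₂ := resF D.le_P₂ (pc P 1)
  res_t₂ := resF_resF _ _ _
  v := D.e₂
  res_v := by
    have h := congrArg (resF (show tor P ⊓ tor Q ≤ D.W₂ from D.tor_le 2)) D.eq₂
    rw [map_mul] at h
    rw [Units.val_mul, Units.eq_mul_inv_iff_mul_eq, mul_comm]
    refine Eq.trans ?_ (h.symm.trans ?_)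
    · rw [coe_unitOn]
      exact congrArg (· * _) (resF_resF _ _ _).symm
    · exact resF_resF _ _ _
  s := resF inf_le_left (pc P 0)
  res_s := resF_resF _ _ _
  y₃ := resF inf_le_right (pc Q 1)
  res_y₃ := resF_resF _ _ _
  koszul := D.isAffineSpace₁.koszul

end BlowUpCharts

end

/-! ### The fibres over closed points -/

section

variable {X Y S Z : Scheme.{0}}

/-- The closed subscheme `ι : Z ⟶ S` is the fibre of `P` over the point of the `i`-th chart of the
projective line with coordinate `z`. -/
structure IsFibreOver (P : S ⟶ P1) (i : Fin 2) (z : ℂ) (ι : Z ⟶ S) : Prop where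
  mono : Mono ι
  le : ⊤ ≤ (ι ≫ P) ⁻¹ᵁ P1.chart i
  eq : pullF (ι ≫ P) le (P1.coord i (1 - i)) = cst ((ι ≫ P) ≫ P1.toSpecC) ⊤ z
  exists_lift : ∀ (X : Scheme.{0}) (f : X ⟶ S) (h : ⊤ ≤ (f ≫ P) ⁻¹ᵁ P1.chart i),
    pullF (f ≫ P) h (P1.coord i (1 - i)) = cst ((f ≫ P) ≫ P1.toSpecC) ⊤ z → ∃ g, g ≫ ι = f

lemma isAffineSpace_chart' (i : Fin 2) :
    IsAffineSpace P1.toSpecC (P1.chart i) (fun _ : Fin 1 ↦ P1.coord i (1 - i)) :=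
  P1.isAffineSpace_chart (by revert i; decide)

lemma le_preimage_of_comp {f : X ⟶ Y} {g : Y ⟶ Z} {h : X ⟶ Z} (hfg : f ≫ g = h) {V : Z.Opens}
    {W : X.Opens} (hW : W ≤ h ⁻¹ᵁ V) : W ≤ f ⁻¹ᵁ g ⁻¹ᵁ V := by
  subst hfg
  exact hW

/-- The residue field of a closed point is ℂ, so the coordinate takes there a constant value `z`; a
morphism to the chart with constant coordinate `z` factors through the residue field, which is the
universal property of the fibre. If `z` were nonzero, the coordinate would be a unit and the point
would lie in both charts. -/
theorem isFibreOver (π : S ⟶ P1) {τ : P1 ⟶ P1} [IsIso τ] (hτ : τ ≫ P1.toSpecC = P1.toSpecC)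
    {c : P1} (hc : IsClosed {c}) {i : Fin 2} (hi : τ c ∈ P1.chart i) :
    ∃ z, IsFibreOver (π ≫ τ) i z (π.fiberι c) ∧ (τ c ∉ P1.chart (1 - i) → z = 0) := by
  let j := P1.fromSpecResidueField c
  have hj : Spec.map (residueFieldIsoBase P1.toSpecC c hc).inv = j ≫ P1.toSpecC :=
    SpecMap_residueFieldIsoBase_inv _ _ _
  have hiso : IsIso (j ≫ P1.toSpecC) := by
    rw [← hj]
    infer_instance
  have hjc (x) : (j ≫ τ) x = τ c := by
    have : j x ∈ Set.range j := ⟨x, rfl⟩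
    rw [Scheme.range_fromSpecResidueField] at this
    rw [Scheme.Hom.comp_apply]
    exact congrArg τ this
  have hle : ⊤ ≤ (j ≫ τ) ⁻¹ᵁ P1.chart i := by
    intro x _
    change (j ≫ τ) x ∈ P1.chart i
    rwa [hjc]
  have hcst : Function.Surjective (cst (j ≫ P1.toSpecC) ⊤) := by
    have := (pullF_bijective (j ≫ P1.toSpecC) (V := ⊤) (W := ⊤) rfl).comp (specF_bijective ℂ)
    exact this.2
  obtain ⟨z, hz⟩ := hcst (pullF (j ≫ τ) hle (P1.coord i (1 - i)))
  have hmono : Mono (π.fiberι c) := inferInstance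
  have hfac : π.fiberι c ≫ π ≫ τ = π.fiberToSpecResidueField c ≫ j ≫ τ := by
    rw [← Category.assoc, Scheme.Hom.fiber_fac, Category.assoc]
  refine ⟨z, ⟨hmono, ?_, ?_, ?_⟩, ?_⟩
  · rw [hfac]
    exact fun x _ ↦ hle (x := π.fiberToSpecResidueField c x) trivial
  · have h₁ : ⊤ ≤ (π.fiberToSpecResidueField c ≫ j ≫ τ) ⁻¹ᵁ P1.chart i :=
      fun x _ ↦ hle (x := π.fiberToSpecResidueField c x) trivial
    have h₂ := congrArg (pullF (π.fiberToSpecResidueField c) (top_le_preimage_top _)) hz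
    rw [pullF_cst, pullF_pullF] at h₂
    rw [pullF_congr hfac, ← h₂, ← Category.assoc, hfac]
    simp [hτ]
  · intro X f h hf
    have h₁ : ((f ≫ π ≫ P1.toSpecC) ≫ inv (j ≫ P1.toSpecC)) ≫ j = f ≫ π := by
      rw [← cancel_mono τ]
      have hle' : ⊤ ≤ ((((f ≫ π ≫ P1.toSpecC) ≫ inv (j ≫ P1.toSpecC)) ≫ j) ≫ τ) ⁻¹ᵁ P1.chart i := by
        rw [Category.assoc]
        exact fun x _ ↦ hle (x := ((f ≫ π ≫ P1.toSpecC) ≫ inv (j ≫ P1.toSpecC)) x) trivial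
      have hle'' : ⊤ ≤ ((f ≫ π) ≫ τ) ⁻¹ᵁ P1.chart i := by
        rw [Category.assoc]
        exact h
      refine (isAffineSpace_chart' i).hom_ext hle' hle'' (by simp [hτ]) fun _ ↦ ?_
      have h₂ := congrArg (pullF ((f ≫ π ≫ P1.toSpecC) ≫ inv (j ≫ P1.toSpecC))
        (top_le_preimage_top _)) hz
      rw [pullF_cst, pullF_pullF] at h₂
      rw [pullF_congr (Category.assoc f π τ), hf, pullF_congr (Category.assoc _ j τ), ← h₂]
      simp [hτ]
    exact ⟨Limits.pullback.lift f _ h₁.symm, Limits.pullback.lift_fst _ _ _⟩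
  · intro hci
    by_contra hz0
    have hu : IsUnit (pullF (j ≫ τ) hle (P1.coord i (1 - i))) :=
      hz ▸ (IsUnit.mk0 z hz0).map _
    obtain ⟨x⟩ : Nonempty (Spec (P1.residueField c)) := inferInstance
    have h := mem_basicOpen_of_isUnit_pullF (j ≫ τ) hle hu (x := x) trivial
    rw [P1.basicOpen_coord] at h
    have h' := h.2
    rw [hjc] at h'
    exact hci h'

/-- Lifting to the blow-up away from the centre. -/
theorem IsBlowUpAtPoint.existsUnique_lift {p₁ p₂ : Y ⟶ P1}
    (hp : IsPullback p₁ p₂ P1.toSpecC P1.toSpecC) {q : Y} {hq : IsClosed {q}}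
    (hq₁ : p₁ q ∉ P1.chart 0) {φ : S ⟶ Y} (hφ : IsBlowUpAtPoint φ q hq) {f₁ f₂ : X ⟶ P1}
    (h : f₁ ≫ P1.toSpecC = f₂ ≫ P1.toSpecC) (hf₁ : ⊤ ≤ f₁ ⁻¹ᵁ P1.chart 0) :
    ∃! g : X ⟶ S, g ≫ φ ≫ p₁ = f₁ ∧ g ≫ φ ≫ p₂ = f₂ := by
  have htop : (Scheme.IdealSheafData.vanishingIdeal ⟨{q}, hq⟩).comap (hp.lift f₁ f₂ h) = ⊤ := by
    refine comap_vanishingIdeal_eq_top hq _ fun x hx ↦ hq₁ ?_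
    have h₁ : f₁ x ∈ P1.chart 0 := hf₁ (x := x) trivial
    rw [← hp.lift_fst f₁ f₂ h, Scheme.Hom.comp_apply, hx] at h₁
    exact h₁
  obtain ⟨g, hg, huniq⟩ := hφ.2 X (hp.lift f₁ f₂ h) (by rw [htop]; exact isEffectiveCartier_top)
  refine ⟨g, ⟨?_, ?_⟩, fun g' hg' ↦ huniq g' ?_⟩
  · rw [← Category.assoc]
    exact (congrArg (· ≫ p₁) hg).trans (hp.lift_fst f₁ f₂ h)
  · rw [← Category.assoc]
    exact (congrArg (· ≫ p₂) hg).trans (hp.lift_snd f₁ f₂ h)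
  · refine hp.hom_ext ?_ ?_
    · rw [Category.assoc, hg'.1, hp.lift_fst]
    · rw [Category.assoc, hg'.2, hp.lift_snd]

/-- The general fibres are projective lines. -/
theorem IsFibreOver.exists_iso {P Q : S ⟶ P1} {z : ℂ} {ι : Z ⟶ S} (hι : IsFibreOver P 0 z ι)
    (hcomm : P ≫ P1.toSpecC = Q ≫ P1.toSpecC)
    (hS : ∀ (X : Scheme.{0}) (f₁ f₂ : X ⟶ P1), f₁ ≫ P1.toSpecC = f₂ ≫ P1.toSpecC →
      ⊤ ≤ f₁ ⁻¹ᵁ P1.chart 0 → ∃! g : X ⟶ S, g ≫ P = f₁ ∧ g ≫ Q = f₂) :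
    ∃ e : P1 ≅ Z, e.hom ≫ ι ≫ P ≫ P1.toSpecC = P1.toSpecC ∧ e.hom ≫ ι ≫ Q = 𝟙 P1 ∧
      ⊤ ≤ (e.hom ≫ ι ≫ P) ⁻¹ᵁ P1.chart 0 := by
  have := hι.mono
  -- `k` is the constant map to the point with coordinate `z`. Lifting `(k, 𝟙)` to `S` parametrizes
  -- the fibre, with inverse the restriction of `Q`.
  obtain ⟨k, hk, hks, hkz⟩ := (isAffineSpace_chart' 0).exists_hom P1.toSpecC
    fun _ ↦ cst P1.toSpecC ⊤ z
  obtain ⟨g, ⟨hgP, hgQ⟩, -⟩ := hS _ k (𝟙 P1) (by simpa using hks) hk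
  have hle : ⊤ ≤ (g ≫ P) ⁻¹ᵁ P1.chart 0 := by rwa [hgP]
  obtain ⟨e, he⟩ := hι.exists_lift _ g hle (by rw [pullF_congr hgP, hkz 0, hgP, hks])
  refine ⟨⟨e, ι ≫ Q, ?_, ?_⟩, ?_, ?_, ?_⟩
  · rw [← Category.assoc, he, hgQ]
  · rw [← cancel_mono ι]
    have hle₁ : ⊤ ≤ (ι ≫ P) ⁻¹ᵁ P1.chart 0 := hι.le
    refine (hS _ (ι ≫ P) (ι ≫ Q) (by simp [hcomm]) hι.le).unique ⟨?_, ?_⟩ (by simp)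
    · have h : (((ι ≫ Q) ≫ e) ≫ ι) ≫ P = (ι ≫ Q) ≫ k := by
        simp only [Category.assoc, he, hgP]
      rw [h]
      have hle₂ : ⊤ ≤ ((ι ≫ Q) ≫ k) ⁻¹ᵁ P1.chart 0 :=
        fun x _ ↦ hk (x := (ι ≫ Q) x) trivial
      refine (isAffineSpace_chart' 0).hom_ext hle₂ hle₁ (by simp [hks, hcomm]) fun _ ↦ ?_
      have h₂ := congrArg (pullF (ι ≫ Q) (top_le_preimage_top _)) (hkz 0)
      rw [pullF_pullF, pullF_cst] at h₂
      refine h₂.trans (Eq.trans ?_ hι.eq.symm)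
      simp [hcomm]
    · simp only [Category.assoc]
      rw [reassoc_of% he, hgQ]
      simp
  · rw [reassoc_of% he, reassoc_of% hgP, hks]
  · rw [reassoc_of% he, hgQ]
  · rw [reassoc_of% he]
    exact hle

end

/-! ### The charts of the nodal fibre -/

/-- The charts of a union of two projective lines meeting in a node: two affine lines and a
nodal conic. -/
structure NodalCharts {Z : Scheme.{0}} (s : Z ⟶ Spec (.of ℂ)) where
  Z₀ : Z.Opens
  Z₁ : Z.Opens
  Z₂ : Z.Opens
  cover : ∀ x, x ∈ Z₀ ∨ x ∈ Z₁ ∨ x ∈ Z₂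
  disjoint : ∀ x ∈ Z₀, x ∉ Z₂
  w : Γ(Z, Z₀)
  v : Γ(Z, Z₂)
  isAffineSpace_w : IsAffineSpace s Z₀ (fun _ : Fin 1 ↦ w)
  isAffineSpace_v : IsAffineSpace s Z₂ (fun _ : Fin 1 ↦ v)
  isAffineOpen : IsAffineOpen Z₁
  x₁ : Γ(Z, Z₁)
  x₂ : Γ(Z, Z₁)
  surjective : Function.Surjective (MvPolynomial.eval₂Hom (cst s Z₁) ![x₁, x₂])
  dvd : ∀ p, MvPolynomial.eval₂Hom (cst s Z₁) ![x₁, x₂] p = 0 →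
    MvPolynomial.X 0 * MvPolynomial.X 1 ∣ p
  mul_eq_zero : x₁ * x₂ = 0
  basicOpen_w : Z.basicOpen w = Z₀ ⊓ Z₁
  basicOpen_x₁ : Z.basicOpen x₁ = Z₀ ⊓ Z₁
  w_mul_x₁ : resF inf_le_left w * resF (inf_le_right : Z₀ ⊓ Z₁ ≤ Z₁) x₁ = 1
  basicOpen_v : Z.basicOpen v = Z₂ ⊓ Z₁
  basicOpen_x₂ : Z.basicOpen x₂ = Z₂ ⊓ Z₁
  v_mul_x₂ : resF inf_le_left v * resF (inf_le_right : Z₂ ⊓ Z₁ ≤ Z₁) x₂ = 1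

section

variable {S Z : Scheme.{0}}

/-- The other order of the branches. -/
def NodalCharts.symm {s : Z ⟶ Spec (.of ℂ)} (N : NodalCharts s) : NodalCharts s where
  Z₀ := N.Z₂
  Z₁ := N.Z₁
  Z₂ := N.Z₀
  cover x := by
    have := N.cover x
    tauto
  disjoint x hx hx' := N.disjoint x hx' hx
  w := N.v
  v := N.w
  isAffineSpace_w := N.isAffineSpace_v
  isAffineSpace_v := N.isAffineSpace_w
  isAffineOpen := N.isAffineOpen
  x₁ := N.x₂
  x₂ := N.x₁
  surjective f := by
    obtain ⟨p, hp⟩ := N.surjective f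
    refine ⟨MvPolynomial.rename (Equiv.swap (0 : Fin 2) 1) p, ?_⟩
    rw [← hp, MvPolynomial.coe_eval₂Hom, MvPolynomial.coe_eval₂Hom, MvPolynomial.eval₂_rename]
    congr 1
    ext i
    fin_cases i <;> simp
  dvd p hp := by
    obtain ⟨d, hd⟩ := N.dvd (MvPolynomial.rename (Equiv.swap (0 : Fin 2) 1) p) (by
      rw [← hp, MvPolynomial.coe_eval₂Hom, MvPolynomial.coe_eval₂Hom, MvPolynomial.eval₂_rename]
      congr 1
      ext i
      fin_cases i <;> simp)
    refine ⟨MvPolynomial.rename (Equiv.swap (0 : Fin 2) 1) d, ?_⟩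
    have h := congrArg (MvPolynomial.rename (Equiv.swap (0 : Fin 2) 1)) hd
    rw [MvPolynomial.rename_rename] at h
    have h' : (Equiv.swap (0 : Fin 2) 1) ∘ (Equiv.swap (0 : Fin 2) 1) = id := by
      ext i
      simp
    rw [h', MvPolynomial.rename_id_apply] at h
    rw [h]
    simp [mul_comm]
  mul_eq_zero := (mul_comm _ _).trans N.mul_eq_zero
  basicOpen_w := N.basicOpen_v
  basicOpen_x₁ := N.basicOpen_x₂
  w_mul_x₁ := N.v_mul_x₂
  basicOpen_v := N.basicOpen_w
  basicOpen_x₂ := N.basicOpen_x₁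
  v_mul_x₂ := N.w_mul_x₁

variable {P Q : S ⟶ P1} {ι : Z ⟶ S}

lemma IsFibreOver.pullF_pc_eq_zero (hι : IsFibreOver P 1 0 ι) {V : Z.Opens}
    (h : V ≤ ι ⁻¹ᵁ P ⁻¹ᵁ P1.chart 1) : pullF ι h (pc P 1) = 0 := by
  have h₁ := congrArg (resF (le_top : V ≤ ⊤)) hι.eq
  rw [map_zero, map_zero, resF_pullF] at h₁
  exact (pullF_pullF _ _ _ _ _).trans h₁

lemma IsFibreOver.exists_lift' (hι : IsFibreOver P 1 0 ι) {X : Scheme.{0}} (f : X ⟶ S)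
    (h : ⊤ ≤ f ⁻¹ᵁ P ⁻¹ᵁ P1.chart 1) (hf : pullF f h (pc P 1) = 0) : ∃ g, g ≫ ι = f := by
  refine hι.exists_lift X f h ?_
  exact ((pullF_pullF _ _ _ _ _).symm.trans hf).trans (map_zero _).symm

/-- The components of the fibre away from the node. -/
theorem IsFibreOver.isAffineSpace (hι : IsFibreOver P 1 0 ι) {W : S.Opens}
    (hW : W ≤ P ⁻¹ᵁ P1.chart 1) {u : Γ(S, W)}
    (hu : IsAffineSpace (P ≫ P1.toSpecC) W ![resF hW (pc P 1), u]) :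
    IsAffineSpace ((ι ≫ P) ≫ P1.toSpecC) (ι ⁻¹ᵁ W) (fun _ : Fin 1 ↦ pullF ι le_rfl u) := by
  have hmono := hι.mono
  obtain ⟨f, hf, hfs, hfa⟩ := hu.exists_hom (specC (Fin 1)) ![0, specF _ (.X 0)]
  have hf0 : pullF f hf (resF hW (pc P 1)) = 0 := hfa 0
  obtain ⟨k, hk⟩ := hι.exists_lift' f (hf.trans fun x hx ↦ hW hx) (by rw [← pullF_resF f hf hW, hf0])
  have hkW : ⊤ ≤ k ⁻¹ᵁ ι ⁻¹ᵁ W := le_preimage_of_comp hk hf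
  refine isAffineSpace_of_section k hkW (by simp only [Category.assoc, reassoc_of% hk, hfs])
    (fun i ↦ ?_) fun g hg hgs hga ↦ ?_
  · rw [pullF_pullF, pullF_congr hk, Subsingleton.elim i 0]
    exact hfa 1
  · have hι' := top_le_ι_preimage (ι ⁻¹ᵁ W)
    rw [← cancel_mono ι]
    refine hu.hom_ext (fun _ hx ↦ hg hx) (fun _ hx ↦ hι' hx)
      (by simpa using hgs) fun i ↦ ?_
    fin_cases i
    · have h₀ : pullF ι (le_refl (ι ⁻¹ᵁ W)) (resF hW (pc P 1)) = 0 :=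
        (pullF_resF ι _ hW _).trans (hι.pullF_pc_eq_zero _)
      have h (X : Scheme.{0}) (j : X ⟶ Z) (hj : ⊤ ≤ j ⁻¹ᵁ ι ⁻¹ᵁ W) :
          pullF (j ≫ ι) (fun _ hx ↦ hj hx) (resF hW (pc P 1)) = 0 :=
        (pullF_pullF j ι hj le_rfl _).symm.trans
          ((congrArg (pullF j hj) h₀).trans (map_zero (pullF j hj)))
      exact (h _ g hg).trans (h _ _ hι').symm
    · exact (pullF_pullF g ι hg le_rfl u).symm.trans
        ((hga 0).trans (pullF_pullF _ ι hι' le_rfl u))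

/-- The neighbourhood of the node in the fibre. -/
theorem IsFibreOver.isChart (hι : IsFibreOver P 1 0 ι) {W : S.Opens}
    (hW : W ≤ P ⁻¹ᵁ P1.chart 1) {a b : Γ(S, W)} (hab : resF hW (pc P 1) = a * b)
    (hu : IsAffineSpace (P ≫ P1.toSpecC) W ![a, b]) : IsAffineOpen (ι ⁻¹ᵁ W) ∧
      Function.Surjective (MvPolynomial.eval₂Hom (cst ((ι ≫ P) ≫ P1.toSpecC) (ι ⁻¹ᵁ W))
        ![pullF ι le_rfl a, pullF ι le_rfl b]) ∧
      ∀ p, MvPolynomial.eval₂Hom (cst ((ι ≫ P) ≫ P1.toSpecC) (ι ⁻¹ᵁ W))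
        ![pullF ι le_rfl a, pullF ι le_rfl b] p = 0 → MvPolynomial.X 0 * MvPolynomial.X 1 ∣ p := by
  have hmono := hι.mono
  let θ := MvPolynomial.eval₂Hom (cst ((ι ≫ P) ≫ P1.toSpecC) (ι ⁻¹ᵁ W))
        ![pullF ι le_rfl a, pullF ι le_rfl b]
  let I : Ideal (MvPolynomial (Fin 2) ℂ) := Ideal.span {MvPolynomial.X 0 * MvPolynomial.X 1}
  have hθ0 : pullF ι le_rfl a * pullF ι le_rfl b = 0 := by
    rw [← map_mul, ← hab, pullF_resF, hι.pullF_pc_eq_zero]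
  have hθ (p) (hp : p ∈ I) : θ p = 0 := by
    obtain ⟨d, rfl⟩ := Ideal.mem_span_singleton.1 hp
    have : θ (MvPolynomial.X 0 * MvPolynomial.X 1) = 0 := by
      simp only [θ, map_mul, MvPolynomial.coe_eval₂Hom, MvPolynomial.eval₂_X]
      exact hθ0
    rw [map_mul, this, zero_mul]
  have hθp (p) : θ p = pullF ι le_rfl (MvPolynomial.eval₂Hom (cst (P ≫ P1.toSpecC) W) ![a, b] p) := by
    have : θ = (pullF ι le_rfl).comp (MvPolynomial.eval₂Hom (cst (P ≫ P1.toSpecC) W) ![a, b]) := by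
      refine MvPolynomial.ringHom_ext (fun c ↦ by simp [θ]) fun i ↦ ?_
      fin_cases i <;> simp [θ]
    exact congr($this p)
  let ρ : MvPolynomial (Fin 2) ℂ ⧸ I →+* Γ(Z, ι ⁻¹ᵁ W) := Ideal.Quotient.lift I θ hθ
  -- The tautological point of the plane restricted to the two axes satisfies `a * b = 0`, which is
  -- the equation of the fibre, so it factors through the fibre.
  obtain ⟨f, hf, hfa⟩ := IsChart.exists_hom hu
    ((specF (MvPolynomial (Fin 2) ℂ ⧸ I)).comp (Ideal.Quotient.mk I))
  have hf0 : pullF f hf (resF hW (pc P 1)) = 0 := by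
    have := hfa (MvPolynomial.X 0 * MvPolynomial.X 1)
    simp only [map_mul, MvPolynomial.coe_eval₂Hom, MvPolynomial.eval₂_X] at this
    have h' : pullF f hf (a * b) = 0 := by
      rw [map_mul]
      refine this.trans ?_
      rw [← map_mul, RingHom.comp_apply, Ideal.Quotient.eq_zero_iff_mem.2
        (Ideal.mem_span_singleton_self _), map_zero]
    rw [hab, h']
  obtain ⟨k, hk⟩ := hι.exists_lift' f (hf.trans fun x hx ↦ hW hx) (by rw [← pullF_resF f hf hW, hf0])
  have hkW : ⊤ ≤ k ⁻¹ᵁ ι ⁻¹ᵁ W := le_preimage_of_comp hk hf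
  have hchart : IsChart (ι ⁻¹ᵁ W) ρ := by
    refine isChart_of_section k hkW (fun r ↦ ?_) fun g hg hga ↦ ?_
    · obtain ⟨p, rfl⟩ := Ideal.Quotient.mk_surjective r
      rw [Ideal.Quotient.lift_mk, hθp, pullF_pullF, pullF_congr hk, hfa]
      rfl
    · have hι' := top_le_ι_preimage (ι ⁻¹ᵁ W)
      rw [← cancel_mono ι]
      refine IsChart.hom_ext hu (fun _ hx ↦ hg hx) (fun _ hx ↦ hι' hx) fun p ↦ ?_
      have := hga (Ideal.Quotient.mk I p)
      rw [Ideal.Quotient.lift_mk, hθp, pullF_pullF, pullF_pullF] at this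
      exact this
  refine ⟨hchart.1, fun z ↦ ?_, fun p hp ↦ ?_⟩
  · obtain ⟨r, hr⟩ := hchart.2.2 z
    obtain ⟨p, rfl⟩ := Ideal.Quotient.mk_surjective r
    exact ⟨p, hr⟩
  · have : Ideal.Quotient.mk I p = 0 := hchart.2.1 (by rw [map_zero]; exact hp)
    exact Ideal.mem_span_singleton.1 (Ideal.Quotient.eq_zero_iff_mem.1 this)

lemma preimage_basicOpen' (ι : Z ⟶ S) {W : S.Opens} (a : Γ(S, W)) :
    Z.basicOpen (pullF ι (le_refl (ι ⁻¹ᵁ W)) a) = ι ⁻¹ᵁ S.basicOpen a := by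
  refine (Scheme.basicOpen_appLE _ _ _ _ _).trans (inf_eq_right.2 ?_)
  exact fun x hx ↦ S.basicOpen_le a hx

/-- The charts of the nodal fibre. -/
def IsFibreOver.nodalCharts (hι : IsFibreOver P 1 0 ι) (D : BlowUpCharts P Q) :
    NodalCharts ((ι ≫ P) ≫ P1.toSpecC) where
  Z₀ := ι ⁻¹ᵁ (P ⁻¹ᵁ P1.chart 1 ⊓ Q ⁻¹ᵁ P1.chart 0)
  Z₁ := ι ⁻¹ᵁ D.W₁
  Z₂ := ι ⁻¹ᵁ D.W₂
  cover x := by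
    have hP : P (ι x) ∈ P1.chart 1 := hι.le (x := x) trivial
    rcases mem_chart (Q (ι x)) with hQ | hQ
    · exact .inl ⟨hP, hQ⟩
    · exact .inr (D.le_sup ⟨hP, hQ⟩)
  -- On the fibre `t` vanishes, so `y = t * e₂` vanishes on its part in `W₂`; but `y` is invertible
  -- at a point of `W₂` lying over `P1.chart 0` under `Q`.
  disjoint x hx hx' := by
    have hx₂ : ι x ∈ D.W₂ := hx'
    have h₁ : ι x ∈ S.basicOpen (resF D.le_Q₂ (pc Q 1)) :=
      (mem_basicOpen_resF _ _).2 ⟨hx₂, (mem_basicOpen_pc _ _ _).2 ⟨hx.2, D.le_Q₂ hx₂⟩⟩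
    have h₂ : x ∈ Z.basicOpen (pullF ι (le_refl (ι ⁻¹ᵁ D.W₂)) (resF D.le_Q₂ (pc Q 1))) := by
      rw [preimage_basicOpen']
      exact h₁
    rw [D.eq₂, map_mul, pullF_resF, hι.pullF_pc_eq_zero, zero_mul, Z.basicOpen_zero] at h₂
    exact h₂
  w := pullF ι le_rfl (resF inf_le_right (pc Q 0))
  v := pullF ι le_rfl D.e₂
  isAffineSpace_w := hι.isAffineSpace inf_le_left (D.isAffineSpace 1 0 (.inr rfl))
  isAffineSpace_v := hι.isAffineSpace D.le_P₂ D.isAffineSpace₂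
  isAffineOpen := (hι.isChart D.le_P₁ D.eq₁ D.isAffineSpace₁).1
  x₁ := pullF ι le_rfl (resF D.le_Q₁ (pc Q 1))
  x₂ := pullF ι le_rfl D.e₁
  surjective := (hι.isChart D.le_P₁ D.eq₁ D.isAffineSpace₁).2.1
  dvd := (hι.isChart D.le_P₁ D.eq₁ D.isAffineSpace₁).2.2
  mul_eq_zero := by
    rw [← map_mul, ← D.eq₁, pullF_resF, hι.pullF_pc_eq_zero]
  basicOpen_w := by
    rw [preimage_basicOpen']
    ext x
    change ι x ∈ S.basicOpen _ ↔ _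
    rw [mem_basicOpen_resF, mem_basicOpen_pc]
    exact ⟨fun h ↦ ⟨h.1, D.le₁ ⟨h.1.1, h.2⟩⟩, fun h ↦ ⟨h.1, h.1.2, D.le_Q₁ h.2⟩⟩
  basicOpen_x₁ := by
    rw [preimage_basicOpen']
    ext x
    change ι x ∈ S.basicOpen _ ↔ _
    rw [mem_basicOpen_resF, mem_basicOpen_pc]
    exact ⟨fun h ↦ ⟨⟨D.le_P₁ h.1, h.2.1⟩, h.1⟩, fun h ↦ ⟨h.2, h.1.2, D.le_Q₁ h.2⟩⟩
  w_mul_x₁ := by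
    have h := congrArg (pullF ι (le_refl (ι ⁻¹ᵁ (P ⁻¹ᵁ P1.chart 1 ⊓ Q ⁻¹ᵁ P1.chart 0 ⊓ D.W₁))))
      (pc_mul_pc Q (inf_le_right.trans D.le_Q₁)
        ((inf_le_left : P ⁻¹ᵁ P1.chart 1 ⊓ Q ⁻¹ᵁ P1.chart 0 ⊓ D.W₁ ≤ _).trans inf_le_right))
    rw [map_mul, map_one, pullF_resF, pullF_resF, mul_comm] at h
    rw [resF_pullF, resF_pullF, pullF_resF, pullF_resF]
    exact h
  basicOpen_v := by
    rw [preimage_basicOpen']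
    ext x
    refine ⟨fun h ↦ ⟨S.basicOpen_le _ h, D.basicOpen_le₂ h⟩, fun h ↦ ?_⟩
    have h₁ : ι x ∈ D.W₁ ⊓ D.W₂ := ⟨h.2, h.1⟩
    rw [← S.basicOpen_of_isUnit (IsUnit.of_mul_eq_one_right _ D.mul_eq_one),
      mem_basicOpen_resF] at h₁
    exact h₁.2
  basicOpen_x₂ := by
    rw [preimage_basicOpen']
    ext x
    refine ⟨fun h ↦ ⟨D.basicOpen_le₁ h, S.basicOpen_le _ h⟩, fun h ↦ ?_⟩
    have h₁ : ι x ∈ D.W₁ ⊓ D.W₂ := ⟨h.2, h.1⟩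
    rw [← S.basicOpen_of_isUnit (IsUnit.of_mul_eq_one _ D.mul_eq_one),
      mem_basicOpen_resF] at h₁
    exact h₁.2
  v_mul_x₂ := by
    have h := congrArg (pullF ι (show ι ⁻¹ᵁ D.W₂ ⊓ ι ⁻¹ᵁ D.W₁ ≤ ι ⁻¹ᵁ (D.W₁ ⊓ D.W₂) from
      fun x hx ↦ ⟨hx.2, hx.1⟩)) D.mul_eq_one
    rw [map_mul, map_one, pullF_resF, pullF_resF, mul_comm] at h
    rw [resF_pullF, resF_pullF]
    exact h

end

/-! ### Modules that are locally free of rank `r`, and their reductions modulo a prime -/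

section LocalBasis

variable {A N : Type*} [CommRing A] [AddCommGroup N] [Module A N] {r : ℕ}

/-- `s` becomes a basis of the module after inverting `g`. -/
structure IsLocalBasis (g : A) (s : Fin r → N) : Prop where
  exists_eq : ∀ x : N, ∃ (n : ℕ) (c : Fin r → A), g ^ n • x = ∑ j, c j • s j
  eq_zero : ∀ c : Fin r → A, ∑ j, c j • s j = 0 → ∃ n : ℕ, ∀ j, g ^ n * c j = 0

lemma IsLocalBasis.exists_eq_of_mem {g : A} {s : Fin r → N} (h : IsLocalBasis g s) (I : Ideal A)
    {x : N} (hx : x ∈ I • (⊤ : Submodule A N)) :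
    ∃ (n : ℕ) (c : Fin r → A), (∀ j, c j ∈ I) ∧ g ^ n • x = ∑ j, c j • s j := by
  refine Submodule.smul_induction_on hx (fun a ha y _ ↦ ?_) ?_
  · obtain ⟨n, c, hc⟩ := h.exists_eq y
    refine ⟨n, fun j ↦ a * c j, fun j ↦ I.mul_mem_right _ ha, ?_⟩
    rw [smul_comm, hc, Finset.smul_sum]
    simp only [mul_smul]
  · rintro y z ⟨n, c, hcI, hc⟩ ⟨k, d, hdI, hd⟩
    refine ⟨n + k, fun j ↦ g ^ k * c j + g ^ n * d j,
      fun j ↦ I.add_mem (I.mul_mem_left _ (hcI j)) (I.mul_mem_left _ (hdI j)), ?_⟩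
    simp only [add_smul, mul_smul, Finset.sum_add_distrib, ← Finset.smul_sum, ← hc, ← hd, smul_add]
    simp only [← mul_smul, pow_add, mul_comm]

/-- A local basis remains independent modulo a prime that does not contain the inverted element `g`,
since powers of `g` can be cancelled modulo that prime. -/
lemma IsLocalBasis.mem_of_sum_mem {g : A} {s : Fin r → N} (h : IsLocalBasis g s) (I : Ideal A)
    [I.IsPrime] (hg : g ∉ I) {c : Fin r → A} (hc : ∑ j, c j • s j ∈ I • (⊤ : Submodule A N))
    (j : Fin r) : c j ∈ I := by
  obtain ⟨n, d, hdI, hd⟩ := h.exists_eq_of_mem I hc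
  obtain ⟨k, hk⟩ := h.eq_zero (fun j ↦ g ^ n * c j - d j) (by
    simp only [sub_smul, mul_smul, Finset.sum_sub_distrib, ← Finset.smul_sum, hd, sub_self])
  have h1 : g ^ (k + n) * c j ∈ I := by
    have : g ^ (k + n) * c j = g ^ k * d j := by linear_combination hk j
    rw [this]
    exact I.mul_mem_left _ (hdI j)
  exact (Ideal.IsPrime.mem_or_mem ‹_› h1).resolve_left fun h2 ↦
    hg (Ideal.IsPrime.mem_of_pow_mem ‹_› _ h2)

variable {ι : Type*} {g : ι → A} (hg : Ideal.span (Set.range g) = ⊤)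
  {s : ι → Fin r → N} (hs : ∀ i, IsLocalBasis (g i) (s i))

lemma exists_notMem_of_span_eq_top (hg : Ideal.span (Set.range g) = ⊤) (I : Ideal A) [h : I.IsPrime] :
    ∃ i, g i ∉ I := by
  by_contra! h'
  exact h.ne_top (top_le_iff.1 (hg ▸ Ideal.span_le.2 (by rintro _ ⟨i, rfl⟩; exact h' i)))

lemma mem_of_forall_pow_smul_mem (hg : Ideal.span (Set.range g) = ⊤) (N' : Submodule A N) {x : N}
    (h : ∀ i, ∃ n : ℕ, g i ^ n • x ∈ N') : x ∈ N' := by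
  refine Submodule.mem_of_span_eq_top_of_smul_pow_mem N' _ hg x ?_
  rintro ⟨_, i, rfl⟩
  exact h i

lemma finite_of_isLocalBasis [Finite ι] (hg : Ideal.span (Set.range g) = ⊤)
    (hs : ∀ i, IsLocalBasis (g i) (s i)) : Module.Finite A N := by
  refine ⟨Submodule.fg_def.2 ⟨Set.range fun x : ι × Fin r ↦ s x.1 x.2, Set.finite_range _, ?_⟩⟩
  refine top_le_iff.1 fun x _ ↦ mem_of_forall_pow_smul_mem hg _ fun i ↦ ?_
  obtain ⟨n, c, hc⟩ := (hs i).exists_eq x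
  exact ⟨n, hc ▸ Submodule.sum_mem _ fun j _ ↦ Submodule.smul_mem _ _
    (Submodule.subset_span ⟨(i, j), rfl⟩)⟩

/-- This is torsion-freeness of `N / I N` over `A / I`. It is checked after inverting each `g i`: if
`g i ∈ I` there is nothing to prove, and otherwise coordinates in the local basis can be compared.
-/
lemma mem_of_smul_mem (hg : Ideal.span (Set.range g) = ⊤)
    (hs : ∀ i, IsLocalBasis (g i) (s i)) (I : Ideal A) [I.IsPrime] {a : A} (ha : a ∉ I) {x : N}
    (hx : a • x ∈ I • (⊤ : Submodule A N)) : x ∈ I • (⊤ : Submodule A N) := by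
  refine mem_of_forall_pow_smul_mem hg _ fun i ↦ ?_
  by_cases hi : g i ∈ I
  · exact ⟨1, by
      rw [pow_one]
      exact Submodule.smul_mem_smul hi trivial⟩
  obtain ⟨n, c, hc⟩ := (hs i).exists_eq x
  refine ⟨n, hc ▸ Submodule.sum_mem _ fun j _ ↦ Submodule.smul_mem_smul ?_ trivial⟩
  refine (Ideal.IsPrime.mem_or_mem ‹I.IsPrime›
    ((hs i).mem_of_sum_mem I hi (c := fun j ↦ a * c j) ?_ j)).resolve_left ha
  simp only [mul_smul, ← Finset.smul_sum, ← hc]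
  rw [smul_comm]
  exact Submodule.smul_mem _ _ hx

/-- `p` generates the module modulo `I`. -/
def GeneratesMod (I : Ideal A) (p : Fin r → N) : Prop :=
  ∀ x : N, ∃ c : Fin r → A, x - ∑ j, c j • p j ∈ I • (⊤ : Submodule A N)

lemma GeneratesMod.mono {I I' : Ideal A} (h : I ≤ I') {p : Fin r → N} (hp : GeneratesMod I p) :
    GeneratesMod I' p := fun x ↦
  let ⟨c, hc⟩ := hp x
  ⟨c, Submodule.smul_mono_left h hc⟩

/-- The module `N / I N` is finite and torsion-free over the principal ideal domain `A / I`, hence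
free. A local basis at some `g i ∉ I` bounds its rank by `r`, and a basis is padded with zeros to
`r` generators. -/
lemma exists_generatesMod [Finite ι] (hg : Ideal.span (Set.range g) = ⊤)
    (hs : ∀ i, IsLocalBasis (g i) (s i)) (I : Ideal A) [I.IsPrime] [IsPrincipalIdealRing (A ⧸ I)] :
    ∃ p : Fin r → N, GeneratesMod I p := by
  let Q := N ⧸ (I • (⊤ : Submodule A N))
  have : Module.Finite A N := finite_of_isLocalBasis hg hs
  have : Module.Finite A Q := inferInstance
  have : Module.Finite (A ⧸ I) Q := Module.Finite.of_restrictScalars_finite A _ _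
  have : Module.IsTorsionFree (A ⧸ I) Q := by
    refine Module.isTorsionFree_iff_smul_eq_zero.2 fun a x h ↦ ?_
    obtain ⟨a, rfl⟩ := Ideal.Quotient.mk_surjective a
    obtain ⟨x, rfl⟩ := Submodule.mkQ_surjective _ x
    refine or_iff_not_imp_left.2 fun ha ↦ (Submodule.Quotient.mk_eq_zero _).2 ?_
    exact mem_of_smul_mem hg hs I (fun h' ↦ ha (Ideal.Quotient.eq_zero_iff_mem.2 h'))
      ((Submodule.Quotient.mk_eq_zero _).1 h)
  obtain ⟨n, b⟩ := Module.basisOfFiniteTypeTorsionFree' (R := A ⧸ I) (M := Q)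
  choose p hp using fun k ↦ Submodule.mkQ_surjective (I • (⊤ : Submodule A N)) (b k)
  have key : ∀ c : Fin n → A, ∑ k, c k • p k ∈ I • (⊤ : Submodule A N) → ∀ k, c k ∈ I := by
    intro c hc k
    have h1 : ∑ k, Ideal.Quotient.mk I (c k) • b k = 0 := by
      rw [← (Submodule.Quotient.mk_eq_zero _).2 hc, ← Submodule.mkQ_apply, map_sum]
      refine Finset.sum_congr rfl fun k _ ↦ ?_
      rw [map_smul, hp]
      rfl
    exact Ideal.Quotient.eq_zero_iff_mem.1
      (Fintype.linearIndependent_iff.1 b.linearIndependent _ h1 k)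
  have hgen : ∀ x : N, ∃ c : Fin n → A, x - ∑ k, c k • p k ∈ I • (⊤ : Submodule A N) := by
    intro x
    choose c hc using fun k ↦ Ideal.Quotient.mk_surjective (b.repr (Submodule.mkQ _ x) k)
    refine ⟨c, (Submodule.Quotient.mk_eq_zero _).1 ?_⟩
    rw [← Submodule.mkQ_apply, map_sub, sub_eq_zero, map_sum]
    refine (b.sum_repr _).symm.trans (Finset.sum_congr rfl fun k _ ↦ ?_)
    rw [map_smul, hp, ← hc]
    rfl
  have hn : n ≤ r := by
    obtain ⟨i, hi⟩ := exists_notMem_of_span_eq_top hg I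
    choose l G hG using fun k ↦ (hs i).exists_eq (p k)
    let f : (Fin n → A ⧸ I) →ₗ[A ⧸ I] (Fin r → A ⧸ I) :=
      Matrix.vecMulLinear (Matrix.of fun k j ↦ Ideal.Quotient.mk I (G k j))
    have hf : Function.Injective f := by
      refine (injective_iff_map_eq_zero f).2 fun c hc ↦ ?_
      choose c' hc' using fun k ↦ Ideal.Quotient.mk_surjective (c k)
      have h2 := key (fun k ↦ c' k * g i ^ l k) (by
        simp only [mul_smul, hG, Finset.smul_sum]
        rw [Finset.sum_comm]
        simp only [← mul_smul, ← Finset.sum_smul]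
        refine Submodule.sum_mem _ fun j _ ↦ Submodule.smul_mem_smul ?_ trivial
        refine Ideal.Quotient.eq_zero_iff_mem.1 ?_
        have := congrFun hc j
        simpa [f, Matrix.vecMul, dotProduct, ← hc'] using this)
      funext k
      rw [← hc' k]
      exact Ideal.Quotient.eq_zero_iff_mem.2 ((Ideal.IsPrime.mem_or_mem ‹_› (h2 k)).resolve_right
        fun h3 ↦ hi (Ideal.IsPrime.mem_of_pow_mem ‹_› _ h3))
    simpa using LinearMap.finrank_le_finrank_of_injective hf
  refine ⟨fun j ↦ if h : (j : ℕ) < n then p ⟨j, h⟩ else 0, fun x ↦ ?_⟩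
  obtain ⟨c, hc⟩ := hgen x
  refine ⟨fun j ↦ if h : (j : ℕ) < n then c ⟨j, h⟩ else 0, ?_⟩
  convert hc using 2
  symm
  refine Finset.sum_of_injOn (Fin.castLE hn) (Fin.castLE_injective hn).injOn (by simp) ?_ ?_
  · intro j _ hj
    have h : ¬ (j : ℕ) < n := fun h ↦ hj ⟨⟨j, h⟩, by simp, by ext; simp⟩
    simp only [dif_neg h, zero_smul]
  · intro k _
    simp

/-- As many generators as the rank are independent. Expressing `p` in a local basis `s` and `s` in
`p` gives matrices with `H' * G' = u • 1` over the domain `A / I`, where `u ≠ 0` is a product of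
denominators; hence `det G' ≠ 0`. -/
lemma GeneratesMod.mem_of_sum_mem (hg : Ideal.span (Set.range g) = ⊤)
    (hs : ∀ i, IsLocalBasis (g i) (s i)) {I : Ideal A} [I.IsPrime] {p : Fin r → N}
    (hp : GeneratesMod I p) {c : Fin r → A} (hc : ∑ j, c j • p j ∈ I • (⊤ : Submodule A N))
    (k : Fin r) : c k ∈ I := by
  obtain ⟨i, hi⟩ := exists_notMem_of_span_eq_top hg I
  choose H hH using fun j ↦ hp (s i j)
  choose l G hG using fun k ↦ (hs i).exists_eq (p k)
  let u := ∏ k, g i ^ l k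
  have hu : ∀ k, ∃ v, u = v * g i ^ l k := fun k ↦
    ⟨∏ j ∈ Finset.univ.erase k, g i ^ l j, (Finset.prod_erase_mul _ _ (Finset.mem_univ k)).symm⟩
  choose v hv using hu
  have huI : u ∉ I := fun h ↦ by
    obtain ⟨k, -, hk⟩ := (Ideal.IsPrime.prod_mem_iff).1 h
    exact hi (Ideal.IsPrime.mem_of_pow_mem ‹_› _ hk)
  have hGu : ∀ k, u • p k = ∑ j, (v k * G k j) • s i j := fun k ↦ by
    rw [hv k, mul_smul, hG, Finset.smul_sum]
    simp only [mul_smul]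
  let G' : Matrix (Fin r) (Fin r) (A ⧸ I) := Matrix.of fun k j ↦ Ideal.Quotient.mk I (v k * G k j)
  let H' : Matrix (Fin r) (Fin r) (A ⧸ I) := Matrix.of fun j k ↦ Ideal.Quotient.mk I (H j k)
  have h1 : H' * G' = Ideal.Quotient.mk I u • (1 : Matrix (Fin r) (Fin r) (A ⧸ I)) := by
    ext j j'
    have h2 := (hs i).mem_of_sum_mem I hi
      (c := fun j' ↦ u * (if j = j' then 1 else 0) - ∑ k, H j k * (v k * G k j')) (by
        simp only [sub_smul, Finset.sum_sub_distrib, Finset.sum_smul]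
        rw [Finset.sum_comm]
        simp only [mul_smul, ite_smul, one_smul, zero_smul, smul_ite, smul_zero,
          Finset.sum_ite_eq, Finset.mem_univ, if_true]
        simp only [← Finset.smul_sum, ← hG]
        have h3 := Submodule.smul_mem _ u (hH j)
        rw [smul_sub, Finset.smul_sum] at h3
        convert h3 using 3 with k
        rw [hv k, smul_comm (H j k), mul_smul, smul_comm (H j k)]) j'
    have h3 := Ideal.Quotient.eq_zero_iff_mem.2 h2
    rw [map_sub, sub_eq_zero] at h3
    simp only [G', H', Matrix.mul_apply, Matrix.of_apply, Matrix.smul_apply, Matrix.one_apply]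
    rw [← map_one (Ideal.Quotient.mk I), ← map_zero (Ideal.Quotient.mk I), ← apply_ite,
      smul_eq_mul, ← map_mul, h3, map_sum]
    simp only [map_mul]
  have hdet : G'.det ≠ 0 := fun h ↦ by
    have h2 := congrArg Matrix.det h1
    rw [Matrix.det_mul, h, mul_zero, Matrix.det_smul, Matrix.det_one, mul_one] at h2
    exact huI (Ideal.Quotient.eq_zero_iff_mem.1 (eq_zero_of_pow_eq_zero h2.symm))
  have h4 : Matrix.vecMul (fun k ↦ Ideal.Quotient.mk I (c k)) G' = 0 := by
    funext j
    have h5 := (hs i).mem_of_sum_mem I hi (c := fun j ↦ ∑ k, c k * (v k * G k j)) (by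
      simp only [Finset.sum_smul]
      rw [Finset.sum_comm]
      simp only [mul_smul (c _), ← Finset.smul_sum, ← hGu]
      have h6 := Submodule.smul_mem _ u hc
      rw [Finset.smul_sum] at h6
      simpa only [smul_comm u] using h6) j
    have h6 := Ideal.Quotient.eq_zero_iff_mem.2 h5
    rw [map_sum] at h6
    simpa only [G', Matrix.vecMul, dotProduct, Matrix.of_apply, ← map_mul, Pi.zero_apply] using h6
  exact Ideal.Quotient.eq_zero_iff_mem.1
    (congrFun (Matrix.eq_zero_of_vecMul_eq_zero hdet h4) k)

end LocalBasis

/-! ### Sections of a vector bundle over an affine open subset -/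

section AffineSections

variable {X : Scheme.{0}} {M : X.Modules} {U : X.Opens} {r : ℕ}

lemma exists_pow_mul_eq_zero {W : X.Opens} (hW : IsAffineOpen W) (h : W ≤ U) (f : Γ(X, U))
    (a : Γ(X, W)) (ha : resF (inf_le_left : W ⊓ X.basicOpen f ≤ W) a = 0) :
    ∃ n : ℕ, resF h f ^ n * a = 0 := by
  have hl := hW.isLocalization_of_eq_basicOpen (resF h f)
    (homOfLE (inf_le_left : W ⊓ X.basicOpen f ≤ W)) (Scheme.basicOpen_res _ _ _).symm
  let := (X.presheaf.map (homOfLE (inf_le_left : W ⊓ X.basicOpen f ≤ W)).op).hom.toAlgebra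
  obtain ⟨⟨_, n, rfl⟩, hn⟩ :=
    (IsLocalization.map_eq_zero_iff (Submonoid.powers (resF h f)) Γ(X, W ⊓ X.basicOpen f) a).1 ha
  exact ⟨n, hn⟩

lemma exists_resF_eq_pow_mul {W : X.Opens} (hW : IsAffineOpen W) (h : W ≤ U) (f : Γ(X, U))
    (a : Γ(X, W ⊓ X.basicOpen f)) :
    ∃ (n : ℕ) (b : Γ(X, W)), resF inf_le_left b = resF (inf_le_left.trans h) f ^ n * a := by
  have hl := hW.isLocalization_of_eq_basicOpen (resF h f)
    (homOfLE (inf_le_left : W ⊓ X.basicOpen f ≤ W)) (Scheme.basicOpen_res _ _ _).symm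
  let := (X.presheaf.map (homOfLE (inf_le_left : W ⊓ X.basicOpen f ≤ W)).op).hom.toAlgebra
  obtain ⟨⟨b, ⟨_, n, rfl⟩⟩, hn⟩ := IsLocalization.surj (Submonoid.powers (resF h f)) a
  refine ⟨n, b, hn.symm.trans ?_⟩
  rw [mul_comm]
  refine congrArg (· * a) ?_
  refine (map_pow (resF inf_le_left) (resF h f) n).trans ?_
  rw [resF_resF]

lemma exists_forall_of_monotone {ι : Type*} [Finite ι] {P : ι → ℕ → Prop}
    (hP : ∀ i, Monotone (P i)) (h : ∀ i, ∃ n, P i n) : ∃ n, ∀ i, P i n := by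
  cases nonempty_fintype ι
  choose n hn using h
  exact ⟨∑ i, n i, fun i ↦ hP i (Finset.single_le_sum (fun _ _ ↦ Nat.zero_le _)
    (Finset.mem_univ i)) (hn i)⟩

lemma IsFrame.exists_pow_smul_eq_zero {W : X.Opens} {e : Fin r → Γ(M, W)} (he : IsFrame M W e)
    (hW : IsAffineOpen W) (h : W ≤ U) (f : Γ(X, U)) (s : Γ(M, W))
    (hs : res M (inf_le_left : W ⊓ X.basicOpen f ≤ W) s = 0) :
    ∃ n : ℕ, resF h f ^ n • s = 0 := by
  have h1 : ∀ j, resF (inf_le_left : W ⊓ X.basicOpen f ≤ W) (he.coeff le_rfl s j) = 0 := by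
    refine congrFun (he.coeff_ext inf_le_left (d := 0) ?_)
    rw [he.eq_sum le_rfl s] at hs
    simpa using hs
  obtain ⟨n, hn⟩ := exists_forall_of_monotone
    (P := fun j n ↦ resF h f ^ n * he.coeff le_rfl s j = 0)
    (fun j n m hnm h' ↦ by
      obtain ⟨k, rfl⟩ := Nat.exists_eq_add_of_le' hnm
      change _ = _ at h'
      rw [pow_add, mul_assoc, h', mul_zero])
    (fun j ↦ exists_pow_mul_eq_zero hW h f _ (h1 j))
  refine ⟨n, ?_⟩
  rw [he.eq_sum le_rfl s, Finset.smul_sum]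
  exact Finset.sum_eq_zero fun j _ ↦ by rw [smul_smul, hn, zero_smul]

lemma IsFrame.exists_res_eq_pow_smul {W : X.Opens} {e : Fin r → Γ(M, W)} (he : IsFrame M W e)
    (hW : IsAffineOpen W) (h : W ≤ U) (f : Γ(X, U)) (s : Γ(M, W ⊓ X.basicOpen f)) :
    ∃ n : ℕ, ∃ t : Γ(M, W), res M (inf_le_left : W ⊓ X.basicOpen f ≤ W) t =
      resF (inf_le_left.trans h : W ⊓ X.basicOpen f ≤ U) f ^ n • s := by
  obtain ⟨n, hn⟩ := exists_forall_of_monotone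
    (P := fun j n ↦ ∃ b : Γ(X, W), resF inf_le_left b =
      resF (inf_le_left.trans h) f ^ n * he.coeff (inf_le_left : W ⊓ X.basicOpen f ≤ W) s j)
    (fun j n m hnm ↦ by
      rintro ⟨b, hb⟩
      obtain ⟨k, rfl⟩ := Nat.exists_eq_add_of_le' hnm
      refine ⟨resF h f ^ k * b, ?_⟩
      rw [map_mul, map_pow, resF_resF, hb, pow_add, mul_assoc])
    (fun j ↦ exists_resF_eq_pow_mul hW h f _)
  choose b hb using hn
  refine ⟨n, ∑ j, b j • e j, ?_⟩
  conv_rhs => rw [he.eq_sum inf_le_left s]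
  simp only [res_sum, res_smul, hb, Finset.smul_sum, mul_smul]

lemma IsFrame.of_generates {e : Fin r → Γ(M, U)} (he : IsFrame M U e) {s : Fin r → Γ(M, U)}
    {h : Matrix (Fin r) (Fin r) Γ(X, U)} (hs : ∀ j, e j = ∑ i, h i j • s i) : IsFrame M U s := by
  let g : Matrix (Fin r) (Fin r) Γ(X, U) := .of fun i j ↦ he.coeff le_rfl (s j) i
  have hg : ∀ j, s j = ∑ i, g i j • e i := fun j ↦
    (by simpa using he.eq_sum le_rfl (s j) : s j = ∑ i, he.coeff le_rfl (s j) i • e i)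
  have hgh : g * h = 1 := by
    ext i j
    refine congrFun (he.coeff_ext le_rfl (c := fun i ↦ (g * h) i j)
      (d := fun i ↦ (1 : Matrix (Fin r) (Fin r) _) i j) ?_) i
    simp only [res_self, Matrix.mul_apply, Matrix.one_apply, ite_smul, one_smul,
      zero_smul, Finset.sum_ite_eq', Finset.mem_univ, if_true, Finset.sum_smul]
    rw [Finset.sum_comm]
    conv_rhs => rw [hs j]
    refine Finset.sum_congr rfl fun k _ ↦ ?_
    rw [hg k, Finset.smul_sum]
    exact Finset.sum_congr rfl fun l _ ↦ by rw [smul_smul, mul_comm]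
  have := he.change g h hgh (mul_eq_one_comm.1 hgh)
  rwa [show s = _ from funext hg]

lemma exists_local_frames (hU : IsAffineOpen U) (hM : IsVectorBundle M r) :
    ∃ (n : ℕ) (g : Fin n → Γ(X, U)), Ideal.span (Set.range g) = ⊤ ∧
      ∀ i, ∃ e : Fin r → Γ(M, X.basicOpen (g i)), IsFrame M (X.basicOpen (g i)) e := by
  let s : Set Γ(X, U) := {g | ∃ e : Fin r → Γ(M, X.basicOpen g), IsFrame M (X.basicOpen g) e}
  have hs : Ideal.span s = ⊤ := by
    refine (IsAffineOpen.self_le_iSup_basicOpen_iff hU).1 fun x hx ↦ ?_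
    obtain ⟨V, hxV, e, he⟩ := hM x
    obtain ⟨g, hg, hxg⟩ := IsAffineOpen.exists_basicOpen_le hU ⟨x, hxV⟩ hx
    exact TopologicalSpace.Opens.mem_iSup.2 ⟨⟨g, _, he.mono hg⟩, hxg⟩
  obtain ⟨t, ht, ht'⟩ := (Ideal.span_eq_top_iff_finite s).1 hs
  refine ⟨t.card, fun i ↦ (t.equivFin.symm i : Γ(X, U)), ?_, fun i ↦ ht (t.equivFin.symm i).2⟩
  rw [← ht']
  congr 1
  ext x
  constructor
  · rintro ⟨i, rfl⟩
    exact (t.equivFin.symm i).2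
  · intro hx
    exact ⟨t.equivFin ⟨x, hx⟩, by simp⟩

variable {n : ℕ} {g : Fin n → Γ(X, U)}

lemma le_iSup_basicOpen (hU : IsAffineOpen U) (hg : Ideal.span (Set.range g) = ⊤) :
    U ≤ ⨆ i, X.basicOpen (g i) := by
  have := (IsAffineOpen.self_le_iSup_basicOpen_iff hU).2 hg
  rwa [iSup_range' X.basicOpen g] at this

/-- This and `exists_res_eq_pow_smul` say that sections over `X.basicOpen f` are the localization at
`f` of the sections over `U`. The claim holds on members of the finite cover with frames, and a
common power of `f` serves all of them. -/
lemma exists_pow_smul_eq_zero (hU : IsAffineOpen U) (hg : Ideal.span (Set.range g) = ⊤)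
    {e : ∀ i, Fin r → Γ(M, X.basicOpen (g i))} (he : ∀ i, IsFrame M _ (e i)) (f : Γ(X, U))
    (s : Γ(M, U)) (hs : res M (X.basicOpen_le f) s = 0) : ∃ n : ℕ, f ^ n • s = 0 := by
  obtain ⟨k, hk⟩ := exists_forall_of_monotone
    (P := fun i k ↦ resF (X.basicOpen_le (g i)) f ^ k • res M (X.basicOpen_le (g i)) s = 0)
    (fun i k m hkm h' ↦ by
      obtain ⟨l, rfl⟩ := Nat.exists_eq_add_of_le' hkm
      change _ = _ at h'
      rw [pow_add, mul_smul, h', smul_zero])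
    (fun i ↦ IsFrame.exists_pow_smul_eq_zero (he i) (hU.basicOpen _) _ f _ (by
      have := congrArg (res M (inf_le_right : X.basicOpen (g i) ⊓ X.basicOpen f ≤ _)) hs
      simpa using this))
  refine ⟨k, section_ext M _ (fun i ↦ X.basicOpen_le (g i)) (le_iSup_basicOpen hU hg) fun i ↦ ?_⟩
  rw [res_smul, map_pow, hk, res_zero]

/-- A power of `f` extends the section to each member of the finite cover. The extensions differ on
the affine overlaps by sections that vanish on `X.basicOpen f`, so a further power makes them agree
and they glue. -/
lemma exists_res_eq_pow_smul (hU : IsAffineOpen U) (hg : Ideal.span (Set.range g) = ⊤)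
    {e : ∀ i, Fin r → Γ(M, X.basicOpen (g i))} (he : ∀ i, IsFrame M _ (e i)) (f : Γ(X, U))
    (t : Γ(M, X.basicOpen f)) :
    ∃ n : ℕ, ∃ s : Γ(M, U), res M (X.basicOpen_le f) s = resF (X.basicOpen_le f) f ^ n • t := by
  obtain ⟨k, hk⟩ := exists_forall_of_monotone
    (P := fun i k ↦ ∃ s : Γ(M, X.basicOpen (g i)),
      res M (inf_le_left : X.basicOpen (g i) ⊓ X.basicOpen f ≤ _) s =
      resF (inf_le_left.trans (X.basicOpen_le _)) f ^ k • res M inf_le_right t)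
    (fun i k m hkm ↦ by
      rintro ⟨b, hb⟩
      obtain ⟨l, rfl⟩ := Nat.exists_eq_add_of_le' hkm
      refine ⟨resF (X.basicOpen_le (g i)) f ^ l • b, ?_⟩
      rw [res_smul, map_pow, resF_resF, hb, pow_add]
      exact (mul_smul _ _ _).symm)
    (fun i ↦ IsFrame.exists_res_eq_pow_smul (he i) (hU.basicOpen _) (X.basicOpen_le _) f _)
  choose s hs using hk
  have hle (i j) : X.basicOpen (g i) ⊓ X.basicOpen (g j) ≤ U := inf_le_left.trans (X.basicOpen_le _)
  obtain ⟨l, hl⟩ := exists_forall_of_monotone (ι := Fin n × Fin n)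
    (P := fun i l ↦ resF (hle i.1 i.2) f ^ l •
      (res M (inf_le_left : X.basicOpen (g i.1) ⊓ X.basicOpen (g i.2) ≤ _) (s i.1) -
        res M inf_le_right (s i.2)) = 0)
    (fun i k m hkm h' ↦ by
      obtain ⟨l, rfl⟩ := Nat.exists_eq_add_of_le' hkm
      change _ = _ at h'
      rw [pow_add, mul_smul, h', smul_zero])
    (fun i ↦ ((he i.1).mono inf_le_left).exists_pow_smul_eq_zero
      (by
        have := hU.basicOpen (g i.1 * g i.2)
        rwa [Scheme.basicOpen_mul] at this) _ f _ (by
      have h1 := congrArg (res M (le_inf (inf_le_left.trans inf_le_left) inf_le_right :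
        (X.basicOpen (g i.1) ⊓ X.basicOpen (g i.2)) ⊓ X.basicOpen f ≤
          X.basicOpen (g i.1) ⊓ X.basicOpen f)) (hs i.1)
      have h2 := congrArg (res M (le_inf (inf_le_left.trans inf_le_right) inf_le_right :
        (X.basicOpen (g i.1) ⊓ X.basicOpen (g i.2)) ⊓ X.basicOpen f ≤
          X.basicOpen (g i.2) ⊓ X.basicOpen f)) (hs i.2)
      simp only [res_res, res_smul, map_pow, resF_resF] at h1 h2
      rw [res_sub, res_res, res_res, sub_eq_zero]
      exact h1.trans (Eq.symm h2)))
  obtain ⟨s', hs'⟩ := section_glue M _ (fun i ↦ X.basicOpen_le (g i)) (le_iSup_basicOpen hU hg)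
    (fun i ↦ resF (X.basicOpen_le _) f ^ l • s i) (fun i j ↦ by
      rw [res_smul, res_smul, map_pow, map_pow, resF_resF, resF_resF, ← sub_eq_zero, ← smul_sub]
      exact hl (i, j))
  refine ⟨l + k, s', section_ext M (fun i ↦ X.basicOpen (g i) ⊓ X.basicOpen f)
    (fun i ↦ inf_le_right) ?_ fun i ↦ ?_⟩
  · rw [← iSup_inf_eq]
    exact le_inf ((X.basicOpen_le f).trans (le_iSup_basicOpen hU hg)) le_rfl
  · have h1 := congrArg (res M (inf_le_left : X.basicOpen (g i) ⊓ X.basicOpen f ≤ _)) (hs' i)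
    rw [res_res, res_smul, map_pow, resF_resF, hs] at h1
    rw [res_res, res_smul, map_pow, resF_resF, h1, smul_smul, pow_add]

/-- A frame over `X.basicOpen (g i)` extends to `U` after multiplication by a power of `g i`, and it
stays a frame because that power is invertible there. -/
lemma exists_global_local_frames (hU : IsAffineOpen U) (hM : IsVectorBundle M r) :
    ∃ (n : ℕ) (g : Fin n → Γ(X, U)) (s : Fin n → Fin r → Γ(M, U)), Ideal.span (Set.range g) = ⊤ ∧
      (∀ i, IsFrame M (X.basicOpen (g i)) (fun j ↦ res M (X.basicOpen_le _) (s i j))) ∧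
      ∀ i, IsLocalBasis (g i) (s i) := by
  obtain ⟨n, g, hg, h⟩ := exists_local_frames hU hM
  choose e he using h
  have h1 (i) : ∃ k : ℕ, ∀ j, ∃ s : Γ(M, U), res M (X.basicOpen_le (g i)) s =
      resF (X.basicOpen_le (g i)) (g i) ^ k • e i j :=
    exists_forall_of_monotone (fun j k m hkm ↦ by
      rintro ⟨b, hb⟩
      obtain ⟨l, rfl⟩ := Nat.exists_eq_add_of_le' hkm
      exact ⟨g i ^ l • b, by rw [res_smul, hb, map_pow, pow_add, mul_smul]⟩)
      fun j ↦ exists_res_eq_pow_smul hU hg he _ _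
  choose k s hs using h1
  have hu (i) : IsUnit (resF (X.basicOpen_le (g i)) (g i)) := RingedSpace.isUnit_res_basicOpen _ _
  choose v hv using fun i ↦ (hu i).exists_right_inv
  have hf : ∀ i, IsFrame M (X.basicOpen (g i)) (fun j ↦ res M (X.basicOpen_le _) (s i j)) := by
    intro i
    refine (he i).of_generates (h := Matrix.diagonal fun _ ↦ v i ^ k i) fun j ↦ ?_
    simp only [Matrix.diagonal_apply, ite_smul, zero_smul, Finset.sum_ite_eq',
      Finset.mem_univ, if_true]
    rw [hs, smul_smul, ← mul_pow, mul_comm, hv, one_pow, one_smul]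
  refine ⟨n, g, s, hg, hf, fun i ↦ ⟨fun x ↦ ?_, fun c hc ↦ ?_⟩⟩
  · obtain ⟨l, c, hc⟩ : ∃ (l : ℕ) (c : Fin r → Γ(X, U)), ∀ j, resF (X.basicOpen_le (g i)) (c j) =
        resF (X.basicOpen_le (g i)) (g i) ^ l *
          (hf i).coeff le_rfl (res M (X.basicOpen_le _) x) j := by
      obtain ⟨l, hl⟩ := exists_forall_of_monotone (P := fun j l ↦ ∃ c : Γ(X, U),
        resF (X.basicOpen_le (g i)) c = resF (X.basicOpen_le (g i)) (g i) ^ l *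
          (hf i).coeff le_rfl (res M (X.basicOpen_le _) x) j)
        (fun j k m hkm ↦ by
          rintro ⟨b, hb⟩
          obtain ⟨l, rfl⟩ := Nat.exists_eq_add_of_le' hkm
          exact ⟨g i ^ l * b, by rw [map_mul, hb, map_pow, pow_add, mul_assoc]⟩)
        (fun j ↦ by
          obtain ⟨l, c, hc⟩ := exists_resF_eq_pow_mul hU le_rfl (g i)
            (resF inf_le_right ((hf i).coeff le_rfl (res M (X.basicOpen_le _) x) j))
          refine ⟨l, c, ?_⟩
          have := congrArg (resF (le_inf (X.basicOpen_le _) le_rfl :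
            X.basicOpen (g i) ≤ U ⊓ X.basicOpen (g i))) hc
          simpa using this)
      choose c hc using hl
      exact ⟨l, c, hc⟩
    obtain ⟨m, hm⟩ := exists_pow_smul_eq_zero hU hg he (g i) (g i ^ l • x - ∑ j, c j • s i j) (by
      rw [res_sub, res_smul, res_sum, (hf i).eq_sum le_rfl (res M _ x), Finset.smul_sum, sub_eq_zero]
      refine Finset.sum_congr rfl fun j _ ↦ ?_
      rw [res_smul, hc, mul_smul, map_pow, res_self])
    refine ⟨m + l, fun j ↦ g i ^ m * c j, ?_⟩
    rw [smul_sub, sub_eq_zero] at hm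
    rw [pow_add, mul_smul, hm, Finset.smul_sum]
    simp only [mul_smul]
  · have h1 : ∀ j, resF (X.basicOpen_le (g i)) (c j) = 0 := by
      refine congrFun ((hf i).coeff_ext le_rfl (d := 0) ?_)
      have := congrArg (res M (X.basicOpen_le (g i))) hc
      simpa using this
    refine exists_forall_of_monotone (P := fun j l ↦ g i ^ l * c j = 0)
      (fun j n m hnm h' ↦ by
        obtain ⟨k, rfl⟩ := Nat.exists_eq_add_of_le' hnm
        change _ = _ at h'
        rw [pow_add, mul_assoc, h', mul_zero]) fun j ↦ ?_
    obtain ⟨l, hl⟩ := exists_pow_mul_eq_zero hU le_rfl (g i) (c j) (by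
      have := congrArg (resF (inf_le_right : U ⊓ X.basicOpen (g i) ≤ _)) (h1 j)
      simpa using this)
    exact ⟨l, by simpa using hl⟩

/-- Sections that generate the module of sections of a vector bundle over an affine open subset
form a frame if their number is the rank. -/
lemma isFrame_of_generatesMod (hU : IsAffineOpen U) (hM : IsVectorBundle M r)
    {p : Fin r → Γ(M, U)} (hp : GeneratesMod (⊥ : Ideal Γ(X, U)) p) : IsFrame M U p := by
  obtain ⟨n, g, s, hg, hf, -⟩ := exists_global_local_frames hU hM
  refine isFrame_of_cover p _ (fun i ↦ X.basicOpen_le (g i)) (le_iSup_basicOpen hU hg) fun i ↦ ?_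
  choose c hc using fun j ↦ hp (s i j)
  refine (hf i).of_generates (h := .of fun k j ↦ resF (X.basicOpen_le _) (c j k)) fun j ↦ ?_
  have := hc j
  rw [Submodule.bot_smul, Submodule.mem_bot, sub_eq_zero] at this
  rw [this, res_sum]
  simp

lemma exists_isFrame_of_isPrincipalIdealRing (hU : IsAffineOpen U) (hM : IsVectorBundle M r)
    [IsDomain Γ(X, U)] [IsPrincipalIdealRing Γ(X, U)] :
    ∃ p : Fin r → Γ(M, U), IsFrame M U p := by
  obtain ⟨n, g, s, hg, -, hs⟩ := exists_global_local_frames hU hM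
  have : (⊥ : Ideal Γ(X, U)).IsPrime := Ideal.isPrime_bot
  have : IsPrincipalIdealRing (Γ(X, U) ⧸ (⊥ : Ideal Γ(X, U))) :=
    IsPrincipalIdealRing.of_surjective (Ideal.Quotient.mk _) Ideal.Quotient.mk_surjective
  obtain ⟨p, hp⟩ := exists_generatesMod hg hs ⊥
  exact ⟨p, isFrame_of_generatesMod hU hM hp⟩

end AffineSections

/-! ### Vector bundles on the charts of a nodal curve -/

section NodalRing

variable {A N : Type*} [CommRing A] [AddCommGroup N] [Module A N] {r : ℕ}

/-- `A` is the coordinate ring of the union of the two axes in the plane. -/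
structure IsNodalRing (κ : ℂ →+* A) (x₁ x₂ : A) : Prop where
  surjective : Function.Surjective (MvPolynomial.eval₂Hom κ ![x₁, x₂])
  dvd : ∀ p, MvPolynomial.eval₂Hom κ ![x₁, x₂] p = 0 → MvPolynomial.X 0 * MvPolynomial.X 1 ∣ p
  mul_eq_zero : x₁ * x₂ = 0

variable {κ : ℂ →+* A} {x₁ x₂ : A} (h : IsNodalRing κ x₁ x₂)

/-- The relations are multiples of `X 0 * X 1`, so a polynomial lands in the ideal only if it is
divisible by the prime `X 0`. -/
lemma IsNodalRing.isPrime (h : IsNodalRing κ x₁ x₂) : (Ideal.span {x₁}).IsPrime := by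
  have key : ∀ p, MvPolynomial.eval₂Hom κ ![x₁, x₂] p ∈ Ideal.span {x₁} →
      (MvPolynomial.X 0 : MvPolynomial (Fin 2) ℂ) ∣ p := by
    intro p hp
    obtain ⟨b, hb⟩ := Ideal.mem_span_singleton.1 hp
    obtain ⟨q, rfl⟩ := h.surjective b
    have h1 : MvPolynomial.X 0 * MvPolynomial.X 1 ∣ p - MvPolynomial.X 0 * q :=
      h.dvd _ (by rw [map_sub, hb, map_mul, MvPolynomial.eval₂Hom_X']; simp)
    have h2 := (dvd_mul_right _ _).trans h1
    exact (dvd_sub_left (dvd_mul_right _ _)).1 h2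
  have hX : Prime (MvPolynomial.X 0 : MvPolynomial (Fin 2) ℂ) := by
    rw [← MulEquiv.prime_iff (MvPolynomial.finSuccEquiv ℂ 1), MvPolynomial.finSuccEquiv_X_zero]
    exact Polynomial.prime_X
  refine ⟨fun h1 ↦ ?_, fun {a b} hab ↦ ?_⟩
  · have h2 := key 1 (h1 ▸ trivial)
    obtain ⟨c, hc⟩ := h2
    have := congrArg (MvPolynomial.eval 0) hc
    simp at this
  · obtain ⟨p, rfl⟩ := h.surjective a
    obtain ⟨q, rfl⟩ := h.surjective b
    rw [← map_mul] at hab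
    refine (hX.dvd_or_dvd (key _ hab)).imp ?_ ?_ <;>
    · rintro ⟨c, rfl⟩
      rw [map_mul, MvPolynomial.eval₂Hom_X']
      exact Ideal.mul_mem_right _ _ (Ideal.mem_span_singleton_self _)

/-- The quotient is generated over ℂ by the class of `x₂`, hence is a quotient of a polynomial ring
in one variable. -/
lemma IsNodalRing.isPrincipalIdealRing (h : IsNodalRing κ x₁ x₂) :
    IsPrincipalIdealRing (A ⧸ Ideal.span {x₁}) := by
  let Ψ : Polynomial ℂ →+* A ⧸ Ideal.span {x₁} :=
    Polynomial.eval₂RingHom ((Ideal.Quotient.mk _).comp κ) (Ideal.Quotient.mk _ x₂)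
  let σ : MvPolynomial (Fin 2) ℂ →+* Polynomial ℂ :=
    MvPolynomial.eval₂Hom Polynomial.C ![0, Polynomial.X]
  have h1 : Ψ.comp σ = (Ideal.Quotient.mk _).comp (MvPolynomial.eval₂Hom κ ![x₁, x₂]) := by
    apply MvPolynomial.ringHom_ext
    · simp [Ψ, σ]
    · intro i
      fin_cases i
      · simpa [Ψ, σ] using (Ideal.Quotient.eq_zero_iff_mem.2 (Ideal.mem_span_singleton_self x₁)).symm
      · simp [Ψ, σ]
  refine IsPrincipalIdealRing.of_surjective Ψ fun y ↦ ?_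
  obtain ⟨a, rfl⟩ := Ideal.Quotient.mk_surjective y
  obtain ⟨p, rfl⟩ := h.surjective a
  exact ⟨σ p, congr($h1 p)⟩

lemma IsNodalRing.exists_eq (h : IsNodalRing κ x₁ x₂) (a : A) :
    ∃ c, a - κ c ∈ Ideal.span {x₁, x₂} := by
  obtain ⟨p, rfl⟩ := h.surjective a
  induction p using MvPolynomial.induction_on with
  | C c => exact ⟨c, by simp⟩
  | add p q hp hq =>
    obtain ⟨c, hc⟩ := hp
    obtain ⟨d, hd⟩ := hq
    refine ⟨c + d, ?_⟩
    have := add_mem hc hd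
    rw [map_add, map_add]
    convert this using 1
    ring
  | mul_X p i _ =>
    refine ⟨0, ?_⟩
    rw [map_zero, sub_zero, map_mul, MvPolynomial.eval₂Hom_X']
    refine Ideal.mul_mem_left _ _ (Ideal.subset_span ?_)
    fin_cases i <;> simp

/-- Evaluation at the origin, the node, kills both coordinates and their product. -/
lemma IsNodalRing.eq_zero (h : IsNodalRing κ x₁ x₂) {c : ℂ} (hc : κ c ∈ Ideal.span {x₁, x₂}) :
    c = 0 := by
  obtain ⟨a, b, hab⟩ := Ideal.mem_span_pair.1 hc
  obtain ⟨p, rfl⟩ := h.surjective a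
  obtain ⟨q, rfl⟩ := h.surjective b
  obtain ⟨d, hd⟩ := h.dvd (p * MvPolynomial.X 0 + q * MvPolynomial.X 1 - MvPolynomial.C c)
    (by rw [map_sub, map_add, map_mul, map_mul, MvPolynomial.eval₂Hom_X', MvPolynomial.eval₂Hom_X',
          MvPolynomial.eval₂Hom_C]
        simpa [sub_eq_zero] using hab)
  have := congrArg (MvPolynomial.eval 0) hd
  simpa using this

lemma IsNodalRing.isPrime_node (h : IsNodalRing κ x₁ x₂) : (Ideal.span {x₁, x₂}).IsPrime := by
  refine ⟨fun h1 ↦ ?_, fun {a b} hab ↦ ?_⟩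
  · exact one_ne_zero (h.eq_zero (c := 1) (h1 ▸ trivial))
  · obtain ⟨c, hc⟩ := h.exists_eq a
    obtain ⟨d, hd⟩ := h.exists_eq b
    have h2 : κ (c * d) ∈ Ideal.span {x₁, x₂} := by
      have := sub_mem hab (add_mem (Ideal.mul_mem_left _ a hd) (Ideal.mul_mem_left _ (κ d) hc))
      rw [map_mul]
      convert this using 1
      ring
    refine (_root_.mul_eq_zero.1 (h.eq_zero h2)).imp ?_ ?_
    · rintro rfl
      simpa using hc
    · rintro rfl
      simpa using hd

lemma exists_eq_smul_of_mem {a : A} {x : N} (hx : x ∈ Ideal.span {a} • (⊤ : Submodule A N)) :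
    ∃ y, x = a • y := by
  refine Submodule.smul_induction_on hx (fun b hb y _ ↦ ?_) ?_
  · obtain ⟨c, rfl⟩ := Ideal.mem_span_singleton.1 hb
    exact ⟨c • y, mul_smul _ _ _⟩
  · rintro _ _ ⟨y, rfl⟩ ⟨z, rfl⟩
    exact ⟨y + z, (smul_add _ _ _).symm⟩

/-- Frames `p` and `q` exist on the two branches, whose rings are principal. At the node they differ
by an invertible matrix of constants, which exists on the whole curve and can be applied to `p`. The
transformed `p` and `q` then differ by elements of the form `x₁ u + x₂ u'`, and distributing these
two terms gives one family `n` that lifts both frames. -/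
lemma IsNodalRing.exists_generatesMod (h : IsNodalRing κ x₁ x₂)
    (h' : IsNodalRing κ x₂ x₁) {ι : Type*} [Finite ι] {g : ι → A} {s : ι → Fin r → N}
    (hg : Ideal.span (Set.range g) = ⊤) (hs : ∀ i, IsLocalBasis (g i) (s i)) :
    ∃ p : Fin r → N, GeneratesMod (⊥ : Ideal A) p := by
  have := h.isPrime
  have := h'.isPrime
  have := h.isPrime_node
  have := h.isPrincipalIdealRing
  have := h'.isPrincipalIdealRing
  obtain ⟨p, hp⟩ := DegreeBound.exists_generatesMod hg hs (Ideal.span {x₂})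
  obtain ⟨q, hq⟩ := DegreeBound.exists_generatesMod hg hs (Ideal.span {x₁})
  have hI₁ : Ideal.span {x₁} ≤ Ideal.span {x₁, x₂} := Ideal.span_mono (by simp)
  have hI₂ : Ideal.span {x₂} ≤ Ideal.span {x₁, x₂} := Ideal.span_mono (by simp)
  have hconst : ∀ p : Fin r → N, GeneratesMod (Ideal.span {x₁, x₂}) p → ∀ x : N,
      ∃ c : Fin r → ℂ, x - ∑ j, κ (c j) • p j ∈ Ideal.span {x₁, x₂} • (⊤ : Submodule A N) := by
    intro p hp x
    obtain ⟨c, hc⟩ := hp x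
    choose d hd using fun j ↦ h.exists_eq (c j)
    refine ⟨d, ?_⟩
    have h1 : ∑ j, (c j - κ (d j)) • p j ∈ Ideal.span {x₁, x₂} • (⊤ : Submodule A N) :=
      Submodule.sum_mem _ fun j _ ↦ Submodule.smul_mem_smul (hd j) trivial
    have h2 := add_mem hc h1
    simp only [sub_smul, Finset.sum_sub_distrib] at h2
    simpa using h2
  -- At the node coefficients may be replaced by constants, because the residue ring there is ℂ. So
  -- `M` and `M'` are matrices of complex numbers.
  choose M hM using fun i ↦ hconst p (hp.mono hI₂) (q i)
  choose M' hM' using fun i ↦ hconst q (hq.mono hI₁) (p i)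
  have hinv : Matrix.of M' * Matrix.of M = 1 := by
    ext i k
    rw [← sub_eq_zero]
    refine h.eq_zero ?_
    have h1 := add_mem (hM' i) (Submodule.sum_mem _ (t := Finset.univ) fun j _ ↦
      Submodule.smul_mem _ (κ (M' i j)) (hM j))
    refine (hp.mono hI₂).mem_of_sum_mem hg hs (I := Ideal.span {x₁, x₂})
      (c := fun k ↦ κ ((Matrix.of M' * Matrix.of M) i k - (1 : Matrix (Fin r) (Fin r) ℂ) i k)) ?_ k
    rw [← neg_mem_iff]
    convert h1 using 1
    simp only [map_sub, sub_smul, Finset.sum_sub_distrib, Matrix.one_apply, smul_sub,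
      apply_ite κ, map_one, map_zero, ite_smul, one_smul, zero_smul, Finset.sum_ite_eq,
      Finset.mem_univ, if_true, Matrix.mul_apply, map_sum, map_mul, Finset.sum_smul, mul_smul,
      Matrix.of_apply, Finset.smul_sum]
    rw [Finset.sum_comm]
    abel
  have hdiff : ∀ i, ∃ u u' : N, ∑ j, κ (M i j) • p j - q i = x₁ • u + x₂ • u' := by
    intro i
    have h1 := neg_mem (hM i)
    rw [Ideal.span_insert, Submodule.sup_smul] at h1
    obtain ⟨y, hy, z, hz, hyz⟩ := Submodule.mem_sup.1 h1
    obtain ⟨u, rfl⟩ := exists_eq_smul_of_mem hy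
    obtain ⟨u', rfl⟩ := exists_eq_smul_of_mem hz
    exact ⟨u, u', by rw [← neg_sub, hyz]⟩
  choose u u' hu using hdiff
  let n : Fin r → N := fun i ↦ q i + x₁ • u i
  have hn : ∀ i, n i = ∑ j, κ (M i j) • p j - x₂ • u' i := fun i ↦ by
    rw [eq_sub_iff_add_eq, add_assoc, ← hu, add_sub_cancel]
  have hp' : ∀ k, p k = ∑ i, κ (M' k i) • ∑ j, κ (M i j) • p j := by
    intro k
    simp only [Finset.smul_sum, smul_smul, ← map_mul]
    rw [Finset.sum_comm]
    simp only [← Finset.sum_smul, ← map_sum]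
    have : ∀ j, ∑ i, M' k i * M i j = (1 : Matrix (Fin r) (Fin r) ℂ) k j := fun j ↦ by
      rw [← hinv]; rfl
    simp [this, Matrix.one_apply, apply_ite κ, ite_smul]
  have h₂ : ∀ x, ∃ (c : Fin r → A) (y : N), x = ∑ i, c i • n i + x₂ • y := by
    intro x
    obtain ⟨c, hc⟩ := hp x
    obtain ⟨y, hy⟩ := exists_eq_smul_of_mem hc
    rw [sub_eq_iff_eq_add'] at hy
    refine ⟨fun i ↦ ∑ k, c k * κ (M' k i), y + ∑ i, (∑ k, c k * κ (M' k i)) • u' i, ?_⟩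
    rw [hy]
    simp only [hn, smul_sub, Finset.sum_sub_distrib, smul_add, Finset.smul_sum (s := Finset.univ)
      (r := x₂), smul_comm x₂]
    have : ∑ k, c k • p k = ∑ i, (∑ k, c k * κ (M' k i)) • ∑ j, κ (M i j) • p j := by
      conv_lhs => enter [2, k]; rw [hp' k, Finset.smul_sum]
      rw [Finset.sum_comm]
      simp only [Finset.sum_smul, mul_smul]
    rw [this]
    abel
  have h₁ : ∀ x, ∃ (c : Fin r → A) (y : N), x = ∑ i, c i • n i + x₁ • y := by
    intro x
    obtain ⟨c, hc⟩ := hq x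
    obtain ⟨y, hy⟩ := exists_eq_smul_of_mem hc
    rw [sub_eq_iff_eq_add'] at hy
    refine ⟨c, y - ∑ i, c i • u i, ?_⟩
    rw [hy]
    simp only [n, smul_add, Finset.sum_add_distrib, smul_sub, Finset.smul_sum (s := Finset.univ)
      (r := x₁), smul_comm x₁]
    abel
  -- Generation modulo `x₂` and then modulo `x₁` leaves a remainder divisible by `x₁ * x₂ = 0`.
  refine ⟨n, fun x ↦ ?_⟩
  obtain ⟨c, y, rfl⟩ := h₂ x
  obtain ⟨d, z, rfl⟩ := h₁ y
  refine ⟨fun i ↦ c i + x₂ * d i, ?_⟩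
  rw [Submodule.bot_smul, Submodule.mem_bot, sub_eq_zero, smul_add, smul_smul, mul_comm x₂,
    h.mul_eq_zero, zero_smul, add_zero]
  simp only [add_smul, Finset.sum_add_distrib, mul_smul, Finset.smul_sum]

end NodalRing

/-! ### Frames of vector bundles on the three charts of the nodal curve -/

section

variable {Z : Scheme.{0}} {s : Z ⟶ Spec (.of ℂ)} {M : Z.Modules} {r : ℕ}

lemma IsAffineSpace.exists_isFrame {V : Z.Opens} {a : Fin 1 → Γ(Z, V)} (h : IsAffineSpace s V a)
    (hM : IsVectorBundle M r) : ∃ e : Fin r → Γ(M, V), IsFrame M V e := by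
  have := h.isDomain
  have : IsPrincipalIdealRing Γ(Z, V) :=
    IsPrincipalIdealRing.of_surjective ((MvPolynomial.eval₂Hom (cst s V) a).comp
      (MvPolynomial.uniqueAlgEquiv ℂ (Fin 1)).symm.toRingEquiv.toRingHom)
      (h.2.2.comp (MvPolynomial.uniqueAlgEquiv ℂ (Fin 1)).symm.surjective)
  exact exists_isFrame_of_isPrincipalIdealRing h.1 hM

lemma NodalCharts.isNodalRing (D : NodalCharts s) : IsNodalRing (cst s D.Z₁) D.x₁ D.x₂ :=
  ⟨D.surjective, D.dvd, D.mul_eq_zero⟩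

lemma NodalCharts.exists_isFrame (D : NodalCharts s) (hM : IsVectorBundle M r) :
    ∃ e : Fin r → Γ(M, D.Z₁), IsFrame M D.Z₁ e := by
  obtain ⟨n, g, t, hg, -, ht⟩ := exists_global_local_frames D.isAffineOpen hM
  obtain ⟨p, hp⟩ := D.isNodalRing.exists_generatesMod D.symm.isNodalRing hg ht
  exact ⟨p, isFrame_of_generatesMod D.isAffineOpen hM hp⟩

end

/-! ### Simultaneous diagonalization of two transition matrices -/

section Branch

open Polynomial

variable {A : Type*} [CommRing A] {κ : ℂ →+* A} {r : ℕ}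

/-- A branch of a curve at a point, with the coordinate `x`: functions on the complement of the
point in the branch are Laurent polynomials, and `T` is the restriction of `x`. -/
structure Branch (κ : ℂ →+* A) (x : A) (R : Type*) [CommRing R] where
  ρ : A →+* R
  i : ℂ[X] →+* R
  T : Rˣ
  ρ_x : ρ x = T
  i_X : i X = ↑T⁻¹
  ρ_κ : ∀ c, ρ (κ c) = i (C c)
  injective : Function.Injective i
  exists_eq : ∀ f : R, ∃ (n : ℕ) (p : ℂ[X]), f = i p * T ^ n

variable {x x₁ x₂ : A} {R R₁ R₂ : Type*} [CommRing R] [CommRing R₁] [CommRing R₂]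

lemma Branch.i_X_pow (B : Branch κ x R) (n : ℕ) : B.i (X ^ n) = ↑(B.T ^ (-n : ℤ)) := by
  rw [map_pow, B.i_X, zpow_neg, zpow_natCast, ← inv_pow, Units.val_pow_eq_pow_val]

/-- A unit among Laurent polynomials divides a power of `X`, and nonvanishing at 0 excludes the
factor `X`. -/
lemma Branch.isUnit_of_isUnit (B : Branch κ x R) {p : ℂ[X]} (hp : IsUnit (B.i p))
    (h0 : p.eval 0 ≠ 0) : IsUnit p := by
  obtain ⟨u, hu⟩ := hp.exists_right_inv
  obtain ⟨n, q, rfl⟩ := B.exists_eq u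
  have h1 : p * q = X ^ n := by
    apply B.injective
    rw [B.i_X_pow, map_mul]
    have : (↑(B.T ^ n) : R) * ↑(B.T ^ (-n : ℤ)) = 1 := by
      rw [zpow_neg, zpow_natCast, Units.mul_inv]
    rw [Units.val_pow_eq_pow_val] at this
    linear_combination (↑(B.T ^ (-n : ℤ)) : R) * hu - B.i p * B.i q * this
  obtain ⟨k, -, hk⟩ := (dvd_prime_pow prime_X n).1 ⟨q, h1.symm⟩
  rcases k with _ | k
  · exact associated_one_iff_isUnit.1 (by simpa using hk)
  · obtain ⟨d, rfl⟩ := hk.symm.dvd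
    simp at h0

/-- The columns of the matrix `M * N` have poles of order at most `-α` in the coordinate `T`. -/
def Branch.IsBound (B : Branch κ x R) (M : Matrix (Fin r) (Fin r) R) (N : Matrix (Fin r) (Fin r) A)
    (α : Fin r → ℤ) (W : Matrix (Fin r) (Fin r) ℂ[X]) : Prop :=
  M * N.map B.ρ = W.map B.i * Matrix.diagonal fun l ↦ (↑(B.T ^ α l) : R)

lemma Branch.IsBound.apply {B : Branch κ x R} {M : Matrix (Fin r) (Fin r) R}
    {N : Matrix (Fin r) (Fin r) A} {α : Fin r → ℤ} {W : Matrix (Fin r) (Fin r) ℂ[X]}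
    (h : B.IsBound M N α W) (k l : Fin r) :
    (M * N.map B.ρ) k l = B.i (W k l) * ↑(B.T ^ α l) := by
  rw [h, Matrix.mul_diagonal, Matrix.map_apply]

lemma Branch.IsBound.det_eq {B : Branch κ x R} {M : Matrix (Fin r) (Fin r) R}
    {N : Matrix (Fin r) (Fin r) A} {α : Fin r → ℤ} {W : Matrix (Fin r) (Fin r) ℂ[X]}
    (h : B.IsBound M N α W) (hN : N.det = 1) : M.det = B.i W.det * ↑(B.T ^ ∑ l, α l) := by
  have h1 := congrArg Matrix.det h
  rw [Matrix.det_mul, Matrix.det_mul, Matrix.det_diagonal, ← RingHom.mapMatrix_apply,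
    ← RingHom.map_det, hN, map_one, mul_one, ← RingHom.mapMatrix_apply, ← RingHom.map_det] at h1
  rw [h1, ← Units.coe_prod]
  congr 2
  refine Finset.induction_on Finset.univ (by simp) fun l s hl ih ↦ ?_
  rw [Finset.prod_insert hl, Finset.sum_insert hl, zpow_add, ih]

/-- The determinant of `M` is that of `W`, a polynomial in the inverse of `T`, times `T ^ ∑ α`. If
the exponent were too small, the inverse of `det M`, which has bounded pole order, would make a
multiple of `X` equal to 1. -/
lemma Branch.exists_le_sum (B : Branch κ x R) (M : Matrix (Fin r) (Fin r) R) (hM : IsUnit M.det) :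
    ∃ n : ℤ, ∀ N α W, B.IsBound M N α W → N.det = 1 → n ≤ ∑ l, α l := by
  obtain ⟨u, hu⟩ := hM.exists_right_inv
  obtain ⟨n, q, rfl⟩ := B.exists_eq u
  refine ⟨-n, fun N α W h hN ↦ ?_⟩
  by_contra! hlt
  obtain ⟨k, hk⟩ : ∃ k : ℕ, ∑ l, α l + n = -(k + 1 : ℕ) :=
    ⟨(-(∑ l, α l + n) - 1).toNat, by omega⟩
  have h1 : W.det * q * X ^ (k + 1) = 1 := by
    apply B.injective
    rw [h.det_eq hN] at hu
    rw [map_mul, map_mul, B.i_X_pow, map_one, ← hk, ← hu, zpow_add, zpow_natCast, Units.val_mul,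
      Units.val_pow_eq_pow_val]
    ring
  have := congrArg (eval 0) h1
  simp at this

lemma mul_map_mul_updateCol (ρ : A →+* R) (M : Matrix (Fin r) (Fin r) R)
    (N : Matrix (Fin r) (Fin r) A) (l₀ : Fin r) (v : Fin r → A) (k l : Fin r) :
    (M * (N * (1 : Matrix (Fin r) (Fin r) A).updateCol l₀ v).map ρ) k l =
      if l = l₀ then ∑ j, (M * N.map ρ) k j * ρ (v j) else (M * N.map ρ) k l := by
  rw [Matrix.map_mul, ← Matrix.mul_assoc, Matrix.mul_apply]
  split_ifs with hl
  · subst hl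
    simp
  · simp [Matrix.updateCol_ne hl, Matrix.one_apply, apply_ite ρ]

/-- If `W₁` is singular at `X = 0`, the point at infinity of the first branch, some combination of
its columns is divisible by `X`. The corresponding column operation, with coefficients `c l * x₁ ^
(α l₀ - α l)`, lowers the exponent of column `l₀` on the first branch. On the second branch `x₁`
vanishes, so only the columns with `α l = α l₀` contribute, and the exponents `β` are kept if `β l₀`
is the largest among those. -/
lemma exists_col_op (B₁ : Branch κ x₁ R₁) (B₂ : Branch κ x₂ R₂) (h₂ : B₂.ρ x₁ = 0)
    {M₁ : Matrix (Fin r) (Fin r) R₁} {M₂ : Matrix (Fin r) (Fin r) R₂}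
    {N : Matrix (Fin r) (Fin r) A} {α β : Fin r → ℤ} {W₁ W₂ : Matrix (Fin r) (Fin r) ℂ[X]}
    (hN : N.det = 1) (hb₁ : B₁.IsBound M₁ N α W₁) (hb₂ : B₂.IsBound M₂ N β W₂)
    (h0 : W₁.det.eval 0 = 0) :
    ∃ (N' : Matrix (Fin r) (Fin r) A) (α' : Fin r → ℤ) (W₁' W₂' : Matrix (Fin r) (Fin r) ℂ[X]),
      N'.det = 1 ∧ B₁.IsBound M₁ N' α' W₁' ∧ B₂.IsBound M₂ N' β W₂' ∧
      ∑ l, α' l < ∑ l, α l := by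
  have h1 : (W₁.map (eval 0)).det = 0 := by
    have h := (evalRingHom (0 : ℂ)).map_det W₁
    exact h.symm.trans h0
  obtain ⟨c', hc', hc0'⟩ := Matrix.exists_mulVec_eq_zero_iff.2 h1
  -- The lexicographic maximum of `(α, β)` over the columns that occur in the relation ensures both
  -- that the exponents of `x₁` are nonnegative and that `β` is not increased.
  obtain ⟨l₀, hl₀, hmax⟩ := Finset.exists_max_image (Finset.univ.filter fun l ↦ c' l ≠ 0)
    (fun l ↦ toLex (α l, β l)) (by
      by_contra! h
      refine hc' (funext fun l ↦ ?_)
      by_contra hl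
      have : l ∈ (∅ : Finset (Fin r)) := h ▸ Finset.mem_filter.2 ⟨Finset.mem_univ _, hl⟩
      simp at this)
  simp only [Finset.mem_filter, Finset.mem_univ, true_and] at hl₀ hmax
  set c : Fin r → ℂ := fun l ↦ c' l / c' l₀ with hc
  have hc0 : ∀ k, ∑ l, (W₁ k l).eval 0 * c l = 0 := fun k ↦ by
    have := congrFun hc0' k
    simp only [Matrix.mulVec, dotProduct, Matrix.map_apply, Pi.zero_apply] at this
    simp only [hc, mul_div_assoc']
    rw [← Finset.sum_div, this, zero_div]
  have hcl₀ : c l₀ = 1 := div_self hl₀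
  have hle : ∀ l, c l ≠ 0 → α l ≤ α l₀ := fun l hl ↦ by
    have := hmax l (fun h ↦ hl (by simp [hc, h]))
    rw [Prod.Lex.toLex_le_toLex] at this
    rcases this with h | h
    · exact h.le
    · exact h.1.le
  have hle' : ∀ l, c l ≠ 0 → α l = α l₀ → β l ≤ β l₀ := fun l hl hα ↦ by
    have := hmax l (fun h ↦ hl (by simp [hc, h]))
    rw [Prod.Lex.toLex_le_toLex] at this
    rcases this with h | h
    · exact absurd hα h.ne
    · exact h.2
  have hdvd : ∀ k, ∃ q, ∑ l, W₁ k l * C (c l) = X * q := fun k ↦ by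
    refine X_dvd_iff.2 ?_
    rw [coeff_zero_eq_eval_zero, eval_finsetSum]
    simpa using hc0 k
  choose q hq using hdvd
  let v : Fin r → A := fun l ↦ κ (c l) * x₁ ^ (α l₀ - α l).toNat
  let E : Matrix (Fin r) (Fin r) A := (1 : Matrix (Fin r) (Fin r) A).updateCol l₀ v
  have hE : E.det = 1 := by
    change Matrix.det (Matrix.updateCol 1 l₀ v) = 1
    rw [← Matrix.cramer_apply, Matrix.cramer_one]
    simp [v, hcl₀]
  refine ⟨N * E, Function.update α l₀ (α l₀ - 1),
    .of fun k l ↦ if l = l₀ then q k else W₁ k l,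
    .of fun k l ↦ if l = l₀ then
      ∑ j, if α j = α l₀ then W₂ k j * C (c j) * X ^ (β l₀ - β j).toNat else 0 else W₂ k l,
    by rw [Matrix.det_mul, hN, hE, one_mul], ?_, ?_, ?_⟩
  · ext k l
    rw [mul_map_mul_updateCol, Matrix.mul_diagonal, Matrix.map_apply, Matrix.of_apply]
    split_ifs with hl
    · subst hl
      rw [Function.update_self]
      have h3 : B₁.i (q k) * ↑(B₁.T ^ (α l - 1)) =
          B₁.i (∑ l, W₁ k l * C (c l)) * ↑(B₁.T ^ α l) := by
        rw [hq, map_mul, B₁.i_X, sub_eq_add_neg, zpow_add, zpow_neg_one, Units.val_mul]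
        ring
      rw [h3, map_sum, Finset.sum_mul]
      refine Finset.sum_congr rfl fun j _ ↦ ?_
      rw [hb₁.apply, map_mul, map_mul, B₁.ρ_κ, map_pow, B₁.ρ_x]
      by_cases hj : c j = 0
      · simp [hj]
      · have h4 : B₁.T ^ α l = B₁.T ^ α j * B₁.T ^ (α l - α j).toNat := by
          rw [← zpow_natCast, ← zpow_add]
          congr 1
          have := hle j hj
          omega
        rw [h4, Units.val_mul, Units.val_pow_eq_pow_val]
        ring
    · rw [Function.update_of_ne hl, hb₁.apply]
  · ext k l
    rw [mul_map_mul_updateCol, Matrix.mul_diagonal, Matrix.map_apply, Matrix.of_apply]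
    split_ifs with hl
    · subst hl
      rw [map_sum, Finset.sum_mul]
      refine Finset.sum_congr rfl fun j _ ↦ ?_
      rw [hb₂.apply, map_mul, B₂.ρ_κ, map_pow, h₂]
      by_cases hj : c j = 0
      · simp [hj]
      split_ifs with hα
      · have h4 : B₂.T ^ β j = B₂.T ^ (-((β l - β j).toNat : ℤ)) * B₂.T ^ β l := by
          rw [← zpow_add]
          congr 1
          have := hle' j hj hα
          omega
        rw [hα, sub_self, Int.toNat_zero, pow_zero, mul_one, map_mul, map_mul, B₂.i_X_pow, h4,
          Units.val_mul]
        ring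
      · have h5 : (α l - α j).toNat ≠ 0 := by
          have := hle j hj
          omega
        rw [zero_pow h5]
        simp
    · rw [hb₂.apply]
  · refine Finset.sum_lt_sum (fun l _ ↦ ?_) ⟨l₀, Finset.mem_univ _, by simp⟩
    rcases eq_or_ne l l₀ with rfl | hl
    · simp
    · rw [Function.update_of_ne hl]

lemma Branch.exists_isBound (B : Branch κ x R) (M : Matrix (Fin r) (Fin r) R) :
    ∃ α W, B.IsBound M 1 α W := by
  obtain ⟨n, hn⟩ := exists_forall_of_monotone (ι := Fin r × Fin r)
    (P := fun kl n ↦ ∃ p : ℂ[X], M kl.1 kl.2 = B.i p * B.T ^ n) (fun kl n m hnm ↦ by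
      rintro ⟨p, hp⟩
      obtain ⟨k, rfl⟩ := Nat.exists_eq_add_of_le' hnm
      refine ⟨p * X ^ k, ?_⟩
      have : (↑(B.T ^ (-k : ℤ)) : R) * ↑(B.T ^ k) = 1 := by
        rw [zpow_neg, zpow_natCast, Units.inv_mul]
      rw [Units.val_pow_eq_pow_val] at this
      rw [hp, map_mul, B.i_X_pow, pow_add]
      linear_combination -B.i p * B.T ^ n * this) fun kl ↦ B.exists_eq _
  choose p hp using hn
  refine ⟨fun _ ↦ n, .of fun k l ↦ p (k, l), ?_⟩
  ext k l
  rw [Matrix.map_one _ (map_zero _) (map_one _), mul_one, Matrix.mul_diagonal, Matrix.map_apply,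
    Matrix.of_apply, zpow_natCast, Units.val_pow_eq_pow_val]
  exact hp (k, l)

/-- Two invertible matrices on the two branches at a node can be diagonalized by the same
change of frame near the node. -/
theorem exists_isBound_isUnit (B₁ : Branch κ x₁ R₁) (B₂ : Branch κ x₂ R₂) (h₁ : B₁.ρ x₂ = 0)
    (h₂ : B₂.ρ x₁ = 0) {M₁ : Matrix (Fin r) (Fin r) R₁} {M₂ : Matrix (Fin r) (Fin r) R₂}
    (hM₁ : IsUnit M₁.det) (hM₂ : IsUnit M₂.det) :
    ∃ (N : Matrix (Fin r) (Fin r) A) (α β : Fin r → ℤ) (W₁ W₂ : Matrix (Fin r) (Fin r) ℂ[X]),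
      N.det = 1 ∧ B₁.IsBound M₁ N α W₁ ∧ B₂.IsBound M₂ N β W₂ ∧ IsUnit W₁.det ∧ IsUnit W₂.det := by
  obtain ⟨n₁, hn₁⟩ := B₁.exists_le_sum M₁ hM₁
  obtain ⟨n₂, hn₂⟩ := B₂.exists_le_sum M₂ hM₂
  obtain ⟨α₀, U₁, hU₁⟩ := B₁.exists_isBound M₁
  obtain ⟨β₀, U₂, hU₂⟩ := B₂.exists_isBound M₂
  -- The total exponent is bounded below by the determinants. At a minimum neither `W₁` nor `W₂` can
  -- be singular at 0, by `exists_col_op` applied to either branch.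
  obtain ⟨z, ⟨N, α, β, W₁, W₂, hN, hb₁, hb₂, hz⟩, hmin⟩ := Int.exists_least_of_bdd
    (P := fun z ↦ ∃ (N : Matrix (Fin r) (Fin r) A) (α β : Fin r → ℤ)
      (W₁ W₂ : Matrix (Fin r) (Fin r) ℂ[X]), N.det = 1 ∧ B₁.IsBound M₁ N α W₁ ∧
        B₂.IsBound M₂ N β W₂ ∧ ∑ l, α l + ∑ l, β l = z)
    ⟨n₁ + n₂, by
      rintro _ ⟨N, α, β, W₁, W₂, hN, hb₁, hb₂, rfl⟩
      exact add_le_add (hn₁ N α W₁ hb₁ hN) (hn₂ N β W₂ hb₂ hN)⟩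
    ⟨_, 1, α₀, β₀, U₁, U₂, Matrix.det_one, hU₁, hU₂, rfl⟩
  refine ⟨N, α, β, W₁, W₂, hN, hb₁, hb₂, B₁.isUnit_of_isUnit ?_ fun h0 ↦ ?_,
    B₂.isUnit_of_isUnit ?_ fun h0 ↦ ?_⟩
  · rw [hb₁.det_eq hN] at hM₁
    exact isUnit_of_mul_isUnit_left hM₁
  · obtain ⟨N', α', W₁', W₂', hN', hb₁', hb₂', hlt⟩ := exists_col_op B₁ B₂ h₂ hN hb₁ hb₂ h0
    have := hmin _ ⟨N', α', β, W₁', W₂', hN', hb₁', hb₂', rfl⟩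
    omega
  · rw [hb₂.det_eq hN] at hM₂
    exact isUnit_of_mul_isUnit_left hM₂
  · obtain ⟨N', β', W₂', W₁', hN', hb₂', hb₁', hlt⟩ := exists_col_op B₂ B₁ h₁ hN hb₂ hb₁ h0
    have := hmin _ ⟨N', α, β', W₁', W₂', hN', hb₁', hb₂', rfl⟩
    omega

end Branch

/-! ### Diagonal transition matrices on a nodal curve -/

section Compatible

variable {X : Scheme.{0}} {M N : X.Modules} {n : ℕ}

/-- Frames of two sheaves of modules over two open subsets have the same transition matrix. -/
def SameTransition {U V : X.Opens} (e : Fin n → Γ(M, U)) (e' : Fin n → Γ(M, V))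
    (f : Fin n → Γ(N, U)) (f' : Fin n → Γ(N, V)) : Prop :=
  ∃ A : Matrix (Fin n) (Fin n) Γ(X, U ⊓ V),
    (∀ k, res M inf_le_left (e k) = ∑ l, A l k • res M inf_le_right (e' l)) ∧
    ∀ k, res N inf_le_left (f k) = ∑ l, A l k • res N inf_le_right (f' l)

variable {U V : X.Opens} {e : Fin n → Γ(M, U)} {e' : Fin n → Γ(M, V)}
  {f : Fin n → Γ(N, U)} {f' : Fin n → Γ(N, V)}

lemma SameTransition.refl (e : Fin n → Γ(M, U)) (f : Fin n → Γ(N, U)) : SameTransition e e f f :=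
  ⟨1, fun k ↦ by simp [Matrix.one_apply], fun k ↦ by simp [Matrix.one_apply]⟩

lemma SameTransition.symm (h : SameTransition e e' f f') (he : IsFrame M U e)
    (he' : IsFrame M V e') : SameTransition e' e f' f := by
  obtain ⟨A, hA, hA'⟩ := h
  obtain ⟨g, k, hg, hk, hgk, -⟩ := (he'.mono (inf_le_right : U ⊓ V ≤ V)).transition
    (he.mono (inf_le_left : U ⊓ V ≤ U))
  have hgA : g = A := by
    ext i j
    refine congrFun ((he'.mono (inf_le_right : U ⊓ V ≤ V)).coeff_ext le_rfl
      (c := fun i ↦ g i j) (d := fun i ↦ A i j) ?_) i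
    simp only [res_self]
    exact (hg j).symm.trans (hA j)
  subst hgA
  have hle : V ⊓ U ≤ U ⊓ V := inf_comm V U |>.le
  refine ⟨k.map (resF hle), fun j ↦ ?_, fun j ↦ ?_⟩
  · have := congrArg (res M hle) (hk j)
    simpa using this
  · have h1 : res N (inf_le_right : U ⊓ V ≤ V) (f' j) = ∑ i, k i j • res N inf_le_left (f i) := by
      simp only [hA', Finset.smul_sum, smul_smul]
      rw [Finset.sum_comm]
      simp only [← Finset.sum_smul]
      have : ∀ i, ∑ l, k l j * g i l = (1 : Matrix (Fin n) (Fin n) Γ(X, U ⊓ V)) i j := fun i ↦ by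
        rw [← hgk, Matrix.mul_apply]
        exact Finset.sum_congr rfl fun _ _ ↦ mul_comm _ _
      simp [this, Matrix.one_apply]
    have := congrArg (res N hle) h1
    simpa using this

lemma SameTransition.of_inf_le_bot (h : U ⊓ V ≤ ⊥) : SameTransition e e' f f' := by
  have hbot : ∀ (M : X.Modules) (s t : Γ(M, U ⊓ V)), s = t := fun M s t ↦
    section_ext M (ι := Empty) (fun i ↦ i.elim) (fun i ↦ i.elim) (h.trans bot_le) fun i ↦ i.elim
  exact ⟨0, fun k ↦ hbot _ _ _, fun k ↦ hbot _ _ _⟩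

end Compatible

section

variable {Z : Scheme.{0}} {s : Z ⟶ Spec (.of ℂ)} {M N : Z.Modules} {r : ℕ} (D : NodalCharts s)

lemma NodalCharts.nonempty_iso {e₀ : Fin r → Γ(M, D.Z₀)} {e₁ : Fin r → Γ(M, D.Z₁)}
    {e₂ : Fin r → Γ(M, D.Z₂)} {f₀ : Fin r → Γ(N, D.Z₀)} {f₁ : Fin r → Γ(N, D.Z₁)}
    {f₂ : Fin r → Γ(N, D.Z₂)} (he₀ : IsFrame M D.Z₀ e₀) (he₁ : IsFrame M D.Z₁ e₁)
    (he₂ : IsFrame M D.Z₂ e₂) (hf₀ : IsFrame N D.Z₀ f₀) (hf₁ : IsFrame N D.Z₁ f₁)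
    (hf₂ : IsFrame N D.Z₂ f₂) (h₀ : SameTransition e₁ e₀ f₁ f₀) (h₂ : SameTransition e₁ e₂ f₁ f₂) :
    Nonempty (M ≅ N) := by
  let U : Fin 3 → Z.Opens := ![D.Z₀, D.Z₁, D.Z₂]
  let e : ∀ i, Fin r → Γ(M, U i) := Fin.cons e₀ (Fin.cons e₁ (Fin.cons e₂ (fun i ↦ i.elim0)))
  let f : ∀ i, Fin r → Γ(N, U i) := Fin.cons f₀ (Fin.cons f₁ (Fin.cons f₂ (fun i ↦ i.elim0)))
  have hbot : D.Z₀ ⊓ D.Z₂ ≤ ⊥ := fun x hx ↦ (D.disjoint x hx.1 hx.2).elim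
  have h : ∀ i j, SameTransition (e i) (e j) (f i) (f j) := by
    intro i j
    fin_cases i <;> fin_cases j
    · exact .refl _ _
    · exact h₀.symm he₁ he₀
    · exact .of_inf_le_bot hbot
    · exact h₀
    · exact .refl _ _
    · exact h₂
    · exact .of_inf_le_bot ((inf_comm _ _).le.trans hbot)
    · exact h₂.symm he₁ he₂
    · exact .refl _ _
  choose A hA hA' using h
  refine nonempty_iso_of_frames (U := U) (top_le_iff.1 fun x _ ↦ ?_) (e := e) (fun i ↦ ?_) (f := f)
    (fun i ↦ ?_) A hA hA'
  · refine TopologicalSpace.Opens.mem_iSup.2 ?_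
    rcases D.cover x with h | h | h
    exacts [⟨0, h⟩, ⟨1, h⟩, ⟨2, h⟩]
  · fin_cases i
    exacts [he₀, he₁, he₂]
  · fin_cases i
    exacts [hf₀, hf₁, hf₂]

/-- `M` has frames on the charts with the transition matrices of `⨁ᵢ 𝒪(aᵢ, bᵢ)`. -/
def NodalCharts.IsDiagonal (D : NodalCharts s) (M : Z.Modules) (a b : Fin r → ℤ) : Prop :=
  ∃ (e₀ : Fin r → Γ(M, D.Z₀)) (e₁ : Fin r → Γ(M, D.Z₁)) (e₂ : Fin r → Γ(M, D.Z₂)),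
    IsFrame M D.Z₀ e₀ ∧ IsFrame M D.Z₁ e₁ ∧ IsFrame M D.Z₂ e₂ ∧
    (∀ k, res M inf_le_right (e₁ k) = zp (resF inf_le_right D.x₁) (resF inf_le_left D.w) (-a k) •
      res M (inf_le_left : D.Z₀ ⊓ D.Z₁ ≤ D.Z₀) (e₀ k)) ∧
    ∀ k, res M inf_le_right (e₁ k) = zp (resF inf_le_right D.x₂) (resF inf_le_left D.v) (-b k) •
      res M (inf_le_left : D.Z₂ ⊓ D.Z₁ ≤ D.Z₂) (e₂ k)

variable {D} {a b : Fin r → ℤ}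

lemma NodalCharts.IsDiagonal.symm (h : D.IsDiagonal M a b) : D.symm.IsDiagonal M b a := by
  obtain ⟨e₀, e₁, e₂, he₀, he₁, he₂, h₀, h₂⟩ := h
  exact ⟨e₂, e₁, e₀, he₂, he₁, he₀, h₂, h₀⟩

lemma NodalCharts.IsDiagonal.iso (h : D.IsDiagonal M a b) (φ : M ≅ N) : D.IsDiagonal N a b := by
  obtain ⟨e₀, e₁, e₂, he₀, he₁, he₂, h₀, h₂⟩ := h
  refine ⟨_, _, _, he₀.iso φ, he₁.iso φ, he₂.iso φ, fun k ↦ ?_, fun k ↦ ?_⟩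
  · rw [← app_res, ← app_res, h₀, Scheme.Modules.Hom.app_smul]
  · rw [← app_res, ← app_res, h₂, Scheme.Modules.Hom.app_smul]

lemma sameTransition_of_diagonal {U V : Z.Opens} {e : Fin r → Γ(M, U)} {e' : Fin r → Γ(M, V)}
    {f : Fin r → Γ(N, U)} {f' : Fin r → Γ(N, V)} (c : Fin r → Γ(Z, V ⊓ U))
    (h : ∀ k, res M inf_le_right (e k) = c k • res M inf_le_left (e' k))
    (h' : ∀ k, res N inf_le_right (f k) = c k • res N inf_le_left (f' k)) :
    SameTransition e e' f f' := by
  have hle : U ⊓ V ≤ V ⊓ U := inf_comm U V |>.le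
  refine ⟨Matrix.diagonal fun k ↦ resF hle (c k), fun k ↦ ?_, fun k ↦ ?_⟩
  · have := congrArg (res M hle) (h k)
    simpa [Matrix.diagonal_apply, ite_smul] using this
  · have := congrArg (res N hle) (h' k)
    simpa [Matrix.diagonal_apply, ite_smul] using this

lemma NodalCharts.IsDiagonal.nonempty_iso (h : D.IsDiagonal M a b) (h' : D.IsDiagonal N a b) :
    Nonempty (M ≅ N) := by
  obtain ⟨e₀, e₁, e₂, he₀, he₁, he₂, h₀, h₂⟩ := h
  obtain ⟨f₀, f₁, f₂, hf₀, hf₁, hf₂, h₀', h₂'⟩ := h'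
  exact D.nonempty_iso he₀ he₁ he₂ hf₀ hf₁ hf₂ (sameTransition_of_diagonal _ h₀ h₀')
    (sameTransition_of_diagonal _ h₂ h₂')

lemma NodalCharts.IsDiagonal.biproduct {L : Fin r → Z.Modules}
    (h : ∀ i, D.IsDiagonal (L i) (fun _ : Fin 1 ↦ a i) (fun _ ↦ b i)) :
    D.IsDiagonal (Limits.biproduct L) a b := by
  choose e₀ e₁ e₂ he₀ he₁ he₂ h₀ h₂ using h
  refine ⟨_, _, _, isFrame_biproduct L he₀, isFrame_biproduct L he₁, isFrame_biproduct L he₂,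
    fun k ↦ ?_, fun k ↦ ?_⟩
  · rw [← app_res, ← app_res, h₀, Scheme.Modules.Hom.app_smul]
  · rw [← app_res, ← app_res, h₂, Scheme.Modules.Hom.app_smul]

lemma NodalCharts.IsDiagonal.isVectorBundle (h : D.IsDiagonal M a b) : IsVectorBundle M r := by
  obtain ⟨e₀, e₁, e₂, he₀, he₁, he₂, -, -⟩ := h
  intro x
  rcases D.cover x with h | h | h
  exacts [⟨_, h, _, he₀⟩, ⟨_, h, _, he₁⟩, ⟨_, h, _, he₂⟩]

end

/-! ### Splitting of vector bundles on the nodal curve -/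

section

open Polynomial

variable {Z : Scheme.{0}} {s : Z ⟶ Spec (.of ℂ)} {M : Z.Modules} {r : ℕ}

lemma IsAffineSpace.bijective_eval₂ {V : Z.Opens} {w : Γ(Z, V)}
    (h : IsAffineSpace s V (fun _ : Fin 1 ↦ w)) :
    Function.Bijective (eval₂RingHom (cst s V) w) := by
  have h1 : eval₂RingHom (cst s V) w = (MvPolynomial.eval₂Hom (cst s V) fun _ : Fin 1 ↦ w).comp
      (MvPolynomial.uniqueAlgEquiv ℂ (Fin 1)).symm.toRingEquiv.toRingHom := by
    apply ringHom_ext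
    · intro c
      simp
    · simp
  rw [h1]
  exact h.2.comp (MvPolynomial.uniqueAlgEquiv ℂ (Fin 1)).symm.bijective

/-- The branch of a nodal curve on the first component. -/
def NodalCharts.branch (D : NodalCharts s) : Branch (cst s D.Z₁) D.x₁ Γ(Z, D.Z₀ ⊓ D.Z₁) where
  ρ := resF inf_le_right
  i := (resF inf_le_left).comp (eval₂RingHom (cst s D.Z₀) D.w)
  T := ⟨resF inf_le_right D.x₁, resF inf_le_left D.w, (mul_comm _ _).trans D.w_mul_x₁, D.w_mul_x₁⟩
  ρ_x := rfl
  i_X := by simp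
  ρ_κ c := by simp
  injective := by
    have hl := D.isAffineSpace_w.1.isLocalization_of_eq_basicOpen D.w
      (homOfLE (inf_le_left : D.Z₀ ⊓ D.Z₁ ≤ D.Z₀)) D.basicOpen_w.symm
    let := (Z.presheaf.map (homOfLE (inf_le_left : D.Z₀ ⊓ D.Z₁ ≤ D.Z₀)).op).hom.toAlgebra
    have hb := D.isAffineSpace_w.bijective_eval₂
    refine (injective_iff_map_eq_zero _).2 fun p hp ↦ ?_
    obtain ⟨⟨_, n, rfl⟩, hn⟩ := (IsLocalization.map_eq_zero_iff (Submonoid.powers D.w)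
      Γ(Z, D.Z₀ ⊓ D.Z₁) (eval₂RingHom (cst s D.Z₀) D.w p)).1 hp
    have h1 : X ^ n * p = 0 := by
      apply hb.1
      rw [map_zero, map_mul, ← hn]
      simp
    simpa using h1
  exists_eq f := by
    have hl := D.isAffineSpace_w.1.isLocalization_of_eq_basicOpen D.w
      (homOfLE (inf_le_left : D.Z₀ ⊓ D.Z₁ ≤ D.Z₀)) D.basicOpen_w.symm
    let := (Z.presheaf.map (homOfLE (inf_le_left : D.Z₀ ⊓ D.Z₁ ≤ D.Z₀)).op).hom.toAlgebra
    have hb := D.isAffineSpace_w.bijective_eval₂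
    obtain ⟨⟨a, ⟨_, n, rfl⟩⟩, hn⟩ := IsLocalization.surj (Submonoid.powers D.w) f
    obtain ⟨p, rfl⟩ := hb.2 a
    refine ⟨n, p, ?_⟩
    replace hn : f * resF inf_le_left (D.w ^ n) =
      resF inf_le_left (eval₂RingHom (cst s D.Z₀) D.w p) := hn
    rw [RingHom.comp_apply, ← hn, map_pow, mul_assoc, ← mul_pow]
    have : resF inf_le_left D.w * resF (inf_le_right : D.Z₀ ⊓ D.Z₁ ≤ D.Z₁) D.x₁ = 1 := D.w_mul_x₁
    simp [this]

/-- On the overlap with `D.Z₀` the function `x₁` is invertible, and `x₁ * x₂ = 0`. -/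
lemma NodalCharts.resF_x₂ (D : NodalCharts s) :
    resF (inf_le_right : D.Z₀ ⊓ D.Z₁ ≤ D.Z₁) D.x₂ = 0 := by
  have h := congrArg (resF (inf_le_right : D.Z₀ ⊓ D.Z₁ ≤ D.Z₁)) D.mul_eq_zero
  rw [map_mul, map_zero] at h
  have h1 := D.w_mul_x₁
  linear_combination resF inf_le_left D.w * h - resF inf_le_right D.x₂ * h1

/-- The matrix `W` is invertible over polynomials in `w`, that is, over the functions on `D.Z₀`, so
it can be absorbed into the frame there. -/
lemma exists_diagonal_frame (D : NodalCharts s) {e₀ : Fin r → Γ(M, D.Z₀)} {e₁ : Fin r → Γ(M, D.Z₁)}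
    (he₀ : IsFrame M D.Z₀ e₀) {g : Matrix (Fin r) (Fin r) Γ(Z, D.Z₀ ⊓ D.Z₁)}
    (hg : ∀ j, res M inf_le_right (e₁ j) = ∑ i, g i j • res M inf_le_left (e₀ i))
    {N : Matrix (Fin r) (Fin r) Γ(Z, D.Z₁)} {α : Fin r → ℤ} {W : Matrix (Fin r) (Fin r) ℂ[X]}
    (h : D.branch.IsBound g N α W) (hW : IsUnit W.det) :
    ∃ f₀ : Fin r → Γ(M, D.Z₀), IsFrame M D.Z₀ f₀ ∧
      ∀ k, res M inf_le_right (∑ j, N j k • e₁ j) =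
        zp (resF inf_le_right D.x₁) (resF inf_le_left D.w) (α k) •
          res M (inf_le_left : D.Z₀ ⊓ D.Z₁ ≤ D.Z₀) (f₀ k) := by
  let Φ := eval₂RingHom (cst s D.Z₀) D.w
  have h1 : W.map Φ * W⁻¹.map Φ = 1 := by
    rw [← Matrix.map_mul, Matrix.mul_nonsing_inv _ hW, Matrix.map_one _ (map_zero _) (map_one _)]
  refine ⟨_, he₀.change (W.map Φ) (W⁻¹.map Φ) h1 (mul_eq_one_comm.1 h1), fun k ↦ ?_⟩
  have h2 : ∀ l, ∑ j, resF inf_le_right (N j k) * g l j =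
      zp (resF inf_le_right D.x₁) (resF inf_le_left D.w) (α k) *
        resF inf_le_left (Φ (W l k)) := fun l ↦ by
    have h3 := h.apply l k
    rw [Matrix.mul_apply] at h3
    refine (Finset.sum_congr rfl fun _ _ ↦ mul_comm _ _).trans (h3.trans ((mul_comm _ _).trans ?_))
    exact congrArg (· * _) (zp_unit D.branch.T (α k)).symm
  simp only [res_sum, res_smul, hg, Finset.smul_sum, smul_smul, Matrix.map_apply]
  rw [Finset.sum_comm]
  simp only [← Finset.sum_smul, h2]

/-- A vector bundle on a nodal curve is a direct sum of line bundles. -/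
theorem NodalCharts.exists_isDiagonal (D : NodalCharts s) (hM : IsVectorBundle M r) :
    ∃ a b : Fin r → ℤ, D.IsDiagonal M a b := by
  obtain ⟨e₀, he₀⟩ := D.isAffineSpace_w.exists_isFrame hM
  obtain ⟨e₂, he₂⟩ := D.isAffineSpace_v.exists_isFrame hM
  obtain ⟨e₁, he₁⟩ := D.exists_isFrame hM
  obtain ⟨g, g', hg, -, hgg', -⟩ := (he₀.mono (inf_le_left : D.Z₀ ⊓ D.Z₁ ≤ _)).transition
    (he₁.mono inf_le_right)
  obtain ⟨h, h', hh, -, hhh', -⟩ := (he₂.mono (inf_le_left : D.Z₂ ⊓ D.Z₁ ≤ _)).transition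
    (he₁.mono inf_le_right)
  obtain ⟨N, α, β, W₁, W₂, hN, hb₁, hb₂, hW₁, hW₂⟩ := exists_isBound_isUnit D.branch
    D.symm.branch D.resF_x₂ D.symm.resF_x₂
    (M₁ := g) (M₂ := h) (Matrix.isUnit_det_of_right_inverse hgg')
    (Matrix.isUnit_det_of_right_inverse hhh')
  obtain ⟨f₀, hf₀, h₀⟩ := exists_diagonal_frame D he₀ hg hb₁ hW₁
  obtain ⟨f₂, hf₂, h₂⟩ := exists_diagonal_frame D.symm he₂ hh hb₂ hW₂
  have hNu : IsUnit N.det := by rw [hN]; exact isUnit_one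
  -- The signs reflect the convention that the transition function of degree `a` is `x₁ ^ (-a)`.
  refine ⟨fun k ↦ -α k, fun k ↦ -β k, f₀, _, f₂, hf₀,
    he₁.change N N⁻¹ (Matrix.mul_nonsing_inv _ hNu) (Matrix.nonsing_inv_mul _ hNu), hf₂,
    fun k ↦ ?_, fun k ↦ ?_⟩
  · rw [neg_neg]
    exact h₀ k
  · rw [neg_neg]
    exact h₂ k

end

/-! ### Degrees of line bundles on the projective line -/

section Glue

variable {X : Scheme.{0}} {M : X.Modules} {n : ℕ}

lemma IsFrame.units_smul {U : X.Opens} {e : Fin n → Γ(M, U)} (he : IsFrame M U e)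
    (u : Γ(X, U)ˣ) : IsFrame M U (fun k ↦ (u : Γ(X, U)) • e k) := by
  have h := he.change (Matrix.diagonal fun _ ↦ (u : Γ(X, U))) (Matrix.diagonal fun _ ↦ ↑u⁻¹)
    (by simp) (by simp)
  simpa [Matrix.diagonal_apply, ite_smul] using h

lemma exists_frame_glue {V V₁ V₂ : X.Opens} (hV : V ≤ V₁ ⊔ V₂) {e₁ : Fin n → Γ(M, V₁)}
    (he₁ : IsFrame M V₁ e₁) {e₂ : Fin n → Γ(M, V₂)} (he₂ : IsFrame M V₂ e₂)
    (u₁ : Γ(X, V ⊓ V₁)ˣ) (u₂ : Γ(X, V ⊓ V₂)ˣ)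
    (h : ∀ k, resF (inf_le_left : (V ⊓ V₁) ⊓ (V ⊓ V₂) ≤ _) (u₁ : Γ(X, V ⊓ V₁)) •
        res M (inf_le_left.trans inf_le_right : (V ⊓ V₁) ⊓ (V ⊓ V₂) ≤ V₁) (e₁ k) =
      resF (inf_le_right : (V ⊓ V₁) ⊓ (V ⊓ V₂) ≤ _) (u₂ : Γ(X, V ⊓ V₂)) •
        res M (inf_le_right.trans inf_le_right : (V ⊓ V₁) ⊓ (V ⊓ V₂) ≤ V₂) (e₂ k)) :
    ∃ e : Fin n → Γ(M, V), IsFrame M V e ∧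
      (∀ k, res M inf_le_left (e k) = (u₁ : Γ(X, V ⊓ V₁)) • res M inf_le_right (e₁ k)) ∧
      ∀ k, res M inf_le_left (e k) = (u₂ : Γ(X, V ⊓ V₂)) • res M inf_le_right (e₂ k) := by
  let U : Fin 2 → X.Opens := ![V ⊓ V₁, V ⊓ V₂]
  let t : ∀ i, Fin n → Γ(M, U i) := Fin.cons
    (fun k ↦ (u₁ : Γ(X, V ⊓ V₁)) • res M inf_le_right (e₁ k))
    (Fin.cons (fun k ↦ (u₂ : Γ(X, V ⊓ V₂)) • res M inf_le_right (e₂ k)) (fun i ↦ i.elim0))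
  have hU : ∀ i, U i ≤ V := by
    intro i
    fin_cases i
    exacts [inf_le_left, inf_le_left]
  have hcov : V ≤ ⨆ i, U i := fun x hx ↦ TopologicalSpace.Opens.mem_iSup.2 (by
    rcases hV hx with h | h
    exacts [⟨0, hx, h⟩, ⟨1, hx, h⟩])
  have h01 : ∀ k, res M (inf_le_left : (V ⊓ V₁) ⊓ (V ⊓ V₂) ≤ V ⊓ V₁)
      ((u₁ : Γ(X, V ⊓ V₁)) • res M inf_le_right (e₁ k)) =
      res M (inf_le_right : (V ⊓ V₁) ⊓ (V ⊓ V₂) ≤ V ⊓ V₂)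
        ((u₂ : Γ(X, V ⊓ V₂)) • res M inf_le_right (e₂ k)) := fun k ↦ by
    rw [res_smul, res_smul, res_res, res_res]
    exact h k
  have h10 : ∀ k, res M (inf_le_left : (V ⊓ V₂) ⊓ (V ⊓ V₁) ≤ V ⊓ V₂)
      ((u₂ : Γ(X, V ⊓ V₂)) • res M inf_le_right (e₂ k)) =
      res M (inf_le_right : (V ⊓ V₂) ⊓ (V ⊓ V₁) ≤ V ⊓ V₁)
        ((u₁ : Γ(X, V ⊓ V₁)) • res M inf_le_right (e₁ k)) := fun k ↦ by
    have := congrArg (res M (inf_comm (V ⊓ V₂) (V ⊓ V₁)).le) (h01 k)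
    rw [res_res, res_res] at this
    exact this.symm
  have hglue : ∀ k, ∃ s : Γ(M, V), ∀ i, res M (hU i) s = t i k := by
    intro k
    refine section_glue M U hU hcov (fun i ↦ t i k) fun i j ↦ ?_
    fin_cases i <;> fin_cases j
    · rfl
    · exact h01 k
    · exact h10 k
    · rfl
  choose e he using hglue
  refine ⟨e, isFrame_of_cover e U hU hcov fun i ↦ ?_, fun k ↦ he k 0, fun k ↦ he k 1⟩
  simp only [he]
  fin_cases i
  exacts [(he₁.mono inf_le_right).units_smul u₁, (he₂.mono inf_le_right).units_smul u₂]

end Glue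

namespace P1

open MvPolynomial

section Ratio

variable {K L N : MvPolynomial (Fin 2) ℂ} (hK : K ∈ grading 1) (hL : L ∈ grading 1)
  (hN : N ∈ grading 1)

/-- The quotient of two linear forms where both do not vanish. -/
def ratio {W : P1.Opens} (hWL : W ≤ Proj.basicOpen grading L)
    (hWN : W ≤ Proj.basicOpen grading N) : Γ(P1, W)ˣ where
  val := resF hWN (linFrac hL hN)
  inv := resF hWL (linFrac hN hL)
  val_inv := by
    have := congrArg (resF (le_inf hWN hWL)) (linFrac_mul_linFrac hL hN)
    simpa using this
  inv_val := by
    have := congrArg (resF (le_inf hWL hWN)) (linFrac_mul_linFrac hN hL)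
    simpa using this

variable {W W' : P1.Opens} (hWK : W ≤ Proj.basicOpen grading K)
  (hWL : W ≤ Proj.basicOpen grading L) (hWN : W ≤ Proj.basicOpen grading N)

lemma ratio_mul : ratio hK hL hWK hWL * ratio hL hN hWL hWN = ratio hK hN hWK hWN := by
  apply Units.ext
  have := congrArg (resF (le_inf hWL hWN)) (linFrac_mul hK hL hN)
  rw [map_mul, resF_resF, resF_resF, resF_resF] at this
  exact this

lemma ratio_zpow_mul (d : ℤ) : (↑(ratio hK hL hWK hWL ^ d) : Γ(P1, W)) *
    ↑(ratio hL hN hWL hWN ^ d) = ↑(ratio hK hN hWK hWN ^ d) := by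
  rw [← Units.val_mul, ← mul_zpow, ratio_mul]

lemma resF_ratio_zpow (h : W' ≤ W) (d : ℤ) : resF h (↑(ratio hL hN hWL hWN ^ d) : Γ(P1, W)) =
    ↑(ratio hL hN (h.trans hWL) (h.trans hWN) ^ d) := by
  have : Units.map (resF h : Γ(P1, W) →* Γ(P1, W')) (ratio hL hN hWL hWN) =
      ratio hL hN (h.trans hWL) (h.trans hWN) :=
    Units.ext (resF_resF _ _ _)
  rw [← this, ← map_zpow]
  rfl

lemma zp_linFrac (d : ℤ) : zp (resF hWN (linFrac hL hN)) (resF hWL (linFrac hN hL)) d =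
    ↑(ratio hL hN hWL hWN ^ d) :=
  zp_unit (ratio hL hN hWL hWN) d

lemma transition_eq (d : ℤ) : transition d =
    ↑(ratio (X_mem 0) (X_mem 1) (inf_le_left : chart 0 ⊓ chart 1 ≤ _) inf_le_right ^ d) := by
  rw [← zp_linFrac, zp, ← map_pow, ← map_pow]
  rfl

end Ratio

variable {M : P1.Modules}

/-- This frees the degree from the standard charts. The hypothesis says that `e` and `f` transform
like `L ^ a` and `N ^ a`; so `(X i / L) ^ a • e` and `(X i / N) ^ a • f` glue to a frame over the
chart `i` that transforms like `X i ^ a`. -/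
theorem hasRankDegree_of_frames {L N : MvPolynomial (Fin 2) ℂ} (hL : L ∈ grading 1)
    (hN : N ∈ grading 1) (hcov : Proj.basicOpen grading L ⊔ Proj.basicOpen grading N = ⊤)
    {e : Fin 1 → Γ(M, Proj.basicOpen grading L)} (he : IsFrame M _ e)
    {f : Fin 1 → Γ(M, Proj.basicOpen grading N)} (hf : IsFrame M _ f) {a : ℤ}
    (h : res M inf_le_right (f 0) = (↑(ratio hN hL (inf_le_right :
        Proj.basicOpen grading L ⊓ Proj.basicOpen grading N ≤ _) inf_le_left ^ a) :
        Γ(P1, Proj.basicOpen grading L ⊓ Proj.basicOpen grading N)) •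
      res M inf_le_left (e 0)) : HasRankDegree M 1 a := by
  have hglue (i : Fin 2) := exists_frame_glue (V := chart i) (le_top.trans hcov.ge) he hf
    (ratio (X_mem i) hL inf_le_left inf_le_right ^ a)
    (ratio (X_mem i) hN inf_le_left inf_le_right ^ a) (fun k ↦ by
      obtain rfl : k = 0 := Subsingleton.elim _ _
      have h1 := congrArg (res M (le_inf (inf_le_left.trans inf_le_right)
        (inf_le_right.trans inf_le_right) : (chart i ⊓ Proj.basicOpen grading L) ⊓
          (chart i ⊓ Proj.basicOpen grading N) ≤ _)) h
      rw [res_res, res_smul, res_res, resF_ratio_zpow] at h1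
      rw [resF_ratio_zpow, resF_ratio_zpow, h1, smul_smul, ratio_zpow_mul])
  choose t ht htL htN using hglue
  refine ⟨t 0, t 1, .of fun _ _ ↦ transition a, ht 0, ht 1, fun j ↦ ?_, by simp⟩
  obtain rfl : j = 0 := Subsingleton.elim _ _
  rw [Fin.sum_univ_one, Matrix.of_apply, transition_eq]
  have hW : ∀ i, (![Proj.basicOpen grading L, Proj.basicOpen grading N] i) ⊓
      (chart 0 ⊓ chart 1) ≤ chart 0 ⊓ chart 1 := fun i ↦ inf_le_right
  refine section_ext M _ hW (fun x hx ↦ TopologicalSpace.Opens.mem_iSup.2 ?_) fun i ↦ ?_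
  · have hx' : x ∈ Proj.basicOpen grading L ⊔ Proj.basicOpen grading N := hcov.ge trivial
    rcases hx' with h | h
    exacts [⟨0, h, hx⟩, ⟨1, h, hx⟩]
  · rw [res_smul, res_res, res_res, resF_ratio_zpow]
    have key {P : MvPolynomial (Fin 2) ℂ} (hP : P ∈ grading 1)
        {p : Γ(M, Proj.basicOpen grading P)} (hp : ∀ i, res M inf_le_left (t i 0) =
          (↑(ratio (X_mem i) hP (inf_le_left : chart i ⊓ Proj.basicOpen grading P ≤ _)
            inf_le_right ^ a) : Γ(P1, chart i ⊓ Proj.basicOpen grading P)) •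
              res M inf_le_right p) {W : P1.Opens}
        (hWP : W ≤ Proj.basicOpen grading P) (hW₀ : W ≤ chart 0) (hW₁ : W ≤ chart 1) :
        res M hW₀ (t 0 0) = (↑(ratio (X_mem 0) (X_mem 1) hW₀ hW₁ ^ a) : Γ(P1, W)) •
          res M hW₁ (t 1 0) := by
      have h0 := congrArg (res M (le_inf hW₀ hWP)) (hp 0)
      have h1 := congrArg (res M (le_inf hW₁ hWP)) (hp 1)
      rw [res_res, res_smul, res_res, resF_ratio_zpow] at h0 h1
      rw [h0, h1, smul_smul, ratio_zpow_mul]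
    fin_cases i
    · exact key hL (fun i ↦ htL i 0) inf_le_left (inf_le_right.trans inf_le_left)
        (inf_le_right.trans inf_le_right)
    · exact key hN (fun i ↦ htN i 0) inf_le_left (inf_le_right.trans inf_le_left)
        (inf_le_right.trans inf_le_right)

end P1

lemma IsAffineSpace.exists_eq_cst {X : Scheme.{0}} {s : X ⟶ Spec (.of ℂ)} {V : X.Opens}
    {w : Γ(X, V)} (h : IsAffineSpace s V (fun _ : Fin 1 ↦ w)) {f : Γ(X, V)} (hf : IsUnit f) :
    ∃ c, c ≠ 0 ∧ f = cst s V c := by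
  let Φ := RingEquiv.ofBijective _ h.bijective_eval₂
  obtain ⟨p, rfl⟩ := h.bijective_eval₂.2 f
  have hp : IsUnit p := (MulEquiv.isUnit_map Φ).1 hf
  obtain ⟨c, hc, rfl⟩ := Polynomial.isUnit_iff.1 hp
  exact ⟨c, hc.ne_zero, by simp⟩

lemma IsAffineSpace.pow_ne_cst {X : Scheme.{0}} {s : X ⟶ Spec (.of ℂ)} {V : X.Opens}
    {w : Γ(X, V)} (h : IsAffineSpace s V (fun _ : Fin 1 ↦ w)) {n : ℕ} (hn : n ≠ 0) (c : ℂ) :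
    w ^ n ≠ cst s V c := by
  intro hw
  have h1 : (Polynomial.X ^ n : Polynomial ℂ) = Polynomial.C c := by
    apply h.bijective_eval₂.1
    simpa using hw
  have h2 := congrArg Polynomial.natDegree h1
  simp at h2
  exact hn h2

namespace P1

lemma nonempty_inf_chart : ∃ x, x ∈ chart 0 ⊓ chart 1 := by
  by_contra! h
  have h1 : P1.basicOpen (coord 0 1) = ⊥ := by
    rw [basicOpen_coord]
    exact le_bot_iff.1 fun x hx ↦ h x hx
  have := (isAffineSpace_chart (i := 0) (j := 1) (by decide)).isDomain
  have h2 := (Scheme.isNilpotent_iff_basicOpen_eq_bot_of_isCompact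
    (isAffineSpace_chart (i := 0) (j := 1) (by decide)).1.isCompact (coord 0 1)).2 h1
  refine (isAffineSpace_chart (i := 0) (j := 1) (by decide)).pow_ne_cst one_ne_zero 0 ?_
  rw [pow_one, map_zero, h2.eq_zero]

instance isIntegral : IsIntegral P1 := by
  obtain ⟨x, hx⟩ := nonempty_inf_chart
  refine isIntegral_of_cover (fun i : Fin 2 ↦ chart i) ?_ (fun i ↦ ?_) (x := x) fun i ↦ ?_
  · rw [← iSup_chart]
    refine le_antisymm (iSup_le fun i ↦ ?_) (sup_le (le_iSup chart 0) (le_iSup chart 1))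
    fin_cases i
    exacts [le_sup_left, le_sup_right]
  · refine (isAffineSpace_chart' i).isIntegral ⟨x, ?_⟩
    fin_cases i
    exacts [hx.1, hx.2]
  · fin_cases i
    exacts [hx.1, hx.2]

lemma resF_injective {U V : P1.Opens} (h : V ≤ U) {x : P1} (hx : x ∈ V) :
    Function.Injective (resF h) := by
  have : Nonempty V := ⟨⟨x, hx⟩⟩
  exact map_injective_of_isIntegral P1 (homOfLE h)

lemma ratio_pow_ne_cst {n : ℕ} (hn : n ≠ 0) (c : ℂ) :
    (↑(ratio (X_mem 0) (X_mem 1) (inf_le_left : chart 0 ⊓ chart 1 ≤ _) inf_le_right ^ n) :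
      Γ(P1, chart 0 ⊓ chart 1)) ≠ cst toSpecC _ c := by
  intro h
  obtain ⟨x, hx⟩ := nonempty_inf_chart
  refine (isAffineSpace_chart (i := 1) (j := 0) (by decide)).pow_ne_cst hn c ?_
  apply resF_injective (inf_le_right : chart 0 ⊓ chart 1 ≤ _) hx
  rw [map_pow, resF_cst, ← h, Units.val_pow_eq_pow_val]
  rfl

/-- Invertible functions on the affine line are constant, so two frames on a chart differ by a
constant. Comparing transition functions shows that `t ^ (a - b)` is constant on the torus, which is
impossible if `a > b`. -/
lemma le_of_hasRankDegree {M : P1.Modules} {a b : ℤ} (h : HasRankDegree M 1 a)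
    (h' : HasRankDegree M 1 b) : a ≤ b := by
  obtain ⟨e₀, e₁, g, he₀, he₁, hg, hdet⟩ := h
  obtain ⟨f₀, f₁, g', hf₀, hf₁, hg', hdet'⟩ := h'
  rw [Matrix.det_fin_one, transition_eq] at hdet hdet'
  have hunit (i : Fin 2) {e f : Fin 1 → Γ(M, chart i)} (he : IsFrame M _ e) (hf : IsFrame M _ f) :
      ∃ c, c ≠ 0 ∧ f 0 = cst toSpecC (chart i) c • e 0 := by
    obtain ⟨g, h, hg, -, hgh, -⟩ := he.transition hf
    have hu : IsUnit (g 0 0) := .of_mul_eq_one (h 0 0) (by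
      simpa [Matrix.mul_apply] using congrFun (congrFun hgh 0) 0)
    obtain ⟨c, hc, hgc⟩ := (isAffineSpace_chart' i).exists_eq_cst hu
    exact ⟨c, hc, by rw [hg, Fin.sum_univ_one, hgc]⟩
  obtain ⟨c, hc, hfe₀⟩ := hunit 0 he₀ hf₀
  obtain ⟨c', hc', hfe₁⟩ := hunit 1 he₁ hf₁
  set t := ratio (X_mem 0) (X_mem 1) (inf_le_left : chart 0 ⊓ chart 1 ≤ _) inf_le_right
  have h1 := hg 0
  have h2 := hg' 0
  rw [Fin.sum_univ_one, hdet] at h1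
  rw [Fin.sum_univ_one, hdet', hfe₀, hfe₁, res_smul, res_smul, h1, resF_cst, resF_cst, smul_smul,
    smul_smul] at h2
  have h3 : cst toSpecC _ c * (↑(t ^ a) : Γ(P1, chart 0 ⊓ chart 1)) =
      (↑(t ^ b) : Γ(P1, chart 0 ⊓ chart 1)) * cst toSpecC (chart 0 ⊓ chart 1) c' :=
    congrFun (he₁.coeff_ext inf_le_right
      (c := fun _ ↦ cst toSpecC _ c * (↑(t ^ a) : Γ(P1, chart 0 ⊓ chart 1)))
      (d := fun _ ↦ (↑(t ^ b) : Γ(P1, chart 0 ⊓ chart 1)) * cst toSpecC (chart 0 ⊓ chart 1) c') (by simpa using h2)) 0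
  by_contra! hlt
  refine ratio_pow_ne_cst (n := (a - b).toNat) (by omega) (c⁻¹ * c') ?_
  have h4 : t ^ a = t ^ (a - b).toNat * t ^ b := by
    rw [← zpow_natCast, ← zpow_add]
    congr 1
    omega
  have h5 : (↑(t ^ b) : Γ(P1, chart 0 ⊓ chart 1)) * ↑(t ^ (-b)) = 1 := by
    rw [← Units.val_mul, ← zpow_add, add_neg_cancel, zpow_zero, Units.val_one]
  have h6 : cst toSpecC (chart 0 ⊓ chart 1) c⁻¹ * cst toSpecC _ c = 1 := by
    rw [← map_mul, inv_mul_cancel₀ hc, map_one]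
  rw [h4, Units.val_mul] at h3
  rw [map_mul]
  change (↑(t ^ (a - b).toNat) : Γ(P1, chart 0 ⊓ chart 1)) = _
  generalize (↑(t ^ (a - b).toNat) : Γ(P1, chart 0 ⊓ chart 1)) = T at *
  linear_combination cst toSpecC _ c⁻¹ * ↑(t ^ (-b)) * h3 -
    (T * (cst toSpecC (chart 0 ⊓ chart 1) c⁻¹ * cst toSpecC _ c) -
      cst toSpecC _ c⁻¹ * cst toSpecC _ c') * h5 - T * h6

/-- The degree of a line bundle on the projective line is well defined. -/
theorem degree_unique {M : P1.Modules} {a b : ℤ} (h : HasRankDegree M 1 a)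
    (h' : HasRankDegree M 1 b) : a = b :=
  le_antisymm (le_of_hasRankDegree h h') (le_of_hasRankDegree h' h)

end P1

/-! ### Restriction of line bundles to the components of a nodal curve -/

section

variable {X Y : Scheme.{0}}

lemma eval₂Hom_mem {A σ : Type*} [CommRing A] (S : Subring A) {κ : ℂ →+* A} {b : σ → A}
    (hκ : ∀ c, κ c ∈ S) (hb : ∀ i, b i ∈ S) (p : MvPolynomial σ ℂ) :
    MvPolynomial.eval₂Hom κ b p ∈ S := by
  induction p using MvPolynomial.induction_on with
  | C c => simpa using hκ c
  | add p q hp hq =>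
    rw [map_add]
    exact add_mem hp hq
  | mul_X p i hp =>
    rw [map_mul, MvPolynomial.eval₂Hom_X']
    exact mul_mem hp (hb i)

lemma hasCoord_of_mem_range {s : X ⟶ Spec (.of ℂ)} {V : X.Opens} (hV : IsAffineOpen V)
    {a : Γ(X, V)} {σ : Type*} {b : σ → Γ(X, V)}
    (hb : Function.Surjective (MvPolynomial.eval₂Hom (cst s V) b))
    (h : ∀ i, b i ∈ (MvPolynomial.eval₂Hom (cst s V) fun _ : Fin 1 ↦ a).range) :
    HasCoord s V a := by
  refine ⟨hV, fun f ↦ ?_⟩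
  obtain ⟨p, rfl⟩ := hb f
  exact eval₂Hom_mem (MvPolynomial.eval₂Hom (cst s V) fun _ : Fin 1 ↦ a).range
    (fun c ↦ ⟨MvPolynomial.C c, by simp⟩) h p

lemma HasCoord.sub_cst {s : X ⟶ Spec (.of ℂ)} {V : X.Opens} {a : Γ(X, V)} (h : HasCoord s V a)
    (c : ℂ) : HasCoord s V (a - cst s V c) :=
  hasCoord_of_mem_range h.1 h.2 fun _ ↦ ⟨MvPolynomial.X 0 + MvPolynomial.C c, by simp⟩

lemma surjective_eval₂_preimage {s : Y ⟶ Spec (.of ℂ)} {V : Y.Opens} (hV : IsAffineOpen V)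
    {σ : Type*} {b : σ → Γ(Y, V)} (hb : Function.Surjective (MvPolynomial.eval₂Hom (cst s V) b))
    (f : X ⟶ Y) [IsClosedImmersion f] : Function.Surjective
      (MvPolynomial.eval₂Hom (cst (f ≫ s) (f ⁻¹ᵁ V)) fun i ↦ pullF f le_rfl (b i)) := by
  intro g
  obtain ⟨g, rfl⟩ := f.app_surjective V hV g
  obtain ⟨p, rfl⟩ := hb g
  refine ⟨p, ?_⟩
  have h : MvPolynomial.eval₂Hom (cst (f ≫ s) (f ⁻¹ᵁ V)) (fun i ↦ pullF f le_rfl (b i)) =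
      (pullF f le_rfl).comp (MvPolynomial.eval₂Hom (cst s V) b) := by
    apply MvPolynomial.ringHom_ext <;> simp
  exact congr($h p).trans (pullF_eq_app f le_rfl _)

lemma HasCoord.preimage {s : Y ⟶ Spec (.of ℂ)} {V : Y.Opens} {a : Γ(Y, V)} (h : HasCoord s V a)
    (f : X ⟶ Y) [IsClosedImmersion f] : HasCoord (f ≫ s) (f ⁻¹ᵁ V) (pullF f le_rfl a) :=
  ⟨h.1.preimage f, surjective_eval₂_preimage h.1 h.2 f⟩

end

namespace P1

lemma exists_notMem_chart : ∃ x : P1, x ∉ chart 0 := by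
  by_contra! h
  have h1 : P1.basicOpen (coord 1 0) = chart 1 := by
    rw [basicOpen_coord]
    exact inf_eq_left.2 fun x _ ↦ h x
  have h2 : IsUnit (coord 1 0) := by
    have h3 := isUnit_resF_basicOpen (coord 1 0)
    have h4 := h3.map (resF h1.ge)
    simpa using h4
  obtain ⟨c, -, hc⟩ := (isAffineSpace_chart (i := 1) (j := 0) (by decide)).exists_eq_cst h2
  exact (isAffineSpace_chart (i := 1) (j := 0) (by decide)).pow_ne_cst one_ne_zero c
    (by rw [pow_one, hc])

lemma mem_chart_of_notMem {x : P1} (hx : x ∉ chart 0) : x ∈ chart 1 :=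
  (show x ∈ chart 0 ⊔ chart 1 from iSup_chart ▸ trivial).resolve_left hx

/-- The projective line is not a closed subscheme of the affine line. -/
lemma ne_top_of_hasCoord {V : P1.Opens} {a : Γ(P1, V)} (ha : HasCoord toSpecC V a) : V ≠ ⊤ := by
  rintro rfl
  obtain ⟨x, hx⟩ := exists_notMem_chart
  obtain ⟨y, hy⟩ := nonempty_inf_chart
  have hx₁ := mem_chart_of_notMem hx
  have hc := isAffineSpace_chart (i := 1) (j := 0) (by decide)
  have hxc : x ∉ P1.basicOpen (coord 1 0) := by
    rw [basicOpen_coord]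
    exact fun h ↦ hx h.2
  obtain ⟨c, g, hg⟩ := hc.hasCoord.exists_eq (resF le_top a)
  -- Subtracting the value at `x`, the point outside `chart 0`, gives a coordinate with its only
  -- possible zero at `x`. It is then invertible on `chart 0`, hence constant, hence zero because it
  -- vanishes at `x`; but then it has more than one zero.
  set a' := a - cst toSpecC ⊤ c
  have ha' : HasCoord toSpecC ⊤ a' := ha.sub_cst c
  have hxa : x ∉ P1.basicOpen a' := by
    have h1 : resF (le_top : chart 1 ≤ ⊤) a' = cst toSpecC _ 0 + coord 1 0 * g := by
      rw [map_sub, hg, resF_cst, map_zero]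
      ring
    have h2 := (mem_basicOpen_cst_add_iff (s := toSpecC) hx₁ hxc 0 g).not_left.2 rfl
    rw [← h1] at h2
    exact fun h ↦ h2 ((mem_basicOpen_resF _ _).2 ⟨hx₁, h⟩)
  have hle : chart 0 ≤ P1.basicOpen a' := fun z hz ↦ by
    by_contra h
    exact hx (ha'.eq_of_notMem trivial trivial hxa h ▸ hz)
  have hu : IsUnit (resF (le_top : chart 0 ≤ ⊤) a') := by
    simpa using (isUnit_resF_basicOpen a').map (resF hle)
  obtain ⟨d, -, hd⟩ := (isAffineSpace_chart (i := 0) (j := 1) (by decide)).exists_eq_cst hu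
  have hd' : a' = cst toSpecC ⊤ d := by
    apply resF_injective (le_top : chart 0 ≤ ⊤) hy.1
    rw [hd, resF_cst]
  have hd0 : d = 0 := by
    by_contra h
    exact hxa (hd' ▸ (mem_basicOpen_cst_iff (s := toSpecC) (V := ⊤) (x := x) trivial d).2 h)
  refine hx ((ha'.eq_of_notMem (x := x) (y := y) trivial trivial hxa ?_) ▸ hy.1)
  rw [hd', hd0, map_zero, P1.basicOpen_zero]
  exact fun h ↦ h

/-- The complement of `V` is nonempty because the projective line has no global coordinate. It lies
in `V'` in the zero set of `a'`, which has at most one point. -/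
lemma exists_compl_point {V V' : P1.Opens} {a : Γ(P1, V)} {a' : Γ(P1, V')}
    (ha : HasCoord P1.toSpecC V a) (ha' : HasCoord P1.toSpecC V' a')
    (hb : P1.basicOpen a' = V ⊓ V') (hcov : ∀ x, x ∈ V ∨ x ∈ V') :
    ∃ α, IsClosed {α} ∧ ∀ x, x ∈ V ↔ x ≠ α := by
  have hne := P1.ne_top_of_hasCoord ha
  obtain ⟨α, hα⟩ : ∃ α, α ∉ V := by
    by_contra! h
    exact hne (top_le_iff.1 fun x _ ↦ h x)
  have h1 : ∀ x, x ∈ V ↔ x ≠ α := fun x ↦ by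
    refine ⟨?_, fun h ↦ ?_⟩
    · rintro h rfl
      exact hα h
    · by_contra hx
      have h2 {y : P1} (hy : y ∉ V) : y ∉ P1.basicOpen a' := by
        rw [hb]
        exact fun h ↦ hy h.1
      exact h (ha'.eq_of_notMem ((hcov x).resolve_left hx) ((hcov α).resolve_left hα) (h2 hx)
        (h2 hα))
  refine ⟨α, ?_, h1⟩
  rw [← isOpen_compl_iff]
  convert V.isOpen using 1
  ext x
  exact (h1 x).symm

/-- Each of the two coordinates generates the functions vanishing at `β`, so each divides the other.
Their quotient is a unit on an affine line, hence a constant. -/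
lemma eq_cst_mul {V : P1.Opens} {w l : Γ(P1, V)} (hl : IsAffineSpace toSpecC V (fun _ : Fin 1 ↦ l))
    (hw : HasCoord toSpecC V w) {β : P1} (hβ : β ∈ V) (hwβ : β ∉ P1.basicOpen w)
    (hlβ : β ∉ P1.basicOpen l) : ∃ c, c ≠ 0 ∧ w = cst toSpecC V c * l := by
  have key {a b : Γ(P1, V)} (ha : HasCoord toSpecC V a) (haβ : β ∉ P1.basicOpen a)
      (hbβ : β ∉ P1.basicOpen b) : ∃ g, b = a * g := by
    obtain ⟨c, g, rfl⟩ := ha.exists_eq b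
    rw [mem_basicOpen_cst_add_iff (s := toSpecC) hβ haβ, not_not] at hbβ
    exact ⟨g, by rw [hbβ, map_zero, zero_add]⟩
  obtain ⟨g, hg⟩ := key hl.hasCoord hlβ hwβ
  obtain ⟨g', hg'⟩ := key hw hwβ hlβ
  have := hl.isDomain
  have hl0 : l ≠ 0 := fun h ↦ hl.pow_ne_cst one_ne_zero 0 (by simp [h])
  have h1 : g * g' = 1 := by
    apply mul_left_cancel₀ hl0
    rw [← mul_assoc, ← hg, ← hg', mul_one]
  obtain ⟨c, hc, rfl⟩ := hl.exists_eq_cst (.of_mul_eq_one _ h1)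
  exact ⟨c, hc, by rw [hg, mul_comm]⟩

lemma isAffineSpace_linFrac_of_eq {A B : Matrix (Fin 2) (Fin 2) ℂ} (hAB : A * B = 1)
    (hBA : B * A = 1) {u u' : Fin 2 → ℂ} (hu : A 0 = u) (hu' : A 1 = u') :
    IsAffineSpace toSpecC (Proj.basicOpen grading (lin u))
      (fun _ : Fin 1 ↦ linFrac (lin_mem u') (lin_mem u)) := by
  subst hu hu'
  exact isAffineSpace_linFrac hAB hBA zero_ne_one

lemma sup_basicOpen_lin_of_eq {A B : Matrix (Fin 2) (Fin 2) ℂ} (hAB : A * B = 1)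
    (hBA : B * A = 1) {u u' : Fin 2 → ℂ} (hu : A 0 = u) (hu' : A 1 = u') :
    Proj.basicOpen grading (lin u) ⊔ Proj.basicOpen grading (lin u') = ⊤ := by
  subst hu hu'
  exact sup_basicOpen_lin hAB hBA

lemma exists_linFrac {α β : P1} (hα : IsClosed {α}) (hβ : IsClosed {β}) (hαβ : α ≠ β) :
    ∃ (L N : MvPolynomial (Fin 2) ℂ) (hL : L ∈ grading 1) (hN : N ∈ grading 1),
      (∀ x, x ∈ Proj.basicOpen grading L ↔ x ≠ α) ∧ (∀ x, x ∈ Proj.basicOpen grading N ↔ x ≠ β) ∧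
      Proj.basicOpen grading L ⊔ Proj.basicOpen grading N = ⊤ ∧
      IsAffineSpace toSpecC (Proj.basicOpen grading L) (fun _ : Fin 1 ↦ linFrac hN hL) := by
  obtain ⟨u, hu, hLα⟩ := P1.exists_lin hα
  obtain ⟨u', -, hNβ⟩ := P1.exists_lin hβ
  obtain ⟨B, hB, hB'⟩ := P1.exists_inv_of_ne hαβ hu hLα hNβ
  exact ⟨lin u, lin u', lin_mem u, lin_mem u', hLα, hNβ, P1.sup_basicOpen_lin_of_eq hB hB' rfl rfl,
    P1.isAffineSpace_linFrac_of_eq hB hB' rfl rfl⟩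

/-- Two affine lines which cover the projective line are the complements of two points. -/
lemma exists_lin_pair {V V' : P1.Opens} {a : Γ(P1, V)} {a' : Γ(P1, V')}
    (ha : HasCoord P1.toSpecC V a) (ha' : HasCoord P1.toSpecC V' a')
    (hb : P1.basicOpen a = V ⊓ V') (hb' : P1.basicOpen a' = V ⊓ V') (hcov : ∀ x, x ∈ V ∨ x ∈ V') :
    (∃ α, α ∉ V) ∧ ∃ (L N : MvPolynomial (Fin 2) ℂ) (hL : L ∈ grading 1) (hN : N ∈ grading 1)
      (c : ℂ) (hA : Proj.basicOpen grading L ≤ V), Proj.basicOpen grading N ≤ V' ∧ c ≠ 0 ∧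
      Proj.basicOpen grading L ⊔ Proj.basicOpen grading N = ⊤ ∧
      resF hA a = cst P1.toSpecC _ c * P1.linFrac hN hL := by
  obtain ⟨α, hα, hAα⟩ := P1.exists_compl_point ha ha' hb' hcov
  obtain ⟨β, hβ, hBβ⟩ :=
    P1.exists_compl_point ha' ha (hb.trans (inf_comm _ _)) fun x ↦ (hcov x).symm
  have hαA : α ∉ V := fun h ↦ (hAα α).1 h rfl
  have hβB : β ∉ V' := fun h ↦ (hBβ β).1 h rfl
  have hαβ : α ≠ β := fun h ↦ hαA (h ▸ (hcov β).resolve_right hβB)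
  obtain ⟨L, N, hL, hN, hLα, hNβ, hLN, hl⟩ := P1.exists_linFrac hα hβ hαβ
  obtain rfl : Proj.basicOpen grading L = V := by
    ext x
    exact (hLα x).trans (hAα x).symm
  have hlβ : β ∉ P1.basicOpen (P1.linFrac hN hL) := by
    rw [P1.basicOpen_linFrac]
    exact fun h ↦ (hNβ β).1 h.2 rfl
  have hwβ : β ∉ P1.basicOpen a := by
    rw [hb]
    exact fun h ↦ hβB h.2
  obtain ⟨c, hc, h⟩ := P1.eq_cst_mul hl ha ((hLα β).2 hαβ.symm) hwβ hlβ
  exact ⟨⟨α, hαA⟩, L, N, hL, hN, c, le_rfl, fun x hx ↦ (hBβ x).2 ((hNβ x).1 hx), hc, hLN,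
    (resF_self _ _).trans h⟩

end P1

section

variable {Z : Scheme.{0}} {s : Z ⟶ Spec (.of ℂ)}

/-- The node is the only point outside of the two lines. -/
lemma NodalCharts.eq_of_notMem (D : NodalCharts s) {x y : Z} (hx₀ : x ∉ D.Z₀) (hx₂ : x ∉ D.Z₂)
    (hy₀ : y ∉ D.Z₀) (hy₂ : y ∉ D.Z₂) : x = y := by
  have key {x : Z} (hx₀ : x ∉ D.Z₀) (hx₂ : x ∉ D.Z₂) : x ∈ D.Z₁ ∧ x ∉ Z.basicOpen D.x₁ ∧
      x ∉ Z.basicOpen D.x₂ := by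
    refine ⟨((D.cover x).resolve_left hx₀).resolve_right hx₂, ?_, ?_⟩
    · rw [D.basicOpen_x₁]
      exact fun h ↦ hx₀ h.1
    · rw [D.basicOpen_x₂]
      exact fun h ↦ hx₂ h.1
  obtain ⟨hx, hx1, hx2⟩ := key hx₀ hx₂
  obtain ⟨hy, hy1, hy2⟩ := key hy₀ hy₂
  refine IsAffineOpen.ext_of_basicOpen D.isAffineOpen hx hy fun f ↦ ?_
  obtain ⟨c, hc⟩ := D.isNodalRing.exists_eq f
  obtain ⟨a, b, hab⟩ := Ideal.mem_span_pair.1 hc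
  obtain rfl : f = cst s D.Z₁ c + (a * D.x₁ + b * D.x₂) * 1 := by rw [hab]; ring
  have h {x : Z} (h1 : x ∉ Z.basicOpen D.x₁) (h2 : x ∉ Z.basicOpen D.x₂) :
      x ∉ Z.basicOpen (a * D.x₁ + b * D.x₂) := fun h ↦
    (Z.basicOpen_add_le _ _ h).elim (fun h ↦ h1 ((mem_basicOpen_mul_iff _ _ _).1 h).2)
      fun h ↦ h2 ((mem_basicOpen_mul_iff _ _ _).1 h).2
  rw [mem_basicOpen_cst_add_iff hx (h hx1 hx2), mem_basicOpen_cst_add_iff hy (h hy1 hy2)]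

variable (D : NodalCharts s) (f : P1 ⟶ Z) [IsClosedImmersion f]

/-- A closed immersion of the projective line which misses a component of a nodal curve is given by
coordinates on the other component. -/
lemma NodalCharts.hasCoord_component (hf : f ≫ s = P1.toSpecC) (hf₂ : ∀ x, f x ∉ D.Z₂) :
    HasCoord P1.toSpecC (f ⁻¹ᵁ D.Z₀) (pullF f le_rfl D.w) ∧
      HasCoord P1.toSpecC (f ⁻¹ᵁ D.Z₁) (pullF f le_rfl D.x₁) := by
  rw [← hf]
  refine ⟨(D.isAffineSpace_w.hasCoord).preimage f,
    hasCoord_of_mem_range (D.isAffineOpen.preimage f)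
      (surjective_eval₂_preimage D.isAffineOpen D.surjective f) ?_⟩
  have hx₂ : pullF f (le_refl (f ⁻¹ᵁ D.Z₁)) D.x₂ = 0 := by
    -- The locus where the pulled back `x₂` is invertible is empty because `f` misses `D.Z₂`; the
    -- function is therefore nilpotent, and zero since the projective line is reduced.
    have h1 : P1.basicOpen (pullF f (le_refl (f ⁻¹ᵁ D.Z₁)) D.x₂) = ⊥ := by
      rw [preimage_basicOpen', D.basicOpen_x₂]
      exact le_bot_iff.1 fun x hx ↦ hf₂ x hx.1
    exact ((Scheme.isNilpotent_iff_basicOpen_eq_bot_of_isCompact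
      (D.isAffineOpen.preimage f).isCompact _).2 h1).eq_zero
  rw [Fin.forall_fin_two]
  exact ⟨⟨MvPolynomial.X 0, by simp⟩, ⟨0, by simpa using hx₂.symm⟩⟩

/-- The coordinates on a component of a nodal curve. -/
theorem NodalCharts.exists_component (hf : f ≫ s = P1.toSpecC) (hf₂ : ∀ x, f x ∉ D.Z₂) :
    (∃ α, f α ∉ D.Z₀) ∧ ∃ (L N : MvPolynomial (Fin 2) ℂ) (hL : L ∈ grading 1) (hN : N ∈ grading 1)
      (c : ℂ) (hA : Proj.basicOpen grading L ≤ f ⁻¹ᵁ D.Z₀),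
      Proj.basicOpen grading N ≤ f ⁻¹ᵁ D.Z₁ ∧ c ≠ 0 ∧
      Proj.basicOpen grading L ⊔ Proj.basicOpen grading N = ⊤ ∧
      pullF f hA D.w = cst P1.toSpecC _ c * P1.linFrac hN hL := by
  have hcov : ∀ x, x ∈ f ⁻¹ᵁ D.Z₀ ∨ x ∈ f ⁻¹ᵁ D.Z₁ := fun x ↦
    (D.cover (f x)).imp_right fun h ↦ h.resolve_right (hf₂ x)
  have hbw : P1.basicOpen (pullF f (le_refl (f ⁻¹ᵁ D.Z₀)) D.w) = f ⁻¹ᵁ D.Z₀ ⊓ f ⁻¹ᵁ D.Z₁ :=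
    (preimage_basicOpen' f D.w).trans (congrArg (f ⁻¹ᵁ ·) D.basicOpen_w)
  have hbx₁ : P1.basicOpen (pullF f (le_refl (f ⁻¹ᵁ D.Z₁)) D.x₁) = f ⁻¹ᵁ D.Z₀ ⊓ f ⁻¹ᵁ D.Z₁ :=
    (preimage_basicOpen' f D.x₁).trans (congrArg (f ⁻¹ᵁ ·) D.basicOpen_x₁)
  obtain ⟨hw, hx₁⟩ := D.hasCoord_component f hf hf₂
  obtain ⟨⟨α, hα⟩, L, N, hL, hN, c, hA, hB, hc, hLN, h⟩ :=
    P1.exists_lin_pair hw hx₁ hbw hbx₁ hcov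
  exact ⟨⟨α, hα⟩, L, N, hL, hN, c, hA, hB, hc, hLN, (resF_pullF f le_rfl hA _).symm.trans h⟩

lemma res_pull_smul {X Y : Scheme.{0}} (f : X ⟶ Y) {M : Y.Modules} {V : Y.Opens} {W : X.Opens}
    (h : W ≤ f ⁻¹ᵁ V) (a : Γ(Y, V)) (t : Γ(M, V)) :
    res (restr f M) h (pull f (a • t)) = pullF f h a • res (restr f M) h (pull f t) := by
  rw [pull_smul, res_smul]
  rw [← pullF_eq_app f le_rfl, resF_pullF]

lemma res_pull_res {X Y : Scheme.{0}} (f : X ⟶ Y) {M : Y.Modules} {V V' : Y.Opens} {W : X.Opens}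
    (h : W ≤ f ⁻¹ᵁ V') (h' : V' ≤ V) (t : Γ(M, V)) :
    res (restr f M) h (pull f (res M h' t)) =
      res (restr f M) (h.trans (f.preimage_mono h')) (pull f t) := by
  rw [pull_res, res_res]

/-- The degree of a line bundle on a component of a nodal curve. -/
theorem NodalCharts.IsDiagonal.hasRankDegree {D : NodalCharts s} {M : Z.Modules} {a b : ℤ}
    (h : D.IsDiagonal M (fun _ : Fin 1 ↦ a) (fun _ ↦ b)) (hf : f ≫ s = P1.toSpecC)
    (hf₂ : ∀ x, f x ∉ D.Z₂) : HasRankDegree (restr f M) 1 a := by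
  obtain ⟨e₀, e₁, e₂, he₀, he₁, -, h₀, -⟩ := h
  obtain ⟨-, L, N, hL, hN, c, hA, hB, hc, hcov, hw⟩ := D.exists_component f hf hf₂
  let C : ∀ V : P1.Opens, Γ(P1, V)ˣ := fun V ↦
    Units.map (cst P1.toSpecC V : ℂ →* Γ(P1, V)) (Units.mk0 c hc)
  -- The coordinate `w` is `c` times a quotient of linear forms; rescaling one frame by `c ^ (-a)`
  -- absorbs this constant.
  refine P1.hasRankDegree_of_frames (a := a) hL hN hcov (he₀.pull.mono hA)
    ((he₁.pull.mono hB).units_smul (C _ ^ (-a))) ?_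
  set W := Proj.basicOpen grading L ⊓ Proj.basicOpen grading N
  have hAB : W ≤ f ⁻¹ᵁ (D.Z₀ ⊓ D.Z₁) := fun x hx ↦ ⟨hA hx.1, hB hx.2⟩
  have h1 := congrArg (fun t ↦ res (restr f M) hAB (pull f t)) (h₀ 0)
  dsimp only at h1
  rw [res_pull_res, res_pull_smul, res_pull_res, map_zp, pullF_resF, pullF_resF] at h1
  rw [res_smul, res_res, res_res, h1, smul_smul]
  congr 1
  have hwx : pullF f (hAB.trans (f.preimage_mono inf_le_left)) D.w *
      pullF f (hAB.trans (f.preimage_mono inf_le_right)) D.x₁ = 1 := by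
    have := congrArg (pullF f hAB) D.w_mul_x₁
    simpa using this
  have hw' : pullF f (hAB.trans (f.preimage_mono inf_le_left)) D.w =
      ↑(C W * P1.ratio hN hL (inf_le_right : W ≤ _) inf_le_left) := by
    have := congrArg (resF (inf_le_left : W ≤ _)) hw
    rw [resF_pullF, map_mul, resF_cst] at this
    exact this
  have hx' : pullF f (hAB.trans (f.preimage_mono inf_le_right)) D.x₁ =
      ↑(C W * P1.ratio hN hL (inf_le_right : W ≤ _) inf_le_left)⁻¹ := by
    rw [hw'] at hwx
    exact (Units.inv_eq_of_mul_eq_one_right hwx).symm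
  have hC : resF (inf_le_right : W ≤ _) (↑(C (Proj.basicOpen grading N) ^ (-a)) :
      Γ(P1, Proj.basicOpen grading N)) = ↑(C W ^ (-a)) := by
    have : Units.map (resF (inf_le_right : W ≤ _) : Γ(P1, Proj.basicOpen grading N) →* Γ(P1, W))
        (C _) = C W := Units.ext (resF_cst _ _ _)
    exact congrArg Units.val ((map_zpow (Units.map (resF (inf_le_right : W ≤ _) :
      Γ(P1, Proj.basicOpen grading N) →* Γ(P1, W))) (C _) (-a)).trans (by rw [this]))
  rw [zp_eq_unit hx' (by rw [inv_inv]; exact hw'), hC, ← Units.val_mul, inv_zpow, ← zpow_neg,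
    neg_neg, mul_zpow, ← mul_assoc, ← zpow_add, neg_add_cancel, zpow_zero, one_mul]

end

/-! ### Splitting types on a nodal curve -/

section

lemma IsAffineSpace.ne_bot {X : Scheme.{0}} {s : X ⟶ Spec (.of ℂ)} {V : X.Opens}
    {a : Fin 1 → Γ(X, V)} (h : IsAffineSpace s V a) : V ≠ ⊥ := by
  rintro rfl
  have := h.isDomain
  exact one_ne_zero (α := Γ(X, ⊥)) (Subsingleton.elim _ _)

variable {Z : Scheme.{0}} {s : Z ⟶ Spec (.of ℂ)} (D : NodalCharts s)

/-- Two curves are the components of a nodal curve, in the order of its charts. -/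
structure NodalCharts.IsParametrization (f₁ f₂ : P1 ⟶ Z) : Prop where
  isClosedImmersion₁ : IsClosedImmersion f₁
  isClosedImmersion₂ : IsClosedImmersion f₂
  comp₁ : f₁ ≫ s = P1.toSpecC
  comp₂ : f₂ ≫ s = P1.toSpecC
  notMem₁ : ∀ x, f₁ x ∉ D.Z₂
  notMem₂ : ∀ x, f₂ x ∉ D.Z₀

variable {D} {f₁ f₂ : P1 ⟶ Z}

variable (D) in
-- The projective line is irreducible, while `D.Z₀` and `D.Z₂` are disjoint, so each curve misses
-- one of them. Both cannot miss the same one, because together they cover the nodal curve.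
lemma NodalCharts.isParametrization_or_symm [IsClosedImmersion f₁] [IsClosedImmersion f₂]
    (h₁ : f₁ ≫ s = P1.toSpecC) (h₂ : f₂ ≫ s = P1.toSpecC)
    (hcov : Set.range f₁ ∪ Set.range f₂ = Set.univ) :
    D.IsParametrization f₁ f₂ ∨ D.IsParametrization f₂ f₁ := by
  have key (f : P1 ⟶ Z) : (∀ x, f x ∉ D.Z₀) ∨ ∀ x, f x ∉ D.Z₂ := by
    by_contra! h
    obtain ⟨⟨x, hx⟩, ⟨y, hy⟩⟩ := h
    obtain ⟨z, -, hz₀, hz₂⟩ := PreirreducibleSpace.isPreirreducible_univ (X := P1)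
      (f ⁻¹ᵁ D.Z₀ : P1.Opens) (f ⁻¹ᵁ D.Z₂ : P1.Opens) (f ⁻¹ᵁ D.Z₀).isOpen (f ⁻¹ᵁ D.Z₂).isOpen
      ⟨x, trivial, hx⟩ ⟨y, trivial, hy⟩
    exact D.disjoint _ hz₀ hz₂
  have hne {V : Z.Opens} {v : Fin 1 → Γ(Z, V)} (hV : IsAffineSpace s V v)
      (hV₁ : ∀ x, f₁ x ∉ V) (hV₂ : ∀ x, f₂ x ∉ V) : False := by
    refine hV.ne_bot (le_bot_iff.1 fun z hz ↦ ?_)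
    rcases hcov.ge (Set.mem_univ z) with ⟨x, rfl⟩ | ⟨x, rfl⟩
    exacts [hV₁ x hz, hV₂ x hz]
  rcases key f₁ with k₁ | k₁ <;> rcases key f₂ with k₂ | k₂
  · exact (hne D.isAffineSpace_w k₁ k₂).elim
  · exact .inr ⟨‹_›, ‹_›, h₂, h₁, k₂, k₁⟩
  · exact .inl ⟨‹_›, ‹_›, h₁, h₂, k₁, k₂⟩
  · exact (hne D.isAffineSpace_v k₁ k₂).elim

/-- A component is not contained in an affine line, so each of the two curves passes through a point
outside `D.Z₀` and `D.Z₂`, and there is only one such point. -/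
lemma NodalCharts.IsParametrization.mem_range (h : D.IsParametrization f₁ f₂) {z : Z}
    (h₀ : z ∉ D.Z₀) (h₂ : z ∉ D.Z₂) : z ∈ Set.range f₁ ∩ Set.range f₂ := by
  have := h.isClosedImmersion₁
  have := h.isClosedImmersion₂
  obtain ⟨⟨α, hα⟩, -⟩ := D.exists_component f₁ h.comp₁ h.notMem₁
  obtain ⟨⟨β, hβ⟩, -⟩ := D.symm.exists_component f₂ h.comp₂ h.notMem₂
  exact ⟨⟨α, D.eq_of_notMem hα (h.notMem₁ α) h₀ h₂⟩, ⟨β, D.eq_of_notMem (h.notMem₂ β) hβ h₀ h₂⟩⟩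

variable {M : Z.Modules} {r : ℕ}

lemma NodalCharts.IsParametrization.isLineBundleOfBidegree (h : D.IsParametrization f₁ f₂) {a b : ℤ}
    (hM : D.IsDiagonal M (fun _ : Fin 1 ↦ a) (fun _ ↦ b)) :
    IsLineBundleOfBidegree f₁ f₂ M a b := by
  have := h.isClosedImmersion₁
  have := h.isClosedImmersion₂
  exact ⟨hM.isVectorBundle, hM.hasRankDegree f₁ h.comp₁ h.notMem₁,
    hM.symm.hasRankDegree f₂ h.comp₂ h.notMem₂⟩

/-- The bundle has some diagonal type by `exists_isDiagonal`; its entries are the degrees on the two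
components and hence equal `a` and `b`. -/
lemma NodalCharts.IsParametrization.isDiagonal (h : D.IsParametrization f₁ f₂) {a b : ℤ}
    (hM : IsLineBundleOfBidegree f₁ f₂ M a b) : D.IsDiagonal M (fun _ : Fin 1 ↦ a) (fun _ ↦ b) := by
  obtain ⟨a', b', hab⟩ := D.exists_isDiagonal hM.1
  obtain ⟨a', rfl⟩ : ∃ c : ℤ, a' = fun _ ↦ c := ⟨a' 0, funext fun i ↦ by rw [Subsingleton.elim i 0]⟩
  obtain ⟨b', rfl⟩ : ∃ c : ℤ, b' = fun _ ↦ c := ⟨b' 0, funext fun i ↦ by rw [Subsingleton.elim i 0]⟩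
  have h' := h.isLineBundleOfBidegree hab
  rwa [P1.degree_unique hM.2.1 h'.2.1, P1.degree_unique hM.2.2 h'.2.2]

lemma NodalCharts.IsParametrization.isDiagonal_of_isSplittingType
    (h : D.IsParametrization f₁ f₂) {a b : Fin r → ℤ} (hM : IsSplittingType f₁ f₂ M a b) :
    D.IsDiagonal M a b := by
  obtain ⟨L, hL, ⟨e⟩⟩ := hM
  exact (NodalCharts.IsDiagonal.biproduct fun i ↦ h.isDiagonal (hL i)).iso e.symm

/-- Vector bundles on a nodal curve are sums of line bundles. -/
theorem NodalCharts.IsParametrization.exists_isSplittingType (h : D.IsParametrization f₁ f₂)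
    (hL : ∀ a b : ℤ, ∃ L, D.IsDiagonal L (fun _ : Fin 1 ↦ a) (fun _ ↦ b))
    (hM : IsVectorBundle M r) : ∃ a b : Fin r → ℤ, IsSplittingType f₁ f₂ M a b := by
  obtain ⟨a, b, hab⟩ := D.exists_isDiagonal hM
  choose L hL using hL
  exact ⟨a, b, fun i ↦ L (a i) (b i), fun i ↦ h.isLineBundleOfBidegree (hL _ _),
    hab.nonempty_iso (NodalCharts.IsDiagonal.biproduct fun i ↦ hL _ _)⟩

lemma IsSplittingType.symm {a b : Fin r → ℤ} (h : IsSplittingType f₁ f₂ M a b) :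
    IsSplittingType f₂ f₁ M b a := by
  obtain ⟨L, hL, e⟩ := h
  exact ⟨L, fun i ↦ ⟨(hL i).1, (hL i).2.2, (hL i).2.1⟩, e⟩

end

/-! ### Restriction of the bundle on the surface to the nodal fibre -/

section

variable {X Y : Scheme.{0}} {M : Y.Modules} {r : ℕ}

/-- The transition matrix of the restriction of a bundle to a subscheme on which a summand of the
matrix vanishes. -/
lemma res_pull_of_diagonal (f : X ⟶ Y) {U V : Y.Opens} {e : Fin r → Γ(M, U)} {e' : Fin r → Γ(M, V)}
    {c : Fin r → Γ(Y, U ⊓ V)} {t : Γ(Y, U)} {R : Matrix (Fin r) (Fin r) Γ(Y, U ⊓ V)}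
    (h : ∀ k, res M inf_le_left (e k) = ∑ l, (Matrix.diagonal c +
      resF (inf_le_left : U ⊓ V ≤ U) t • R) l k • res M inf_le_right (e' l)) {W : X.Opens}
    (hU : W ≤ f ⁻¹ᵁ U) (hV : W ≤ f ⁻¹ᵁ V) (hUV : W ≤ f ⁻¹ᵁ (U ⊓ V)) (ht : pullF f hU t = 0)
    (k : Fin r) :
    res (restr f M) hU (pull f (e k)) = pullF f hUV (c k) • res (restr f M) hV (pull f (e' k)) := by
  have h1 : res (restr f M) hUV (pull f (res M inf_le_left (e k))) =
      res (restr f M) hUV (pull f (∑ l, (Matrix.diagonal c +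
        resF (inf_le_left : U ⊓ V ≤ U) t • R) l k • res M inf_le_right (e' l))) :=
    congrArg (fun t ↦ res (restr f M) hUV (pull f t)) (h k)
  rw [res_pull_res, pull_sum, res_sum] at h1
  refine h1.trans ?_
  rw [Finset.sum_eq_single k]
  · rw [res_pull_smul, res_pull_res, Matrix.add_apply, Matrix.diagonal_apply_eq, Matrix.smul_apply,
      smul_eq_mul, map_add, map_mul, pullF_resF, ht, zero_mul, add_zero]
  · intro l _ hl
    rw [res_pull_smul, Matrix.add_apply, Matrix.diagonal_apply_ne _ hl, Matrix.smul_apply,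
      smul_eq_mul, map_add, map_mul, pullF_resF, ht, zero_mul, map_zero, add_zero, zero_smul]
  · simp

variable {P Q : Y ⟶ P1} {ι : X ⟶ Y}

/-- The restriction of a bundle on the surface to the nodal fibre. -/
theorem IsFibreOver.isDiagonal_restr [IsIntegral Y] (hι : IsFibreOver P 1 0 ι) (D : BlowUpCharts P Q)
    {a b : Fin r → ℤ} {e : ∀ i, Fin r → Γ(M, D.surfaceCharts.U i)}
    {R₁ : Matrix (Fin r) (Fin r) Γ(Y, D.surfaceCharts.U 1 ⊓ D.surfaceCharts.U 0)}
    {R₂ : Matrix (Fin r) (Fin r) Γ(Y, D.surfaceCharts.U 1 ⊓ D.surfaceCharts.U 2)}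
    (he : ∀ i, IsFrame M (D.surfaceCharts.U i) (e i))
    (h₁ : ∀ k, res M inf_le_left (e 1 k) = ∑ l, ((Matrix.diagonal fun k ↦
        zp (resF inf_le_left D.surfaceCharts.x₁) (resF inf_le_right D.surfaceCharts.w) (-a k)) +
      resF (inf_le_left : D.surfaceCharts.U 1 ⊓ D.surfaceCharts.U 0 ≤ D.surfaceCharts.U 1)
        D.surfaceCharts.x₂ • R₁) l k • res M inf_le_right (e 0 l))
    (h₂ : ∀ k, res M inf_le_left (e 1 k) = ∑ l, ((Matrix.diagonal fun k ↦
        zp (resF inf_le_left D.surfaceCharts.x₂) (resF inf_le_right D.surfaceCharts.v) (-b k)) +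
      resF (inf_le_left : D.surfaceCharts.U 1 ⊓ D.surfaceCharts.U 2 ≤ D.surfaceCharts.U 1)
        D.surfaceCharts.x₁ • R₂) l k • res M inf_le_right (e 2 l)) :
    (hι.nodalCharts D).IsDiagonal (restr ι M) a b := by
  set N := hι.nodalCharts D
  have hle : N.Z₀ ≤ ι ⁻¹ᵁ D.surfaceCharts.U 0 := fun x hx ↦ hx.2
  refine ⟨_, _, _, (he 0).pull.mono hle, (he 1).pull, (he 2).pull, fun k ↦ ?_, fun k ↦ ?_⟩
  · have ht : pullF ι (show N.Z₀ ⊓ N.Z₁ ≤ ι ⁻¹ᵁ D.surfaceCharts.U 1 from inf_le_right)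
        D.surfaceCharts.x₂ = 0 :=
      (resF_pullF ι le_rfl (inf_le_right : N.Z₀ ⊓ N.Z₁ ≤ _) D.e₁).symm.trans N.resF_x₂
    refine (res_pull_of_diagonal ι h₁ _ (inf_le_left.trans hle) (fun x hx ↦ ⟨hx.2, hle hx.1⟩) ht
      k).trans ?_
    rw [res_res]
    refine congrArg (· • _) ((map_zp _ _ _ _).trans ?_)
    congr 1
    · exact (pullF_resF ι _ _ _).trans (resF_pullF ι le_rfl inf_le_right _).symm
    · exact (pullF_resF ι _ _ _).trans ((pullF_resF ι _ _ _).symm.trans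
        (resF_pullF ι le_rfl inf_le_left _).symm)
  · have ht : pullF ι (show N.Z₂ ⊓ N.Z₁ ≤ ι ⁻¹ᵁ D.surfaceCharts.U 1 from inf_le_right)
        D.surfaceCharts.x₁ = 0 :=
      (resF_pullF ι le_rfl (inf_le_right : N.Z₂ ⊓ N.Z₁ ≤ _) _).symm.trans N.symm.resF_x₂
    refine (res_pull_of_diagonal ι h₂ _ inf_le_left (fun x hx ↦ ⟨hx.2, hx.1⟩) ht k).trans ?_
    refine congrArg (· • _) ((map_zp _ _ _ _).trans ?_)
    congr 1
    · exact (pullF_resF ι _ _ _).trans (resF_pullF ι le_rfl inf_le_right _).symm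
    · exact (pullF_resF ι _ _ _).trans (resF_pullF ι le_rfl inf_le_left _).symm

end

/-! ### The degree bound is attained -/

section

variable {r m : ℕ}

lemma degbd_comm (a b : Fin r → ℤ) (m : ℕ) : degbd b a m = degbd a b m := by
  refine congrArg sInf (Set.ext fun d ↦ ?_)
  constructor <;> rintro ⟨J, K₁, K₂, h₁, h₂, h, hc₁, hc₂, rfl⟩ <;>
    exact ⟨J, K₂, K₁, h₂, h₁, h.symm, hc₂, hc₁, by simp only [add_comm (a _) (b _)]; ring⟩

/-- The set of values is finite, and nonempty because `m ≤ r` allows a set `J` with `m` elements and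
empty `K₁`, `K₂`; so the infimum in ℤ is a genuine minimum. -/
lemma exists_degbd_eq (a b : Fin r → ℤ) (hm : m ≤ r) : ∃ J K₁ K₂ : Finset (Fin r),
    Disjoint J K₁ ∧ Disjoint J K₂ ∧ Disjoint K₁ K₂ ∧ J.card + K₁.card = m ∧ J.card + K₂.card = m ∧
    degbd a b m = ∑ i ∈ J, (a i + b i) + ∑ i ∈ K₁, (a i + 1) + ∑ i ∈ K₂, (b i + 1) := by
  refine Int.csInf_mem (s := {d : ℤ | ∃ J K₁ K₂ : Finset (Fin r),
    Disjoint J K₁ ∧ Disjoint J K₂ ∧ Disjoint K₁ K₂ ∧ J.card + K₁.card = m ∧ J.card + K₂.card = m ∧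
    d = ∑ i ∈ J, (a i + b i) + ∑ i ∈ K₁, (a i + 1) + ∑ i ∈ K₂, (b i + 1)}) ?_ ?_
  · obtain ⟨J, -, hJ⟩ := Finset.exists_subset_card_eq
      (show m ≤ (Finset.univ : Finset (Fin r)).card by simpa using hm)
    exact ⟨_, J, ∅, ∅, by simp, by simp, by simp, by simpa using hJ, by simpa using hJ, rfl⟩
  · refine ((Set.finite_range fun x : Finset (Fin r) × Finset (Fin r) × Finset (Fin r) ↦
      ∑ i ∈ x.1, (a i + b i) + ∑ i ∈ x.2.1, (a i + 1) + ∑ i ∈ x.2.2, (b i + 1)).subset ?_).bddBelow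
    rintro _ ⟨J, K₁, K₂, -, -, -, -, -, rfl⟩
    exact ⟨(J, K₁, K₂), rfl⟩

end

/-! ### The degree on a general fibre -/

section

variable {S Z : Scheme.{0}} {P Q : S ⟶ P1} {m : ℕ}

lemma prod_zp {R ι : Type*} [CommRing R] {x w : R} (h : x * w = 1) (I : Finset ι) (d : ι → ℤ) :
    ∏ k ∈ I, zp x w (d k) = zp x w (∑ k ∈ I, d k) := by
  classical
  obtain ⟨u, rfl, rfl⟩ := exists_unit_of_mul_eq_one h
  induction I using Finset.induction_on with
  | empty => simp [zp]
  | insert i I hi ih =>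
    rw [Finset.prod_insert hi, Finset.sum_insert hi, ih, zp_unit, zp_unit, zp_unit, zpow_add,
      Units.val_mul]

/-- The degree of a sheaf with a diagonal transition matrix on a section of `Q`. -/
lemma hasRankDegree_of_diagonal (e : P1 ⟶ Z) (ι : Z ⟶ S) (hQ : e ≫ ι ≫ Q = 𝟙 P1)
    (hP : ⊤ ≤ (e ≫ ι ≫ P) ⁻¹ᵁ P1.chart 0) {F : S.Modules}
    {f₀ : Fin m → Γ(F, Q ⁻¹ᵁ P1.chart 0)}
    {f₃ : Fin m → Γ(F, P ⁻¹ᵁ P1.chart 0 ⊓ Q ⁻¹ᵁ P1.chart 1)} (h₀ : IsFrame F _ f₀)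
    (h₃ : IsFrame F _ f₃) {d : Fin m → ℤ}
    (h : ∀ k, res F inf_le_left (f₀ k) =
      zp (resF inf_le_right (resF (inf_le_right : P ⁻¹ᵁ P1.chart 0 ⊓ _ ≤ _) (pc Q 1)))
        (resF inf_le_left (pc Q 0)) (d k) •
      res F (inf_le_right : Q ⁻¹ᵁ P1.chart 0 ⊓ (P ⁻¹ᵁ P1.chart 0 ⊓ Q ⁻¹ᵁ P1.chart 1) ≤ _) (f₃ k)) :
    HasRankDegree (restr e (restr ι F)) m (∑ k, d k) := by
  have hle (i : Fin 2) : P1.chart i ≤ e ⁻¹ᵁ ι ⁻¹ᵁ Q ⁻¹ᵁ P1.chart i :=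
    le_preimage_of_comp (g := ι ≫ Q) hQ (V := P1.chart i) (W := P1.chart i) le_rfl
  have h1 : P1.chart 1 ≤ e ⁻¹ᵁ ι ⁻¹ᵁ (P ⁻¹ᵁ P1.chart 0 ⊓ Q ⁻¹ᵁ P1.chart 1) := fun x hx ↦
    ⟨hP (x := x) trivial, hle 1 hx⟩
  have h01 : P1.chart 0 ⊓ P1.chart 1 ≤
      e ⁻¹ᵁ ι ⁻¹ᵁ (Q ⁻¹ᵁ P1.chart 0 ⊓ (P ⁻¹ᵁ P1.chart 0 ⊓ Q ⁻¹ᵁ P1.chart 1)) :=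
    fun x hx ↦ ⟨hle 0 hx.1, h1 hx.2⟩
  have hx : zp (P1.coord 1 0 |> resF (inf_le_right : P1.chart 0 ⊓ P1.chart 1 ≤ _))
      (P1.coord 0 1 |> resF inf_le_left) = P1.transition := by
    funext d
    rw [zp, ← map_pow, ← map_pow]
    rfl
  refine ⟨_, _, Matrix.diagonal fun k ↦ zp (P1.coord 1 0 |> resF inf_le_right)
      (P1.coord 0 1 |> resF inf_le_left) (d k), (h₀.pull.pull).mono (hle 0),
    (h₃.pull.pull).mono h1, fun k ↦ ?_, ?_⟩
  · rw [Finset.sum_eq_single k (fun l _ hl ↦ by rw [Matrix.diagonal_apply_ne _ hl, zero_smul])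
      (by simp), Matrix.diagonal_apply_eq]
    have h2 : res (restr e (restr ι F)) h01 (pull e (pull ι (res F inf_le_left (f₀ k)))) = _ :=
      congrArg (fun t ↦ res (restr e (restr ι F)) h01 (pull e (pull ι t))) (h k)
    rw [pull_res, res_pull_res, pull_smul, res_pull_smul, pull_res, res_pull_res] at h2
    rw [res_res, res_res]
    refine h2.trans (congrArg (· • _) ?_)
    rw [← pullF_eq_app ι le_rfl, pullF_pullF, map_zp, pullF_resF, pullF_resF, pullF_resF, pc, pc,
      pullF_pullF, pullF_pullF, pullF_congr ((Category.assoc _ _ _).trans hQ),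
      pullF_congr ((Category.assoc _ _ _).trans hQ), pullF_id, pullF_id]
    rfl
  · rw [Matrix.det_diagonal, prod_zp (P1.coord_mul_coord 1 0 _ _ _), hx]

end

/-! ### The image of a closed point -/

namespace P1

instance isProper_toSpecC : IsProper P1.toSpecC := by
  have hb : Function.Bijective (algebraMap ℂ (grading 0)) := by
    refine ⟨fun a b h ↦ MvPolynomial.C_injective (Fin 2) ℂ (congrArg Subtype.val h),
      fun ⟨p, hp⟩ ↦ ⟨p.coeff 0, Subtype.ext ?_⟩⟩
    exact ((MvPolynomial.totalDegree_eq_zero_iff_eq_C).1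
      ((MvPolynomial.totalDegree_zero_iff_isHomogeneous (Fin 2)).2 hp)).symm
  have : IsScalarTower ℂ (grading 0) (MvPolynomial (Fin 2) ℂ) :=
    ⟨fun c x y ↦ smul_mul_assoc c (x : MvPolynomial (Fin 2) ℂ) y⟩
  have : Algebra.FiniteType (grading 0) (MvPolynomial (Fin 2) ℂ) :=
    Algebra.FiniteType.of_restrictScalars_finiteType ℂ _ _
  have : IsIso (CommRingCat.ofHom (algebraMap ℂ (grading 0))) :=
    (RingEquiv.ofBijective _ hb).toCommRingCatIso.isIso_hom
  unfold P1.toSpecC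
  infer_instance

end P1

/-! ### The sheaf attached to a splitting type -/

section

variable {S Z : Scheme.{0}} {P Q : S ⟶ P1} {ι : Z ⟶ S} {f₁ f₂ : P1 ⟶ Z} {r m : ℕ} {EZ : Z.Modules}

/-- The line bundle of bidegree `(a, b)` on the fibre is the restriction of a line bundle on the
surface: the construction with no paired indices and a zero quotient. -/
lemma IsFibreOver.exists_isDiagonal (hι : IsFibreOver P 1 0 ι) (D : BlowUpCharts P Q) (a b : ℤ) :
    ∃ L, (hι.nodalCharts D).IsDiagonal L (fun _ : Fin 1 ↦ a) (fun _ ↦ b) := by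
  have := D.isIntegral
  obtain ⟨E, -, -, e, -, -, -, -, R₁, R₂, he, h₁, h₂, -⟩ := D.surfaceCharts.exists_quotient
    (fun _ : Fin 1 ↦ a) (fun _ ↦ b) (J := ∅) (K₁ := ∅) (K₂ := ∅) (m := 0) (by simp) (by simp)
    (by simp) rfl rfl
  exact ⟨_, hι.isDiagonal_restr D he h₁ h₂⟩

theorem IsFibreOver.exists_sheaf (hι : IsFibreOver P 1 0 ι) (D : BlowUpCharts P Q)
    (hr : ∀ x, P x ∉ P1.chart 0 → x ∈ Set.range ι)
    (h : (hι.nodalCharts D).IsParametrization f₁ f₂) (hm : m ≤ r) {a b : Fin r → ℤ}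
    (hab : IsSplittingType f₁ f₂ EZ a b) :
    ∃ (E F : S.Modules) (ψ : E ⟶ F), IsVectorBundle E r ∧ Nonempty (restr ι E ≅ EZ) ∧ Epi ψ ∧
      IsCoherent F ∧ IsTorsionFree F ∧
      (∀ x, x ∉ ι '' (Set.range f₁ ∩ Set.range f₂) → IsLocallyFreeAt F m x) ∧
      ∀ (C : Scheme.{0}) (j : C ⟶ S) (e : P1 ⟶ C), e ≫ j ≫ Q = 𝟙 P1 →
        ⊤ ≤ (e ≫ j ≫ P) ⁻¹ᵁ P1.chart 0 → HasRankDegree (restr e (restr j F)) m (degbd a b m) := by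
  have := D.isIntegral
  obtain ⟨J, K₁, K₂, hJ₁, hJ₂, hK, hc₁, hc₂, hd⟩ := exists_degbd_eq a b hm
  obtain ⟨E, F, ψ, e, g₀, g₂, g₃, d, R₁, R₂, he, h₁, h₂, hψ, hF, hF', hg₀, hg₂, hg₃, hg, hsum⟩ :=
    D.surfaceCharts.exists_quotient a b hJ₁ hJ₂ hK hc₁ hc₂
  refine ⟨E, F, ψ, fun x ↦ ?_, ?_, hψ, hF, hF', fun x hx ↦ ?_, fun C j e hQ hP ↦ ?_⟩
  · obtain ⟨i, hi⟩ := TopologicalSpace.Opens.mem_iSup.1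
      (D.surfaceCharts.iSup_eq_top.ge (show x ∈ (⊤ : S.Opens) from trivial))
    exact ⟨_, hi, _, he i⟩
  · exact (hι.isDiagonal_restr D he h₁ h₂).nonempty_iso (h.isDiagonal_of_isSplittingType hab)
  -- Outside the three charts where `F` has a frame, a point lies on the special fibre and on
  -- neither affine line of it, so it is the node.
  · by_contra hx'
    have hx₀ : Q x ∉ P1.chart 0 := fun h ↦ hx' ⟨_, h, _, hg₀⟩
    have hx₂ : x ∉ D.W₂ := fun h ↦ hx' ⟨_, h, _, hg₂⟩
    have hx₃ : P x ∉ P1.chart 0 := fun h ↦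
      hx' ⟨_, (show x ∈ P ⁻¹ᵁ P1.chart 0 ⊓ Q ⁻¹ᵁ P1.chart 1 from
        ⟨h, P1.mem_chart_of_notMem hx₀⟩), _, hg₃⟩
    obtain ⟨z, rfl⟩ := hr x hx₃
    exact hx ⟨z, h.mem_range (fun h ↦ hx₀ h.2) hx₂, rfl⟩
  · rw [hd, ← hsum]
    exact hasRankDegree_of_diagonal e j hQ hP hg₀ hg₃ hg

/-- The two images of `q` are closed since the projections are closed maps, so automorphisms of the
two factors move both of them to `[0 : 1]`. The product, the blow-up and the fibres are unaffected
by this. -/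
theorem IsBlowUpAtPoint.exists_sheaf {Y : Scheme.{0}} {pr pr' : Y ⟶ P1}
    (hp : IsPullback pr pr' P1.toSpecC P1.toSpecC) {q : Y} {hq : IsClosed {q}} {φ : S ⟶ Y}
    (hφ : IsBlowUpAtPoint φ q hq) {π : S ⟶ P1} (hπ : π = φ ≫ pr) {f₁ f₂ : P1 ⟶ π.fiber (pr q)}
    (hf₁ : IsClosedImmersion f₁) (hf₂ : IsClosedImmersion f₂)
    (hf₁C : f₁ ≫ π.fiberι (pr q) ≫ π ≫ P1.toSpecC = P1.toSpecC)
    (hf₂C : f₂ ≫ π.fiberι (pr q) ≫ π ≫ P1.toSpecC = P1.toSpecC)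
    (hcov : Set.range f₁ ∪ Set.range f₂ = Set.univ) {EZ : (π.fiber (pr q)).Modules}
    (hEZ : IsVectorBundle EZ r) (hm : m ≤ r) :
    (∃ a b : Fin r → ℤ, IsSplittingType f₁ f₂ EZ a b) ∧
    ∀ a b : Fin r → ℤ, IsSplittingType f₁ f₂ EZ a b →
      ∃ E F : S.Modules, ∃ ψ : E ⟶ F, IsVectorBundle E r ∧
        Nonempty (restr (π.fiberι (pr q)) E ≅ EZ) ∧ Epi ψ ∧ IsCoherent F ∧ IsTorsionFree F ∧
        (∀ x : S, x ∉ π.fiberι (pr q) '' (Set.range f₁ ∩ Set.range f₂) → IsLocallyFreeAt F m x) ∧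
        ∃ U : P1.Opens, (U : Set P1).Nonempty ∧
          ∀ c ∈ U, IsClosed {c} → ∃ f : P1 ≅ π.fiber c,
            f.hom ≫ π.fiberι c ≫ π ≫ P1.toSpecC = P1.toSpecC ∧
            HasRankDegree (restr f.hom (restr (π.fiberι c) F)) m (degbd a b m) := by
  have hclosed {g g' : Y ⟶ P1} (hg : IsPullback g g' P1.toSpecC P1.toSpecC) : IsClosed {g q} := by
    have : UniversallyClosed g :=
      MorphismProperty.of_isPullback hg.flip (inferInstanceAs (UniversallyClosed P1.toSpecC))
    rw [← Set.image_singleton]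
    exact g.isClosedMap _ hq
  obtain ⟨τ, hτ, hτq⟩ := P1.exists_iso (hclosed hp)
  obtain ⟨τ', hτ', hτq'⟩ := P1.exists_iso (hclosed hp.flip)
  have hp' : IsPullback (pr ≫ τ.hom) (pr' ≫ τ'.hom) P1.toSpecC P1.toSpecC :=
    hp.of_iso (Iso.refl _) τ τ' (Iso.refl _) (by simp) (by simp) (by simp [hτ]) (by simp [hτ'])
  have hq₁ : (pr ≫ τ.hom) q ∉ P1.chart 0 := fun h ↦ (hτq (pr q)).1 h rfl
  have hq₂ : (pr' ≫ τ'.hom) q ∉ P1.chart 0 := fun h ↦ (hτq' (pr' q)).1 h rfl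
  obtain ⟨D⟩ := exists_blowUpCharts hp' hq hq₁ hq₂ hφ
  have hS := fun (X : Scheme.{0}) (f₁ f₂ : X ⟶ P1) h h' ↦
    hφ.existsUnique_lift hp' hq₁ (X := X) (f₁ := f₁) (f₂ := f₂) h h'
  have hπτ : φ ≫ pr ≫ τ.hom = π ≫ τ.hom := by rw [hπ, Category.assoc]
  rw [hπτ] at D
  simp only [hπτ] at hS
  obtain ⟨z, hι, hz⟩ := isFibreOver π hτ (hclosed hp) (P1.mem_chart_of_notMem hq₁)
  obtain rfl := hz hq₁
  have hr (x : S) (hx : (π ≫ τ.hom) x ∉ P1.chart 0) : x ∈ Set.range (π.fiberι (pr q)) := by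
    rw [Scheme.Hom.range_fiberι]
    by_contra h
    exact hx ((hτq (π x)).2 h)
  have hs : (π.fiberι (pr q) ≫ π ≫ τ.hom) ≫ P1.toSpecC = π.fiberι (pr q) ≫ π ≫ P1.toSpecC := by
    simp [hτ]
  have hopen (F : S.Modules) (d : ℤ) (hF : ∀ (C : Scheme.{0}) (j : C ⟶ S) (e : P1 ⟶ C),
      e ≫ j ≫ φ ≫ pr' ≫ τ'.hom = 𝟙 P1 → ⊤ ≤ (e ≫ j ≫ π ≫ τ.hom) ⁻¹ᵁ P1.chart 0 →
        HasRankDegree (restr e (restr j F)) m d) :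
      ∃ U : P1.Opens, (U : Set P1).Nonempty ∧
        ∀ c ∈ U, IsClosed {c} → ∃ f : P1 ≅ π.fiber c,
          f.hom ≫ π.fiberι c ≫ π ≫ P1.toSpecC = P1.toSpecC ∧
          HasRankDegree (restr f.hom (restr (π.fiberι c) F)) m d := by
    obtain ⟨x, hx⟩ := P1.nonempty_inf_chart
    -- Every fibre except the one over `pr q` is general in the sense needed.
    refine ⟨τ.hom ⁻¹ᵁ P1.chart 0, ⟨τ.inv x, ?_⟩, fun c hcU hc ↦ ?_⟩
    · have : τ.hom (τ.inv x) = x := by rw [← Scheme.Hom.comp_apply, τ.inv_hom_id]; rfl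
      change τ.hom (τ.inv x) ∈ P1.chart 0
      rw [this]
      exact hx.1
    · obtain ⟨z, hz, -⟩ := isFibreOver π hτ hc (i := 0) hcU
      obtain ⟨e, he, heQ, heP⟩ := hz.exists_iso D.comm hS
      exact ⟨e, by simpa [hτ] using he, hF _ _ _ heQ heP⟩
  have hparam := (hι.nodalCharts D).isParametrization_or_symm (hs ▸ hf₁C) (hs ▸ hf₂C) hcov
  rcases hparam with h | h
  · refine ⟨h.exists_isSplittingType (hι.exists_isDiagonal D) hEZ, fun a b hab ↦ ?_⟩
    obtain ⟨E, F, ψ, hE, hEZ', hψ, hF, hF', hfree, hdeg⟩ := hι.exists_sheaf D hr h hm hab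
    exact ⟨E, F, ψ, hE, hEZ', hψ, hF, hF', hfree, hopen F _ hdeg⟩
  -- The parametrized components are in the opposite order to the charts. The roles of `a` and `b`
  -- are exchanged, and the degree bound is symmetric in them.
  · refine ⟨?_, fun a b hab ↦ ?_⟩
    · obtain ⟨a, b, hab⟩ := h.exists_isSplittingType (hι.exists_isDiagonal D) hEZ
      exact ⟨b, a, hab.symm⟩
    · obtain ⟨E, F, ψ, hE, hEZ', hψ, hF, hF', hfree, hdeg⟩ := hι.exists_sheaf D hr h hm hab.symm
      rw [degbd_comm] at hdeg
      rw [Set.inter_comm] at hfree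
      exact ⟨E, F, ψ, hE, hEZ', hψ, hF, hF', hfree, hopen F _ hdeg⟩

end

end

end DegreeBound

theorem mainTheorem7
    -- the blow-up of a closed point `q` of `ℙ¹ × ℙ¹`
    (S : Scheme.{0}) (φ : S ⟶ DegreeBound.P1xP1) (q : DegreeBound.P1xP1) (hq : IsClosed {q})
    (hφ : DegreeBound.IsBlowUpAtPoint φ q hq)
    -- one of the two projections, and its composition with the blow-up
    (pr : DegreeBound.P1xP1 ⟶ DegreeBound.P1)
    (hpr : pr = Limits.pullback.fst DegreeBound.P1.toSpecC DegreeBound.P1.toSpecC ∨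
      pr = Limits.pullback.snd DegreeBound.P1.toSpecC DegreeBound.P1.toSpecC)
    (π : S ⟶ DegreeBound.P1) (hπ : π = φ ≫ pr)
    -- the two components of the central fibre `Z = π⁻¹(pr q)`, parametrized over `ℂ`
    (f₁ f₂ : DegreeBound.P1 ⟶ π.fiber (pr q))
    (hf₁ : IsClosedImmersion f₁) (hf₂ : IsClosedImmersion f₂)
    (hf₁C : f₁ ≫ π.fiberι (pr q) ≫ π ≫ DegreeBound.P1.toSpecC = DegreeBound.P1.toSpecC)
    (hf₂C : f₂ ≫ π.fiberι (pr q) ≫ π ≫ DegreeBound.P1.toSpecC = DegreeBound.P1.toSpecC)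
    (hne : Set.range f₁ ≠ Set.range f₂) (hcov : Set.range f₁ ∪ Set.range f₂ = Set.univ)
    -- a vector bundle of rank `r` on `Z`
    (r : ℕ) (EZ : (π.fiber (pr q)).Modules) (hEZ : DegreeBound.IsVectorBundle EZ r)
    (m : ℕ) (hm : m ≤ r) :
    (∃ a b : Fin r → ℤ, DegreeBound.IsSplittingType f₁ f₂ EZ a b) ∧
    ∀ a b : Fin r → ℤ, DegreeBound.IsSplittingType f₁ f₂ EZ a b →
      ∃ E F : S.Modules, ∃ ψ : E ⟶ F,
        DegreeBound.IsVectorBundle E r ∧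
        Nonempty (DegreeBound.restr (π.fiberι (pr q)) E ≅ EZ) ∧
        Epi ψ ∧
        DegreeBound.IsCoherent F ∧
        DegreeBound.IsTorsionFree F ∧
        -- `F` is locally free away from the node of `Z`
        (∀ x : S, x ∉ π.fiberι (pr q) '' (Set.range f₁ ∩ Set.range f₂) →
          DegreeBound.IsLocallyFreeAt F m x) ∧
        -- the rank and the degree of `F` on a general fibre of `π`
        ∃ U : DegreeBound.P1.Opens, (U : Set DegreeBound.P1).Nonempty ∧
          ∀ c ∈ U, IsClosed {c} →
            ∃ f : DegreeBound.P1 ≅ π.fiber c,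
              f.hom ≫ π.fiberι c ≫ π ≫ DegreeBound.P1.toSpecC = DegreeBound.P1.toSpecC ∧
              DegreeBound.HasRankDegree
                (DegreeBound.restr f.hom (DegreeBound.restr (π.fiberι c) F)) m
                (DegreeBound.degbd a b m) := by
  rcases hpr with rfl | rfl
  · exact hφ.exists_sheaf (.of_hasPullback _ _) hπ hf₁ hf₂ hf₁C hf₂C hcov hEZ hm
  · exact hφ.exists_sheaf (IsPullback.of_hasPullback _ _).flip hπ hf₁ hf₂ hf₁C hf₂C hcov hEZ hm
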